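/- **Setting.** Let $d\ge 1$, $\mu>0$ and, for $m>0$, let $\Pi_m^-=\mathbf 1(-\Delta\le m)$ and $\Pi_m^+=\mathbf 1(-\Delta\ge m)$ on $L^2(\mathbb R^d;\mathbb C)$. Write $\mathfrak S^p$ for the Schatten classes, with $\|A\|_{\mathfrak S^p}=(\operatorname{tr}|A|^p)^{1/p}$. A locally trace-class self-adjoint operator $Q$ has a density $\rho_Q\in L^1_{\rm loc}(\mathbb R^d)$, determined by $\operatorname{tr}(\mathbf 1_BQ\mathbf 1_B)=\int_B\rho_Q$ for all bounded measurable $B\subset\mathbb R^d$. Let $$\mathcal Y_\mu=\Big\{Q=Q^*\ \text{bounded on } L^2(\mathbb R^d):\ \Pi_{2\mu}^+Q\Pi_{2\mu}^-\in\mathfrak S^2,\ \Pi_{2\mu}^+Q\Pi_{2\mu}^+\in\mathfrak S^1,\ \rho_{\Pi_{2\mu}^-Q\Pi_{2\mu}^-}\in L^2(\mathbb R^d)\Big\},$$ $$\|Q\|_{\mathcal Y_\mu}=\|Q\|+\|\Pi_{2\mu}^+Q\Pi_{2\mu}^-\|_{\mathfrak S^2}+\|\Pi_{2\mu}^+Q\Pi_{2\mu}^+\|_{\mathfrak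 S^1}+\|\rho_{\Pi_{2\mu}^-Q\Pi_{2\mu}^-}\|_{L^2}.$$ Given a real-valued $w$ and $Q_0\in\mathcal Y_\mu$, a solution on an interval $J\ni 0$ is a map $Q\in C^0(J,\mathcal Y_\mu)$ such that for all $t\in J$ $$Q(t)=e^{it\Delta}Q_0e^{-it\Delta}-i\int_0^te^{i(t-s)\Delta}\big[w*\rho_{Q(s)},\,\Pi_\mu^-+Q(s)\big]e^{i(s-t)\Delta}\,ds .\qquad(\ast)$$ **Proposition (Local well-posedness in $\mathcal Y_\mu$).** Let $w\in L^1(\mathbb R^d)\cap L^\infty(\mathbb R^d)$ be real-valued and let $Q_0\in\mathcal Y_\mu$ be such that $$t\mapsto\rho_{e^{it\Delta}\Pi_{2\mu}^-Q_0\Pi_{2\mu}^-e^{-it\Delta}}\ \text{ belongs to } C^0(\mathbb R,L^2(\mathbb R^d)).\qquad(\ast\ast)$$ Then there are $T^-,T^+\in(0,\infty]$ and a unique maximal solution $Q\in C^0((-T^-,T^+),\mathcal Y_\mu)$ of $(\ast)$: it cannot be extended to a larger interval, and every solution on any interval $J\ni0$ satisfies $J\subset(-T^-,T^+)$ and coincides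 with $Q$ on $J$. Moreover: 1. (Blow-up criterion) If $T^+<\infty$ then $\lim_{t\to T^+}\|Q(t)\|_{\mathcal Y_\mu}=+\infty$, and if $T^-<\infty$ then $\lim_{t\to-T^-}\|Q(t)\|_{\mathcal Y_\mu}=+\infty$. 2. (Continuous dependence) Let $w_n\in L^1\cap L^\infty$ be real-valued and $Q_0^{(n)}\in\mathcal Y_\mu$ satisfy $(\ast\ast)$, with maximal solutions $Q^{(n)}\in C^0((-T_n^-,T_n^+),\mathcal Y_\mu)$. Assume that $w_n\to w$ in $L^1$ and in $L^\infty$, that $Q_0^{(n)}\to Q_0$ in $\mathcal Y_\mu$, and that $\rho_{e^{it\Delta}\Pi_{2\mu}^-Q_0^{(n)}\Pi_{2\mu}^-e^{-it\Delta}}\to\rho_{e^{it\Delta}\Pi_{2\mu}^-Q_0\Pi_{2\mu}^-e^{-it\Delta}}$ in $L^2(\mathbb R^d)$, uniformly for $t$ in each compact subset of $(-T^-,T^+)$. Then $\liminf_nT_n^\pm\ge T^\pm$, and $\sup_{t\in[a,b]}\|Q^{(n)}(t)-Q(t)\|_{\mathcal Y_\mu}\to0$ for all $a,b$ with $-T^-<a\le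 b<T^+$. -/

import Mathlib

open MeasureTheory Filter Topology Set
open scoped ENNReal

noncomputable section

namespace Hartree

/-- Physical space `ℝ^d` with its Euclidean norm and Lebesgue measure. -/
abbrev Space (d : ℕ) : Type := EuclideanSpace ℝ (Fin d)

/-- The one-particle Hilbert space `L²(ℝ^d; ℂ)`. -/
abbrev L2 (d : ℕ) : Type := Lp ℂ 2 (volume : Measure (Space d))

/-- Bounded operators on `L²(ℝ^d)`; `‖·‖` is the operator norm, `star` the adjoint and `*` the
composition. -/
abbrev Op (d : ℕ) : Type := L2 d →L[ℂ] L2 d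

/-! ### Multiplication operators and Fourier multipliers -/

open Classical in
/-- Multiplication by the essentially bounded function `m` (and `0` if `m` is not in `L^∞`). -/
def mulOp {d : ℕ} (m : Space d → ℂ) : Op d :=
  if h : MemLp m ∞ (volume : Measure (Space d)) then
    (ContinuousLinearMap.mul ℂ ℂ).holderL volume ∞ 2 2 h.toLp
  else 0

/-- The Fourier multiplier with symbol `m`. The Fourier transform is normalised as
`∫ exp(-2πi x·ξ) f(x) dx`. -/
def fourierMul {d : ℕ} (m : Space d → ℂ) : Op d :=
  ((Lp.fourierTransformₗᵢ (Space d) ℂ).symm.toContinuousLinearEquiv : Op d) * mulOp m *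
    ((Lp.fourierTransformₗᵢ (Space d) ℂ).toContinuousLinearEquiv : Op d)

/-- The symbol of `-Δ`: with this normalisation of the Fourier transform, `k = 2πξ`. -/
def lapSymbol {d : ℕ} (ξ : Space d) : ℝ := (2 * Real.pi * ‖ξ‖) ^ 2

/-- The free Schrödinger group `e^{itΔ}`. -/
def freeProp {d : ℕ} (t : ℝ) : Op d :=
  fourierMul fun ξ => Complex.exp (-(Complex.I * t * lapSymbol ξ))

/-- The free evolution `e^{itΔ} Q e^{-itΔ}` of an operator. -/
def freeEvol {d : ℕ} (t : ℝ) (Q : Op d) : Op d := freeProp t * Q * freeProp (-t)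

/-- The spectral projection `Π_m^- = 𝟙(-Δ ≤ m)`. -/
def lowProj {d : ℕ} (m : ℝ) : Op d :=
  fourierMul (Set.indicator {ξ | lapSymbol ξ ≤ m} fun _ => 1)

/-- The spectral projection `Π_m^+ = 𝟙(-Δ ≥ m)`. -/
def highProj {d : ℕ} (m : ℝ) : Op d :=
  fourierMul (Set.indicator {ξ | m ≤ lapSymbol ξ} fun _ => 1)

/-! ### Traces and Schatten norms -/

/-- An index set for a fixed orthonormal basis of `L²(ℝ^d)`. -/
def basisSet (d : ℕ) : Set (L2 d) := (exists_hilbertBasis ℂ (L2 d)).choose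

/-- A fixed orthonormal basis of `L²(ℝ^d)`. The traces below do not depend on this choice, for
positive operators and for trace-class operators. -/
def basis (d : ℕ) : HilbertBasis (basisSet d) ℂ (L2 d) :=
  (exists_hilbertBasis ℂ (L2 d)).choose_spec.choose

/-- The trace, with values in `[0, ∞]`, of a positive operator. -/
def posTrace {d : ℕ} (A : Op d) : ℝ≥0∞ :=
  ∑' i, ENNReal.ofReal (inner ℂ (basis d i) (A (basis d i))).re

/-- The trace of a trace-class operator. -/
def trace {d : ℕ} (A : Op d) : ℂ := ∑' i, inner ℂ (basis d i) (A (basis d i))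

/-- The absolute value `|A| = √(A* A)` of a bounded operator on a Hilbert space. -/
def opAbs {H : Type*} [NormedAddCommGroup H] [InnerProductSpace ℂ H] [CompleteSpace H]
    (A : H →L[ℂ] H) : H →L[ℂ] H := CFC.abs A

/-- The Schatten norm `‖A‖_{𝔖^p} = (tr |A|^p)^{1/p}` for integers `p ≥ 1`.
It is finite if and only if `A` belongs to `𝔖^p`. -/
def schattenENorm {d : ℕ} (p : ℕ) (A : Op d) : ℝ≥0∞ :=
  (posTrace (opAbs A ^ p)) ^ (1 / (p : ℝ))

/-! ### Densities -/

/-- The localised operator `𝟙_B Q 𝟙_B`. -/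
def cutOff {d : ℕ} (B : Set (Space d)) (Q : Op d) : Op d :=
  mulOp (B.indicator fun _ => 1) * Q * mulOp (B.indicator fun _ => 1)

/-- `Q` is locally trace class with density `ρ`: for every bounded measurable set `B`, the operator
`𝟙_B Q 𝟙_B` is trace class, with trace `∫_B ρ`. This determines `ρ` almost everywhere. -/
def IsDensity {d : ℕ} (Q : Op d) (ρ : Space d → ℝ) : Prop :=
  LocallyIntegrable ρ volume ∧
    ∀ B : Set (Space d), MeasurableSet B → Bornology.IsBounded B →
      schattenENorm 1 (cutOff B Q) < ∞ ∧ trace (cutOff B Q) = ((∫ x in B, ρ x : ℝ) : ℂ)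

open Classical in
/-- The density `ρ_Q` of a locally trace-class self-adjoint operator `Q`. It is applied to operators
in `𝒴_μ` and to operators `Π_{2μ}^- Q Π_{2μ}^-` with `Q` bounded self-adjoint, which are all locally
trace class. -/
def density {d : ℕ} (Q : Op d) : Space d → ℝ :=
  if h : ∃ ρ, IsDensity Q ρ then h.choose else 0

/-! ### The space `𝒴_μ` -/

/-- The low-momentum block `Π_{2μ}^- Q Π_{2μ}^-`. -/
def lowBlock {d : ℕ} (μ : ℝ) (Q : Op d) : Op d := lowProj (2 * μ) * Q * lowProj (2 * μ)

/-- The off-diagonal block `Π_{2μ}^+ Q Π_{2μ}^-`. -/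
def mixedBlock {d : ℕ} (μ : ℝ) (Q : Op d) : Op d := highProj (2 * μ) * Q * lowProj (2 * μ)

/-- The high-momentum block `Π_{2μ}^+ Q Π_{2μ}^+`. -/
def highBlock {d : ℕ} (μ : ℝ) (Q : Op d) : Op d := highProj (2 * μ) * Q * highProj (2 * μ)

/-- Membership in `𝒴_μ`. -/
def InY {d : ℕ} (μ : ℝ) (Q : Op d) : Prop :=
  IsSelfAdjoint Q ∧ schattenENorm 2 (mixedBlock μ Q) < ∞ ∧ schattenENorm 1 (highBlock μ Q) < ∞ ∧
    MemLp (density (lowBlock μ Q)) 2 volume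

/-- The norm of `𝒴_μ`, with values in `[0, ∞]` (finite on `𝒴_μ`). -/
def yNorm {d : ℕ} (μ : ℝ) (Q : Op d) : ℝ≥0∞ :=
  ENNReal.ofReal ‖Q‖ + schattenENorm 2 (mixedBlock μ Q) + schattenENorm 1 (highBlock μ Q) +
    eLpNorm (density (lowBlock μ Q)) 2 volume

/-- The density of `e^{itΔ} Π_{2μ}^- Q Π_{2μ}^- e^{-itΔ}`. -/
def freeLowDensity {d : ℕ} (μ : ℝ) (Q : Op d) (t : ℝ) : Space d → ℝ :=
  density (freeEvol t (lowBlock μ Q))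

/-- The low-momentum density of the free evolution belongs to `C⁰(ℝ, L²(ℝ^d))`. -/
def FreeLowDensityContinuous {d : ℕ} (μ : ℝ) (Q : Op d) : Prop :=
  (∀ t, MemLp (freeLowDensity μ Q t) 2 volume) ∧
    ∀ t₀, Tendsto (fun t => eLpNorm (freeLowDensity μ Q t - freeLowDensity μ Q t₀) 2 volume)
      (𝓝 t₀) (𝓝 0)

/-! ### The Hartree equation in Duhamel form -/

/-- The mean-field potential `w * ρ_Q`, as a function. -/
def meanField {d : ℕ} (w : Space d → ℝ) (Q : Op d) (x : Space d) : ℝ :=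
  ∫ y, w (x - y) * density Q y

/-- The commutator `[w * ρ_Q, Π_μ^- + Q]`. -/
def hartreeComm {d : ℕ} (μ : ℝ) (w : Space d → ℝ) (Q : Op d) : Op d :=
  mulOp (fun x => (meanField w Q x : ℂ)) * (lowProj μ + Q) -
    (lowProj μ + Q) * mulOp (fun x => (meanField w Q x : ℂ))

/-- `Q` belongs to `C⁰(J, 𝒴_μ)` and solves, for all `t ∈ J`,
`Q(t) = e^{itΔ} Q₀ e^{-itΔ} - i ∫₀ᵗ e^{i(t-s)Δ} [w * ρ_{Q(s)}, Π_μ^- + Q(s)] e^{i(s-t)Δ} ds`,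
the integral being a Bochner integral in the space of bounded operators. Only the values of `Q`
on `J` matter when `J` is an interval containing `0`. -/
structure IsSolution {d : ℕ} (μ : ℝ) (w : Space d → ℝ) (Q₀ : Op d) (J : Set ℝ) (Q : ℝ → Op d) :
    Prop where
  mem : ∀ t ∈ J, InY μ (Q t)
  cont : ∀ t₀ ∈ J, Tendsto (fun t => yNorm μ (Q t - Q t₀)) (𝓝[J] t₀) (𝓝 0)
  integrable : ∀ t ∈ J, IntervalIntegrable
    (fun s => freeEvol (t - s) (hartreeComm μ w (Q s))) volume 0 t
  duhamel : ∀ t ∈ J, Q t = freeEvol t Q₀ -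
    Complex.I • ∫ s in (0 : ℝ)..t, freeEvol (t - s) (hartreeComm μ w (Q s))

/-- The open interval `(-T⁻, T⁺)`, with possibly infinite `T⁻` and `T⁺`. -/
def lifespan (Tm Tp : EReal) : Set ℝ := {t | -Tm < (t : EReal) ∧ (t : EReal) < Tp}

/-- `Q` is a solution in `C⁰((-T⁻, T⁺), 𝒴_μ)`, with `T⁻, T⁺ ∈ (0, ∞]`, which cannot be extended to
a solution on a larger interval. -/
structure IsMaximalSolution {d : ℕ} (μ : ℝ) (w : Space d → ℝ) (Q₀ : Op d) (Tm Tp : EReal)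
    (Q : ℝ → Op d) : Prop where
  pos_left : 0 < Tm
  pos_right : 0 < Tp
  sol : IsSolution μ w Q₀ (lifespan Tm Tp) Q
  maximal : ∀ (J : Set ℝ) (Q' : ℝ → Op d), J.OrdConnected → lifespan Tm Tp ⊆ J →
    IsSolution μ w Q₀ J Q' → EqOn Q' Q (lifespan Tm Tp) → J ⊆ lifespan Tm Tp

end Hartree

end

open Hartree

noncomputable section

namespace Hartree

open ContinuousLinearMap (star_eq_adjoint adjoint_inner_right adjoint_inner_left)
open ENNReal (mul_lt_top ofReal tsum_le_tsum add_lt_top ofReal_le_ofReal pow_le_pow_left_iff ofReal_mul pow_lt_top toReal_nonneg one_lt_top ofReal_le_one toReal_mul coe_lt_top tsum_comm ofReal_sum_of_nonneg toReal_ofReal toReal_mono ofReal_toReal summable_toReal ofReal_add mul_top ofReal_lt_top)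

variable {H : Type*} [NormedAddCommGroup H] [InnerProductSpace ℂ H]

section Abstract

abbrev BOp (H : Type*) [NormedAddCommGroup H] [InnerProductSpace ℂ H] : Type _ := H →L[ℂ] H

/-! ### Hilbert–Schmidt and trace norms on all bounded operators -/

/-- A finite family satisfying Bessel's inequality. -/
def IsBessel {ι : Type*} [Fintype ι] (v : ι → H) : Prop := ∀ x, ∑ i, ‖inner ℂ (v i) x‖ ^ 2 ≤ ‖x‖ ^ 2

/-- The tuple of images of a family, with its `ℓ²` norm. -/
def tuple {ι : Type*} (A : BOp H) (v : ι → H) : PiLp 2 fun _ : ι => H :=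
  WithLp.toLp 2 fun i => A (v i)

/-- The Hilbert–Schmidt norm of a bounded operator, with values in `[0, ∞]`. -/
def hsNorm (A : BOp H) : ℝ≥0∞ := ⨆ (n : ℕ) (v : Fin n → H) (_ : IsBessel v), ‖tuple A v‖ₑ

/-- The trace norm of a bounded operator, with values in `[0, ∞]`. -/
def trNorm (A : BOp H) : ℝ≥0∞ :=
  ⨆ (n : ℕ) (u : Fin n → H) (v : Fin n → H) (_ : IsBessel u) (_ : IsBessel v),
    ‖∑ i, inner ℂ (u i) (A (v i))‖ₑ

lemma norm_tuple_sq {ι : Type*} [Fintype ι] (A : BOp H) (v : ι → H) :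
    ‖tuple A v‖ ^ 2 = ∑ i, ‖A (v i)‖ ^ 2 := by
  simp [PiLp.norm_sq_eq_of_L2, tuple]

lemma IsBessel.comp_equiv {ι κ : Type*} [Fintype ι] [Fintype κ] {v : ι → H} (hv : IsBessel v)
    (e : κ ≃ ι) : IsBessel (v ∘ e) := fun x => by
  have := e.sum_comp (fun i => ‖inner ℂ (v i) x‖ ^ 2)
  simpa [this] using hv x

lemma enorm_tuple_le_hsNorm {ι : Type*} [Fintype ι] (A : BOp H) {v : ι → H}
    (hv : IsBessel v) : ‖tuple A v‖ₑ ≤ hsNorm A := by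
  let e := (Fintype.equivFin ι).symm
  have h1 : ‖tuple A v‖ = ‖tuple A (v ∘ e)‖ := by
    rw [← sq_eq_sq₀ (norm_nonneg _) (norm_nonneg _), norm_tuple_sq, norm_tuple_sq]
    exact (e.sum_comp (fun i => ‖A (v i)‖ ^ 2)).symm
  have h2 : ‖tuple A v‖ₑ = ‖tuple A (v ∘ e)‖ₑ := by rw [← ofReal_norm, ← ofReal_norm, h1]
  rw [h2]
  exact le_iSup_of_le _ (le_iSup_of_le _ (le_iSup_of_le (hv.comp_equiv e) le_rfl))

lemma hsNorm_le {A : BOp H} {c : ℝ≥0∞}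
    (h : ∀ (n : ℕ) (v : Fin n → H), IsBessel v → ‖tuple A v‖ₑ ≤ c) : hsNorm A ≤ c :=
  iSup_le fun n => iSup_le fun v => iSup_le fun hv => h n v hv

lemma enorm_sum_inner_le_trNorm {ι : Type*} [Fintype ι] (A : BOp H) {u v : ι → H}
    (hu : IsBessel u) (hv : IsBessel v) : ‖∑ i, inner ℂ (u i) (A (v i))‖ₑ ≤ trNorm A := by
  let e := (Fintype.equivFin ι).symm
  rw [← e.sum_comp]
  exact le_iSup_of_le _ (le_iSup_of_le (u ∘ e) (le_iSup_of_le (v ∘ e)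
    (le_iSup_of_le (hu.comp_equiv e) (le_iSup_of_le (hv.comp_equiv e) le_rfl))))

lemma trNorm_le {A : BOp H} {c : ℝ≥0∞} (h : ∀ (n : ℕ) (u v : Fin n → H), IsBessel u → IsBessel v →
      ‖∑ i, inner ℂ (u i) (A (v i))‖ₑ ≤ c) : trNorm A ≤ c :=
  iSup_le fun n => iSup_le fun u => iSup_le fun v => iSup_le fun hu => iSup_le fun hv =>
    h n u v hu hv

lemma isBessel_single {x : H} (hx : ‖x‖ ≤ 1) : IsBessel (fun _ : Unit => x) := fun y => by
  simp only [Finset.univ_unique, Finset.sum_const, Finset.card_singleton, one_smul]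
  have := norm_inner_le_norm (𝕜 := ℂ) x y
  have h2 : ‖x‖ * ‖y‖ ≤ ‖y‖ := by nlinarith [norm_nonneg y]
  gcongr
  exact this.trans h2

lemma enorm_le_of_forall_unit {A : BOp H} {c : ℝ≥0∞} (h : ∀ x, ‖x‖ ≤ 1 → ‖A x‖ₑ ≤ c) :
    ‖A‖ₑ ≤ c := by
  rcases eq_or_ne c ∞ with rfl | hc
  · exact le_top
  · lift c to NNReal using hc
    rw [enorm_le_coe]
    have : ‖A‖ ≤ c := by
      apply ContinuousLinearMap.opNorm_le_of_unit_norm c.2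
      intro x hx
      have := h x hx.le
      rw [enorm_le_coe] at this
      exact_mod_cast this
    exact_mod_cast this

lemma enorm_le_hsNorm (A : BOp H) : ‖A‖ₑ ≤ hsNorm A := by
  refine enorm_le_of_forall_unit fun x hx => ?_
  refine le_trans (le_of_eq ?_) (enorm_tuple_le_hsNorm A (isBessel_single hx))
  rw [← ofReal_norm, ← ofReal_norm]
  congr 1
  rw [← sq_eq_sq₀ (norm_nonneg _) (norm_nonneg _), norm_tuple_sq]
  simp

lemma hsNorm_zero : hsNorm (0 : BOp H) = 0 := by
  refine le_antisymm (hsNorm_le fun n v _ => ?_) zero_le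
  have : tuple (0 : BOp H) v = 0 := by ext i; simp [tuple]
  simp [this]

lemma hsNorm_add_le (A B : BOp H) : hsNorm (A + B) ≤ hsNorm A + hsNorm B := by
  refine hsNorm_le fun n v hv => ?_
  have : tuple (A + B) v = tuple A v + tuple B v := by ext i; simp [tuple]
  rw [this]
  exact (enorm_add_le _ _).trans
    (add_le_add (enorm_tuple_le_hsNorm A hv) (enorm_tuple_le_hsNorm B hv))

lemma hsNorm_smul_le (c : ℝ) (A : BOp H) : hsNorm (c • A) ≤ ‖c‖ₑ * hsNorm A := by
  refine hsNorm_le fun n v hv => ?_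
  have : tuple (c • A) v = c • tuple A v := by ext i; simp [tuple]
  rw [this, enorm_smul]
  gcongr
  exact enorm_tuple_le_hsNorm A hv

lemma trNorm_zero : trNorm (0 : BOp H) = 0 := by
  refine le_antisymm (trNorm_le fun n u v _ _ => ?_) zero_le
  simp

lemma trNorm_add_le (A B : BOp H) : trNorm (A + B) ≤ trNorm A + trNorm B := by
  refine trNorm_le fun n u v hu hv => ?_
  simp only [add_apply, inner_add_right, Finset.sum_add_distrib]
  exact (enorm_add_le _ _).trans
    (add_le_add (enorm_sum_inner_le_trNorm A hu hv) (enorm_sum_inner_le_trNorm B hu hv))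

lemma trNorm_smul_le (c : ℝ) (A : BOp H) : trNorm (c • A) ≤ ‖c‖ₑ * trNorm A := by
  refine trNorm_le fun n u v hu hv => ?_
  have : ∑ i, inner ℂ (u i) ((c • A) (v i)) = c • ∑ i, inner ℂ (u i) (A (v i)) := by
    simp [Finset.smul_sum, inner_smul_right_eq_smul]
  rw [this, enorm_smul]
  gcongr
  exact enorm_sum_inner_le_trNorm A hu hv

/-- Lower semicontinuity of the Hilbert–Schmidt norm for strong convergence. -/
lemma hsNorm_le_liminf {F : Filter (BOp H)} [F.NeBot] {A : BOp H}
    (h : ∀ u, Tendsto (fun T : BOp H => T u) F (𝓝 (A u))) : hsNorm A ≤ liminf hsNorm F := by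
  refine hsNorm_le fun n v hv => ?_
  have h1 : Tendsto (fun T : BOp H => ‖tuple T v‖ₑ) F (𝓝 ‖tuple A v‖ₑ) := by
    refine (continuous_enorm.tendsto _).comp ?_
    exact ((PiLp.continuous_toLp 2 _).tendsto _).comp (tendsto_pi_nhds.2 fun i => h (v i))
  rw [← h1.liminf_eq]
  exact liminf_le_liminf (.of_forall fun T => enorm_tuple_le_hsNorm T hv)

/-- Lower semicontinuity of the trace norm for strong convergence. -/
lemma trNorm_le_liminf {F : Filter (BOp H)} [F.NeBot] {A : BOp H}
    (h : ∀ u, Tendsto (fun T : BOp H => T u) F (𝓝 (A u))) : trNorm A ≤ liminf trNorm F := by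
  refine trNorm_le fun n u v hu hv => ?_
  have h1 : Tendsto (fun T : BOp H => ‖∑ i, inner ℂ (u i) (T (v i))‖ₑ) F
      (𝓝 ‖∑ i, inner ℂ (u i) (A (v i))‖ₑ) := by
    refine (continuous_enorm.tendsto _).comp ?_
    exact tendsto_finsetSum _ fun i _ => (tendsto_const_nhds.inner (h (v i)))
  rw [← h1.liminf_eq]
  exact liminf_le_liminf (.of_forall fun T => enorm_sum_inner_le_trNorm T hu hv)

lemma hsNorm_mul_le (K A : BOp H) : hsNorm (K * A) ≤ ‖K‖ₑ * hsNorm A := by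
  refine hsNorm_le fun n v hv => ?_
  calc ‖tuple (K * A) v‖ₑ ≤ ‖K‖ₑ * ‖tuple A v‖ₑ := by
        rw [← ofReal_norm, ← ofReal_norm, ← ofReal_norm, ← ofReal_mul (norm_nonneg _)]
        apply ofReal_le_ofReal
        rw [← sq_le_sq₀ (norm_nonneg _) (by positivity), mul_pow, norm_tuple_sq, norm_tuple_sq,
          Finset.mul_sum]
        gcongr with i
        rw [← mul_pow]
        gcongr
        exact K.le_opNorm _
    _ ≤ _ := by gcongr; exact enorm_tuple_le_hsNorm A hv

lemma isBessel_of_norm_le [CompleteSpace H] {ι : Type*} [Fintype ι] {v : ι → H} (hv : IsBessel v)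
    {K : BOp H} (hK : ‖K‖ ≤ 1) : IsBessel (fun i => K (v i)) := fun x => by
  have h1 : ∀ i, inner ℂ (K (v i)) x = inner ℂ (v i) (star K x) := fun i => by
    rw [star_eq_adjoint, adjoint_inner_right]
  simp only [h1]
  refine (hv _).trans ?_
  have := (star K).le_opNorm x
  rw [norm_star] at this
  have h3 : ‖(star K) x‖ ≤ ‖x‖ := this.trans (by nlinarith [norm_nonneg x])
  gcongr

lemma exists_smul_contraction (K : BOp H) : ∃ K' : BOp H, ‖K'‖ ≤ 1 ∧ K = ‖K‖ • K' := by
  rcases eq_or_ne K 0 with rfl | hK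
  · exact ⟨0, by simp, by simp⟩
  · refine ⟨‖K‖⁻¹ • K, ?_, ?_⟩
    · rw [norm_smul, norm_inv, norm_norm, inv_mul_cancel₀ (norm_ne_zero_iff.2 hK)]
    · rw [smul_smul, mul_inv_cancel₀ (norm_ne_zero_iff.2 hK), one_smul]

lemma hsNorm_mul_le' [CompleteSpace H] (A K : BOp H) : hsNorm (A * K) ≤ hsNorm A * ‖K‖ₑ := by
  obtain ⟨K', hK', h⟩ := exists_smul_contraction K
  have h1 : hsNorm (A * K') ≤ hsNorm A := hsNorm_le fun n v hv =>
    enorm_tuple_le_hsNorm A (isBessel_of_norm_le hv hK')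
  have h2 : A * K = ‖K‖ • (A * K') := by
    conv_lhs => rw [h]
    exact mul_smul_comm _ _ _
  rw [h2, mul_comm]
  refine (hsNorm_smul_le _ _).trans ?_
  rw [enorm_norm]
  gcongr

lemma trNorm_mul_le [CompleteSpace H] (K A : BOp H) : trNorm (K * A) ≤ ‖K‖ₑ * trNorm A := by
  obtain ⟨K', hK', h⟩ := exists_smul_contraction K
  have h1 : trNorm (K' * A) ≤ trNorm A := trNorm_le fun n u v hu hv => by
    have h2 : ‖star K'‖ ≤ 1 := by rwa [norm_star]
    refine le_trans (le_of_eq ?_) (enorm_sum_inner_le_trNorm A (isBessel_of_norm_le hu h2) hv)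
    simp [star_eq_adjoint, adjoint_inner_left]
  have h2 : K * A = ‖K‖ • (K' * A) := by
    conv_lhs => rw [h]
    exact smul_mul_assoc _ _ _
  rw [h2]
  refine (trNorm_smul_le _ _).trans ?_
  rw [enorm_norm]
  gcongr

lemma trNorm_star [CompleteSpace H] (A : BOp H) : trNorm (star A) = trNorm A := by
  have h : ∀ A : BOp H, trNorm (star A) ≤ trNorm A := fun A => trNorm_le fun n u v hu hv => by
    refine le_trans (le_of_eq ?_) (enorm_sum_inner_le_trNorm A hv hu)
    have h1 : ∀ i, inner ℂ (u i) (star A (v i)) = star (inner ℂ (v i) (A (u i))) := fun i => by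
      rw [star_eq_adjoint, adjoint_inner_right]
      exact (inner_conj_symm _ _).symm
    simp only [h1]
    rw [← star_sum, ← ofReal_norm, ← ofReal_norm, norm_star]
  exact le_antisymm (h A) (by simpa using h (star A))

lemma trNorm_mul_le' [CompleteSpace H] (A K : BOp H) : trNorm (A * K) ≤ trNorm A * ‖K‖ₑ := by
  rw [← trNorm_star, star_mul, mul_comm]
  refine (trNorm_mul_le _ _).trans ?_
  rw [trNorm_star, ← ofReal_norm, norm_star, ofReal_norm]

lemma norm_sum_inner_tuple_le {ι : Type*} [Fintype ι] (A B : BOp H) (u v : ι → H) :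
    ‖∑ i, inner ℂ (A (u i)) (B (v i))‖ ≤ ‖tuple A u‖ * ‖tuple B v‖ := by
  have : ∑ i, inner ℂ (A (u i)) (B (v i)) = inner ℂ (tuple A u) (tuple B v) := by
    simp [PiLp.inner_apply, tuple]
  rw [this]
  exact norm_inner_le_norm _ _

lemma trNorm_star_mul_le [CompleteSpace H] (A B : BOp H) :
    trNorm (star A * B) ≤ hsNorm A * hsNorm B := by
  refine trNorm_le fun n u v hu hv => ?_
  have h1 : ∀ i, inner ℂ (u i) ((star A * B) (v i)) = inner ℂ (A (u i)) (B (v i)) := fun i => by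
    simp [star_eq_adjoint, adjoint_inner_right]
  simp only [h1]
  calc _ ≤ ‖tuple A u‖ₑ * ‖tuple B v‖ₑ := by
        rw [← ofReal_norm, ← ofReal_norm, ← ofReal_norm, ← ofReal_mul (norm_nonneg _)]
        exact ofReal_le_ofReal (norm_sum_inner_tuple_le _ _ _ _)
    _ ≤ _ := by
        gcongr
        · exact enorm_tuple_le_hsNorm A hu
        · exact enorm_tuple_le_hsNorm B hv

lemma isBessel_orthonormal {ι : Type*} [Fintype ι] {v : ι → H} (hv : Orthonormal ℂ v) :
    IsBessel v := fun x => hv.sum_inner_products_le x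

lemma ofReal_sq_norm {E : Type*} [NormedAddCommGroup E] (x : E) : ofReal (‖x‖ ^ 2) = ‖x‖ₑ ^ 2 := by
  rw [ENNReal.ofReal_pow (norm_nonneg _), ofReal_norm]

lemma HilbertBasis.tsum_enorm_inner_sq {ι : Type*} (b : HilbertBasis ι ℂ H) (x : H) :
    ∑' i, ‖inner ℂ (b i) x‖ₑ ^ 2 = ‖x‖ₑ ^ 2 := by
  have h := b.hasSum_inner_mul_inner x x
  have h2 : HasSum (fun i => ‖inner ℂ (b i) x‖ ^ 2) (‖x‖ ^ 2) := by
    have h3 := (Complex.reCLM.hasSum h)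
    simp only [Complex.reCLM_apply] at h3
    convert h3 using 1
    · ext i
      rw [← inner_conj_symm x (b i), Complex.conj_mul']
      norm_cast
    · have := inner_self_eq_norm_sq (𝕜 := ℂ) x
      exact this.symm
  rw [← ofReal_sq_norm, ← h2.tsum_eq, ENNReal.ofReal_tsum_of_nonneg (fun i => by positivity) h2.summable]
  exact tsum_congr fun i => (ofReal_sq_norm _).symm

lemma enorm_tuple_sq {ι : Type*} [Fintype ι] (A : BOp H) (v : ι → H) :
    ‖tuple A v‖ₑ ^ 2 = ∑ i, ‖A (v i)‖ₑ ^ 2 := by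
  rw [← ofReal_norm, ← ENNReal.ofReal_pow (norm_nonneg _), norm_tuple_sq,
    ofReal_sum_of_nonneg (fun i _ => by positivity)]
  exact Finset.sum_congr rfl fun i _ => ofReal_sq_norm _

lemma IsBessel.sum_enorm_le {ι : Type*} [Fintype ι] {v : ι → H} (hv : IsBessel v) (x : H) :
    ∑ i, ‖inner ℂ (v i) x‖ₑ ^ 2 ≤ ‖x‖ₑ ^ 2 := by
  have := ofReal_le_ofReal (hv x)
  rw [ofReal_sum_of_nonneg (fun i _ => by positivity), ofReal_sq_norm] at this
  simpa [ENNReal.ofReal_pow] using this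

lemma tsum_basis_le_hsNorm_sq {ι : Type*} (b : HilbertBasis ι ℂ H) (A : BOp H) :
    ∑' i, ‖A (b i)‖ₑ ^ 2 ≤ hsNorm A ^ 2 := by
  refine ENNReal.summable.tsum_le_of_sum_le fun s => ?_
  have h := enorm_tuple_le_hsNorm A (v := fun i : s => b i)
    (isBessel_orthonormal (b.orthonormal.comp _ Subtype.val_injective))
  have h2 := enorm_tuple_sq A (fun i : s => b i)
  rw [← Finset.sum_coe_sort s (fun i => ‖A (b i)‖ₑ ^ 2), ← h2]
  gcongr

lemma hsNorm_sq_le_tsum_star [CompleteSpace H] {ι : Type*} (b : HilbertBasis ι ℂ H)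
    (A : BOp H) : hsNorm A ^ 2 ≤ ∑' i, ‖star A (b i)‖ₑ ^ 2 := by
  have h1 : ∀ c : ℝ≥0∞, (∀ (n : ℕ) (v : Fin n → H), IsBessel v → ‖tuple A v‖ₑ ^ 2 ≤ c) →
      hsNorm A ^ 2 ≤ c := by
    intro c hc
    have : hsNorm A ≤ c ^ (1 / 2 : ℝ) := hsNorm_le fun n v hv => by
      have := hc n v hv
      rw [one_div, ENNReal.le_rpow_inv_iff (by norm_num)]
      exact_mod_cast this
    rw [one_div, ENNReal.le_rpow_inv_iff (by norm_num)] at this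
    exact_mod_cast this
  refine h1 _ fun n v hv => ?_
  rw [enorm_tuple_sq]
  calc ∑ i, ‖A (v i)‖ₑ ^ 2 = ∑ i, ∑' k, ‖inner ℂ (b k) (A (v i))‖ₑ ^ 2 := by
        simp only [HilbertBasis.tsum_enorm_inner_sq]
    _ = ∑' k, ∑ i, ‖inner ℂ (b k) (A (v i))‖ₑ ^ 2 :=
        (Summable.tsum_finsetSum fun i _ => ENNReal.summable).symm
    _ ≤ _ := by
        refine tsum_le_tsum fun k => ?_
        refine le_trans (le_of_eq ?_) (hv.sum_enorm_le (star A (b k)))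
        refine Finset.sum_congr rfl fun i _ => ?_
        rw [star_eq_adjoint, adjoint_inner_right, ← ofReal_norm, ← ofReal_norm, norm_inner_symm]

lemma hsNorm_star_of_basis [CompleteSpace H] {ι : Type*} (b : HilbertBasis ι ℂ H)
    (A : BOp H) : hsNorm (star A) = hsNorm A := by
  have h : ∀ A : BOp H, hsNorm A ≤ hsNorm (star A) := fun A => by
    have := (hsNorm_sq_le_tsum_star b A).trans (tsum_basis_le_hsNorm_sq b (star A))
    exact (pow_le_pow_left_iff two_ne_zero).1 this
  exact le_antisymm (by simpa using h (star A)) (h A)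

lemma hsNorm_star [CompleteSpace H] (A : BOp H) : hsNorm (star A) = hsNorm A := by
  obtain ⟨w, b, -⟩ := exists_hilbertBasis ℂ H
  exact hsNorm_star_of_basis b A

lemma hsNorm_sq_eq_tsum [CompleteSpace H] {ι : Type*} (b : HilbertBasis ι ℂ H) (A : BOp H) :
    hsNorm A ^ 2 = ∑' i, ‖A (b i)‖ₑ ^ 2 := by
  refine le_antisymm ?_ (tsum_basis_le_hsNorm_sq b A)
  have := hsNorm_sq_le_tsum_star b (star A)
  rwa [star_star, hsNorm_star] at this

lemma trNorm_mul_le_hsNorm [CompleteSpace H] (A B : BOp H) :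
    trNorm (A * B) ≤ hsNorm A * hsNorm B := by
  have := trNorm_star_mul_le (star A) B
  rwa [star_star, hsNorm_star] at this

lemma enorm_le_trNorm (A : BOp H) : ‖A‖ₑ ≤ trNorm A := by
  refine enorm_le_of_forall_unit fun x hx => ?_
  set y : H := (‖A x‖⁻¹ : ℂ) • A x
  have hy : ‖y‖ ≤ 1 := by
    simp only [y, norm_smul, norm_inv, Complex.norm_real, norm_norm]
    exact inv_mul_le_one
  refine le_trans (le_of_eq ?_) (enorm_sum_inner_le_trNorm A (isBessel_single hy) (isBessel_single hx))
  simp only [Finset.univ_unique, Finset.sum_const, Finset.card_singleton, one_smul, y]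
  rw [inner_smul_left, inner_self_eq_norm_sq_to_K, ← ofReal_norm, ← ofReal_norm]
  congr 1
  rcases eq_or_ne ‖A x‖ 0 with h | h
  · simp [h]
  · simp [pow_two, h]

lemma hsNorm_le_trNorm [CompleteSpace H] (A : BOp H) : hsNorm A ≤ trNorm A := by
  refine hsNorm_le fun n v hv => ?_
  set s := ‖tuple A v‖
  rcases eq_or_ne s 0 with hs | hs
  · rw [← ofReal_norm]; simp [show ‖tuple A v‖ = 0 from hs]
  have hs2 : 0 < s := lt_of_le_of_ne (norm_nonneg _) (Ne.symm hs)
  have hsum : ∑ i, ‖A (v i)‖ ^ 2 = s ^ 2 := (norm_tuple_sq A v).symm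
  have hb : IsBessel (fun i => ((s⁻¹ : ℝ) : ℂ) • A (v i)) := fun x => by
    calc _ ≤ ∑ i, (s⁻¹ ^ 2 * ‖x‖ ^ 2) * ‖A (v i)‖ ^ 2 := by
          gcongr with i
          rw [inner_smul_left, norm_mul, mul_pow]
          have h := norm_inner_le_norm (𝕜 := ℂ) (A (v i)) x
          have h2 : ‖inner ℂ (A (v i)) x‖ ^ 2 ≤ (‖A (v i)‖ * ‖x‖) ^ 2 := by gcongr
          have h3 : ‖(starRingEnd ℂ) ((s⁻¹ : ℝ) : ℂ)‖ = s⁻¹ := by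
            rw [RCLike.norm_conj, Complex.norm_real, Real.norm_of_nonneg (by positivity)]
          rw [h3]
          calc _ ≤ s⁻¹ ^ 2 * (‖A (v i)‖ * ‖x‖) ^ 2 := by gcongr
            _ = _ := by ring
      _ = ‖x‖ ^ 2 := by rw [← Finset.mul_sum, hsum]; field_simp
  refine le_trans (le_of_eq ?_) (enorm_sum_inner_le_trNorm A hb hv)
  have : ∑ i, inner ℂ (((s⁻¹ : ℝ) : ℂ) • A (v i)) (A (v i)) = ((s : ℝ) : ℂ) := by
    simp only [inner_smul_left, inner_self_eq_norm_sq_to_K, ← Finset.mul_sum, Complex.conj_ofReal]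
    have : (∑ i, ((‖A (v i)‖ : ℂ)) ^ 2) = ((s ^ 2 : ℝ) : ℂ) := by rw [← hsum]; push_cast; rfl
    simp only [Complex.coe_algebraMap]
    rw [this, ← Complex.ofReal_mul]
    congr 1; field_simp
  rw [this, ← ofReal_norm, ← ofReal_norm, Complex.norm_real, Real.norm_of_nonneg hs2.le]

end Abstract

section Polar

variable [CompleteSpace H]

/-! ### Square root factorisation and the Schatten norms -/

lemma opAbs_nonneg (A : BOp H) : 0 ≤ opAbs A := CFC.abs_nonneg A

lemma opAbs_mul_opAbs (A : BOp H) : opAbs A * opAbs A = star A * A := CFC.abs_mul_abs A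

lemma isSelfAdjoint_opAbs (A : BOp H) : IsSelfAdjoint (opAbs A) := (opAbs_nonneg A).isSelfAdjoint

lemma norm_mul_eq_norm_opAbs_mul (A T : BOp H) : ‖A * T‖ = ‖opAbs A * T‖ := by
  have h : star (A * T) * (A * T) = star (opAbs A * T) * (opAbs A * T) := by
    simp only [star_mul, (isSelfAdjoint_opAbs A).star_eq]
    calc star T * star A * (A * T) = star T * (star A * A) * T := by simp only [mul_assoc]
      _ = star T * (opAbs A * opAbs A) * T := by rw [opAbs_mul_opAbs]
      _ = _ := by simp only [mul_assoc]
  have h1 := CStarRing.norm_star_mul_self (x := A * T)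
  have h2 := CStarRing.norm_star_mul_self (x := opAbs A * T)
  rw [h, h2] at h1
  exact ((mul_self_inj (norm_nonneg _) (norm_nonneg _)).1 h1).symm

/-- The square root of the absolute value. -/
def sqrtAbs (A : BOp H) : BOp H := cfc Real.sqrt (opAbs A)

lemma isSelfAdjoint_sqrtAbs (A : BOp H) : IsSelfAdjoint (sqrtAbs A) := cfc_predicate _ _

lemma spectrum_opAbs_nonneg (A : BOp H) {x : ℝ} (hx : x ∈ spectrum ℝ (opAbs A)) : 0 ≤ x :=
  spectrum_nonneg_of_nonneg (opAbs_nonneg A) hx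

lemma sqrtAbs_mul_sqrtAbs (A : BOp H) : sqrtAbs A * sqrtAbs A = opAbs A := by
  have ha := isSelfAdjoint_opAbs A
  rw [sqrtAbs, ← cfc_mul Real.sqrt Real.sqrt (opAbs A) (by fun_prop) (by fun_prop)]
  conv_rhs => rw [← cfc_id' ℝ (opAbs A)]
  exact cfc_congr fun x hx => Real.mul_self_sqrt (spectrum_opAbs_nonneg A hx)

lemma continuous_regularised_inv {ε : ℝ} (hε : 0 < ε) {f : ℝ → ℝ} (hf : Continuous f) :
    Continuous fun x : ℝ => f x / (|x| + ε) :=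
  hf.div (by fun_prop) fun x => by positivity

/-- The regularisation `A |A|^{1/2} (|A| + ε)⁻¹` of `A |A|^{-1/2}`. -/
def polarReg (A : BOp H) (ε : ℝ) : BOp H := A * cfc (fun x => √x / (|x| + ε)) (opAbs A)

/-- The regularisation `A (|A| + ε)⁻¹` of the polar part. -/
def phaseReg (A : BOp H) (ε : ℝ) : BOp H := A * cfc (fun x => 1 / (|x| + ε)) (opAbs A)

lemma norm_mul_cfc_le (A : BOp H) {f : ℝ → ℝ} (hf : Continuous f) {c : ℝ} (hc : 0 ≤ c)
    (h : ∀ x, 0 ≤ x → |x * f x| ≤ c) : ‖A * cfc f (opAbs A)‖ ≤ c := by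
  have ha := isSelfAdjoint_opAbs A
  rw [norm_mul_eq_norm_opAbs_mul]
  have : opAbs A * cfc f (opAbs A) = cfc (fun x => x * f x) (opAbs A) := by
    rw [cfc_mul (fun x : ℝ => x) f (opAbs A) (by fun_prop) (by fun_prop), cfc_id' ℝ (opAbs A)]
  rw [this]
  exact norm_cfc_le hc fun x hx => h x (spectrum_opAbs_nonneg A hx)

lemma norm_phaseReg_le (A : BOp H) {ε : ℝ} (hε : 0 < ε) : ‖phaseReg A ε‖ ≤ 1 := by
  refine norm_mul_cfc_le A (continuous_regularised_inv hε continuous_const) zero_le_one fun x hx => ?_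
  rw [abs_of_nonneg hx, abs_of_nonneg (by positivity), mul_one_div, div_le_one (by positivity)]
  linarith

lemma phaseReg_mul_sqrtAbs (A : BOp H) {ε : ℝ} (hε : 0 < ε) :
    phaseReg A ε * sqrtAbs A = polarReg A ε := by
  have ha := isSelfAdjoint_opAbs A
  have h1 := continuous_regularised_inv hε (continuous_const (y := (1 : ℝ)))
  rw [phaseReg, polarReg, sqrtAbs, mul_assoc, ← cfc_mul _ _ (opAbs A) h1.continuousOn (by fun_prop)]
  congr 1
  exact cfc_congr fun x _ => by ring

lemma norm_polarReg_sub_le (A : BOp H) {ε δ : ℝ} (hε : 0 < ε) (hδ : 0 < δ) :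
    ‖polarReg A ε - polarReg A δ‖ ≤ √ε + √δ := by
  have ha := isSelfAdjoint_opAbs A
  have h1 := continuous_regularised_inv hε Real.continuous_sqrt
  have h2 := continuous_regularised_inv hδ Real.continuous_sqrt
  rw [polarReg, polarReg, ← mul_sub, ← cfc_sub _ _ (opAbs A) h1.continuousOn h2.continuousOn]
  refine norm_mul_cfc_le A (h1.sub h2) (by positivity) fun x hx => ?_
  have key : ∀ η : ℝ, 0 < η → |√x - x * (√x / (|x| + η))| ≤ √η := fun η hη => by
    rw [abs_of_nonneg hx]
    have e : √x - x * (√x / (x + η)) = √x * η / (x + η) := by field_simp; ring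
    rw [e, abs_of_nonneg (by positivity), div_le_iff₀ (by positivity)]
    have hx2 := Real.sq_sqrt hx
    have hη2 := Real.sq_sqrt hη.le
    nlinarith [Real.sqrt_nonneg x, Real.sqrt_nonneg η, mul_nonneg (Real.sqrt_nonneg x) (Real.sqrt_nonneg η),
      mul_nonneg (Real.sqrt_nonneg η) (sq_nonneg (√x - √η)),
      mul_nonneg (Real.sqrt_nonneg η) (mul_nonneg (Real.sqrt_nonneg x) (Real.sqrt_nonneg η))]
  have e : x * (√x / (|x| + ε) - √x / (|x| + δ)) =
      (√x - x * (√x / (|x| + δ))) - (√x - x * (√x / (|x| + ε))) := by ring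
  rw [Pi.sub_apply, e]
  refine (abs_sub _ _).trans ?_
  linarith [key ε hε, key δ hδ]

lemma norm_polarReg_mul_sqrtAbs_sub_le (A : BOp H) {ε : ℝ} (hε : 0 < ε) :
    ‖polarReg A ε * sqrtAbs A - A‖ ≤ ε := by
  have ha := isSelfAdjoint_opAbs A
  have h1 := continuous_regularised_inv hε Real.continuous_sqrt
  have h2 : Continuous fun x : ℝ => √x / (|x| + ε) * √x := h1.mul Real.continuous_sqrt
  have e : polarReg A ε * sqrtAbs A - A = A * cfc (fun x => √x / (|x| + ε) * √x - 1) (opAbs A) := by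
    rw [cfc_sub _ _ (opAbs A) h2.continuousOn (by fun_prop),
      cfc_mul _ _ (opAbs A) h1.continuousOn (by fun_prop), cfc_const_one ℝ (opAbs A), mul_sub, mul_one,
      polarReg, sqrtAbs, mul_assoc]
  rw [e]
  refine norm_mul_cfc_le A (h2.sub continuous_const) hε.le fun x hx => ?_
  have e : x * (√x / (|x| + ε) * √x - 1) = - (x * ε / (x + ε)) := by
    rw [abs_of_nonneg hx, div_mul_eq_mul_div, Real.mul_self_sqrt hx]; field_simp; ring
  change |x * (√x / (|x| + ε) * √x - 1)| ≤ ε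
  rw [e, abs_neg, abs_of_nonneg (by positivity), div_le_iff₀ (by positivity)]
  nlinarith

lemma norm_star_phaseReg_mul_sub_le (A : BOp H) {ε : ℝ} (hε : 0 < ε) :
    ‖star (phaseReg A ε) * A - opAbs A‖ ≤ ε := by
  have ha := isSelfAdjoint_opAbs A
  have h1 := continuous_regularised_inv hε (continuous_const (y := (1 : ℝ)))
  have hsa : IsSelfAdjoint (cfc (fun x : ℝ => 1 / (|x| + ε)) (opAbs A)) := cfc_predicate _ _
  have h2 : Continuous fun x : ℝ => 1 / (|x| + ε) * (x * x) :=
    h1.mul (continuous_id.mul (continuous_id (X := ℝ)))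
  have e : star (phaseReg A ε) * A - opAbs A =
      cfc (fun x => 1 / (|x| + ε) * (x * x) - x) (opAbs A) := by
    rw [cfc_sub _ _ (opAbs A) h2.continuousOn (by fun_prop),
      cfc_mul _ _ (opAbs A) h1.continuousOn (by fun_prop),
      cfc_mul _ _ (opAbs A) (by fun_prop) (by fun_prop), cfc_id' ℝ (opAbs A), phaseReg, star_mul,
      hsa.star_eq, mul_assoc, opAbs_mul_opAbs]
  rw [e]
  refine norm_cfc_le hε.le fun x hx => ?_
  have hx := spectrum_opAbs_nonneg A hx
  have e : 1 / (|x| + ε) * (x * x) - x = - (x * ε / (x + ε)) := by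
    rw [abs_of_nonneg hx]; field_simp; ring
  rw [e, norm_neg, Real.norm_of_nonneg (by positivity), div_le_iff₀ (by positivity)]
  nlinarith

lemma tendsto_apply_of_tendsto {ι : Type*} {l : Filter ι} {T : ι → BOp H} {A : BOp H}
    (h : Tendsto T l (𝓝 A)) :
    ∀ u, Tendsto (fun B : BOp H => B u) (map T l) (𝓝 (A u)) := fun u =>
  tendsto_map'_iff.2 (((ContinuousLinearMap.apply ℂ H u).continuous.tendsto A).comp h)

lemma trNorm_le_of_tendsto {ι : Type*} {l : Filter ι} [l.NeBot] {T : ι → BOp H}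
    {A : BOp H} {c : ℝ≥0∞} (h : Tendsto T l (𝓝 A)) (hc : ∀ᶠ i in l, trNorm (T i) ≤ c) :
    trNorm A ≤ c := by
  refine (trNorm_le_liminf (tendsto_apply_of_tendsto h)).trans ?_
  exact (liminf_le_liminf (v := fun _ => c) (f := map T l) (eventually_map.2 hc)).trans
    (by rw [liminf_const])

lemma hsNorm_le_of_tendsto {ι : Type*} {l : Filter ι} [l.NeBot] {T : ι → BOp H}
    {A : BOp H} {c : ℝ≥0∞} (h : Tendsto T l (𝓝 A)) (hc : ∀ᶠ i in l, hsNorm (T i) ≤ c) :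
    hsNorm A ≤ c := by
  refine (hsNorm_le_liminf (tendsto_apply_of_tendsto h)).trans ?_
  exact (liminf_le_liminf (v := fun _ => c) (f := map T l) (eventually_map.2 hc)).trans
    (by rw [liminf_const])

lemma tendsto_of_norm_sub_le_eps {E : Type*} [NormedAddCommGroup E] {T : ℝ → E} {A : E}
    (h : ∀ ε : ℝ, 0 < ε → ‖T ε - A‖ ≤ ε) : Tendsto T (𝓝[>] 0) (𝓝 A) := by
  rw [tendsto_iff_norm_sub_tendsto_zero]
  refine squeeze_zero' (.of_forall fun _ => norm_nonneg _) ?_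
    (tendsto_nhdsWithin_of_tendsto_nhds (tendsto_id (α := ℝ)))
  filter_upwards [self_mem_nhdsWithin] with ε hε using h ε hε

lemma trNorm_opAbs_le (A : BOp H) : trNorm (opAbs A) ≤ trNorm A := by
  refine trNorm_le_of_tendsto
    (tendsto_of_norm_sub_le_eps fun ε hε => norm_star_phaseReg_mul_sub_le A hε) ?_
  filter_upwards [self_mem_nhdsWithin] with ε hε
  refine (trNorm_mul_le _ _).trans ?_
  have : ‖star (phaseReg A ε)‖ₑ ≤ 1 := by
    rw [← ofReal_norm, norm_star]; exact ofReal_le_one.2 (norm_phaseReg_le A hε)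
  calc _ ≤ 1 * trNorm A := by gcongr
    _ = _ := one_mul _

/-- Every operator is a product `X |A|^{1/2}` with `‖X‖₂ ≤ ‖|A|^{1/2}‖₂`. -/
lemma exists_mul_sqrtAbs (A : BOp H) :
    ∃ X : BOp H, A = X * sqrtAbs A ∧ hsNorm X ≤ hsNorm (sqrtAbs A) := by
  have hpos : ∀ n : ℕ, (0 : ℝ) < 1 / (n + 1) := fun n => by positivity
  have hlim : Tendsto (fun n : ℕ => (1 : ℝ) / (n + 1)) atTop (𝓝 0) :=
    tendsto_one_div_add_atTop_nhds_zero_nat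
  have hc : CauchySeq fun n : ℕ => polarReg A (1 / (n + 1)) := by
    have hs : Tendsto (fun n : ℕ => 2 * √((1 : ℝ) / (n + 1))) atTop (𝓝 0) := by
      have := ((Real.continuous_sqrt.tendsto 0).comp hlim).const_mul 2
      simpa using this
    refine cauchySeq_of_le_tendsto_0' _ (fun n m hnm => ?_) hs
    rw [dist_eq_norm]
    refine (norm_polarReg_sub_le A (hpos n) (hpos m)).trans ?_
    have : √((1 : ℝ) / (m + 1)) ≤ √(1 / (n + 1)) := by gcongr
    linarith
  obtain ⟨X, hX⟩ := cauchySeq_tendsto_of_complete hc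
  refine ⟨X, ?_, ?_⟩
  · have h1 := hX.mul_const (sqrtAbs A)
    refine tendsto_nhds_unique ?_ h1
    rw [tendsto_iff_norm_sub_tendsto_zero]
    exact squeeze_zero (fun _ => norm_nonneg _)
      (fun n => norm_polarReg_mul_sqrtAbs_sub_le A (hpos n)) hlim
  · refine hsNorm_le_of_tendsto hX (.of_forall fun n => ?_)
    rw [← phaseReg_mul_sqrtAbs A (hpos n)]
    refine (hsNorm_mul_le _ _).trans ?_
    have : ‖phaseReg A (1 / (n + 1))‖ₑ ≤ 1 := by
      rw [← ofReal_norm]; exact ofReal_le_one.2 (norm_phaseReg_le A (hpos n))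
    calc _ ≤ 1 * hsNorm (sqrtAbs A) := by gcongr
      _ = _ := one_mul _

lemma inner_opAbs_re (A : BOp H) (x : H) : (inner ℂ x (opAbs A x)).re = ‖sqrtAbs A x‖ ^ 2 := by
  rw [← sqrtAbs_mul_sqrtAbs]
  have : inner ℂ x ((sqrtAbs A * sqrtAbs A) x) = inner ℂ (sqrtAbs A x) (sqrtAbs A x) := by
    conv_rhs => rw [← (isSelfAdjoint_sqrtAbs A).star_eq, star_eq_adjoint,
      adjoint_inner_left]
    rw [← star_eq_adjoint, (isSelfAdjoint_sqrtAbs A).star_eq]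
    rfl
  rw [this]
  exact inner_self_eq_norm_sq (𝕜 := ℂ) _

lemma hsNorm_sqrtAbs_sq (A : BOp H) : hsNorm (sqrtAbs A) ^ 2 = trNorm A := by
  obtain ⟨w, b, -⟩ := exists_hilbertBasis ℂ H
  refine le_antisymm ?_ ?_
  · refine le_trans ?_ (trNorm_opAbs_le A)
    rw [hsNorm_sq_eq_tsum b]
    refine ENNReal.summable.tsum_le_of_sum_le fun s => ?_
    have hb : IsBessel (fun i : s => b i) :=
      isBessel_orthonormal (b.orthonormal.comp _ Subtype.val_injective)
    refine le_trans ?_ (enorm_sum_inner_le_trNorm (opAbs A) hb hb)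
    have h1 : ∑ i : s, ‖sqrtAbs A (b i)‖ ^ 2 = (∑ i : s, inner ℂ (b i) (opAbs A (b i))).re := by
      rw [Complex.re_sum]
      exact Finset.sum_congr rfl fun i _ => (inner_opAbs_re A _).symm
    rw [← Finset.sum_coe_sort s (fun i => ‖sqrtAbs A (b i)‖ₑ ^ 2)]
    simp only [← ofReal_sq_norm]
    rw [← ofReal_sum_of_nonneg (fun i _ => by positivity), h1, ← ofReal_norm]
    exact ofReal_le_ofReal (Complex.re_le_norm _)
  · obtain ⟨X, hX, hX2⟩ := exists_mul_sqrtAbs A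
    conv_lhs => rw [hX]
    refine (trNorm_mul_le_hsNorm _ _).trans ?_
    rw [pow_two]
    gcongr

/-- A trace-class operator is a product of two Hilbert–Schmidt operators. -/
lemma exists_hsNorm_factorisation (A : BOp H) : ∃ X Y : BOp H, A = X * Y ∧
    hsNorm X ^ 2 ≤ trNorm A ∧ hsNorm Y ^ 2 ≤ trNorm A := by
  obtain ⟨X, hX, hX2⟩ := exists_mul_sqrtAbs A
  refine ⟨X, sqrtAbs A, hX, ?_, (hsNorm_sqrtAbs_sq A).le⟩
  rw [← hsNorm_sqrtAbs_sq A]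
  gcongr

end Polar

lemma schattenENorm_one {d : ℕ} (A : Op d) : schattenENorm 1 A = trNorm A := by
  rw [schattenENorm, posTrace, ← hsNorm_sqrtAbs_sq, hsNorm_sq_eq_tsum (basis d)]
  simp only [pow_one, Nat.cast_one, div_one, ENNReal.rpow_one]
  exact tsum_congr fun i => by rw [inner_opAbs_re, ofReal_sq_norm]

lemma schattenENorm_two {d : ℕ} (A : Op d) : schattenENorm 2 A = hsNorm A := by
  have h : posTrace (opAbs A ^ 2) = hsNorm A ^ 2 := by
    rw [posTrace, hsNorm_sq_eq_tsum (basis d)]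
    refine tsum_congr fun i => ?_
    rw [pow_two, opAbs_mul_opAbs, ← ofReal_sq_norm]
    congr 1
    rw [star_eq_adjoint, mul_apply_eq_comp, adjoint_inner_right]
    exact inner_self_eq_norm_sq (𝕜 := ℂ) _
  rw [schattenENorm, h]
  rw [← ENNReal.rpow_natCast, ← ENNReal.rpow_mul]
  norm_num

/-- Cyclicity of the trace for products of Hilbert–Schmidt operators. -/
lemma trace_mul_star {d : ℕ} {X Y : Op d} (hX : hsNorm X < ∞) (hY : hsNorm Y < ∞) :
    trace (X * star Y) = ∑' i, inner ℂ (Y (basis d i)) (X (basis d i)) := by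
  set b := basis d
  have key : Summable (Function.uncurry fun i k =>
      inner ℂ (Y (b i)) (b k) * inner ℂ (b k) (X (b i))) := by
    have hsum : ∀ A : Op d, hsNorm A < ∞ →
        Summable fun p : basisSet d × basisSet d => ‖inner ℂ (b p.2) (A (b p.1))‖ ^ 2 := by
      intro A hA
      have h1 : ∑' p : basisSet d × basisSet d, ofReal (‖inner ℂ (b p.2) (A (b p.1))‖ ^ 2) =
          hsNorm A ^ 2 := by
        rw [ENNReal.tsum_prod', hsNorm_sq_eq_tsum b]
        refine tsum_congr fun i => ?_
        rw [← HilbertBasis.tsum_enorm_inner_sq b]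
        exact tsum_congr fun k => ofReal_sq_norm _
      have := summable_toReal (h1.trans_ne (pow_lt_top hA).ne)
      simpa [toReal_ofReal] using this
    refine Summable.of_norm_bounded ((hsum Y hY).add (hsum X hX)) fun p => ?_
    rw [Function.uncurry_def, norm_mul, norm_inner_symm]
    nlinarith [sq_nonneg (‖inner ℂ (b p.2) (Y (b p.1))‖ - ‖inner ℂ (b p.2) (X (b p.1))‖),
      norm_nonneg (inner ℂ (b p.2) (Y (b p.1))), norm_nonneg (inner ℂ (b p.2) (X (b p.1)))]
  rw [trace]
  calc _ = ∑' k, ∑' i, inner ℂ (Y (b i)) (b k) * inner ℂ (b k) (X (b i)) := by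
        refine tsum_congr fun k => ?_
        have h1 : inner ℂ (b k) ((X * star Y) (b k)) = inner ℂ (star X (b k)) (star Y (b k)) := by
          simp [star_eq_adjoint, adjoint_inner_left]
        rw [h1, ← b.tsum_inner_mul_inner]
        refine tsum_congr fun i => ?_
        simp only [star_eq_adjoint, adjoint_inner_left, adjoint_inner_right]
        ring
    _ = ∑' i, ∑' k, inner ℂ (Y (b i)) (b k) * inner ℂ (b k) (X (b i)) := key.tsum_comm
    _ = _ := tsum_congr fun i => b.tsum_inner_mul_inner _ _

/-! ### Extended seminorms on the bounded operators -/

lemma ennreal_le_liminf_add {α : Type*} (F : Filter α) (u v : α → ℝ≥0∞) :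
    liminf u F + liminf v F ≤ liminf (fun x => u x + v x) F := by
  rw [liminf_eq_iSup_iInf, liminf_eq_iSup_iInf]
  refine ENNReal.biSup_add_biSup_le' ⟨univ, univ_mem⟩ ⟨univ, univ_mem⟩ fun s hs t ht => ?_
  refine le_liminf_of_le (by isBoundedDefault) ?_
  filter_upwards [hs, ht] with x hx hx'
  exact add_le_add (iInf₂_le x hx) (iInf₂_le x hx')

lemma tendsto_zero_of_le {α : Type*} {l : Filter α} {f g : α → ℝ≥0∞} (hg : Tendsto g l (𝓝 0))
    (h : ∀ a, f a ≤ g a) : Tendsto f l (𝓝 0) :=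
  tendsto_of_tendsto_of_tendsto_of_le_of_le tendsto_const_nhds hg (fun _ => zero_le) h

/-- A `[0, ∞]`-valued real seminorm on bounded operators, lower semicontinuous for strong
convergence. -/
structure ExtNorm (H : Type*) [NormedAddCommGroup H] [InnerProductSpace ℂ H] where
  toFun : BOp H → ℝ≥0∞
  map_zero' : toFun 0 = 0
  add_le' : ∀ A B, toFun (A + B) ≤ toFun A + toFun B
  smul_le' : ∀ (c : ℝ) A, toFun (c • A) ≤ ‖c‖ₑ * toFun A
  le_liminf' : ∀ (F : Filter (BOp H)) [F.NeBot] (A : BOp H),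
    (∀ u, Tendsto (fun T : BOp H => T u) F (𝓝 (A u))) → toFun A ≤ liminf toFun F

namespace ExtNorm

instance : CoeFun (ExtNorm H) fun _ => (BOp H) → ℝ≥0∞ := ⟨toFun⟩

@[simp] lemma map_zero (p : ExtNorm H) : p 0 = 0 := p.map_zero'

lemma add_le (p : ExtNorm H) (A B : BOp H) : p (A + B) ≤ p A + p B := p.add_le' A B

lemma smul_le (p : ExtNorm H) (c : ℝ) (A : BOp H) : p (c • A) ≤ ‖c‖ₑ * p A := p.smul_le' c A

lemma smul_eq (p : ExtNorm H) (c : ℝ) (A : BOp H) : p (c • A) = ‖c‖ₑ * p A := by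
  rcases eq_or_ne c 0 with rfl | hc
  · simp
  refine le_antisymm (p.smul_le c A) ?_
  have h := p.smul_le c⁻¹ (c • A)
  rw [smul_smul, inv_mul_cancel₀ hc, one_smul] at h
  calc ‖c‖ₑ * p A ≤ ‖c‖ₑ * (‖c⁻¹‖ₑ * p (c • A)) := by gcongr
    _ = p (c • A) := by rw [← mul_assoc, ← enorm_mul, mul_inv_cancel₀ hc, enorm_one, one_mul]

lemma neg_eq (p : ExtNorm H) (A : BOp H) : p (-A) = p A := by
  have := p.smul_eq (-1) A
  simpa using this

lemma sub_le (p : ExtNorm H) (A B : BOp H) : p (A - B) ≤ p A + p B := by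
  rw [sub_eq_add_neg, ← p.neg_eq B]
  exact p.add_le _ _

lemma le_liminf (p : ExtNorm H) {F : Filter (BOp H)} [F.NeBot] {A : BOp H}
    (h : ∀ u, Tendsto (fun T : BOp H => T u) F (𝓝 (A u))) : p A ≤ liminf p F :=
  p.le_liminf' F A h

lemma le_of_tendsto_apply (p : ExtNorm H) {ι : Type*} {l : Filter ι} [l.NeBot]
    {T : ι → BOp H} {A : BOp H} {c : ℝ≥0∞} (h : ∀ u, Tendsto (fun i => T i u) l (𝓝 (A u)))
    (hc : ∀ᶠ i in l, p (T i) ≤ c) : p A ≤ c := by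
  refine (p.le_liminf (F := map T l) fun u => tendsto_map'_iff.2 (h u)).trans ?_
  exact (liminf_le_liminf (v := fun _ => c) (f := map T l) (eventually_map.2 hc)).trans
    (by rw [liminf_const])

lemma le_of_tendsto (p : ExtNorm H) {ι : Type*} {l : Filter ι} [l.NeBot]
    {T : ι → BOp H} {A : BOp H} {c : ℝ≥0∞} (h : Tendsto T l (𝓝 A))
    (hc : ∀ᶠ i in l, p (T i) ≤ c) : p A ≤ c :=
  p.le_of_tendsto_apply (fun u => ((ContinuousLinearMap.apply ℂ H u).continuous.tendsto A).comp h) hc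

lemma sum_le (p : ExtNorm H) {ι : Type*} (s : Finset ι) (T : ι → BOp H) :
    p (∑ i ∈ s, T i) ≤ ∑ i ∈ s, p (T i) := by
  classical
  induction s using Finset.induction_on with
  | empty => simp
  | insert a s ha ih =>
    rw [Finset.sum_insert ha, Finset.sum_insert ha]
    exact (p.add_le _ _).trans (by gcongr)

/-- Countable subadditivity for strongly convergent series. -/
lemma le_tsum (p : ExtNorm H) {ι : Type*} {T : ι → BOp H} {A : BOp H}
    (h : ∀ u, HasSum (fun i => T i u) (A u)) : p A ≤ ∑' i, p (T i) := by
  refine p.le_of_tendsto_apply (T := fun s : Finset ι => ∑ i ∈ s, T i) (l := atTop) (fun u => ?_)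
    (.of_forall fun s => (p.sum_le s T).trans (ENNReal.sum_le_tsum s))
  have := h u
  rw [HasSum, SummationFilter.unconditional_filter] at this
  simpa using this

lemma convex_le (p : ExtNorm H) (c : ℝ≥0∞) : Convex ℝ {A | p A ≤ c} := by
  intro A hA B hB a b ha hb hab
  refine (p.add_le _ _).trans ?_
  rw [p.smul_eq, p.smul_eq]
  calc ‖a‖ₑ * p A + ‖b‖ₑ * p B ≤ ‖a‖ₑ * c + ‖b‖ₑ * c := by
        gcongr <;> assumption
    _ = (‖a‖ₑ + ‖b‖ₑ) * c := by ring
    _ = c := by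
      rw [Real.enorm_of_nonneg ha, Real.enorm_of_nonneg hb, ← ofReal_add ha hb, hab]
      simp

lemma isClosed_le (p : ExtNorm H) (c : ℝ≥0∞) : IsClosed {A | p A ≤ c} := by
  refine isClosed_of_closure_subset fun A hA => ?_
  rw [mem_closure_iff_nhdsWithin_neBot] at hA
  exact p.le_of_tendsto (T := id) (l := 𝓝[{A | p A ≤ c}] A)
    (tendsto_id.mono_left nhdsWithin_le_nhds) self_mem_nhdsWithin

lemma integral_le [CompleteSpace H] (p : ExtNorm H) {f : ℝ → BOp H} {a b : ℝ} {c : ℝ≥0∞}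
    (hf : IntervalIntegrable f volume a b) (hc : ∀ s ∈ uIoc a b, p (f s) ≤ c) :
    p (∫ s in a..b, f s) ≤ ‖b - a‖ₑ * c := by
  wlog hab : a ≤ b generalizing a b
  · have h := this hf.symm (by rwa [uIoc_comm]) (le_of_not_ge hab)
    rw [intervalIntegral.integral_symm, p.neg_eq]
    rwa [← enorm_neg, neg_sub] at h
  rcases hab.eq_or_lt with rfl | hab'
  · simp
  have h1 : ⨍ s in Ioc a b, f s ∈ {A | p A ≤ c} := by
    refine (p.convex_le c).set_average_mem (p.isClosed_le c) ?_ ?_ ?_ hf.1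
    · simpa using hab'
    · simp
    · refine (ae_restrict_iff' measurableSet_Ioc).2 (.of_forall fun s hs => hc s ?_)
      rwa [uIoc_of_le hab]
  have h2 : ∫ s in a..b, f s = (b - a) • ⨍ s in Ioc a b, f s := by
    rw [intervalIntegral.integral_of_le hab, setAverage_eq, smul_smul]
    have : (b - a) * (volume.real (Ioc a b))⁻¹ = 1 := by
      rw [Real.volume_real_Ioc_of_le hab, mul_inv_cancel₀ (by linarith)]
    rw [this, one_smul]
  rw [h2, p.smul_eq]
  gcongr
  exact h1

def op (H : Type*) [NormedAddCommGroup H] [InnerProductSpace ℂ H] : ExtNorm H where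
  toFun A := ‖A‖ₑ
  map_zero' := by rw [← ofReal_norm, norm_zero, ENNReal.ofReal_zero]
  add_le' A B := enorm_add_le A B
  smul_le' c A := by rw [enorm_smul]
  le_liminf' F _ A h := by
    refine enorm_le_of_forall_unit fun x hx => ?_
    have h1 : Tendsto (fun T : BOp H => ‖T x‖ₑ) F (𝓝 ‖A x‖ₑ) :=
      (continuous_enorm.tendsto _).comp (h x)
    rw [← h1.liminf_eq]
    refine liminf_le_liminf (.of_forall fun T => ?_)
    rw [← ofReal_norm, ← ofReal_norm]
    exact ofReal_le_ofReal ((T.le_opNorm x).trans (by nlinarith [norm_nonneg T]))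

def hs (H : Type*) [NormedAddCommGroup H] [InnerProductSpace ℂ H] : ExtNorm H where
  toFun := hsNorm
  map_zero' := hsNorm_zero
  add_le' := hsNorm_add_le
  smul_le' := hsNorm_smul_le
  le_liminf' _ _ _ h := hsNorm_le_liminf h

def tr (H : Type*) [NormedAddCommGroup H] [InnerProductSpace ℂ H] : ExtNorm H where
  toFun := trNorm
  map_zero' := trNorm_zero
  add_le' := trNorm_add_le
  smul_le' := trNorm_smul_le
  le_liminf' _ _ _ h := trNorm_le_liminf h

/-- The seminorm `A ↦ p (L A R)`. -/
def sandwich (p : ExtNorm H) (L R : BOp H) : ExtNorm H where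
  toFun A := p (L * A * R)
  map_zero' := by simp
  add_le' A B := by rw [mul_add, add_mul]; exact p.add_le _ _
  smul_le' c A := by rw [mul_smul_comm, smul_mul_assoc]; exact p.smul_le _ _
  le_liminf' F _ A h := by
    have := p.le_liminf (F := map (fun T => L * T * R) F) (A := L * A * R) fun u =>
      tendsto_map'_iff.2 ((L.continuous.tendsto _).comp (h (R u)))
    exact this

def add (p q : ExtNorm H) : ExtNorm H where
  toFun A := p A + q A
  map_zero' := by simp
  add_le' A B := (add_le_add (p.add_le A B) (q.add_le A B)).trans (le_of_eq (by ring))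
  smul_le' c A := by rw [p.smul_eq, q.smul_eq, mul_add]
  le_liminf' F _ A h := (add_le_add (p.le_liminf h) (q.le_liminf h)).trans
    (ennreal_le_liminf_add F p q)

def scale (c : NNReal) (p : ExtNorm H) : ExtNorm H where
  toFun A := c * p A
  map_zero' := by simp
  add_le' A B := by rw [← mul_add]; gcongr (c : ℝ≥0∞) * ?_; exact p.add_le A B
  smul_le' r A := by rw [p.smul_eq, mul_left_comm]
  le_liminf' F _ A h := by
    rw [ENNReal.liminf_const_mul_of_ne_top ENNReal.coe_ne_top]
    gcongr
    exact p.le_liminf h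

def sup {ι : Type*} (p : ι → ExtNorm H) : ExtNorm H where
  toFun A := ⨆ i, p i A
  map_zero' := by simp
  add_le' A B := iSup_le fun i => ((p i).add_le A B).trans
    (add_le_add (le_iSup (fun i => p i A) i) (le_iSup (fun i => p i B) i))
  smul_le' c A := iSup_le fun i => ((p i).smul_le c A).trans
    (by gcongr; exact le_iSup (fun i => p i A) i)
  le_liminf' F _ A h := iSup_le fun i => ((p i).le_liminf h).trans
    (liminf_le_liminf (.of_forall fun T => le_iSup (fun i => p i T) i))

def zero (H : Type*) [NormedAddCommGroup H] [InnerProductSpace ℂ H] : ExtNorm H where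
  toFun _ := 0
  map_zero' := rfl
  add_le' _ _ := by simp
  smul_le' _ _ := by simp
  le_liminf' _ _ _ _ := zero_le

lemma exists_sum {ι : Type*} (p : ι → ExtNorm H) (s : Finset ι) :
    ∃ q : ExtNorm H, ∀ A, q A = ∑ i ∈ s, p i A := by
  classical
  induction s using Finset.induction_on with
  | empty => exact ⟨zero H, fun A => rfl⟩
  | insert a s ha ih =>
    obtain ⟨q, hq⟩ := ih
    exact ⟨(p a).add q, fun A => by rw [Finset.sum_insert ha, ← hq]; rfl⟩

def tsum {ι : Type*} (p : ι → ExtNorm H) : ExtNorm H where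
  toFun A := ∑' i, p i A
  map_zero' := by simp
  add_le' A B := by rw [← ENNReal.tsum_add]; exact tsum_le_tsum fun i => (p i).add_le A B
  smul_le' c A := by rw [← ENNReal.tsum_mul_left]; exact tsum_le_tsum fun i => (p i).smul_le c A
  le_liminf' F _ A h := by
    rw [ENNReal.tsum_eq_iSup_sum]
    refine iSup_le fun s => ?_
    obtain ⟨q, hq⟩ := exists_sum p s
    rw [← hq]
    refine (q.le_liminf h).trans (liminf_le_liminf (.of_forall fun T => ?_))
    rw [hq]
    exact ENNReal.sum_le_tsum s

open Classical in
/-- The seminorm restricted to the self-adjoint operators (infinite elsewhere). -/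
def sa [CompleteSpace H] (p : ExtNorm H) : ExtNorm H where
  toFun A := if IsSelfAdjoint A then p A else ∞
  map_zero' := by simp
  add_le' A B := by
    by_cases hA : IsSelfAdjoint A <;> by_cases hB : IsSelfAdjoint B <;> simp [hA, hB]
    simpa [hA.add hB] using p.add_le A B
  smul_le' c A := by
    rcases eq_or_ne c 0 with rfl | hc
    · simp
    by_cases hA : IsSelfAdjoint A
    · have h : IsSelfAdjoint (c • A) := (IsSelfAdjoint.all c).smul hA
      simpa [hA, h] using p.smul_le c A
    · have : ‖c‖ₑ * ∞ = ∞ := mul_top (by simpa using hc)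
      simp [hA, this]
  le_liminf' F _ A h := by
    by_cases hF : ∃ᶠ T in F, IsSelfAdjoint T
    · have hA : IsSelfAdjoint A := by
        rw [ContinuousLinearMap.isSelfAdjoint_iff_isSymmetric]
        intro x y
        have h1 : Tendsto (fun T : BOp H => inner ℂ (T x) y - inner ℂ x (T y)) F
            (𝓝 (inner ℂ (A x) y - inner ℂ x (A y))) :=
          ((h x).inner tendsto_const_nhds).sub (tendsto_const_nhds.inner (h y))
        have h2 : ∃ᶠ T in F, inner ℂ (T x) y - inner ℂ x (T y) ∈ ({0} : Set ℂ) :=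
          hF.mono fun T hT => by
            rw [ContinuousLinearMap.isSelfAdjoint_iff_isSymmetric] at hT
            exact sub_eq_zero.2 (hT x y)
        have := isClosed_singleton.mem_of_frequently_of_tendsto h2 h1
        exact sub_eq_zero.1 this
      rw [if_pos hA]
      refine (p.le_liminf h).trans (liminf_le_liminf (.of_forall fun T => ?_))
      change p T ≤ if IsSelfAdjoint T then p T else ∞
      split_ifs <;> simp
    · rw [not_frequently] at hF
      have h1 : ∀ᶠ T : BOp H in F, (∞ : ℝ≥0∞) ≤ if IsSelfAdjoint T then p T else ∞ := by
        filter_upwards [hF] with T hT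
        rw [if_neg hT]
      exact le_top.trans (le_liminf_of_le (by isBoundedDefault) h1)

lemma sa_apply [CompleteSpace H] (p : ExtNorm H) {A : BOp H} (hA : IsSelfAdjoint A) :
    p.sa A = p A := if_pos hA

lemma selfAdjoint_of_sa [CompleteSpace H] (p : ExtNorm H) {A : BOp H}
    (hA : p.sa A < ∞) : IsSelfAdjoint A := by
  by_contra h
  exact absurd hA (by simp [sa, h])

lemma le_sa [CompleteSpace H] (p : ExtNorm H) (A : BOp H) : p A ≤ p.sa A := by
  by_cases h : IsSelfAdjoint A <;> simp [sa, h]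

/-- The operators of finite seminorm. -/
def finite (p : ExtNorm H) : Submodule ℝ (BOp H) where
  carrier := {A | p A < ∞}
  add_mem' ha hb := (p.add_le _ _).trans_lt (add_lt_top.2 ⟨ha, hb⟩)
  zero_mem' := by simp
  smul_mem' c A hA := (p.smul_le c A).trans_lt (mul_lt_top enorm_lt_top hA)

end ExtNorm

/-- The Banach space of the operators with finite extended seminorm `p`, with norm
`‖A‖ + p A`. -/
def FN (p : ExtNorm H) : Type _ := p.finite

namespace FN

variable {p q r : ExtNorm H}

instance : AddCommGroup (FN p) := inferInstanceAs (AddCommGroup p.finite)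
instance : Module ℝ (FN p) := inferInstanceAs (Module ℝ p.finite)

def val (a : FN p) : BOp H := Subtype.val (p := fun A => A ∈ p.finite) a

def mk (A : BOp H) (h : p A < ∞) : FN p := (⟨A, h⟩ : p.finite)

@[simp] lemma val_mk (A : BOp H) (h : p A < ∞) : (mk A h : FN p).val = A := rfl
lemma lt_top (a : FN p) : p a.val < ∞ := Subtype.prop (p := fun A => A ∈ p.finite) a
lemma ext {a b : FN p} (h : a.val = b.val) : a = b := Subtype.ext (p := fun A => A ∈ p.finite) h
@[simp] lemma val_add (a b : FN p) : (a + b).val = a.val + b.val := rfl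
@[simp] lemma val_sub (a b : FN p) : (a - b).val = a.val - b.val := rfl
@[simp] lemma val_neg (a : FN p) : (-a).val = -a.val := rfl
@[simp] lemma val_zero : (0 : FN p).val = 0 := rfl
@[simp] lemma val_smul (c : ℝ) (a : FN p) : (c • a).val = c • a.val := rfl

def addGroupNorm (p : ExtNorm H) : AddGroupNorm (FN p) where
  toFun a := ‖a.val‖ + (p a.val).toReal
  map_zero' := by simp
  add_le' a b := by
    have h1 := norm_add_le a.val b.val
    have h2 : (p (a.val + b.val)).toReal ≤ (p a.val).toReal + (p b.val).toReal := by
      rw [← ENNReal.toReal_add a.lt_top.ne b.lt_top.ne]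
      exact toReal_mono (add_lt_top.2 ⟨a.lt_top, b.lt_top⟩).ne (p.add_le _ _)
    simp only [val_add]
    linarith
  neg' a := by simp [p.neg_eq]
  eq_zero_of_map_eq_zero' a h := by
    have h1 := norm_nonneg a.val
    have h2 := toReal_nonneg (a := p a.val)
    have : ‖a.val‖ = 0 := by linarith
    exact FN.ext (norm_eq_zero.1 this)

instance : NormedAddCommGroup (FN p) := (addGroupNorm p).toNormedAddCommGroup

lemma norm_def (a : FN p) : ‖a‖ = ‖a.val‖ + (p a.val).toReal := rfl

lemma enorm_def (a : FN p) : ‖a‖ₑ = ‖a.val‖ₑ + p a.val := by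
  rw [← ofReal_norm, norm_def, ofReal_add (norm_nonneg _) toReal_nonneg,
    ofReal_toReal a.lt_top.ne, ofReal_norm]

instance : NormedSpace ℝ (FN p) where
  norm_smul_le c a := by
    rw [norm_def, norm_def, val_smul, norm_smul, p.smul_eq, toReal_mul, toReal_enorm, mul_add]

lemma norm_val_le (a : FN p) : ‖a.val‖ ≤ ‖a‖ := by
  rw [norm_def]; linarith [toReal_nonneg (a := p a.val)]

lemma le_enorm (a : FN p) : p a.val ≤ ‖a‖ₑ := by rw [enorm_def]; exact le_add_self

/-- The inclusion into the bounded operators. -/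
def valL (p : ExtNorm H) : FN p →L[ℝ] (BOp H) :=
  LinearMap.mkContinuous ⟨⟨val, val_add⟩, val_smul⟩ 1 fun a => by rw [one_mul]; exact norm_val_le a

lemma norm_le_of_enorm {a : FN p} {c : ℝ≥0∞} (hc : c ≠ ∞) (h : ‖a.val‖ₑ + p a.val ≤ c) :
    ‖a‖ ≤ c.toReal := by
  rw [← toReal_enorm, enorm_def]
  exact toReal_mono hc h

instance [CompleteSpace H] : CompleteSpace (FN p) := by
  refine Metric.complete_of_cauchySeq_tendsto fun u hu => ?_
  have hv : CauchySeq fun n => (u n).val := hu.map (valL p).uniformContinuous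
  obtain ⟨A, hA⟩ := cauchySeq_tendsto_of_complete hv
  have key : ∀ ε : ℝ, 0 < ε → ∃ N, ∀ n ≥ N, p (A - (u n).val) ≤ ofReal ε := by
    intro ε hε
    obtain ⟨N, hN⟩ := Metric.cauchySeq_iff.1 hu ε hε
    refine ⟨N, fun n hn => ?_⟩
    refine p.le_of_tendsto (hA.sub_const (u n).val) ?_
    filter_upwards [eventually_ge_atTop N] with m hm
    have h1 := (hN m hm n hn).le
    rw [dist_eq_norm] at h1
    refine (le_enorm (u m - u n)).trans ?_
    rw [← ofReal_norm]
    exact ofReal_le_ofReal h1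
  have hfin : p A < ∞ := by
    obtain ⟨N, hN⟩ := key 1 one_pos
    have := p.add_le (A - (u N).val) (u N).val
    rw [sub_add_cancel] at this
    exact this.trans_lt (add_lt_top.2 ⟨(hN N le_rfl).trans_lt ofReal_lt_top, (u N).lt_top⟩)
  refine ⟨mk A hfin, ?_⟩
  rw [tendsto_iff_norm_sub_tendsto_zero]
  have h0 := tendsto_iff_norm_sub_tendsto_zero.1 hA
  rw [Metric.tendsto_atTop] at h0 ⊢
  intro ε hε
  obtain ⟨N1, hN1⟩ := h0 (ε / 2) (by positivity)
  obtain ⟨N2, hN2⟩ := key (ε / 4) (by positivity)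
  refine ⟨max N1 N2, fun n hn => ?_⟩
  have h1 := hN1 n (le_of_max_le_left hn)
  have h2 := hN2 n (le_of_max_le_right hn)
  simp only [dist_zero_right, norm_norm] at h1 ⊢
  rw [norm_def, val_sub, val_mk, ← p.neg_eq, neg_sub]
  have h3 : (p (A - (u n).val)).toReal ≤ ε / 4 := by
    have := toReal_mono ENNReal.ofReal_ne_top h2
    rwa [toReal_ofReal (by positivity)] at this
  linarith

/-- A continuous linear map `FN p → FN q` from a map of operators, linear on operators of finite
seminorm. -/
def lin (L : BOp H → (BOp H)) (C : NNReal) (hadd : ∀ A B, p A < ∞ → p B < ∞ → L (A + B) = L A + L B)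
    (hsmul : ∀ (c : ℝ) A, p A < ∞ → L (c • A) = c • L A)
    (hL : ∀ A, p A < ∞ → ‖L A‖ₑ + q (L A) ≤ C * (‖A‖ₑ + p A)) : FN p →L[ℝ] FN q :=
  LinearMap.mkContinuous
    { toFun := fun a => mk (L a.val) ((le_add_self.trans (hL a.val a.lt_top)).trans_lt
        (mul_lt_top coe_lt_top (add_lt_top.2 ⟨enorm_lt_top, a.lt_top⟩)))
      map_add' := fun a b => FN.ext (hadd _ _ a.lt_top b.lt_top)
      map_smul' := fun c a => FN.ext (hsmul c _ a.lt_top) } C fun a => by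
    have h : (C : ℝ≥0∞) * ‖a‖ₑ ≠ ∞ := (mul_lt_top coe_lt_top enorm_lt_top).ne
    have := norm_le_of_enorm (p := q) (a := mk (L a.val) ((le_add_self.trans
      (hL a.val a.lt_top)).trans_lt (mul_lt_top coe_lt_top
        (add_lt_top.2 ⟨enorm_lt_top, a.lt_top⟩)))) h
      (by rw [enorm_def]; exact hL a.val a.lt_top)
    rwa [toReal_mul, toReal_enorm, ENNReal.coe_toReal] at this

section Bilin

variable (B : BOp H →ₗ[ℝ] BOp H →ₗ[ℝ] BOp H) (C : NNReal) (hB : ∀ A D, p A < ∞ → q D < ∞ →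
  ‖B A D‖ₑ + r (B A D) ≤ C * ((‖A‖ₑ + p A) * (‖D‖ₑ + q D)))

def bilinVal (a : FN p) (b : FN q) : FN r :=
  mk (B a.val b.val) ((le_add_self.trans (hB _ _ a.lt_top b.lt_top)).trans_lt (mul_lt_top
    coe_lt_top (mul_lt_top (add_lt_top.2 ⟨enorm_lt_top, a.lt_top⟩)
      (add_lt_top.2 ⟨enorm_lt_top, b.lt_top⟩))))

lemma norm_bilinVal_le (a : FN p) (b : FN q) : ‖bilinVal B C hB a b‖ ≤ C * ‖a‖ * ‖b‖ := by
  have h : (C : ℝ≥0∞) * (‖a‖ₑ * ‖b‖ₑ) ≠ ∞ :=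
    (mul_lt_top coe_lt_top (mul_lt_top enorm_lt_top enorm_lt_top)).ne
  have := norm_le_of_enorm (a := bilinVal B C hB a b) h
    (by rw [enorm_def, enorm_def]; exact hB _ _ a.lt_top b.lt_top)
  rwa [toReal_mul, toReal_mul, toReal_enorm, toReal_enorm, ENNReal.coe_toReal, ← mul_assoc] at this

/-- A continuous bilinear map from a bilinear map of operators. -/
def bilin : FN p →L[ℝ] FN q →L[ℝ] FN r :=
  LinearMap.mkContinuous₂ (LinearMap.mk₂ ℝ (bilinVal B C hB)
      (fun a a' b => FN.ext (B.map_add₂ a.val a'.val b.val))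
      (fun c a b => FN.ext (B.map_smul₂ c a.val b.val))
      (fun a b b' => FN.ext ((B a.val).map_add b.val b'.val))
      (fun c a b => FN.ext ((B a.val).map_smul c b.val))) C (norm_bilinVal_le B C hB)

lemma norm_bilin_le (a : FN p) (b : FN q) : ‖bilin B C hB a b‖ ≤ C * ‖a‖ * ‖b‖ :=
  norm_bilinVal_le B C hB a b

end Bilin

end FN

open Hartree.ExtNorm (selfAdjoint_of_sa)

variable {d : ℕ} {μ t : ℝ} {S B : Set (Space d)} {m m' V ρ ρ' : Space d → ℂ} {w w' : Space d → ℝ}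
  {A X : Op d} {p : ExtNorm (L2 d)} {j k l : Fin d → ℤ}

/-! ### Separability -/

instance instCountableBasisSet : Countable (basisSet d) := by
  have : Fact ((2 : ℝ≥0∞) ≠ ∞) := ⟨by norm_num⟩
  have h2 : SecondCountableTopology (L2 d) := Lp.SecondCountableTopology
  have hd : Pairwise (Function.onFun Disjoint fun i : basisSet d => Metric.ball (basis d i) (1 / 2)) := by
    intro i j hij
    refine Metric.ball_disjoint_ball ?_
    have h := (basis d).orthonormal
    have h1 : ‖basis d i - basis d j‖ ^ 2 = 2 := by
      rw [norm_sub_sq (𝕜 := ℂ), h.2 hij, h.1 i, h.1 j]; norm_num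
    rw [dist_eq_norm]
    nlinarith [norm_nonneg (basis d i - basis d j)]
  have := Pairwise.countable_of_isOpen_disjoint hd (fun i => Metric.isOpen_ball)
    fun i => Metric.nonempty_ball.2 (by norm_num)
  exact this

/-! ### Multiplication operators -/

lemma memLp_top_of_forall_norm_le (hm : AEStronglyMeasurable m volume) {C : ℝ}
    (h : ∀ x, ‖m x‖ ≤ C) : MemLp m ∞ (volume : Measure (Space d)) :=
  memLp_top_of_bound hm C (.of_forall h)

lemma mulOp_apply (hm : MemLp m ∞ volume) (u : L2 d) : mulOp m u =ᵐ[volume] fun x => m x * u x := by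
  have h : mulOp m = (ContinuousLinearMap.mul ℂ ℂ).holderL volume ∞ 2 2 hm.toLp := dif_pos hm
  rw [h]
  have h1 := (ContinuousLinearMap.mul ℂ ℂ).coeFn_holder (r := 2) hm.toLp u
  refine h1.trans ?_
  filter_upwards [hm.coeFn_toLp] with x hx
  simp [hx]

lemma mulOp_ext (hm : MemLp m ∞ volume)
    (h : ∀ u : L2 d, A u =ᵐ[volume] fun x => m x * u x) : A = mulOp m := by
  ext1 u
  exact Lp.ext ((h u).trans (mulOp_apply hm u).symm)

lemma mulOp_congr (hm : MemLp m ∞ volume) (h : m =ᵐ[volume] m') : mulOp m = mulOp m' := by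
  refine mulOp_ext ((memLp_congr_ae h).1 hm) fun u => ?_
  filter_upwards [mulOp_apply hm u, h] with x h1 h2
  rw [h1, h2]

lemma memLp_top_mul (hm : MemLp m ∞ volume) (hm' : MemLp m' ∞ volume) :
    MemLp (fun x => m x * m' x) ∞ volume := hm'.mul (r := ∞) hm

lemma mulOp_mul (hm : MemLp m ∞ volume) (hm' : MemLp m' ∞ volume) :
    mulOp m * mulOp m' = mulOp fun x => m x * m' x := by
  refine mulOp_ext (memLp_top_mul hm hm') fun u => ?_
  filter_upwards [mulOp_apply hm (mulOp m' u), mulOp_apply hm' u] with x h1 h2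
  rw [mul_apply_eq_comp, h1, h2, mul_assoc]

lemma mulOp_add (hm : MemLp m ∞ volume) (hm' : MemLp m' ∞ volume) :
    mulOp (fun x => m x + m' x) = mulOp m + mulOp m' := by
  refine (mulOp_ext (hm.add hm') fun u => ?_).symm
  rw [add_apply]
  filter_upwards [mulOp_apply hm u, mulOp_apply hm' u, Lp.coeFn_add (mulOp m u) (mulOp m' u)]
    with x h1 h2 h3
  rw [h3, Pi.add_apply, h1, h2, Pi.add_apply, add_mul]

lemma mulOp_smul (hm : MemLp m ∞ volume) (c : ℂ) : mulOp (fun x => c * m x) = c • mulOp m := by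
  refine (mulOp_ext (hm.const_mul c) fun u => ?_).symm
  rw [smul_apply]
  filter_upwards [mulOp_apply hm u, Lp.coeFn_smul c (mulOp m u)] with x h1 h3
  rw [h3, Pi.smul_apply, h1, smul_eq_mul, mul_assoc]

lemma mulOp_one : mulOp (fun _ => 1 : Space d → ℂ) = 1 := by
  refine (mulOp_ext (memLp_top_const 1) fun u => ?_).symm
  simp

lemma mulOp_zero : mulOp (fun _ => 0 : Space d → ℂ) = 0 := by
  refine (mulOp_ext (memLp_top_const 0) fun u => ?_).symm
  filter_upwards [Lp.coeFn_zero ℂ 2 (volume : Measure (Space d))] with x hx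
  simp

lemma memLp_top_star (hm : MemLp m ∞ volume) : MemLp (fun x => star (m x)) ∞ volume := hm.star

lemma star_mulOp (hm : MemLp m ∞ volume) : star (mulOp m) = mulOp fun x => star (m x) := by
  rw [star_eq_adjoint]
  symm
  rw [ContinuousLinearMap.eq_adjoint_iff]
  intro u v
  rw [L2.inner_def, L2.inner_def]
  refine integral_congr_ae ?_
  filter_upwards [mulOp_apply (memLp_top_star hm) u, mulOp_apply hm v] with x h1 h2
  rw [h1, h2]
  simp only [RCLike.inner_apply, map_mul]
  simp
  ring

lemma eLpNorm_mul_le_of_bound {m u : Space d → ℂ} {C : ℝ} (h : ∀ᵐ x, ‖m x‖ ≤ C) :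
    eLpNorm (fun x => m x * u x) 2 volume ≤ ofReal C * eLpNorm u 2 volume := by
  refine eLpNorm_le_mul_eLpNorm_of_ae_le_mul (p := 2) ?_
  filter_upwards [h] with x hx
  rw [norm_mul]
  gcongr

lemma norm_mulOp_le {C : ℝ} (hC : 0 ≤ C) (h : ∀ᵐ x, ‖m x‖ ≤ C) : ‖mulOp m‖ ≤ C := by
  by_cases hm : MemLp m ∞ volume
  · refine ContinuousLinearMap.opNorm_le_bound _ hC fun u => ?_
    rw [Lp.norm_def, Lp.norm_def, eLpNorm_congr_ae (mulOp_apply hm u)]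
    have := toReal_mono (mul_lt_top ofReal_lt_top (Lp.eLpNorm_lt_top u)).ne
      (eLpNorm_mul_le_of_bound (u := u) h)
    rwa [toReal_mul, toReal_ofReal hC] at this
  · rw [mulOp, dif_neg hm, norm_zero]; exact hC

/-! ### Fourier multipliers -/

/-- The Fourier transform as a unitary operator on `L²`. -/
def fourierIso (d : ℕ) : L2 d ≃ₗᵢ[ℂ] L2 d := Lp.fourierTransformₗᵢ (Space d) ℂ

/-- The Fourier transform as a bounded operator on `L²`. -/
def fourierOp (d : ℕ) : Op d := ((fourierIso d).toContinuousLinearEquiv : Op d)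

lemma star_fourierOp :
    star (fourierOp d) = ((fourierIso d).symm.toContinuousLinearEquiv : Op d) := by
  rw [star_eq_adjoint]
  symm
  rw [ContinuousLinearMap.eq_adjoint_iff]
  intro u v
  have := (fourierIso d).inner_map_map ((fourierIso d).symm u) v
  rw [LinearIsometryEquiv.apply_symm_apply] at this
  exact this.symm

lemma star_fourierOp_mul : star (fourierOp d) * fourierOp d = 1 := by
  rw [star_fourierOp]; ext1 u; exact (fourierIso d).symm_apply_apply u

lemma fourierOp_mul_star : fourierOp d * star (fourierOp d) = 1 := by
  rw [star_fourierOp]; ext1 u; exact (fourierIso d).apply_symm_apply u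

lemma fourierMul_eq (m : Space d → ℂ) :
    fourierMul m = star (fourierOp d) * mulOp m * fourierOp d := by
  rw [star_fourierOp]; rfl

lemma fourierMul_mul (hm : MemLp m ∞ volume) (hm' : MemLp m' ∞ volume) :
    fourierMul m * fourierMul m' = fourierMul fun x => m x * m' x := by
  rw [fourierMul_eq, fourierMul_eq, fourierMul_eq, ← mulOp_mul hm hm']
  calc _ = star (fourierOp d) * mulOp m * (fourierOp d * star (fourierOp d)) * mulOp m' *
      fourierOp d := by simp only [mul_assoc]
    _ = _ := by rw [fourierOp_mul_star]; simp only [mul_assoc, mul_one, one_mul]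

lemma fourierMul_comm (hm : MemLp m ∞ volume) (hm' : MemLp m' ∞ volume) :
    fourierMul m * fourierMul m' = fourierMul m' * fourierMul m := by
  rw [fourierMul_mul hm hm', fourierMul_mul hm' hm]
  simp only [mul_comm]

lemma star_fourierMul (hm : MemLp m ∞ volume) :
    star (fourierMul m) = fourierMul fun x => star (m x) := by
  rw [fourierMul_eq, fourierMul_eq, star_mul, star_mul, star_star, star_mulOp hm, mul_assoc]

lemma fourierMul_one : fourierMul (fun _ => 1 : Space d → ℂ) = 1 := by
  rw [fourierMul_eq, mulOp_one, mul_one, star_fourierOp_mul]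

lemma fourierMul_congr (hm : MemLp m ∞ volume) (h : m =ᵐ[volume] m') :
    fourierMul m = fourierMul m' := by
  rw [fourierMul_eq, fourierMul_eq, mulOp_congr hm h]

lemma fourierMul_add (hm : MemLp m ∞ volume) (hm' : MemLp m' ∞ volume) :
    fourierMul (fun x => m x + m' x) = fourierMul m + fourierMul m' := by
  rw [fourierMul_eq, fourierMul_eq, fourierMul_eq, mulOp_add hm hm', mul_add, add_mul]

lemma norm_fourierOp_apply (u : L2 d) : ‖fourierOp d u‖ = ‖u‖ := (fourierIso d).norm_map u

lemma norm_star_fourierOp_apply (u : L2 d) : ‖star (fourierOp d) u‖ = ‖u‖ := by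
  rw [star_fourierOp]; exact (fourierIso d).symm.norm_map u

lemma fourierOp_fourierMul_apply (m : Space d → ℂ) (u : L2 d) :
    fourierOp d (fourierMul m u) = mulOp m (fourierOp d u) := by
  rw [fourierMul_eq]
  have : fourierOp d * (star (fourierOp d) * mulOp m * fourierOp d) = mulOp m * fourierOp d := by
    rw [← mul_assoc, ← mul_assoc, fourierOp_mul_star, one_mul]
  exact congrArg (fun A : Op d => A u) this

/-! ### Frequency projections -/

/-- The projection onto the functions with Fourier transform supported in `S`. -/
def freqProj (S : Set (Space d)) : Op d := fourierMul (S.indicator fun _ => 1)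

lemma memLp_top_indicator (hS : MeasurableSet S) :
    MemLp (S.indicator fun _ => (1 : ℂ)) ∞ (volume : Measure (Space d)) :=
  (memLp_top_const 1).indicator hS

lemma indicator_mul_indicator_one (S T : Set (Space d)) (x : Space d) :
    S.indicator (fun _ => (1 : ℂ)) x * T.indicator (fun _ => 1) x =
      (S ∩ T).indicator (fun _ => 1) x := by
  by_cases h : x ∈ S <;> by_cases h' : x ∈ T <;> simp [h, h']

lemma freqProj_mul {S T : Set (Space d)} (hS : MeasurableSet S) (hT : MeasurableSet T) :
    freqProj S * freqProj T = freqProj (S ∩ T) := by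
  rw [freqProj, freqProj, fourierMul_mul (memLp_top_indicator hS) (memLp_top_indicator hT)]
  simp only [indicator_mul_indicator_one]
  rfl

lemma freqProj_empty : freqProj (∅ : Set (Space d)) = 0 := by
  rw [freqProj, fourierMul_eq, indicator_empty, mulOp_zero, mul_zero, zero_mul]

lemma star_freqProj (hS : MeasurableSet S) : star (freqProj S) = freqProj S := by
  rw [freqProj, star_fourierMul (memLp_top_indicator hS)]
  congr 1
  ext x
  by_cases h : x ∈ S <;> simp [h]

lemma freqProj_comm (hS : MeasurableSet S)
    (hm : MemLp m ∞ volume) : freqProj S * fourierMul m = fourierMul m * freqProj S :=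
  fourierMul_comm (memLp_top_indicator hS) hm

lemma norm_fourierMul_le {C : ℝ} (hC : 0 ≤ C) (h : ∀ᵐ x, ‖m x‖ ≤ C) : ‖fourierMul m‖ ≤ C := by
  refine ContinuousLinearMap.opNorm_le_bound _ hC fun u => ?_
  rw [← norm_fourierOp_apply, fourierOp_fourierMul_apply, ← norm_fourierOp_apply u]
  exact (mulOp m).le_of_opNorm_le (norm_mulOp_le hC h) _

lemma norm_indicator_one_le (S : Set (Space d)) (x : Space d) :
    ‖S.indicator (fun _ => (1 : ℂ)) x‖ ≤ 1 := by
  by_cases h : x ∈ S <;> simp [h]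

lemma norm_freqProj_le (S : Set (Space d)) : ‖freqProj S‖ ≤ 1 :=
  norm_fourierMul_le zero_le_one (.of_forall (norm_indicator_one_le S))

lemma enorm_freqProj_le (S : Set (Space d)) : ‖freqProj S‖ₑ ≤ 1 := by
  rw [← ofReal_norm]; exact ofReal_le_one.2 (norm_freqProj_le S)

lemma measurable_lapSymbol : Measurable (lapSymbol (d := d)) := by unfold lapSymbol; fun_prop

/-- The ball of momenta `{-Δ ≤ m}`. -/
def lowSet (d : ℕ) (m : ℝ) : Set (Space d) := {ξ | lapSymbol ξ ≤ m}

/-- The set of momenta `{-Δ ≥ m}`. -/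
def highSet (d : ℕ) (m : ℝ) : Set (Space d) := {ξ | m ≤ lapSymbol ξ}

lemma measurableSet_lowSet (m : ℝ) : MeasurableSet (lowSet d m) :=
  measurableSet_le measurable_lapSymbol measurable_const

lemma measurableSet_highSet (m : ℝ) : MeasurableSet (highSet d m) :=
  measurableSet_le measurable_const measurable_lapSymbol

lemma lowProj_eq (m : ℝ) : lowProj m = freqProj (lowSet d m) := rfl

lemma highProj_eq (m : ℝ) : highProj m = freqProj (highSet d m) := rfl

/-! ### The free group -/

/-- The symbol of `e^{itΔ}`. -/
def freeSymbol (t : ℝ) (ξ : Space d) : ℂ := Complex.exp (-(Complex.I * t * lapSymbol ξ))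

lemma norm_freeSymbol (t : ℝ) (ξ : Space d) : ‖freeSymbol t ξ‖ = 1 := by
  have : -(Complex.I * t * lapSymbol ξ) = ((-(t * lapSymbol ξ) : ℝ) : ℂ) * Complex.I := by
    push_cast; ring
  rw [freeSymbol, this, Complex.norm_exp_ofReal_mul_I]

lemma measurable_freeSymbol (t : ℝ) : Measurable (freeSymbol (d := d) t) := by
  have := measurable_lapSymbol (d := d)
  unfold freeSymbol; fun_prop

lemma memLp_freeSymbol (t : ℝ) : MemLp (freeSymbol (d := d) t) ∞ volume :=
  memLp_top_of_forall_norm_le (measurable_freeSymbol t).aestronglyMeasurable (fun x => (norm_freeSymbol t x).le)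

lemma freeProp_eq (t : ℝ) : freeProp t = fourierMul (freeSymbol (d := d) t) := rfl

lemma freeProp_zero : freeProp (d := d) 0 = 1 := by
  rw [freeProp_eq, ← fourierMul_one]
  congr 1
  ext x
  simp [freeSymbol]

lemma freeProp_mul (s t : ℝ) : freeProp (d := d) s * freeProp t = freeProp (s + t) := by
  rw [freeProp_eq, freeProp_eq, freeProp_eq, fourierMul_mul (memLp_freeSymbol s) (memLp_freeSymbol t)]
  congr 1
  ext x
  simp only [freeSymbol]
  rw [← Complex.exp_add]
  push_cast
  ring_nf

lemma star_freeProp (t : ℝ) : star (freeProp (d := d) t) = freeProp (-t) := by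
  rw [freeProp_eq, freeProp_eq, star_fourierMul (memLp_freeSymbol t)]
  congr 1
  ext x
  simp only [freeSymbol]
  rw [Complex.star_def, ← Complex.exp_conj]
  simp

lemma freeProp_mul_neg (t : ℝ) : freeProp (d := d) t * freeProp (-t) = 1 := by
  rw [freeProp_mul, add_neg_cancel, freeProp_zero]

lemma freeProp_neg_mul (t : ℝ) : freeProp (d := d) (-t) * freeProp t = 1 := by
  rw [freeProp_mul, neg_add_cancel, freeProp_zero]

lemma norm_freeProp_le (t : ℝ) : ‖freeProp (d := d) t‖ ≤ 1 :=
  norm_fourierMul_le zero_le_one (.of_forall fun x => (norm_freeSymbol t x).le)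

lemma enorm_freeProp_le (t : ℝ) : ‖freeProp (d := d) t‖ₑ ≤ 1 := by
  rw [← ofReal_norm]; exact ofReal_le_one.2 (norm_freeProp_le t)

lemma freqProj_freeProp_comm (hS : MeasurableSet S) (t : ℝ) :
    freqProj S * freeProp t = freeProp t * freqProj S := freqProj_comm hS (memLp_freeSymbol t)

lemma continuous_freeSymbol (ξ : Space d) : Continuous fun t => freeSymbol t ξ := by
  unfold freeSymbol; fun_prop

/-- Strong continuity of the free group. -/
lemma continuous_freeProp_apply (u : L2 d) : Continuous fun t => freeProp t u := by
  refine continuous_iff_continuousAt.2 fun t₀ => ?_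
  rw [ContinuousAt, tendsto_iff_norm_sub_tendsto_zero]
  set v := fourierOp d u
  have h1 : ∀ t, ‖freeProp t u - freeProp t₀ u‖ ^ 2 =
      ∫ x, ‖(freeSymbol t x - freeSymbol t₀ x) * v x‖ ^ 2 := fun t => by
    have hm := (memLp_freeSymbol (d := d) t).sub (memLp_freeSymbol t₀)
    have e : fourierOp d (freeProp t u - freeProp t₀ u) =ᵐ[volume]
        fun x => (freeSymbol t x - freeSymbol t₀ x) * v x := by
      rw [map_sub, freeProp_eq, freeProp_eq, fourierOp_fourierMul_apply, fourierOp_fourierMul_apply]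
      filter_upwards [mulOp_apply (memLp_freeSymbol t) v, mulOp_apply (memLp_freeSymbol t₀) v,
        Lp.coeFn_sub (mulOp (freeSymbol t) v) (mulOp (freeSymbol t₀) v)] with x h1 h2 h3
      rw [h3, Pi.sub_apply, h1, h2, sub_mul]
    rw [← norm_fourierOp_apply]
    have h2 : ∀ w : L2 d, ‖w‖ ^ 2 = ∫ x, ‖w x‖ ^ 2 := fun w => by
      have := inner_self_eq_norm_sq (𝕜 := ℂ) w
      rw [← this, L2.inner_def]
      have h3 : ∀ x, inner ℂ (w x) (w x) = ((‖w x‖ ^ 2 : ℝ) : ℂ) := fun x => by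
        rw [inner_self_eq_norm_sq_to_K]; norm_cast
      simp only [h3]
      rw [integral_complex_ofReal]
      simp
    rw [h2]
    refine integral_congr_ae ?_
    filter_upwards [e] with x hx
    rw [hx]
  have h3 : Tendsto (fun t => ∫ x, ‖(freeSymbol t x - freeSymbol t₀ x) * v x‖ ^ 2) (𝓝 t₀)
      (𝓝 (∫ x, ‖(freeSymbol t₀ x - freeSymbol t₀ x) * v x‖ ^ 2)) := by
    have hv : Integrable (fun x => ‖v x‖ ^ 2) volume := (Lp.memLp v).integrable_norm_pow two_ne_zero
    refine tendsto_integral_filter_of_dominated_convergence (fun x => 4 * ‖v x‖ ^ 2) ?_ ?_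
      (hv.const_mul 4) ?_
    · refine .of_forall fun t => ?_
      exact ((((measurable_freeSymbol t).sub (measurable_freeSymbol t₀)).aestronglyMeasurable.mul
        (Lp.aestronglyMeasurable v)).norm.pow 2)
    · refine .of_forall fun t => .of_forall fun x => ?_
      rw [Real.norm_of_nonneg (by positivity), norm_mul, mul_pow]
      have : ‖freeSymbol t x - freeSymbol t₀ x‖ ≤ 2 := by
        refine (norm_sub_le _ _).trans ?_
        rw [norm_freeSymbol, norm_freeSymbol]; norm_num
      have h4 : ‖freeSymbol t x - freeSymbol t₀ x‖ ^ 2 ≤ 2 ^ 2 := by gcongr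
      nlinarith [sq_nonneg ‖v x‖]
    · refine .of_forall fun x => ?_
      exact (((((continuous_freeSymbol x).tendsto t₀).sub_const _).mul_const _).norm.pow 2)
  have h4 : Tendsto (fun t => ‖freeProp t u - freeProp t₀ u‖ ^ 2) (𝓝 t₀) (𝓝 0) := by
    simp only [h1]
    simpa using h3
  have h5 := (Real.continuous_sqrt.tendsto 0).comp h4
  simpa [Function.comp_def, Real.sqrt_sq (norm_nonneg _)] using h5

/-! ### Conjugation by the free group -/

lemma freeEvol_add (t : ℝ) (A B : Op d) : freeEvol t (A + B) = freeEvol t A + freeEvol t B := by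
  simp [freeEvol, mul_add, add_mul]

lemma freeEvol_sub (t : ℝ) (A B : Op d) : freeEvol t (A - B) = freeEvol t A - freeEvol t B := by
  simp [freeEvol, mul_sub, sub_mul]

lemma freeEvol_mul (t : ℝ) (A B : Op d) : freeEvol t (A * B) = freeEvol t A * freeEvol t B := by
  simp only [freeEvol]
  calc _ = freeProp t * A * (1 : Op d) * B * freeProp (-t) := by simp only [mul_one, mul_assoc]
    _ = _ := by rw [← freeProp_neg_mul t]; simp only [mul_assoc]

lemma freeEvol_smul {R : Type*} [Monoid R] [DistribMulAction R (Op d)] [SMulCommClass R (Op d) (Op d)]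
    [IsScalarTower R (Op d) (Op d)] (c : R) (t : ℝ) (A : Op d) :
    freeEvol t (c • A) = c • freeEvol t A := by
  simp [freeEvol, mul_smul_comm, smul_mul_assoc]

lemma freeEvol_freeEvol (s t : ℝ) (A : Op d) : freeEvol s (freeEvol t A) = freeEvol (s + t) A := by
  simp only [freeEvol]
  rw [neg_add_rev, ← freeProp_mul, ← freeProp_mul (-t)]
  simp only [mul_assoc]

lemma freeEvol_zero (A : Op d) : freeEvol 0 A = A := by simp [freeEvol, freeProp_zero]

lemma star_freeEvol (t : ℝ) (A : Op d) : star (freeEvol t A) = freeEvol t (star A) := by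
  simp only [freeEvol, star_mul, star_freeProp, neg_neg, mul_assoc]

lemma freeEvol_of_comm (t : ℝ) {P : Op d} (h : P * freeProp t = freeProp t * P) :
    freeEvol t P = P := by
  rw [freeEvol, ← h, mul_assoc, freeProp_mul_neg, mul_one]

lemma norm_freeEvol_le (t : ℝ) (A : Op d) : ‖freeEvol t A‖ ≤ ‖A‖ := by
  refine (norm_mul_le _ _).trans ?_
  have h1 := norm_freeProp_le (d := d) (-t)
  have h2 : ‖freeProp t * A‖ ≤ ‖A‖ := by
    refine (norm_mul_le _ _).trans ?_
    nlinarith [norm_nonneg A, norm_freeProp_le (d := d) t]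
  nlinarith [norm_nonneg (freeProp t * A), norm_nonneg A, norm_nonneg (freeProp (d := d) (-t))]

/-- Conjugation by the free group, as a continuous linear map. -/
def freeEvolL (t : ℝ) : Op d →L[ℝ] Op d :=
  LinearMap.mkContinuous ⟨⟨freeEvol t, freeEvol_add t⟩, fun c A => freeEvol_smul c t A⟩ 1
    fun A => by rw [one_mul]; exact norm_freeEvol_le t A

@[simp] lemma freeEvolL_apply (t : ℝ) (A : Op d) : freeEvolL t A = freeEvol t A := rfl

lemma continuous_neg_innerₗ : Continuous fun p : Space d × Space d => (-innerₗ (Space d)) p.1 p.2 :=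
  (continuous_inner (𝕜 := ℝ) (E := Space d)).neg

open FourierTransform in
/-- An `L²` function with integrable Fourier transform is given by the inversion formula. -/
lemma coe_ae_eq_fourierInv (u : L2 d) (h : Integrable (fourierOp d u : Space d → ℂ)) :
    (u : Space d → ℂ) =ᵐ[volume] 𝓕⁻ (fourierOp d u : Space d → ℂ) := by
  set v := fourierOp d u
  have hu : (𝓕⁻ v : L2 d) = u := (fourierIso d).symm_apply_apply u
  have hc : Continuous (𝓕⁻ (v : Space d → ℂ)) :=
    VectorFourier.fourierIntegral_continuous Real.continuous_fourierChar continuous_neg_innerₗ h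
  refine ae_eq_of_integral_contDiff_smul_eq ((Lp.memLp u).locallyIntegrable (by norm_num))
    hc.locallyIntegrable fun g hg hgc => ?_
  have hg₁ : HasCompactSupport (Complex.ofRealCLM ∘ g) := hgc.comp_left rfl
  have hg₂ : ContDiff ℝ (⊤ : ℕ∞) (Complex.ofRealCLM ∘ g) := by fun_prop
  set G := hg₁.toSchwartzMap hg₂
  have h1 := congrArg (fun T => T G) (Lp.fourierInv_toTemperedDistribution_eq v)
  simp only [hu, TemperedDistribution.fourierInv_apply, Lp.toTemperedDistribution_apply] at h1
  have h2 : ∫ x, (𝓕⁻ (G : Space d → ℂ)) x • v x = ∫ x, G x • (𝓕⁻ (v : Space d → ℂ)) x := by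
    have := VectorFourier.integral_fourierIntegral_smul_eq_flip (L := -innerₗ (Space d))
      (μ := volume) (ν := volume) Real.continuous_fourierChar continuous_neg_innerₗ
      G.integrable h
    have hf : (-innerₗ (Space d)).flip = -innerₗ (Space d) := by ext x y; simp [real_inner_comm]
    rw [hf] at this
    exact this
  have hG : ∀ x, G x = (g x : ℂ) := fun x => rfl
  simp only [hG, smul_eq_mul, ← Complex.real_smul] at h1 h2 ⊢
  rw [← h1, ← h2]
  simp only [SchwartzMap.fourierInv_coe]

/-- `u` has Fourier transform supported in `S`. -/
def IsBand (S : Set (Space d)) (u : L2 d) : Prop := ∀ᵐ ξ, ξ ∉ S → fourierOp d u ξ = 0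

lemma isBand_freqProj (hS : MeasurableSet S) (u : L2 d) : IsBand S (freqProj S u) := by
  have h := mulOp_apply (memLp_top_indicator hS) (fourierOp d u)
  rw [IsBand, freqProj, fourierOp_fourierMul_apply]
  filter_upwards [h] with ξ h1 h2
  rw [h1, indicator_of_notMem h2, zero_mul]

lemma IsBand.integrable (hS : MeasurableSet S) (hv : volume S < ∞) {u : L2 d}
    (h : IsBand S u) : Integrable (fourierOp d u : Space d → ℂ) := by
  have h1 : S.indicator (fourierOp d u : Space d → ℂ) =ᵐ[volume] fourierOp d u := by
    filter_upwards [h] with ξ h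
    by_cases hξ : ξ ∈ S
    · rw [indicator_of_mem hξ]
    · rw [indicator_of_notMem hξ, h hξ]
  refine Integrable.congr ?_ h1
  rw [integrable_indicator_iff hS]
  have : IsFiniteMeasure (volume.restrict S) := ⟨by simpa using hv⟩
  exact ((Lp.memLp (fourierOp d u)).restrict S).integrable (by norm_num)

lemma inner_fourierOp (u v : L2 d) : inner ℂ (fourierOp d u) (fourierOp d v) = inner ℂ u v :=
  (fourierIso d).inner_map_map u v

open FourierTransform in
/-- Multiplication by a character translates the Fourier transform. -/
lemma exists_modulation (θ : Space d) {ψ : L2 d} (hψ : Integrable (fourierOp d ψ : Space d → ℂ)) :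
    ∃ u : L2 d, (u =ᵐ[volume] fun x => Real.fourierChar (-inner ℝ x θ) • ψ x) ∧
      fourierOp d u =ᵐ[volume] fun ζ => fourierOp d ψ (ζ + θ) := by
  have hmp : MeasurePreserving (fun ζ : Space d => ζ + θ) volume volume :=
    measurePreserving_add_right volume θ
  set v : L2 d := Lp.compMeasurePreserving (fun ζ : Space d => ζ + θ) hmp (fourierOp d ψ)
  have hv : v =ᵐ[volume] fun ζ => fourierOp d ψ (ζ + θ) := Lp.coeFn_compMeasurePreserving _ hmp
  have hFu : fourierOp d ((fourierIso d).symm v) = v := (fourierIso d).apply_symm_apply v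
  refine ⟨(fourierIso d).symm v, ?_, by rw [hFu]; exact hv⟩
  have hvi : Integrable (v : Space d → ℂ) := (hψ.comp_add_right θ).congr hv.symm
  have h1 := coe_ae_eq_fourierInv ((fourierIso d).symm v) (by rw [hFu]; exact hvi)
  filter_upwards [h1, coe_ae_eq_fourierInv ψ hψ] with x h1 h2
  rw [h1, h2, hFu, Real.fourierInv_eq, Real.fourierInv_eq]
  rw [integral_congr_ae (g := fun ζ => Real.fourierChar (inner ℝ ζ x) • fourierOp d ψ (ζ + θ))]
  · rw [← integral_add_right_eq_self _ (-θ), Circle.smul_def, ← integral_smul]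
    congr 1
    ext ζ
    rw [neg_add_cancel_right, inner_add_left, inner_neg_left, AddChar.map_add_eq_mul, mul_comm,
      mul_smul, real_inner_comm x θ, Circle.smul_def]
  · filter_upwards [hv] with ζ hζ
    rw [hζ]

open FourierTransform in
lemma fourier_conj_mul_eq_inner {φ ψ : L2 d} (hψ : Integrable (fourierOp d ψ : Space d → ℂ))
    (θ : Space d) :
    𝓕 (fun x => star (φ x) * ψ x) θ =
      ∫ ζ, star (fourierOp d φ ζ) * fourierOp d ψ (ζ + θ) := by
  obtain ⟨u, hu, hu'⟩ := exists_modulation θ hψ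
  have h := inner_fourierOp φ u
  rw [L2.inner_def, L2.inner_def] at h
  rw [Real.fourier_eq]
  trans ∫ a, inner ℂ (φ a) (u a)
  · refine integral_congr_ae ?_
    filter_upwards [hu] with x hx
    rw [hx]
    simp [Circle.smul_def]; ring
  rw [← h]
  refine integral_congr_ae ?_
  filter_upwards [hu'] with x hx
  rw [hx]
  simp; ring

open FourierTransform in
lemma fourier_conj_mul_eq_zero {S T : Set (Space d)} {φ ψ : L2 d}
    (hφ : IsBand S φ) (hψb : IsBand T ψ)
    (hψ : Integrable (fourierOp d ψ : Space d → ℂ)) (θ : Space d)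
    (h : ∀ ζ ∈ S, ζ + θ ∉ T) : 𝓕 (fun x => star (φ x) * ψ x) θ = 0 := by
  rw [fourier_conj_mul_eq_inner hψ]
  refine integral_eq_zero_of_ae ?_
  have h2 : ∀ᵐ ζ : Space d, ζ + θ ∉ T → fourierOp d ψ (ζ + θ) = 0 :=
    (measurePreserving_add_right volume θ).quasiMeasurePreserving.ae hψb
  filter_upwards [hφ, h2] with ζ h3 h4
  by_cases hζ : ζ ∈ S
  · simp [h4 (h ζ hζ)]
  · simp [h3 hζ]

open FourierTransform in
/-- If the Fourier transform of `G` vanishes on `T - S`, then `G` is orthogonal to the products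
`g h̄` with `g` and `h` of frequencies in `S` and `T`. -/
lemma integral_mul_conj_eq_zero {S T : Set (Space d)} (hSm : MeasurableSet S)
    (hTm : MeasurableSet T) (hS : volume S < ∞) (hT : volume T < ∞) {g h : L2 d}
    (hg : IsBand S g) (hh : IsBand T h) {G : Space d → ℂ} (hG : Integrable G)
    (hz : ∀ ξ ∈ S, ∀ η ∈ T, 𝓕 G (η - ξ) = 0) :
    ∫ y, G y * (g y * star (h y)) = 0 := by
  have hgi := hg.integrable hSm hS
  have hhi := hh.integrable hTm hT
  set g' := 𝓕⁻ (fourierOp d g : Space d → ℂ)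
  have hg'c : Continuous g' := VectorFourier.fourierIntegral_continuous Real.continuous_fourierChar
      continuous_neg_innerₗ hgi
  have hg'b : ∀ x, ‖g' x‖ ≤ ∫ v, ‖fourierOp d g v‖ := fun x =>
    VectorFourier.norm_fourierIntegral_le_integral_norm _ _ _ _ _
  have hf : Integrable (fun y => G y * g' y) := by
    refine hG.mul_bdd (c := ∫ v, ‖fourierOp d g v‖) hg'c.aestronglyMeasurable (.of_forall hg'b)
  have key : ∀ η ∈ T, 𝓕 (fun y => G y * g' y) η = 0 := by
    intro η hη
    set G' : Space d → ℂ := fun y => Real.fourierChar (-inner ℝ y η) • G y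
    have hG' : Integrable G' := (Real.fourierIntegral_convergent_iff η).2 hG
    have hflip : (-innerₗ (Space d)).flip = -innerₗ (Space d) := by ext x y; simp [real_inner_comm]
    have h1 := VectorFourier.integral_fourierIntegral_smul_eq_flip (L := -innerₗ (Space d))
      (μ := volume) (ν := volume) Real.continuous_fourierChar continuous_neg_innerₗ
      hG' hgi
    rw [hflip] at h1
    have h2 : 𝓕 (fun y => G y * g' y) η = ∫ x, G' x • g' x := by
      rw [Real.fourier_eq]
      refine integral_congr_ae (.of_forall fun x => ?_)
      simp [G', Circle.smul_def, mul_assoc]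
    rw [h2]
    refine h1.symm.trans (integral_eq_zero_of_ae ?_)
    filter_upwards [hg] with ξ hξ
    by_cases hξS : ξ ∈ S
    · have h3 : VectorFourier.fourierIntegral Real.fourierChar volume (-innerₗ (Space d)) G' ξ
          = 𝓕 G (η - ξ) := by
        change ∫ x, _ = _
        rw [Real.fourier_eq]
        refine integral_congr_ae (.of_forall fun x => ?_)
        simp only [G']
        rw [← mul_smul, ← AddChar.map_add_eq_mul]
        congr 2
        simp [inner_sub_right]; ring
      rw [h3, hz ξ hξS η hη]; simp
    · rw [hξ hξS]; simp
  have hstar : ∫ y, G y * (g y * star (h y)) = ∫ y, (G y * g' y) * star (𝓕⁻ (fourierOp d h : Space d → ℂ) y) := by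
    refine integral_congr_ae ?_
    filter_upwards [coe_ae_eq_fourierInv g hgi, coe_ae_eq_fourierInv h hhi] with y h1 h2
    rw [h1, h2, mul_assoc]
  rw [hstar]
  have hconj : ∀ y, star (𝓕⁻ (fourierOp d h : Space d → ℂ) y) =
      𝓕 (fun η => star (fourierOp d h η)) y := fun y => by
    rw [Real.fourierInv_eq, Real.fourier_eq]
    change (starRingEnd ℂ) _ = _
    rw [← integral_conj]
    refine integral_congr_ae (.of_forall fun x => ?_)
    simp [Circle.smul_def, AddChar.map_neg_eq_inv]
  simp only [hconj]
  have hhi' : Integrable (fun η => star (fourierOp d h η)) :=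
    Complex.conjLIE.toContinuousLinearEquiv.toContinuousLinearMap.integrable_comp hhi
  have h1 := VectorFourier.integral_fourierIntegral_smul_eq_flip (L := innerₗ (Space d))
      (μ := volume) (ν := volume) Real.continuous_fourierChar continuous_inner hf hhi'
  have hflip : (innerₗ (Space d)).flip = innerₗ (Space d) := by ext x y; simp
  rw [hflip] at h1
  refine h1.symm.trans (integral_eq_zero_of_ae ?_)
  filter_upwards [hh] with η hη
  by_cases hηT : η ∈ T
  · have := key η hηT
    change 𝓕 (fun y => G y * g' y) η • _ = _
    rw [this]; simp
  · rw [hη hηT]; simp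

/-! ### Unit cubes in momentum space -/

/-- The unit cube with lower corner `k`. -/
def cube (k : Fin d → ℤ) : Set (Space d) := {ξ | ∀ i, ⌊ξ i⌋ = k i}

lemma measurableSet_cube (k : Fin d → ℤ) : MeasurableSet (cube k) := by
  have : cube k = ⋂ i, {ξ : Space d | ⌊ξ i⌋ = k i} := by ext; simp [cube]
  rw [this]
  refine MeasurableSet.iInter fun i => ?_
  have h : Measurable fun ξ : Space d => ⌊ξ i⌋ := by fun_prop
  exact h (measurableSet_singleton (k i))

lemma volume_cube (k : Fin d → ℤ) : volume (cube k) = 1 := by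
  have h : cube k = (WithLp.ofLp : Space d → Fin d → ℝ) ⁻¹'
      (univ.pi fun i => Ico (k i : ℝ) (k i + 1)) := by
    ext ξ
    simp only [cube, mem_ofPred_eq, mem_preimage, mem_univ_pi, mem_Ico, Int.floor_eq_iff]
  rw [h, (PiLp.volume_preserving_ofLp (Fin d)).measure_preimage
    (MeasurableSet.univ_pi fun i => measurableSet_Ico).nullMeasurableSet, Real.volume_pi_Ico]
  simp

lemma volume_cube_lt_top (k : Fin d → ℤ) : volume (cube k) < ∞ := by
  rw [volume_cube]; exact one_lt_top

lemma disjoint_cube (h : j ≠ k) : Disjoint (cube j) (cube k) := by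
  rw [Set.disjoint_left]
  intro ξ h1 h2
  exact h (funext fun i => (h1 i).symm.trans (h2 i))

lemma iUnion_cube : ⋃ k : Fin d → ℤ, cube k = univ := by
  refine eq_univ_of_forall fun ξ => mem_iUnion.2 ⟨fun i => ⌊ξ i⌋, fun i => rfl⟩

/-- The projection onto the frequencies of a unit cube. -/
def cubeProj (k : Fin d → ℤ) : Op d := freqProj (cube k)

lemma star_cubeProj (k : Fin d → ℤ) : star (cubeProj k) = cubeProj k :=
  star_freqProj (measurableSet_cube k)

lemma cubeProj_mul_self (k : Fin d → ℤ) : cubeProj k * cubeProj k = cubeProj k := by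
  rw [cubeProj, freqProj_mul (measurableSet_cube k) (measurableSet_cube k), inter_self]

lemma cubeProj_mul_of_ne (h : j ≠ k) : cubeProj j * cubeProj k = 0 := by
  rw [cubeProj, cubeProj, freqProj_mul (measurableSet_cube j) (measurableSet_cube k),
    (disjoint_cube h).inter_eq, freqProj_empty]

lemma enorm_cubeProj_le (k : Fin d → ℤ) : ‖cubeProj k‖ₑ ≤ 1 := enorm_freqProj_le _

lemma norm_sq_eq_integral (w : L2 d) : ‖w‖ ^ 2 = ∫ x, ‖w x‖ ^ 2 := by
  have := inner_self_eq_norm_sq (𝕜 := ℂ) w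
  rw [← this, L2.inner_def]
  have h3 : ∀ x, inner ℂ (w x) (w x) = ((‖w x‖ ^ 2 : ℝ) : ℂ) := fun x => by
    rw [inner_self_eq_norm_sq_to_K]; norm_cast
  simp only [h3]
  rw [integral_complex_ofReal]
  simp

lemma norm_sq_freqProj_apply (hS : MeasurableSet S) (u : L2 d) :
    ‖freqProj S u‖ ^ 2 = ∫ ξ in S, ‖fourierOp d u ξ‖ ^ 2 := by
  rw [← norm_fourierOp_apply, norm_sq_eq_integral, ← integral_indicator hS]
  refine integral_congr_ae ?_
  have h := mulOp_apply (memLp_top_indicator hS) (fourierOp d u)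
  rw [freqProj, fourierOp_fourierMul_apply]
  filter_upwards [h] with ξ h1
  rw [h1]
  by_cases hξ : ξ ∈ S <;> simp [hξ]

lemma re_inner_freqProj (hS : MeasurableSet S) (u : L2 d) :
    inner ℂ (freqProj S u) u = ((‖freqProj S u‖ ^ 2 : ℝ) : ℂ) := by
  have h : freqProj S u = freqProj S (freqProj S u) := by
    have := congrArg (fun A : Op d => A u) (freqProj_mul hS hS)
    simpa [inter_self] using this.symm
  have h1 : inner ℂ (freqProj S (freqProj S u)) u = inner ℂ (freqProj S u) (freqProj S u) := by
    conv_lhs => rw [← star_freqProj hS, star_eq_adjoint,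
      adjoint_inner_left, ← star_eq_adjoint,
      star_freqProj hS]
  rw [h, h1, ← h, inner_self_eq_norm_sq_to_K]
  norm_cast

lemma hasSum_norm_sq_cubeProj (u : L2 d) :
    HasSum (fun k : Fin d → ℤ => ‖cubeProj k u‖ ^ 2) (‖u‖ ^ 2) := by
  have hi : Integrable (fun ξ => ‖fourierOp d u ξ‖ ^ 2) volume :=
    (Lp.memLp (fourierOp d u)).integrable_norm_pow two_ne_zero
  have h := hasSum_integral_iUnion (μ := volume) (f := fun ξ => ‖fourierOp d u ξ‖ ^ 2)
    (s := fun k : Fin d → ℤ => cube k)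
    (fun k => measurableSet_cube k) (fun j k hjk => disjoint_cube hjk) hi.integrableOn
  rw [iUnion_cube, Measure.restrict_univ, ← norm_sq_eq_integral, norm_fourierOp_apply] at h
  simpa only [cubeProj, norm_sq_freqProj_apply (measurableSet_cube _)] using h

/-- The frequency cubes resolve the identity strongly. -/
lemma hasSum_cubeProj (u : L2 d) : HasSum (fun k : Fin d → ℤ => cubeProj k u) u := by
  have key : ∀ s : Finset (Fin d → ℤ), ‖∑ k ∈ s, cubeProj k u - u‖ ^ 2 =
      ‖u‖ ^ 2 - ∑ k ∈ s, ‖cubeProj k u‖ ^ 2 := fun s => by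
    have h1 : (inner ℂ (∑ k ∈ s, cubeProj k u) u) = ((∑ k ∈ s, ‖cubeProj k u‖ ^ 2 : ℝ) : ℂ) := by
      rw [sum_inner, Complex.ofReal_sum]
      exact Finset.sum_congr rfl fun k _ => re_inner_freqProj (measurableSet_cube k) u
    have h2 : ‖∑ k ∈ s, cubeProj k u‖ ^ 2 = ∑ k ∈ s, ‖cubeProj k u‖ ^ 2 := by
      have h3 : inner ℂ (∑ k ∈ s, cubeProj k u) (∑ k ∈ s, cubeProj k u) =
          inner ℂ (∑ k ∈ s, cubeProj k u) u := by
        rw [sum_inner, sum_inner]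
        refine Finset.sum_congr rfl fun k hk => ?_
        have h4 : ∀ v, inner ℂ (cubeProj k u) v = inner ℂ u (cubeProj k v) := fun v => by
          conv_lhs => rw [← star_cubeProj k, star_eq_adjoint,
            adjoint_inner_left]
        rw [h4, h4, map_sum, Finset.sum_eq_single_of_mem k hk]
        · congr 1
          exact congrArg (fun A : Op d => A u) (cubeProj_mul_self k)
        · intro j _ hj
          exact congrArg (fun A : Op d => A u) (cubeProj_mul_of_ne hj.symm)
      have h5 := inner_self_eq_norm_sq (𝕜 := ℂ) (∑ k ∈ s, cubeProj k u)
      rw [h3, h1] at h5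
      rw [← h5]; exact (Complex.ofReal_re _).symm
    have h6 : RCLike.re ((∑ k ∈ s, ‖cubeProj k u‖ ^ 2 : ℝ) : ℂ) = ∑ k ∈ s, ‖cubeProj k u‖ ^ 2 :=
      Complex.ofReal_re _
    rw [norm_sub_sq (𝕜 := ℂ), h1, h2, h6]
    ring
  rw [HasSum, SummationFilter.unconditional_filter, tendsto_iff_norm_sub_tendsto_zero]
  have h := hasSum_norm_sq_cubeProj u
  rw [HasSum, SummationFilter.unconditional_filter] at h
  have h2 : Tendsto (fun s : Finset (Fin d → ℤ) => ‖∑ k ∈ s, cubeProj k u - u‖ ^ 2) atTop (𝓝 0) := by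
    simp only [key]
    have h3 := (tendsto_const_nhds (x := ‖u‖ ^ 2)).sub h
    rwa [sub_self] at h3
  have h5 := (Real.continuous_sqrt.tendsto 0).comp h2
  simpa [Function.comp_def, Real.sqrt_sq (norm_nonneg _)] using h5

lemma hasSum_mul_cubeProj (A : Op d) (u : L2 d) :
    HasSum (fun k : Fin d → ℤ => (A * cubeProj k) u) (A u) := (hasSum_cubeProj u).mapL A

lemma hasSum_cubeProj_mul (A : Op d) (u : L2 d) :
    HasSum (fun k : Fin d → ℤ => (cubeProj k * A) u) (A u) := hasSum_cubeProj (A u)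

/-! ### Pointwise bounds for band-limited functions -/

lemma memLp_bandKernel (hS : MeasurableSet S) (hv : volume S < ∞) (x : Space d) :
    MemLp (S.indicator fun ξ => ((Real.fourierChar (-inner ℝ ξ x) : Circle) : ℂ)) 2 volume := by
  rw [memLp_indicator_iff_restrict hS]
  have : IsFiniteMeasure (volume.restrict S) := ⟨by simpa using hv⟩
  refine MemLp.of_bound (C := 1) ?_ (.of_forall fun ξ => (Circle.norm_coe _).le)
  refine Continuous.aestronglyMeasurable ?_
  have := Real.continuous_fourierChar
  fun_prop

/-- The function whose inner product with the Fourier transform is the value at `x`, for functions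
with frequencies in `S`. -/
def bandKernel (hS : MeasurableSet S) (hv : volume S < ∞) (x : Space d) : L2 d :=
  (memLp_bandKernel hS hv x).toLp

lemma norm_bandKernel_sq (hS : MeasurableSet S) (hv : volume S < ∞)
    (x : Space d) : ‖bandKernel hS hv x‖ ^ 2 = (volume S).toReal := by
  rw [norm_sq_eq_integral]
  have : ∀ᵐ ξ, ‖bandKernel hS hv x ξ‖ ^ 2 = S.indicator (fun _ => (1 : ℝ)) ξ := by
    filter_upwards [(memLp_bandKernel hS hv x).coeFn_toLp] with ξ h
    rw [bandKernel, h]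
    by_cases hξ : ξ ∈ S
    · rw [indicator_of_mem hξ, indicator_of_mem hξ]
      exact (congrArg (· ^ 2) (Circle.norm_coe _)).trans (one_pow 2)
    · simp [hξ]
  rw [integral_congr_ae this, integral_indicator_const _ hS]
  simp [Measure.real]

open FourierTransform in
lemma freqProj_apply_ae (hS : MeasurableSet S) (hv : volume S < ∞) (u : L2 d) :
    freqProj S u =ᵐ[volume] fun x => inner ℂ (bandKernel hS hv x) (fourierOp d u) := by
  have hb := isBand_freqProj hS u
  filter_upwards [coe_ae_eq_fourierInv _ (hb.integrable hS hv)] with x hx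
  rw [hx, Real.fourierInv_eq, L2.inner_def]
  refine integral_congr_ae ?_
  have h := mulOp_apply (memLp_top_indicator hS) (fourierOp d u)
  rw [freqProj, fourierOp_fourierMul_apply]
  filter_upwards [h, (memLp_bandKernel hS hv x).coeFn_toLp] with ξ h1 h2
  rw [h1, bandKernel, h2]
  by_cases hξ : ξ ∈ S
  · simp [hξ, Circle.smul_def, AddChar.map_neg_eq_inv]; ring
  · simp [hξ]

lemma tsum_enorm_sq_freqProj_le (hS : MeasurableSet S) (hv : volume S < ∞)
    (T : Op d) : ∀ᵐ x, ∑' i, ‖(freqProj S * T) (basis d i) x‖ₑ ^ 2 ≤ ‖T‖ₑ ^ 2 * volume S := by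
  have h := ae_all_iff.2 fun i => freqProj_apply_ae hS hv (T (basis d i))
  filter_upwards [h] with x hx
  have h1 : ∀ i, ‖(freqProj S * T) (basis d i) x‖ₑ ^ 2 =
      ‖inner ℂ (basis d i) (star T (star (fourierOp d) (bandKernel hS hv x)))‖ₑ ^ 2 := fun i => by
    rw [mul_apply_eq_comp, hx i, star_eq_adjoint, star_eq_adjoint, adjoint_inner_right,
      adjoint_inner_right, ← ofReal_norm, ← ofReal_norm, norm_inner_symm]
  simp only [h1]
  rw [HilbertBasis.tsum_enorm_inner_sq]
  have h2 : ‖star T (star (fourierOp d) (bandKernel hS hv x))‖ ≤ ‖T‖ * ‖bandKernel hS hv x‖ := by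
    refine ((star T).le_opNorm _).trans ?_
    rw [norm_star_fourierOp_apply]
    exact le_of_eq (congrArg (· * _) (norm_star T))
  have h3 : ‖bandKernel hS hv x‖ₑ ^ 2 = volume S := by
    rw [← ofReal_sq_norm, norm_bandKernel_sq, ofReal_toReal hv.ne]
  rw [← h3, ← mul_pow]
  gcongr
  rw [← ofReal_norm, ← ofReal_norm, ← ofReal_norm, ← ofReal_mul (norm_nonneg _)]
  exact ofReal_le_ofReal h2

/-- The sum of the squares of the images of a basis, as a function. -/
def sqDens (X : Op d) (x : Space d) : ℝ≥0∞ := ∑' i, ‖X (basis d i) x‖ₑ ^ 2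

lemma aemeasurable_sqDens (X : Op d) : AEMeasurable (sqDens X) volume :=
  AEMeasurable.tsum fun _ => (Lp.aestronglyMeasurable _).enorm.pow_const 2

lemma enorm_sq_eq_lintegral (w : L2 d) : ‖w‖ₑ ^ 2 = ∫⁻ x, ‖w x‖ₑ ^ 2 := by
  rw [Lp.enorm_def, eLpNorm_eq_lintegral_rpow_enorm_toReal (by norm_num) (by norm_num)]
  rw [← ENNReal.rpow_natCast, ← ENNReal.rpow_mul]
  simp

lemma lintegral_mul_sqDens (hV : MemLp V ∞ volume) (X : Op d) :
    ∫⁻ x, ‖V x‖ₑ ^ 2 * sqDens X x = hsNorm (mulOp V * X) ^ 2 := by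
  rw [hsNorm_sq_eq_tsum (basis d)]
  have h1 : ∀ i, ‖(mulOp V * X) (basis d i)‖ₑ ^ 2 = ∫⁻ x, ‖V x‖ₑ ^ 2 * ‖X (basis d i) x‖ₑ ^ 2 := fun i => by
    rw [enorm_sq_eq_lintegral]
    refine lintegral_congr_ae ?_
    filter_upwards [mulOp_apply hV (X (basis d i))] with x hx
    rw [mul_apply_eq_comp, hx, enorm_mul, mul_pow]
  simp only [h1, sqDens, ← ENNReal.tsum_mul_left]
  exact lintegral_tsum fun i =>
    (hV.aestronglyMeasurable.enorm.pow_const 2).mul ((Lp.aestronglyMeasurable _).enorm.pow_const 2)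

lemma lintegral_sqDens (X : Op d) : ∫⁻ x, sqDens X x = hsNorm X ^ 2 := by
  have := lintegral_mul_sqDens (memLp_top_const 1) X
  rw [mulOp_one, one_mul] at this
  simpa using this

lemma eLpNorm_two_sq : eLpNorm V 2 volume ^ 2 = ∫⁻ x, ‖V x‖ₑ ^ 2 := by
  rw [eLpNorm_eq_lintegral_rpow_enorm_toReal (by norm_num) (by norm_num)]
  rw [← ENNReal.rpow_natCast, ← ENNReal.rpow_mul]
  simp

lemma hsNorm_mulOp_freqProj_mul_le (hS : MeasurableSet S) (hv : volume S < ∞)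
    (hV : MemLp V ∞ volume) (T : Op d) :
    hsNorm (mulOp V * (freqProj S * T)) ^ 2 ≤ eLpNorm V 2 volume ^ 2 * (‖T‖ₑ ^ 2 * volume S) := by
  rw [← lintegral_mul_sqDens hV, eLpNorm_two_sq, ← lintegral_mul_const'' _
    (hV.aestronglyMeasurable.enorm.pow_const 2)]
  refine lintegral_mono_ae ?_
  filter_upwards [tsum_enorm_sq_freqProj_le hS hv T] with x hx
  gcongr
  exact hx

lemma hsNorm_mulOp_cubeProj_le (hV : MemLp V ∞ volume) (k : Fin d → ℤ) :
    hsNorm (mulOp V * cubeProj k) ≤ eLpNorm V 2 volume := by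
  have h := hsNorm_mulOp_freqProj_mul_le (measurableSet_cube k) (volume_cube_lt_top k) hV 1
  rw [volume_cube, mul_one, mul_one] at h
  have h1 : ‖(1 : Op d)‖ₑ ≤ 1 := by
    rw [← ofReal_norm]
    exact ofReal_le_one.2 ContinuousLinearMap.norm_id_le
  refine (pow_le_pow_left_iff two_ne_zero).1 ?_
  refine h.trans ?_
  calc _ ≤ eLpNorm V 2 volume ^ 2 * 1 ^ 2 := by gcongr
    _ = _ := by simp

/-! ### Cauchy–Schwarz in `[0, ∞]` -/

lemma sq_lintegral_mul_le {α : Type*} [MeasurableSpace α] (ν : Measure α) {f g : α → ℝ≥0∞}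
    (hf : AEMeasurable f ν) (hg : AEMeasurable g ν) :
    (∫⁻ x, f x * g x ∂ν) ^ 2 ≤ (∫⁻ x, f x ^ 2 ∂ν) * ∫⁻ x, g x ^ 2 ∂ν := by
  have h := ENNReal.lintegral_mul_le_Lp_mul_Lq ν Real.HolderConjugate.two_two hf hg
  calc (∫⁻ x, f x * g x ∂ν) ^ 2 ≤ ((∫⁻ x, f x ^ (2 : ℝ) ∂ν) ^ (1 / (2 : ℝ)) *
        (∫⁻ x, g x ^ (2 : ℝ) ∂ν) ^ (1 / (2 : ℝ))) ^ 2 := by gcongr; exact h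
    _ = _ := by
      rw [mul_pow]
      simp only [← ENNReal.rpow_natCast, ← ENNReal.rpow_mul]
      simp

lemma sq_tsum_mul_le {ι : Type*} (f g : ι → ℝ≥0∞) :
    (∑' i, f i * g i) ^ 2 ≤ (∑' i, f i ^ 2) * ∑' i, g i ^ 2 := by
  let _ : MeasurableSpace ι := ⊤
  have h := sq_lintegral_mul_le Measure.count (f := f) (g := g) (measurable_from_top.aemeasurable)
    (measurable_from_top.aemeasurable)
  rwa [lintegral_count, lintegral_count, lintegral_count] at h

/-! ### Convolutions -/

lemma aemeasurable_comp_sub {u : Space d → ℝ≥0∞} (hu : AEMeasurable u volume) (x : Space d) :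
    AEMeasurable (fun y => u (x - y)) volume :=
  hu.comp_quasiMeasurePreserving (Measure.measurePreserving_sub_left volume x).quasiMeasurePreserving

lemma aemeasurable_comp_sub_prod {u : Space d → ℝ≥0∞} (hu : AEMeasurable u volume) :
    AEMeasurable (fun p : Space d × Space d => u (p.1 - p.2)) (volume.prod volume) :=
  hu.comp_quasiMeasurePreserving (quasiMeasurePreserving_sub_of_right_invariant volume volume)

/-- The convolution of nonnegative functions. -/
def lconv (u v : Space d → ℝ≥0∞) (x : Space d) : ℝ≥0∞ := ∫⁻ y, u (x - y) * v y

lemma lconv_comm (u v : Space d → ℝ≥0∞) : lconv u v = lconv v u := by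
  ext x
  rw [lconv, ← lintegral_sub_left_eq_self _ x]
  simp only [sub_sub_cancel]
  exact lintegral_congr fun y => mul_comm _ _

lemma sq_lconv_le_sq {u v : Space d → ℝ≥0∞} (hu : AEMeasurable u volume)
    (hv : AEMeasurable v volume) (x : Space d) :
    lconv u v x ^ 2 ≤ (∫⁻ y, u y ^ 2) * ∫⁻ y, v y ^ 2 := by
  refine (sq_lintegral_mul_le volume (aemeasurable_comp_sub hu x) hv).trans (le_of_eq ?_)
  rw [lintegral_sub_left_eq_self (fun y => u y ^ 2) x]

lemma lconv_le_of_bound {u v : Space d → ℝ≥0∞} {c : ℝ≥0∞} (hu : AEMeasurable u volume)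
    (h : ∀ᵐ y, v y ≤ c) (x : Space d) : lconv u v x ≤ (∫⁻ y, u y) * c := by
  calc lconv u v x ≤ ∫⁻ y, u (x - y) * c := by
        refine lintegral_mono_ae ?_
        filter_upwards [h] with y hy
        gcongr
    _ = _ := by
      rw [lintegral_mul_const'' _ (aemeasurable_comp_sub hu x), lintegral_sub_left_eq_self u x]

/-- Young's inequality for `L¹ * L²`. -/
lemma lintegral_sq_lconv_le {u v : Space d → ℝ≥0∞} (hu : AEMeasurable u volume)
    (hv : AEMeasurable v volume) :
    ∫⁻ x, lconv u v x ^ 2 ≤ (∫⁻ y, u y) ^ 2 * ∫⁻ y, v y ^ 2 := by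
  have h1 : ∀ x, lconv u v x ^ 2 ≤ (∫⁻ y, u y) * ∫⁻ y, u (x - y) * v y ^ 2 := fun x => by
    have h2 : ∀ y, u (x - y) * v y = u (x - y) ^ (1 / 2 : ℝ) * (u (x - y) ^ (1 / 2 : ℝ) * v y) :=
      fun y => by
        rw [← mul_assoc, ← ENNReal.rpow_add_of_nonneg _ _ (by norm_num) (by norm_num)]
        norm_num
    have h3 : ∀ y, (u (x - y) ^ (1 / 2 : ℝ)) ^ 2 = u (x - y) := fun y => by
      rw [← ENNReal.rpow_natCast, ← ENNReal.rpow_mul]; norm_num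
    have hux := aemeasurable_comp_sub hu x
    have := sq_lintegral_mul_le volume (hux.pow_const (1 / 2 : ℝ))
      ((hux.pow_const (1 / 2 : ℝ)).mul hv)
    simp only [Pi.mul_apply, ← h2, mul_pow, h3] at this
    rwa [lintegral_sub_left_eq_self u x] at this
  have hm : AEMeasurable (fun p : Space d × Space d => u (p.1 - p.2) * v p.2 ^ 2)
      (volume.prod volume) :=
    (aemeasurable_comp_sub_prod hu).mul
      ((hv.pow_const 2).comp_quasiMeasurePreserving Measure.quasiMeasurePreserving_snd)
  calc ∫⁻ x, lconv u v x ^ 2 ≤ ∫⁻ x, (∫⁻ y, u y) * ∫⁻ y, u (x - y) * v y ^ 2 :=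
        lintegral_mono h1
    _ = (∫⁻ y, u y) * ∫⁻ x, ∫⁻ y, u (x - y) * v y ^ 2 :=
        lintegral_const_mul'' _ hm.lintegral_prod_right'
    _ = (∫⁻ y, u y) * ∫⁻ y, ∫⁻ x, u (x - y) * v y ^ 2 := by rw [lintegral_lintegral_swap hm]
    _ = (∫⁻ y, u y) * ∫⁻ y, (∫⁻ x, u x) * v y ^ 2 := by
        congr 1
        refine lintegral_congr fun y => ?_
        have h4 : AEMeasurable (fun x => u (x - y)) volume :=
          hu.comp_quasiMeasurePreserving (measurePreserving_sub_right volume y).quasiMeasurePreserving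
        rw [lintegral_mul_const'' _ h4, lintegral_sub_right_eq_self u y]
    _ = _ := by rw [lintegral_const_mul'' _ (hv.pow_const 2), ← mul_assoc, sq]

/-- The convolution of a real function with a complex one. -/
def conv (w : Space d → ℝ) (ρ : Space d → ℂ) (x : Space d) : ℂ := ∫ y, (w (x - y) : ℂ) * ρ y

lemma enorm_ofReal_complex (r : ℝ) : ‖(r : ℂ)‖ₑ = ‖r‖ₑ := by
  rw [← ofReal_norm, ← ofReal_norm, Complex.norm_real]

lemma enorm_conv_le (w : Space d → ℝ) (ρ : Space d → ℂ) (x : Space d) :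
    ‖conv w ρ x‖ₑ ≤ lconv (fun y => ‖w y‖ₑ) (fun y => ‖ρ y‖ₑ) x := by
  refine (enorm_integral_le_lintegral_enorm _).trans (le_of_eq ?_)
  refine lintegral_congr fun y => ?_
  rw [enorm_mul, enorm_ofReal_complex]

lemma aestronglyMeasurable_conv
    (hw : AEStronglyMeasurable w volume) (hρ : AEStronglyMeasurable ρ volume) :
    AEStronglyMeasurable (conv w ρ) volume := by
  have h : AEStronglyMeasurable (fun p : Space d × Space d => (w (p.1 - p.2) : ℂ) * ρ p.2)
      (volume.prod volume) :=
    (Complex.continuous_ofReal.comp_aestronglyMeasurable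
      (hw.comp_quasiMeasurePreserving (quasiMeasurePreserving_sub_of_right_invariant volume volume))).mul
      (hρ.comp_quasiMeasurePreserving Measure.quasiMeasurePreserving_snd)
  exact h.integral_prod_right'

/-- The admissible interaction potentials. -/
structure IsPot (w : Space d → ℝ) : Prop where
  one : MemLp w 1 volume
  top : MemLp w ∞ volume

lemma IsPot.sub (hW : IsPot w) (hW' : IsPot w') : IsPot (w - w') := ⟨hW.1.sub hW'.1, hW.2.sub hW'.2⟩

lemma isPot_closedBall (R : ℝ) :
    IsPot ((Metric.closedBall (0 : Space d) R).indicator fun _ => (1 : ℝ)) :=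
  have hm := Metric.isClosed_closedBall.measurableSet
  have hf := Or.inr (isCompact_closedBall (0 : Space d) R).measure_lt_top.ne
  ⟨memLp_indicator_const 1 hm 1 hf, memLp_indicator_const ∞ hm 1 hf⟩

/-- The size of an interaction potential. -/
def wNorm (w : Space d → ℝ) : ℝ≥0∞ := eLpNorm w 1 volume + eLpNorm w ∞ volume

lemma wNorm_lt_top (hW : IsPot w) : wNorm w < ∞ := add_lt_top.2 ⟨hW.1.2, hW.2.2⟩

lemma lintegral_enorm_le_wNorm (w : Space d → ℝ) : ∫⁻ y, ‖w y‖ₑ ≤ wNorm w := by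
  rw [wNorm, eLpNorm_one_eq_lintegral_enorm]; exact le_self_add

lemma enorm_le_wNorm (w : Space d → ℝ) : ∀ᵐ y, ‖w y‖ₑ ≤ wNorm w := by
  filter_upwards [ae_le_eLpNormEssSup (f := w) (μ := volume)] with y hy
  refine hy.trans ?_
  rw [wNorm, eLpNorm_exponent_top]
  exact le_add_self

lemma lintegral_enorm_sq_le_wNorm (hw : AEStronglyMeasurable w volume) :
    ∫⁻ y, ‖w y‖ₑ ^ 2 ≤ wNorm w ^ 2 := by
  calc ∫⁻ y, ‖w y‖ₑ ^ 2 ≤ ∫⁻ y, ‖w y‖ₑ * wNorm w := by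
        refine lintegral_mono_ae ?_
        filter_upwards [enorm_le_wNorm w] with y hy
        rw [sq]
        gcongr
    _ = (∫⁻ y, ‖w y‖ₑ) * wNorm w := lintegral_mul_const'' _ hw.enorm
    _ ≤ _ := by rw [sq]; gcongr; exact lintegral_enorm_le_wNorm w

section Bounds

lemma lconv_le_of_two (hw : AEStronglyMeasurable w volume)
    (hρ : AEStronglyMeasurable ρ volume) (x : Space d) :
    lconv (fun y => ‖w y‖ₑ) (fun y => ‖ρ y‖ₑ) x ≤ wNorm w * eLpNorm ρ 2 volume := by
  refine (pow_le_pow_left_iff two_ne_zero).1 ?_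
  refine (sq_lconv_le_sq hw.enorm hρ.enorm x).trans ?_
  rw [mul_pow, eLpNorm_two_sq]
  gcongr
  exact lintegral_enorm_sq_le_wNorm hw

lemma lconv_le_of_one (hρ : AEStronglyMeasurable ρ volume) (x : Space d) :
    lconv (fun y => ‖w y‖ₑ) (fun y => ‖ρ y‖ₑ) x ≤ wNorm w * eLpNorm ρ 1 volume := by
  rw [lconv_comm, mul_comm, eLpNorm_one_eq_lintegral_enorm]
  exact lconv_le_of_bound hρ.enorm (enorm_le_wNorm w) x

lemma lconv_le_of_top (hw : AEStronglyMeasurable w volume) {c : ℝ≥0∞} (hρ : ∀ᵐ y, ‖ρ y‖ₑ ≤ c)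
    (x : Space d) :
    lconv (fun y => ‖w y‖ₑ) (fun y => ‖ρ y‖ₑ) x ≤ wNorm w * c := by
  refine (lconv_le_of_bound hw.enorm hρ x).trans ?_
  gcongr
  exact lintegral_enorm_le_wNorm w

lemma eLpNorm_conv_le_two (hw : AEStronglyMeasurable w volume)
    (hρ : AEStronglyMeasurable ρ volume) :
    eLpNorm (conv w ρ) 2 volume ≤ wNorm w * eLpNorm ρ 2 volume := by
  refine (pow_le_pow_left_iff two_ne_zero).1 ?_
  rw [eLpNorm_two_sq, mul_pow, eLpNorm_two_sq]
  calc _ ≤ ∫⁻ x, lconv (fun y => ‖w y‖ₑ) (fun y => ‖ρ y‖ₑ) x ^ 2 :=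
        lintegral_mono fun x => by gcongr; exact enorm_conv_le w ρ x
    _ ≤ _ := by
      refine (lintegral_sq_lconv_le hw.enorm hρ.enorm).trans ?_
      gcongr
      exact lintegral_enorm_le_wNorm w

lemma eLpNorm_conv_le_one (hw : AEStronglyMeasurable w volume)
    (hρ : AEStronglyMeasurable ρ volume) :
    eLpNorm (conv w ρ) 2 volume ≤ wNorm w * eLpNorm ρ 1 volume := by
  refine (pow_le_pow_left_iff two_ne_zero).1 ?_
  rw [eLpNorm_two_sq, mul_pow]
  calc _ ≤ ∫⁻ x, lconv (fun y => ‖w y‖ₑ) (fun y => ‖ρ y‖ₑ) x ^ 2 :=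
        lintegral_mono fun x => by gcongr; exact enorm_conv_le w ρ x
    _ ≤ _ := by
      rw [lconv_comm, eLpNorm_one_eq_lintegral_enorm, mul_comm]
      refine (lintegral_sq_lconv_le hρ.enorm hw.enorm).trans ?_
      gcongr
      exact lintegral_enorm_sq_le_wNorm hw

end Bounds

/-- A function whose convolutions with `L¹ ∩ L^∞` functions are uniformly absolutely convergent. -/
structure IsConvolvable (ρ : Space d → ℂ) : Prop where
  meas : AEStronglyMeasurable ρ volume
  bound : ∀ w : Space d → ℝ, IsPot w → ∃ C < ∞, ∀ x, lconv (fun y => ‖w y‖ₑ) (fun y => ‖ρ y‖ₑ) x ≤ C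

namespace IsConvolvable

lemma of_one (h : MemLp ρ 1 volume) : IsConvolvable ρ :=
  ⟨h.1, fun _ hW => ⟨_, mul_lt_top (wNorm_lt_top hW) h.2, lconv_le_of_one h.1⟩⟩

lemma of_two (h : MemLp ρ 2 volume) : IsConvolvable ρ :=
  ⟨h.1, fun _ hW => ⟨_, mul_lt_top (wNorm_lt_top hW) h.2, lconv_le_of_two hW.1.1 h.1⟩⟩

lemma of_top (h : AEStronglyMeasurable ρ volume) {c : ℝ≥0∞} (hc : c < ∞)
    (hρ : ∀ᵐ y, ‖ρ y‖ₑ ≤ c) : IsConvolvable ρ :=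
  ⟨h, fun _ hW => ⟨_, mul_lt_top (wNorm_lt_top hW) hc, lconv_le_of_top hW.1.1 hρ⟩⟩

lemma integrable (h : IsConvolvable ρ) (hW : IsPot w)
    (x : Space d) : Integrable fun y => (w (x - y) : ℂ) * ρ y := by
  obtain ⟨C, hC, hx⟩ := h.bound w hW
  refine ⟨(Complex.continuous_ofReal.comp_aestronglyMeasurable (hW.1.1.comp_quasiMeasurePreserving
      (Measure.measurePreserving_sub_left volume x).quasiMeasurePreserving)).mul h.meas, ?_⟩
  refine lt_of_le_of_lt (le_of_eq ?_) ((hx x).trans_lt hC)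
  refine lintegral_congr fun y => ?_
  rw [enorm_mul, enorm_ofReal_complex]

lemma add (h : IsConvolvable ρ) (h' : IsConvolvable ρ') : IsConvolvable (fun x => ρ x + ρ' x) := by
  refine ⟨h.meas.add h'.meas, fun w hW => ?_⟩
  obtain ⟨C, hC, hx⟩ := h.bound w hW
  obtain ⟨C', hC', hx'⟩ := h'.bound w hW
  refine ⟨C + C', add_lt_top.2 ⟨hC, hC'⟩, fun x => ?_⟩
  refine le_trans ?_ (add_le_add (hx x) (hx' x))
  have hm : AEMeasurable (fun y => ‖w (x - y)‖ₑ * ‖ρ y‖ₑ) volume :=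
    (aemeasurable_comp_sub hW.1.1.enorm x).mul h.meas.enorm
  rw [lconv, lconv, lconv, ← lintegral_add_left' hm]
  refine lintegral_mono fun y => ?_
  rw [← mul_add]
  gcongr
  exact enorm_add_le _ _

lemma smul (h : IsConvolvable ρ) (c : ℂ) : IsConvolvable (fun x => c * ρ x) := by
  refine ⟨h.meas.const_mul c, fun w hW => ?_⟩
  obtain ⟨C, hC, hx⟩ := h.bound w hW
  refine ⟨‖c‖ₑ * C, mul_lt_top enorm_lt_top hC, fun x => ?_⟩
  refine le_trans ?_ (mul_le_mul_right (hx x) ‖c‖ₑ)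
  have hm : AEMeasurable (fun y => ‖w (x - y)‖ₑ * ‖ρ y‖ₑ) volume :=
    (aemeasurable_comp_sub hW.1.1.enorm x).mul h.meas.enorm
  rw [lconv, lconv, ← lintegral_const_mul'' _ hm]
  refine lintegral_mono fun y => le_of_eq ?_
  rw [enorm_mul]; ring

lemma star (h : IsConvolvable ρ) : IsConvolvable (fun x => star (ρ x)) := by
  refine ⟨h.meas.star, fun w hW => ?_⟩
  obtain ⟨C, hC, hx⟩ := h.bound w hW
  refine ⟨C, hC, fun x => ?_⟩
  have : ∀ y, ‖Star.star (ρ y)‖ₑ = ‖ρ y‖ₑ := fun y => by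
    rw [← ofReal_norm, ← ofReal_norm, norm_star]
  simpa only [this] using hx x

lemma conv_add (h : IsConvolvable ρ) (h' : IsConvolvable ρ') (hW : IsPot w) (x : Space d) :
    conv w (fun x => ρ x + ρ' x) x = conv w ρ x + conv w ρ' x := by
  rw [conv, conv, conv, ← integral_add (h.integrable hW x) (h'.integrable hW x)]
  simp only [mul_add]

lemma conv_smul (c : ℂ) (x : Space d) : conv w (fun x => c * ρ x) x = c * conv w ρ x := by
  rw [conv, conv, ← integral_const_mul]
  congr 1; ext y; ring

lemma conv_sub_left (h : IsConvolvable ρ) (hW : IsPot w) (hW' : IsPot w') (x : Space d) :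
    conv (w - w') ρ x = conv w ρ x - conv w' ρ x := by
  rw [conv, conv, conv, ← integral_sub (h.integrable hW x) (h.integrable hW' x)]
  congr 1; ext y; simp [sub_mul]

lemma memLp_conv (h : IsConvolvable ρ) (hW : IsPot w) : MemLp (conv w ρ) ∞ volume := by
  obtain ⟨C, hC, hx⟩ := h.bound w hW
  refine memLp_top_of_bound (aestronglyMeasurable_conv hW.1.1 h.meas) C.toReal
    (.of_forall fun x => ?_)
  have := (enorm_conv_le w ρ x).trans (hx x)
  rw [← ofReal_norm] at this
  exact (ENNReal.ofReal_le_iff_le_toReal hC.ne).1 this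

lemma locallyIntegrable (h : IsConvolvable ρ) : LocallyIntegrable ρ volume := by
  refine locallyIntegrable_iff.2 fun K hK => ?_
  obtain ⟨R, hR⟩ := hK.isBounded.subset_closedBall 0
  have hm : MeasurableSet (Metric.closedBall (0 : Space d) R) := Metric.isClosed_closedBall.measurableSet
  refine IntegrableOn.mono_set ?_ hR
  rw [← integrable_indicator_iff hm]
  refine (h.integrable (isPot_closedBall R) 0).congr (.of_forall fun y => ?_)
  by_cases hy : y ∈ Metric.closedBall (0 : Space d) R
  · have : -y ∈ Metric.closedBall (0 : Space d) R := by simpa using hy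
    simp [this, hy]
  · have : -y ∉ Metric.closedBall (0 : Space d) R := by simpa using hy
    simp [this, hy]

end IsConvolvable

lemma conv_congr (h : ρ =ᵐ[volume] ρ') : conv w ρ = conv w ρ' := by
  ext x
  refine integral_congr_ae ?_
  filter_upwards [h] with y hy
  rw [hy]

/-! ### Traces of trace-class operators -/

lemma tsum_enorm_inner_le_trNorm (T : Op d) :
    ∑' i, ‖inner ℂ (basis d i) (T (basis d i))‖ₑ ≤ trNorm T := by
  refine ENNReal.summable.tsum_le_of_sum_le fun s => ?_
  set z : basisSet d → ℂ := fun i => inner ℂ (basis d i) (T (basis d i))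
  set u : s → L2 d := fun i => (z i / ‖z i‖ : ℂ) • basis d i
  have hv : IsBessel fun i : s => basis d i :=
    isBessel_orthonormal ((basis d).orthonormal.comp _ Subtype.val_injective)
  have hu : IsBessel u := fun x => by
    refine le_trans ?_ (hv x)
    refine Finset.sum_le_sum fun i _ => ?_
    have hc : ‖(starRingEnd ℂ) (z i / ‖z i‖ : ℂ)‖ ≤ 1 := by
      rw [RCLike.norm_conj, norm_div, Complex.norm_real, norm_norm]
      exact div_self_le_one _
    rw [inner_smul_left, norm_mul, mul_pow]
    exact mul_le_of_le_one_left (by positivity) (pow_le_one₀ (norm_nonneg _) hc)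
  have h := enorm_sum_inner_le_trNorm T hu hv
  have h1 : ∀ i : s, inner ℂ (u i) (T (basis d i)) = ((‖z i‖ : ℝ) : ℂ) := fun i => by
    rw [inner_smul_left]
    change _ * z i = _
    rw [map_div₀, Complex.conj_ofReal, div_mul_eq_mul_div, mul_comm, Complex.mul_conj']
    rcases eq_or_ne (‖z i‖ : ℂ) 0 with h0 | h0
    · rw [h0]; simp
    · rw [sq, mul_div_cancel_left₀ _ h0]
  simp only [h1] at h
  rw [← Complex.ofReal_sum, enorm_ofReal_complex,
    Real.enorm_of_nonneg (Finset.sum_nonneg fun i _ => norm_nonneg _),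
    ofReal_sum_of_nonneg fun i _ => norm_nonneg _] at h
  simp only [ofReal_norm] at h
  rwa [← Finset.sum_coe_sort s fun i => ‖z i‖ₑ]

lemma summable_of_tsum_enorm {ι : Type*} {f : ι → ℂ} (h : ∑' i, ‖f i‖ₑ < ∞) : Summable f := by
  refine Summable.of_norm ?_
  have := summable_toReal h.ne
  simpa using this

lemma summable_trace {T : Op d} (h : trNorm T < ∞) :
    Summable fun i => inner ℂ (basis d i) (T (basis d i)) :=
  summable_of_tsum_enorm ((tsum_enorm_inner_le_trNorm T).trans_lt h)

lemma trace_add {S T : Op d} (hS : trNorm S < ∞) (hT : trNorm T < ∞) :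
    trace (S + T) = trace S + trace T := by
  rw [trace, trace, trace, ← (summable_trace hS).tsum_add (summable_trace hT)]
  simp only [add_apply, inner_add_right]

lemma trace_smul (c : ℂ) (T : Op d) : trace (c • T) = c * trace T := by
  rw [trace, trace, ← tsum_mul_left]
  simp only [smul_apply, inner_smul_right]

lemma trace_star (T : Op d) : trace (star T) = star (trace T) := by
  rw [trace, trace, tsum_star]
  refine tsum_congr fun i => ?_
  rw [star_eq_adjoint, adjoint_inner_right]
  exact (inner_conj_symm _ _).symm

lemma trace_hasSum {ι : Type*} [Countable ι] {T : ι → Op d}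
    (h : ∀ u, HasSum (fun n => T n u) (A u)) (hT : ∑' n, trNorm (T n) < ∞) :
    trace A = ∑' n, trace (T n) := by
  have h1 : ∀ i, inner ℂ (basis d i) (A (basis d i)) =
      ∑' n, inner ℂ (basis d i) (T n (basis d i)) := fun i =>
    ((h (basis d i)).mapL (innerSL ℂ (basis d i))).tsum_eq.symm
  simp only [trace, h1]
  refine (Summable.tsum_comm ?_)
  refine summable_of_tsum_enorm ?_
  refine (ENNReal.tsum_prod (f := fun n i => ‖inner ℂ (basis d i) (T n (basis d i))‖ₑ)).trans_lt ?_
  exact (tsum_le_tsum fun n => tsum_enorm_inner_le_trNorm (T n)).trans_lt hT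

/-! ### Complex densities -/

/-- The multiplication by the indicator function of `B`. -/
def boxProj (B : Set (Space d)) : Op d := mulOp (B.indicator fun _ => 1)

lemma cutOff_eq (B : Set (Space d)) (Q : Op d) : cutOff B Q = boxProj B * Q * boxProj B := rfl

lemma star_boxProj (hB : MeasurableSet B) : star (boxProj B) = boxProj B := by
  rw [boxProj, star_mulOp (memLp_top_indicator hB)]
  congr 1
  ext x
  by_cases h : x ∈ B <;> simp [h]

lemma enorm_boxProj_le (B : Set (Space d)) : ‖boxProj B‖ₑ ≤ 1 := by
  rw [← ofReal_norm]
  exact ofReal_le_one.2 (norm_mulOp_le zero_le_one (.of_forall (norm_indicator_one_le B)))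

lemma star_cutOff (hB : MeasurableSet B) (A : Op d) : star (cutOff B A) = cutOff B (star A) := by
  simp only [cutOff_eq, star_mul, star_boxProj hB, mul_assoc]

/-- `A` is locally trace class with the density `ρ`, which may be convolved with functions of
`L¹ ∩ L^∞`. -/
structure HasDens (A : Op d) (ρ : Space d → ℂ) : Prop where
  convolvable : IsConvolvable ρ
  tr_lt_top : ∀ B, MeasurableSet B → Bornology.IsBounded B → trNorm (cutOff B A) < ∞
  trace_eq : ∀ B, MeasurableSet B → Bornology.IsBounded B → trace (cutOff B A) = ∫ x in B, ρ x

lemma integrableOn_of_isBounded (h : LocallyIntegrable ρ volume)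
    (hB : Bornology.IsBounded B) : IntegrableOn ρ B volume :=
  (h.integrableOn_isCompact hB.isCompact_closure).mono_set subset_closure

lemma ae_eq_of_setIntegral (h : LocallyIntegrable ρ volume) (h' : LocallyIntegrable ρ' volume)
    (he : ∀ B, MeasurableSet B → Bornology.IsBounded B → ∫ x in B, ρ x = ∫ x in B, ρ' x) :
    ρ =ᵐ[volume] ρ' := by
  have h1 : ∀ n : ℕ, ρ =ᵐ[volume.restrict (Metric.ball 0 n)] ρ' := fun n => by
    refine Integrable.ae_eq_of_forall_setIntegral_eq _ _
      (integrableOn_of_isBounded h Metric.isBounded_ball)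
      (integrableOn_of_isBounded h' Metric.isBounded_ball) fun s hs _ => ?_
    rw [Measure.restrict_restrict hs]
    exact he _ (hs.inter measurableSet_ball) (Metric.isBounded_ball.subset inter_subset_right)
  have h2 := (ae_restrict_iUnion_iff (μ := volume) (fun n : ℕ => Metric.ball (0 : Space d) n)
    fun x => ρ x = ρ' x).2 h1
  rwa [Metric.iUnion_ball_nat, Measure.restrict_univ] at h2

namespace HasDens

variable {A A' : Op d}

lemma add (h : HasDens A ρ) (h' : HasDens A' ρ') : HasDens (A + A') fun x => ρ x + ρ' x := by
  have e : ∀ B, cutOff B (A + A') = cutOff B A + cutOff B A' := fun B => by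
    simp only [cutOff_eq, mul_add, add_mul]
  refine ⟨h.convolvable.add h'.convolvable, fun B hB hb => ?_, fun B hB hb => ?_⟩
  · rw [e]
    exact (trNorm_add_le _ _).trans_lt (add_lt_top.2 ⟨h.tr_lt_top B hB hb, h'.tr_lt_top B hB hb⟩)
  · rw [e, trace_add (h.tr_lt_top B hB hb) (h'.tr_lt_top B hB hb), h.trace_eq B hB hb,
      h'.trace_eq B hB hb, integral_add
        (integrableOn_of_isBounded h.convolvable.locallyIntegrable hb)
        (integrableOn_of_isBounded h'.convolvable.locallyIntegrable hb)]

lemma smul (h : HasDens A ρ) (c : ℝ) : HasDens (c • A) fun x => (c : ℂ) * ρ x := by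
  have e : ∀ B, cutOff B (c • A) = c • cutOff B A := fun B => by
    simp only [cutOff_eq, mul_smul_comm, smul_mul_assoc]
  refine ⟨h.convolvable.smul c, fun B hB hb => ?_, fun B hB hb => ?_⟩
  · rw [e]
    exact (trNorm_smul_le _ _).trans_lt (mul_lt_top enorm_lt_top (h.tr_lt_top B hB hb))
  · have e' : c • cutOff B A = (c : ℂ) • cutOff B A := by
      ext1 u
      exact (Complex.coe_smul c (cutOff B A u)).symm
    rw [e, e', trace_smul, h.trace_eq B hB hb, integral_const_mul]

lemma sub (h : HasDens A ρ) (h' : HasDens A' ρ') : HasDens (A - A') fun x => ρ x - ρ' x := by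
  have := h.add (h'.smul (-1))
  simpa [sub_eq_add_neg] using this

lemma star (h : HasDens A ρ) : HasDens (star A) fun x => star (ρ x) := by
  refine ⟨h.convolvable.star, fun B hB hb => ?_, fun B hB hb => ?_⟩
  · rw [← star_cutOff hB, trNorm_star]; exact h.tr_lt_top B hB hb
  · rw [← star_cutOff hB, trace_star, h.trace_eq B hB hb]
    exact integral_conj.symm

/-- The density of a self-adjoint operator is real. -/
lemma isDensity (h : HasDens A ρ) (hA : IsSelfAdjoint A) : IsDensity A fun x => (ρ x).re := by
  have hl := h.convolvable.locallyIntegrable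
  refine ⟨fun x => ?_, fun B hB hb => ⟨?_, ?_⟩⟩
  · obtain ⟨s, hs, hi⟩ := hl x
    exact ⟨s, hs, hi.re⟩
  · rw [schattenENorm_one]; exact h.tr_lt_top B hB hb
  · have h1 := (integrableOn_of_isBounded hl hb).re
    have hr := h.trace_eq B hB hb
    have hs : Star.star (trace (cutOff B A)) = trace (cutOff B A) := by
      rw [← trace_star, star_cutOff hB, hA.star_eq]
    have h2 : ((trace (cutOff B A)).re : ℂ) = trace (cutOff B A) := Complex.conj_eq_iff_re.1 hs
    rw [← h2, hr]
    congr 1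
    exact (reCLM_integral h1 h hb)
where
  reCLM_integral {B : Set (Space d)} (h1 : IntegrableOn (fun x => RCLike.re (ρ x)) B volume)
      (h : HasDens A ρ) (hb : Bornology.IsBounded B) :
      (∫ x in B, ρ x).re = ∫ x in B, (ρ x).re :=
    (Complex.reCLM.integral_comp_comm
      (integrableOn_of_isBounded h.convolvable.locallyIntegrable hb)).symm

lemma coe_density (h : HasDens A ρ) (hA : IsSelfAdjoint A) :
    (fun x => (density A x : ℂ)) =ᵐ[volume] ρ := by
  have he : ∃ r, IsDensity A r := ⟨_, h.isDensity hA⟩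
  have hd : IsDensity A (density A) := by rw [density, dif_pos he]; exact he.choose_spec
  refine ae_eq_of_setIntegral ?_ h.convolvable.locallyIntegrable fun B hB hb => ?_
  · intro x
    obtain ⟨s, hs, hi⟩ := hd.1 x
    exact ⟨s, hs, hi.ofReal⟩
  · rw [← h.trace_eq B hB hb, (hd.2 B hB hb).2]
    exact integral_ofReal

lemma meanField_eq (h : HasDens A ρ) (hA : IsSelfAdjoint A) (w : Space d → ℝ) (x : Space d) :
    (meanField w A x : ℂ) = conv w ρ x := by
  rw [← conv_congr (h.coe_density hA), meanField, conv, ← integral_complex_ofReal]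
  congr 1; ext y; push_cast; rfl

lemma eLpNorm_density (h : HasDens A ρ) (hA : IsSelfAdjoint A) (p : ℝ≥0∞) :
    eLpNorm (density A) p volume = eLpNorm ρ p volume := by
  rw [← eLpNorm_congr_ae (h.coe_density hA)]
  exact eLpNorm_congr_norm_ae (.of_forall fun x => (Complex.norm_real _).symm)

end HasDens

/-! ### Densities of products -/

/-- The density of `X Y*`. -/
def dens2 (X Y : Op d) (x : Space d) : ℂ := ∑' i, X (basis d i) x * star (Y (basis d i) x)

lemma sq_tsum_enorm_mul_le (X Y : Op d) (x : Space d) :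
    (∑' i, ‖X (basis d i) x * star (Y (basis d i) x)‖ₑ) ^ 2 ≤ sqDens X x * sqDens Y x := by
  have : ∀ i, ‖X (basis d i) x * star (Y (basis d i) x)‖ₑ =
      ‖X (basis d i) x‖ₑ * ‖Y (basis d i) x‖ₑ := fun i => by
    rw [enorm_mul, ← ofReal_norm (star _), norm_star, ofReal_norm]
  simp only [this]
  exact sq_tsum_mul_le _ _

lemma enorm_dens2_sq_le (X Y : Op d) (x : Space d) :
    ‖dens2 X Y x‖ₑ ^ 2 ≤ sqDens X x * sqDens Y x := by
  refine le_trans ?_ (sq_tsum_enorm_mul_le X Y x)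
  gcongr
  exact enorm_tsum_le_tsum_enorm

/-- `X` is locally Hilbert–Schmidt. -/
def IsLocHS (X : Op d) : Prop :=
  ∀ B, MeasurableSet B → Bornology.IsBounded B → hsNorm (boxProj B * X) < ∞

lemma lintegral_sqDens_restrict (hB : MeasurableSet B) (X : Op d) :
    ∫⁻ x in B, sqDens X x = hsNorm (boxProj B * X) ^ 2 := by
  rw [boxProj, ← lintegral_mul_sqDens (memLp_top_indicator hB), ← lintegral_indicator hB]
  refine lintegral_congr fun x => ?_
  by_cases h : x ∈ B <;> simp [h]

lemma ae_lt_top_of_forall_bounded {f : Space d → ℝ≥0∞} (hf : AEMeasurable f volume)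
    (h : ∀ B, MeasurableSet B → Bornology.IsBounded B → ∫⁻ x in B, f x < ∞) :
    ∀ᵐ x, f x < ∞ := by
  have h1 : ∀ n : ℕ, ∀ᵐ x ∂(volume.restrict (Metric.ball (0 : Space d) n)), f x < ∞ := fun n =>
    ae_lt_top' hf.restrict (h _ measurableSet_ball Metric.isBounded_ball).ne
  have h2 := (ae_restrict_iUnion_iff (μ := volume) (fun n : ℕ => Metric.ball (0 : Space d) n)
    fun x => f x < ∞).2 h1
  rwa [Metric.iUnion_ball_nat, Measure.restrict_univ] at h2

lemma IsLocHS.ae_lt_top (h : IsLocHS X) : ∀ᵐ x, sqDens X x < ∞ :=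
  ae_lt_top_of_forall_bounded (aemeasurable_sqDens X) fun B hB hb => by
    rw [lintegral_sqDens_restrict hB]
    exact pow_lt_top (h B hB hb)

lemma aestronglyMeasurable_tsum {ι : Type*} [Countable ι] {f : ι → Space d → ℂ}
    (hf : ∀ i, AEStronglyMeasurable (f i) volume) (h : ∀ᵐ x, ∑' i, ‖f i x‖ₑ < ∞) :
    AEStronglyMeasurable (fun x => ∑' i, f i x) volume := by
  refine aestronglyMeasurable_of_tendsto_ae (u := (atTop : Filter (Finset ι)))
    (f := fun s x => ∑ i ∈ s, f i x) (fun s => ?_) ?_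
  · exact Finset.aestronglyMeasurable_fun_sum s fun i _ => hf i
  · filter_upwards [h] with x hx
    have := (summable_of_tsum_enorm hx).hasSum
    rwa [HasSum, SummationFilter.unconditional_filter] at this

lemma aestronglyMeasurable_mul_star (X Y : Op d) (i : basisSet d) :
    AEStronglyMeasurable (fun x => X (basis d i) x * star (Y (basis d i) x)) volume :=
  (Lp.aestronglyMeasurable _).mul (Lp.aestronglyMeasurable _).star

lemma aestronglyMeasurable_dens2 {X Y : Op d} (hX : IsLocHS X) (hY : IsLocHS Y) :
    AEStronglyMeasurable (dens2 X Y) volume := by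
  refine aestronglyMeasurable_tsum (aestronglyMeasurable_mul_star X Y) ?_
  filter_upwards [hX.ae_lt_top, hY.ae_lt_top] with x h1 h2
  have := (sq_tsum_enorm_mul_le X Y x).trans_lt (mul_lt_top h1 h2)
  by_contra hc
  rw [not_lt, top_le_iff] at hc
  rw [hc] at this
  simp at this

lemma hasDens_mul_star {X Y : Op d} (hX : IsLocHS X) (hY : IsLocHS Y)
    (hc : IsConvolvable (dens2 X Y)) : HasDens (X * star Y) (dens2 X Y) := by
  have e : ∀ B, MeasurableSet B → cutOff B (X * star Y) = (boxProj B * X) * star (boxProj B * Y) :=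
    fun B hB => by rw [cutOff_eq, star_mul, star_boxProj hB]; simp only [mul_assoc]
  refine ⟨hc, fun B hB hb => ?_, fun B hB hb => ?_⟩
  · rw [e B hB]
    refine (trNorm_mul_le_hsNorm _ _).trans_lt ?_
    rw [hsNorm_star]
    exact mul_lt_top (hX B hB hb) (hY B hB hb)
  · rw [e B hB, trace_mul_star (hX B hB hb) (hY B hB hb)]
    have hsum : ∫⁻ x in B, ∑' i, ‖X (basis d i) x * star (Y (basis d i) x)‖ₑ ≠ ∞ := by
      refine ne_of_lt ?_
      calc ∫⁻ x in B, ∑' i, ‖X (basis d i) x * star (Y (basis d i) x)‖ₑ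
          ≤ ∫⁻ x in B, (sqDens X x + sqDens Y x) := by
            refine lintegral_mono fun x => ?_
            refine (pow_le_pow_left_iff two_ne_zero).1 ?_
            refine (sq_tsum_enorm_mul_le X Y x).trans ?_
            rw [sq]
            gcongr
            · exact le_self_add
            · exact le_add_self
        _ = hsNorm (boxProj B * X) ^ 2 + hsNorm (boxProj B * Y) ^ 2 := by
            rw [lintegral_add_left' (aemeasurable_sqDens X).restrict,
              lintegral_sqDens_restrict hB, lintegral_sqDens_restrict hB]
        _ < ∞ := add_lt_top.2 ⟨pow_lt_top (hX B hB hb), pow_lt_top (hY B hB hb)⟩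
    have hm := fun i => (aestronglyMeasurable_mul_star X Y i).restrict (s := B)
    rw [lintegral_tsum fun i => (hm i).enorm] at hsum
    simp only [dens2]
    rw [integral_tsum hm hsum]
    refine tsum_congr fun i => ?_
    rw [L2.inner_def, ← integral_indicator hB]
    refine integral_congr_ae ?_
    filter_upwards [mulOp_apply (memLp_top_indicator hB) (X (basis d i)),
      mulOp_apply (memLp_top_indicator hB) (Y (basis d i))] with x h1 h2
    rw [mul_apply_eq_comp, mul_apply_eq_comp, boxProj, h1, h2]
    by_cases hx : x ∈ B
    · simp [hx]
    · simp [hx]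

/-! ### Series of densities -/

/-- A series of densities converges if it does so in a suitable norm. -/
structure IsDensSeries {ι : Type*} (T : ι → Op d) (ρ : ι → Space d → ℂ) (c : ι → ℝ≥0∞) : Prop where
  dens : ∀ n, HasDens (T n) (ρ n)
  sum_lt_top : ∑' n, c n < ∞
  lconv_le : ∀ w : Space d → ℝ, IsPot w → ∃ C < ∞, ∀ n x,
    lconv (fun y => ‖w y‖ₑ) (fun y => ‖ρ n y‖ₑ) x ≤ C * c n
  tr_le : ∀ B, MeasurableSet B → Bornology.IsBounded B → ∃ C < ∞, ∀ n,
    trNorm (cutOff B (T n)) ≤ C * c n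

namespace IsDensSeries

variable {ι : Type*} {T : ι → Op d} {ρ : ι → Space d → ℂ} {c : ι → ℝ≥0∞}

lemma lintegral_tsum_lt_top (h : IsDensSeries T ρ c)
    (hb : Bornology.IsBounded B) : ∑' n, ∫⁻ x in B, ‖ρ n x‖ₑ < ∞ := by
  obtain ⟨R, hR⟩ := hb.subset_closedBall 0
  have hm : MeasurableSet (Metric.closedBall (0 : Space d) R) := Metric.isClosed_closedBall.measurableSet
  obtain ⟨C, hC, hx⟩ := h.lconv_le _ (isPot_closedBall R)
  have h1 : ∀ n, ∫⁻ x in B, ‖ρ n x‖ₑ ≤ C * c n := fun n => by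
    refine le_trans ?_ (hx n 0)
    calc ∫⁻ x in B, ‖ρ n x‖ₑ ≤ ∫⁻ x in Metric.closedBall 0 R, ‖ρ n x‖ₑ := lintegral_mono_set hR
      _ = _ := by
        rw [← lintegral_indicator hm]
        refine lintegral_congr fun y => ?_
        by_cases hy : y ∈ Metric.closedBall (0 : Space d) R
        · have : -y ∈ Metric.closedBall (0 : Space d) R := by simpa using hy
          simp [this, hy]
        · have : -y ∉ Metric.closedBall (0 : Space d) R := by simpa using hy
          simp [this, hy]
  refine (tsum_le_tsum h1).trans_lt ?_
  rw [ENNReal.tsum_mul_left]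
  exact mul_lt_top hC h.sum_lt_top

variable [Countable ι]

lemma ae_summable (h : IsDensSeries T ρ c) : ∀ᵐ x, ∑' n, ‖ρ n x‖ₑ < ∞ := by
  refine ae_lt_top_of_forall_bounded
    (AEMeasurable.tsum fun n => (h.dens n).convolvable.meas.enorm) fun B _ hb => ?_
  rw [lintegral_tsum fun n => (h.dens n).convolvable.meas.enorm.restrict]
  exact h.lintegral_tsum_lt_top hb

lemma lconv_tsum_le (h : IsDensSeries T ρ c) (hW : IsPot w)
    (x : Space d) : lconv (fun y => ‖w y‖ₑ) (fun y => ‖∑' n, ρ n y‖ₑ) x ≤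
      ∑' n, lconv (fun y => ‖w y‖ₑ) (fun y => ‖ρ n y‖ₑ) x := by
  simp only [lconv]
  have hm : ∀ n, AEMeasurable (fun y => ‖w (x - y)‖ₑ * ‖ρ n y‖ₑ) volume := fun n =>
    (aemeasurable_comp_sub hW.1.1.enorm x).mul (h.dens n).convolvable.meas.enorm
  rw [← lintegral_tsum hm]
  refine lintegral_mono fun y => ?_
  rw [ENNReal.tsum_mul_left]
  gcongr
  exact enorm_tsum_le_tsum_enorm

lemma isConvolvable (h : IsDensSeries T ρ c) : IsConvolvable fun x => ∑' n, ρ n x := by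
  refine ⟨aestronglyMeasurable_tsum (fun n => (h.dens n).convolvable.meas) h.ae_summable,
    fun w hW => ?_⟩
  obtain ⟨C, hC, hx⟩ := h.lconv_le w hW
  refine ⟨C * ∑' n, c n, mul_lt_top hC h.sum_lt_top, fun x => ?_⟩
  refine (h.lconv_tsum_le hW x).trans ?_
  rw [← ENNReal.tsum_mul_left]
  exact tsum_le_tsum fun n => hx n x

lemma hasDens (h : IsDensSeries T ρ c) (hA : ∀ u, HasSum (fun n => T n u) (A u)) :
    HasDens A fun x => ∑' n, ρ n x := by
  have hs : ∀ B, ∀ u, HasSum (fun n => cutOff B (T n) u) (cutOff B A u) := fun B u =>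
    (hA (boxProj B u)).mapL (boxProj B)
  have ht : ∀ B, MeasurableSet B → Bornology.IsBounded B → ∑' n, trNorm (cutOff B (T n)) < ∞ :=
    fun B hB hb => by
      obtain ⟨C, hC, hn⟩ := h.tr_le B hB hb
      refine (tsum_le_tsum hn).trans_lt ?_
      rw [ENNReal.tsum_mul_left]
      exact mul_lt_top hC h.sum_lt_top
  refine ⟨h.isConvolvable, fun B hB hb => ?_, fun B hB hb => ?_⟩
  · exact ((ExtNorm.tr (L2 d)).le_tsum (hs B)).trans_lt (ht B hB hb)
  · rw [trace_hasSum (hs B) (ht B hB hb), integral_tsum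
      (fun n => (h.dens n).convolvable.meas.restrict) (h.lintegral_tsum_lt_top hb).ne]
    exact tsum_congr fun n => (h.dens n).trace_eq B hB hb

lemma hasSum_conv (h : IsDensSeries T ρ c) (hW : IsPot w) (x : Space d) :
    HasSum (fun n => conv w (ρ n) x) (conv w (fun x => ∑' n, ρ n x) x) := by
  obtain ⟨C, hC, hx⟩ := h.lconv_le w hW
  have hf : ∑' n, lconv (fun y => ‖w y‖ₑ) (fun y => ‖ρ n y‖ₑ) x < ∞ := by
    refine (tsum_le_tsum fun n => hx n x).trans_lt ?_
    rw [ENNReal.tsum_mul_left]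
    exact mul_lt_top hC h.sum_lt_top
  have hs : Summable fun n => conv w (ρ n) x := summable_of_tsum_enorm
    ((tsum_le_tsum fun n => enorm_conv_le w (ρ n) x).trans_lt hf)
  have he : conv w (fun x => ∑' n, ρ n x) x = ∑' n, conv w (ρ n) x := by
    simp only [conv]
    rw [← integral_tsum]
    · simp only [tsum_mul_left]
    · exact fun n => ((h.dens n).convolvable.integrable hW x).1
    · refine ne_of_lt (lt_of_le_of_lt (le_of_eq ?_) hf)
      refine tsum_congr fun n => lintegral_congr fun y => ?_
      rw [enorm_mul, enorm_ofReal_complex]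
  rw [he]
  exact hs.hasSum

end IsDensSeries

/-! ### Densities of blocks -/

lemma eLpNorm_indicator_one_sq (hB : MeasurableSet B) :
    eLpNorm (B.indicator fun _ => (1 : ℂ)) 2 volume ^ 2 = volume B := by
  rw [eLpNorm_two_sq, ← lintegral_indicator_one hB]
  refine lintegral_congr fun x => ?_
  by_cases h : x ∈ B <;> simp [h]

lemma isLocHS_freqProj_mul (hS : MeasurableSet S) (hv : volume S < ∞)
    (T : Op d) : IsLocHS (freqProj S * T) := fun B hB hb => by
  have h := hsNorm_mulOp_freqProj_mul_le hS hv (memLp_top_indicator hB) T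
  rw [eLpNorm_indicator_one_sq hB] at h
  have h1 : volume B * (‖T‖ₑ ^ 2 * volume S) < ∞ :=
    mul_lt_top hb.measure_lt_top (mul_lt_top (pow_lt_top enorm_lt_top) hv)
  by_contra hc
  rw [not_lt, top_le_iff] at hc
  rw [← boxProj, hc] at h
  simp only [ne_eq, OfNat.ofNat_ne_zero, not_false_eq_true, ENNReal.top_pow, top_le_iff] at h
  exact h1.ne h

lemma isLocHS_freqProj (hS : MeasurableSet S) (hv : volume S < ∞) : IsLocHS (freqProj S) := by
  simpa using isLocHS_freqProj_mul hS hv 1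

lemma isLocHS_of_hsNorm (h : hsNorm X < ∞) : IsLocHS X := fun _ _ _ =>
  (hsNorm_mul_le _ _).trans_lt (mul_lt_top enorm_lt_top h)

lemma enorm_one_op_le : ‖(1 : Op d)‖ₑ ≤ 1 := by
  rw [← ofReal_norm]
  exact ofReal_le_one.2 ContinuousLinearMap.norm_id_le

lemma sqDens_freqProj_le (hS : MeasurableSet S) (hv : volume S < ∞) :
    ∀ᵐ x, sqDens (freqProj S) x ≤ volume S := by
  have h := tsum_enorm_sq_freqProj_le hS hv 1
  filter_upwards [h] with x hx
  rw [mul_one] at hx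
  refine hx.trans ?_
  calc _ ≤ (1 : ℝ≥0∞) ^ 2 * volume S := by gcongr; exact enorm_one_op_le
    _ = _ := by simp

/-- The density of a Hilbert–Schmidt operator restricted to bounded frequencies. -/
lemma hasDens_mul_freqProj (hS : MeasurableSet S) (hv : volume S < ∞)
    (hX : hsNorm (X * freqProj S) < ∞) :
    HasDens (X * freqProj S) (dens2 (X * freqProj S) (freqProj S)) ∧
      eLpNorm (dens2 (X * freqProj S) (freqProj S)) 2 volume ^ 2 ≤
        hsNorm (X * freqProj S) ^ 2 * volume S := by
  have h1 := isLocHS_of_hsNorm hX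
  have h2 := isLocHS_freqProj hS hv
  have hb : eLpNorm (dens2 (X * freqProj S) (freqProj S)) 2 volume ^ 2 ≤
        hsNorm (X * freqProj S) ^ 2 * volume S := by
    rw [eLpNorm_two_sq, ← lintegral_sqDens, ← lintegral_mul_const'' _ (aemeasurable_sqDens _)]
    refine lintegral_mono_ae ?_
    filter_upwards [sqDens_freqProj_le hS hv] with x hx
    refine (enorm_dens2_sq_le _ _ _).trans ?_
    gcongr
  have hm : MemLp (dens2 (X * freqProj S) (freqProj S)) 2 volume := by
    refine ⟨aestronglyMeasurable_dens2 h1 h2, ?_⟩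
    have : eLpNorm (dens2 (X * freqProj S) (freqProj S)) 2 volume ^ 2 < ∞ :=
      hb.trans_lt (mul_lt_top (pow_lt_top hX) hv)
    by_contra hc
    rw [not_lt, top_le_iff] at hc
    rw [hc] at this
    simp at this
  refine ⟨?_, hb⟩
  have := hasDens_mul_star h1 h2 (IsConvolvable.of_two hm)
  rwa [star_freqProj hS, mul_assoc, freqProj_mul hS hS, inter_self] at this

lemma hasDens_mul_cubeProj (k : Fin d → ℤ) (hX : hsNorm (X * cubeProj k) < ∞) :
    HasDens (X * cubeProj k) (dens2 (X * cubeProj k) (cubeProj k)) ∧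
      eLpNorm (dens2 (X * cubeProj k) (cubeProj k)) 2 volume ≤ hsNorm (X * cubeProj k) := by
  have h := hasDens_mul_freqProj (measurableSet_cube k) (volume_cube_lt_top k) hX
  rw [volume_cube, mul_one] at h
  exact ⟨h.1, (pow_le_pow_left_iff two_ne_zero).1 h.2⟩

lemma hsNorm_boxProj_cubeProj_le (hB : MeasurableSet B) (k : Fin d → ℤ)
    (T : Op d) : hsNorm (boxProj B * (cubeProj k * T)) ≤
      eLpNorm (B.indicator fun _ => (1 : ℂ)) 2 volume * ‖T‖ₑ := by
  refine (pow_le_pow_left_iff two_ne_zero).1 ?_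
  refine (hsNorm_mulOp_freqProj_mul_le (measurableSet_cube k) (volume_cube_lt_top k)
    (memLp_top_indicator hB) T).trans ?_
  rw [volume_cube, mul_one, mul_pow]

lemma eLpNorm_indicator_lt_top (hb : Bornology.IsBounded B) (hB : MeasurableSet B) :
    eLpNorm (B.indicator fun _ => (1 : ℂ)) 2 volume < ∞ :=
  (memLp_indicator_const 2 hB (1 : ℂ) (Or.inr hb.measure_lt_top.ne)).2

lemma trNorm_cutOff_mul_cubeProj_le (hB : MeasurableSet B) (k : Fin d → ℤ)
    (X : Op d) : trNorm (cutOff B (X * cubeProj k)) ≤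
      eLpNorm (B.indicator fun _ => (1 : ℂ)) 2 volume * hsNorm (X * cubeProj k) := by
  have e : cutOff B (X * cubeProj k) = (boxProj B * (X * cubeProj k)) *
      star (boxProj B * (cubeProj k * 1)) := by
    rw [mul_one, star_mul, star_boxProj hB, star_cubeProj, cutOff_eq]
    conv_lhs => rw [← cubeProj_mul_self k]
    simp only [mul_assoc]
  rw [e]
  refine (trNorm_mul_le_hsNorm _ _).trans ?_
  rw [hsNorm_star, mul_comm]
  gcongr
  · refine (hsNorm_boxProj_cubeProj_le hB k 1).trans ?_
    calc _ ≤ eLpNorm (B.indicator fun _ => (1 : ℂ)) 2 volume * 1 := by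
          gcongr; exact enorm_one_op_le
      _ = _ := mul_one _
  · refine (hsNorm_mul_le _ _).trans ?_
    calc _ ≤ 1 * hsNorm (X * cubeProj k) := by gcongr; exact enorm_boxProj_le B
      _ = _ := one_mul _

/-- The block of an operator between two frequency cubes. -/
def block (j k : Fin d → ℤ) (T : Op d) : Op d := cubeProj j * T * cubeProj k

lemma cubeProj_mul_block (j k : Fin d → ℤ) (T : Op d) : cubeProj j * block j k T = block j k T := by
  rw [block, ← mul_assoc, ← mul_assoc, cubeProj_mul_self]

lemma block_mul_cubeProj (j k : Fin d → ℤ) (T : Op d) : block j k T * cubeProj k = block j k T := by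
  rw [block, mul_assoc, cubeProj_mul_self]

def blockDens (j k : Fin d → ℤ) (T : Op d) : Space d → ℂ := dens2 (block j k T) (cubeProj k)

lemma sqDens_cubeProj_mul_le (j : Fin d → ℤ) (T : Op d) :
    ∀ᵐ x, sqDens (cubeProj j * T) x ≤ ‖T‖ₑ ^ 2 := by
  have h := tsum_enorm_sq_freqProj_le (measurableSet_cube j) (volume_cube_lt_top j) T
  rwa [volume_cube, mul_one] at h

lemma sqDens_cubeProj_le (j : Fin d → ℤ) : ∀ᵐ x, sqDens (cubeProj j) x ≤ 1 := by
  have h := sqDens_freqProj_le (measurableSet_cube j) (volume_cube_lt_top j)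
  rwa [volume_cube] at h

lemma tsum_enorm_block_le (j k : Fin d → ℤ) (T : Op d) :
    ∀ᵐ x, ∑' i, ‖block j k T (basis d i) x * star (cubeProj k (basis d i) x)‖ₑ ≤
      ‖block j k T‖ₑ := by
  filter_upwards [sqDens_cubeProj_mul_le j (block j k T), sqDens_cubeProj_le k] with x h1 h2
  refine (pow_le_pow_left_iff two_ne_zero).1 ?_
  refine (sq_tsum_enorm_mul_le _ _ _).trans ?_
  rw [cubeProj_mul_block] at h1
  calc _ ≤ ‖block j k T‖ₑ ^ 2 * 1 := by gcongr
    _ = _ := mul_one _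

lemma enorm_blockDens_le (j k : Fin d → ℤ) (T : Op d) :
    ∀ᵐ x, ‖blockDens j k T x‖ₑ ≤ ‖block j k T‖ₑ := by
  filter_upwards [tsum_enorm_block_le j k T] with x hx
  exact enorm_tsum_le_tsum_enorm.trans hx

lemma isLocHS_block (j k : Fin d → ℤ) (T : Op d) : IsLocHS (block j k T) := by
  rw [← cubeProj_mul_block]
  exact isLocHS_freqProj_mul (measurableSet_cube j) (volume_cube_lt_top j) _

lemma hasDens_block (j k : Fin d → ℤ) (T : Op d) : HasDens (block j k T) (blockDens j k T) := by
  have h1 := isLocHS_block j k T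
  have h2 : IsLocHS (cubeProj k) := isLocHS_freqProj (measurableSet_cube k) (volume_cube_lt_top k)
  have := hasDens_mul_star h1 h2 (IsConvolvable.of_top (aestronglyMeasurable_dens2 h1 h2)
    enorm_lt_top (enorm_blockDens_le j k T))
  rwa [star_cubeProj, block_mul_cubeProj] at this

lemma eLpNorm_blockDens_le (j k : Fin d → ℤ) (T : Op d) :
    eLpNorm (blockDens j k T) 2 volume ≤ hsNorm (block j k T) := by
  rcases eq_or_ne (hsNorm (block j k T)) ∞ with h | h
  · rw [h]; exact le_top
  · have := (hasDens_mul_cubeProj k (X := block j k T)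
      (by rw [block_mul_cubeProj]; exact h.lt_top)).2
    rwa [block_mul_cubeProj] at this

lemma trNorm_cutOff_block_le (hB : MeasurableSet B) (j k : Fin d → ℤ)
    (T : Op d) : trNorm (cutOff B (block j k T)) ≤
      eLpNorm (B.indicator fun _ => (1 : ℂ)) 2 volume ^ 2 * ‖block j k T‖ₑ := by
  have e : cutOff B (block j k T) = (boxProj B * (cubeProj j * block j k T)) *
      star (boxProj B * (cubeProj k * 1)) := by
    rw [mul_one, star_mul, star_boxProj hB, star_cubeProj, cutOff_eq, cubeProj_mul_block]
    conv_lhs => rw [← block_mul_cubeProj]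
    simp only [mul_assoc]
  rw [e]
  refine (trNorm_mul_le_hsNorm _ _).trans ?_
  rw [hsNorm_star]
  calc _ ≤ (eLpNorm (B.indicator fun _ => (1 : ℂ)) 2 volume * ‖block j k T‖ₑ) *
        (eLpNorm (B.indicator fun _ => (1 : ℂ)) 2 volume * ‖(1 : Op d)‖ₑ) :=
        mul_le_mul' (hsNorm_boxProj_cubeProj_le hB j _) (hsNorm_boxProj_cubeProj_le hB k 1)
    _ ≤ (eLpNorm (B.indicator fun _ => (1 : ℂ)) 2 volume * ‖block j k T‖ₑ) *
        (eLpNorm (B.indicator fun _ => (1 : ℂ)) 2 volume * 1) := by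
        gcongr; exact enorm_one_op_le
    _ = _ := by ring

/-- Trace-class operators have integrable densities. -/
lemma exists_hasDens_of_trNorm (hA : trNorm A < ∞) :
    ∃ ρ, HasDens A ρ ∧ eLpNorm ρ 1 volume ≤ trNorm A := by
  obtain ⟨X, Y, rfl, hX, hY⟩ := exists_hsNorm_factorisation A
  have lt_of_sq : ∀ {x : ℝ≥0∞}, x ^ 2 < ∞ → x < ∞ := fun {x} h => by
    by_contra hc
    rw [not_lt, top_le_iff] at hc
    simp [hc] at h
  have h1 := isLocHS_of_hsNorm (lt_of_sq (hX.trans_lt hA))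
  have h2 := isLocHS_of_hsNorm (X := star Y) (by rw [hsNorm_star]; exact lt_of_sq (hY.trans_lt hA))
  have hb : eLpNorm (dens2 X (star Y)) 1 volume ≤ trNorm (X * Y) := by
    refine (pow_le_pow_left_iff two_ne_zero).1 ?_
    rw [eLpNorm_one_eq_lintegral_enorm]
    calc (∫⁻ x, ‖dens2 X (star Y) x‖ₑ) ^ 2
        ≤ (∫⁻ x, sqDens X x ^ (1 / 2 : ℝ) * sqDens (star Y) x ^ (1 / 2 : ℝ)) ^ 2 := by
          gcongr with x
          rw [← ENNReal.mul_rpow_of_nonneg _ _ (by norm_num)]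
          refine (pow_le_pow_left_iff two_ne_zero).1 ?_
          refine (enorm_dens2_sq_le _ _ _).trans (le_of_eq ?_)
          rw [← ENNReal.rpow_natCast, ← ENNReal.rpow_mul]; norm_num
      _ ≤ (∫⁻ x, (sqDens X x ^ (1 / 2 : ℝ)) ^ 2) * ∫⁻ x, (sqDens (star Y) x ^ (1 / 2 : ℝ)) ^ 2 :=
          sq_lintegral_mul_le _ ((aemeasurable_sqDens _).pow_const _)
            ((aemeasurable_sqDens _).pow_const _)
      _ = hsNorm X ^ 2 * hsNorm Y ^ 2 := by
          have : ∀ a : ℝ≥0∞, (a ^ (1 / 2 : ℝ)) ^ 2 = a := fun a => by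
            rw [← ENNReal.rpow_natCast, ← ENNReal.rpow_mul]; norm_num
          simp only [this]
          rw [lintegral_sqDens, lintegral_sqDens, hsNorm_star]
      _ ≤ _ := by rw [sq (trNorm _)]; gcongr
  refine ⟨dens2 X (star Y), ?_, hb⟩
  have := hasDens_mul_star h1 h2
    (IsConvolvable.of_one ⟨aestronglyMeasurable_dens2 h1 h2, hb.trans_lt hA⟩)
  rwa [star_star] at this

/-! ### Frequency support of the potentials generated by blocks -/

/-- The lattice points `m` and `n` are at distance at most one. -/
def Near (m n : Fin d → ℤ) : Prop := ∀ i, |m i - n i| ≤ 1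

lemma inner_eq_integral (u v : L2 d) : inner ℂ u v = ∫ x, star (u x) * v x := by
  rw [L2.inner_def]
  refine integral_congr_ae (.of_forall fun x => ?_)
  simp [mul_comm]

open FourierTransform Convolution in
lemma integral_conv_blockDens_eq_zero {p l j k : Fin d → ℤ} (hn : ¬ Near (p + k) (l + j))
    (hW : IsPot w) (T : Op d) {φ ψ : L2 d}
    (hφ : IsBand (cube p) φ) (hψ : IsBand (cube l) ψ) :
    ∫ x, star (φ x) * ψ x * conv w (blockDens j k T) x = 0 := by
  set ρ := blockDens j k T
  have hρ := (hasDens_block j k T).convolvable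
  set F : Space d → ℂ := fun x => star (φ x) * ψ x
  have hF : Integrable F := by
    have := L2.integrable_inner (𝕜 := ℂ) φ ψ
    refine this.congr (.of_forall fun x => ?_)
    simp [F, mul_comm]
  set w' : Space d → ℂ := fun z => (w (-z) : ℂ)
  have hwi : Integrable fun z => (w z : ℂ) := (memLp_one_iff_integrable.1 hW.1).ofReal
  have hw' : Integrable w' := hwi.comp_neg
  set G : Space d → ℂ := F ⋆[ContinuousLinearMap.mul ℂ ℂ] w'
  have hG : Integrable G := hF.integrable_convolution _ hw'
  have hGz : ∀ ξ ∈ cube j, ∀ η ∈ cube k, 𝓕 G (η - ξ) = 0 := by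
    intro ξ hξ η hη
    rw [Real.fourier_mul_convolution_eq hF hw']
    rw [fourier_conj_mul_eq_zero hφ hψ (hψ.integrable (measurableSet_cube l) (volume_cube_lt_top l)),
      zero_mul]
    intro ζ hζ hc
    refine hn fun i => ?_
    have e1 := hζ i
    have e2 := hc i
    have e3 := hξ i
    have e4 := hη i
    rw [Int.floor_eq_iff] at e1 e2 e3 e4
    simp only [PiLp.add_apply, PiLp.sub_apply] at e2
    rw [abs_le]
    simp only [Pi.add_apply]
    constructor
    · have : ((l i + j i : ℤ) : ℝ) < ((p i + k i + 2 : ℤ) : ℝ) := by push_cast; linarith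
      have := Int.cast_lt.1 this
      linarith
    · have : ((p i + k i : ℤ) : ℝ) < ((l i + j i + 2 : ℤ) : ℝ) := by push_cast; linarith
      have := Int.cast_lt.1 this
      linarith
  have hswap : ∫ x, F x * conv w ρ x = ∫ y, G y * ρ y := by
    obtain ⟨C, hC, hx⟩ := hρ.bound w hW
    have hm : AEStronglyMeasurable (fun q : Space d × Space d => F q.1 * ((w (q.1 - q.2) : ℂ) * ρ q.2))
        (volume.prod volume) :=
      (hF.1.comp_quasiMeasurePreserving Measure.quasiMeasurePreserving_fst).mul
        ((Complex.continuous_ofReal.comp_aestronglyMeasurable (hW.1.1.comp_quasiMeasurePreserving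
          (quasiMeasurePreserving_sub_of_right_invariant volume volume))).mul
        (hρ.meas.comp_quasiMeasurePreserving Measure.quasiMeasurePreserving_snd))
    have hi : Integrable (fun q : Space d × Space d => F q.1 * ((w (q.1 - q.2) : ℂ) * ρ q.2))
        (volume.prod volume) := by
      refine ⟨hm, ?_⟩
      rw [HasFiniteIntegral, lintegral_prod _ hm.enorm]
      calc _ ≤ ∫⁻ x, ‖F x‖ₑ * C := by
            refine lintegral_mono fun x => ?_
            refine le_trans ?_ (mul_le_mul_right (hx x) ‖F x‖ₑ)
            rw [lconv, ← lintegral_const_mul' _ _ enorm_ne_top]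
            refine lintegral_mono fun y => le_of_eq ?_
            rw [enorm_mul (F _), enorm_mul ((w _ : ℝ) : ℂ), enorm_ofReal_complex]
        _ = (∫⁻ x, ‖F x‖ₑ) * C := lintegral_mul_const' _ _ hC.ne
        _ < ∞ := mul_lt_top hF.2 hC
    have := integral_integral_swap (f := fun x y => F x * ((w (x - y) : ℂ) * ρ y)) hi
    simp only [conv, ← integral_const_mul]
    rw [this]
    congr 1
    ext y
    have hGy : G y = ∫ x, F x * w' (y - x) := rfl
    rw [hGy, ← integral_mul_const]
    congr 1
    ext x
    simp only [w', neg_sub]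
    ring
  change ∫ x, F x * conv w ρ x = 0
  rw [hswap]
  have hm : ∀ i, AEStronglyMeasurable (fun y => G y * (block j k T (basis d i) y *
      star (cubeProj k (basis d i) y))) volume := fun i =>
    hG.1.mul (aestronglyMeasurable_mul_star _ _ i)
  have hs : ∑' i, ∫⁻ y, ‖G y * (block j k T (basis d i) y *
      star (cubeProj k (basis d i) y))‖ₑ ≠ ∞ := by
    rw [← lintegral_tsum fun i => (hm i).enorm]
    refine ne_of_lt ?_
    calc _ ≤ ∫⁻ y, ‖G y‖ₑ * ‖block j k T‖ₑ := by
          refine lintegral_mono_ae ?_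
          filter_upwards [tsum_enorm_block_le j k T] with y hy
          simp only [enorm_mul (G y)]
          rw [ENNReal.tsum_mul_left]
          gcongr
      _ = (∫⁻ y, ‖G y‖ₑ) * ‖block j k T‖ₑ := lintegral_mul_const' _ _ enorm_ne_top
      _ < ∞ := mul_lt_top hG.2 enorm_lt_top
  have he : ∀ y, G y * ρ y = ∑' i, G y * (block j k T (basis d i) y *
      star (cubeProj k (basis d i) y)) := fun y => by
    simp only [ρ, blockDens, dens2]
    rw [tsum_mul_left]
  simp only [he]
  rw [integral_tsum hm hs]
  refine (tsum_congr fun i => ?_).trans tsum_zero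
  have hb1 : IsBand (cube j) (block j k T (basis d i)) := by
    rw [← cubeProj_mul_block]
    exact isBand_freqProj (measurableSet_cube j) _
  exact integral_mul_conj_eq_zero (measurableSet_cube j) (measurableSet_cube k)
    (volume_cube_lt_top j) (volume_cube_lt_top k) hb1 (isBand_freqProj (measurableSet_cube k) _)
    hG hGz

/-- The potential generated by a block couples only neighbouring cubes. -/
lemma block_conv_blockDens_eq_zero {p l j k : Fin d → ℤ} (hn : ¬ Near (p + k) (l + j))
    (hW : IsPot w) (T : Op d) :
    block p l (mulOp (conv w (blockDens j k T))) = 0 := by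
  have hV := (hasDens_block j k T).convolvable.memLp_conv hW
  ext1 ψ
  refine ext_inner_left ℂ fun φ => ?_
  have e : inner ℂ φ (block p l (mulOp (conv w (blockDens j k T))) ψ) =
      inner ℂ (cubeProj p φ) (mulOp (conv w (blockDens j k T)) (cubeProj l ψ)) := by
    conv_rhs => rw [← star_cubeProj p, star_eq_adjoint,
      adjoint_inner_left]
    rfl
  rw [e, inner_eq_integral, zero_apply, inner_zero_right]
  refine Eq.trans ?_ (integral_conv_blockDens_eq_zero hn hW T
    (isBand_freqProj (measurableSet_cube p) φ) (isBand_freqProj (measurableSet_cube l) ψ))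
  refine integral_congr_ae ?_
  filter_upwards [mulOp_apply hV (cubeProj l ψ)] with x hx
  rw [hx, cubeProj, cubeProj]
  ring

/-! ### Lattice norms -/

/-- A seminorm which is an operator ideal norm. -/
structure IsIdealNorm (p : ExtNorm (L2 d)) : Prop where
  mul_le : ∀ K A, p (K * A) ≤ ‖K‖ₑ * p A
  mul_le' : ∀ A K, p (A * K) ≤ p A * ‖K‖ₑ
  star_eq : ∀ A, p (star A) = p A

def opN (d : ℕ) : ExtNorm (L2 d) := ExtNorm.op (L2 d)

def hsN (d : ℕ) : ExtNorm (L2 d) := ExtNorm.hs (L2 d)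

def trN (d : ℕ) : ExtNorm (L2 d) := ExtNorm.tr (L2 d)

lemma opN_apply (A : Op d) : opN d A = ‖A‖ₑ := rfl
lemma trN_apply (A : Op d) : trN d A = trNorm A := rfl

lemma enorm_mul_op_le (A B : Op d) : ‖A * B‖ₑ ≤ ‖A‖ₑ * ‖B‖ₑ := by
  rw [← ofReal_norm, ← ofReal_norm, ← ofReal_norm, ← ofReal_mul (norm_nonneg _)]
  exact ofReal_le_ofReal (norm_mul_le _ _)

lemma enorm_star_op (A : Op d) : ‖star A‖ₑ = ‖A‖ₑ := by
  rw [← ofReal_norm, ← ofReal_norm]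
  exact congrArg _ (norm_star A)

lemma isIdealNorm_op : IsIdealNorm (opN d) := ⟨enorm_mul_op_le, enorm_mul_op_le, enorm_star_op⟩
lemma isIdealNorm_hs : IsIdealNorm (hsN d) := ⟨hsNorm_mul_le, hsNorm_mul_le', hsNorm_star⟩
lemma isIdealNorm_tr : IsIdealNorm (trN d) := ⟨trNorm_mul_le, trNorm_mul_le', trNorm_star⟩

namespace IsIdealNorm

lemma contr_mul_le (hp : IsIdealNorm p) {K : Op d} (hK : ‖K‖ₑ ≤ 1) (A : Op d) : p (K * A) ≤ p A :=
  (hp.mul_le K A).trans (mul_le_of_le_one_left' hK)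

lemma mul_contr_le (hp : IsIdealNorm p) {K : Op d} (hK : ‖K‖ₑ ≤ 1) (A : Op d) : p (A * K) ≤ p A :=
  (hp.mul_le' A K).trans (mul_le_of_le_one_right' hK)

lemma block_le (hp : IsIdealNorm p) (j k : Fin d → ℤ) (A : Op d) : p (block j k A) ≤ p A :=
  (hp.mul_contr_le (enorm_cubeProj_le k) _).trans (hp.contr_mul_le (enorm_cubeProj_le j) A)

lemma freeEvol_le (hp : IsIdealNorm p) (t : ℝ) (A : Op d) : p (freeEvol t A) ≤ p A :=
  (hp.mul_contr_le (enorm_freeProp_le _) _).trans (hp.contr_mul_le (enorm_freeProp_le t) A)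

lemma freeEvol_eq (hp : IsIdealNorm p) (t : ℝ) (A : Op d) : p (freeEvol t A) = p A := by
  refine le_antisymm (hp.freeEvol_le t A) ?_
  have := hp.freeEvol_le (-t) (freeEvol t A)
  rwa [freeEvol_freeEvol, neg_add_cancel, freeEvol_zero] at this

end IsIdealNorm

/-- The sum of the norms of all the blocks. -/
def lat (p : ExtNorm (L2 d)) : ExtNorm (L2 d) :=
  ExtNorm.tsum fun q : (Fin d → ℤ) × (Fin d → ℤ) => p.sandwich (cubeProj q.1) (cubeProj q.2)

/-- The sum over the diagonals of the largest norm of the blocks on a diagonal. -/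
def band (p : ExtNorm (L2 d)) : ExtNorm (L2 d) :=
  ExtNorm.tsum fun m : Fin d → ℤ => ExtNorm.sup fun l : Fin d → ℤ =>
    p.sandwich (cubeProj (l + m)) (cubeProj l)

/-- The sum of the Hilbert–Schmidt norms of the columns. -/
def colSum (d : ℕ) : ExtNorm (L2 d) :=
  ExtNorm.tsum fun k : Fin d → ℤ => (hsN d).sandwich 1 (cubeProj k)

def colSup (d : ℕ) : ExtNorm (L2 d) :=
  ExtNorm.sup fun k : Fin d → ℤ => (hsN d).sandwich 1 (cubeProj k)

lemma lat_apply (p : ExtNorm (L2 d)) (A : Op d) :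
    lat p A = ∑' q : (Fin d → ℤ) × (Fin d → ℤ), p (block q.1 q.2 A) := rfl

lemma lat_apply' (p : ExtNorm (L2 d)) (A : Op d) :
    lat p A = ∑' j, ∑' k, p (block j k A) := ENNReal.tsum_prod (f := fun j k => p (block j k A))

lemma band_apply (p : ExtNorm (L2 d)) (A : Op d) :
    band p A = ∑' m : Fin d → ℤ, ⨆ l : Fin d → ℤ, p (block (l + m) l A) := rfl

lemma colSum_apply (A : Op d) : colSum d A = ∑' k, hsNorm (A * cubeProj k) := by
  refine tsum_congr fun k => ?_
  change hsNorm (1 * A * cubeProj k) = _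
  rw [one_mul]

lemma colSup_apply (A : Op d) : colSup d A = ⨆ k, hsNorm (A * cubeProj k) := by
  refine iSup_congr fun k => ?_
  change hsNorm (1 * A * cubeProj k) = _
  rw [one_mul]

lemma hsNorm_mul_cubeProj_le_colSup (A : Op d) (k : Fin d → ℤ) :
    hsNorm (A * cubeProj k) ≤ colSup d A := by
  rw [colSup_apply]; exact le_iSup (fun k => hsNorm (A * cubeProj k)) k

lemma tsum_block_le_band (p : ExtNorm (L2 d)) (T : Op d) (l : Fin d → ℤ) :
    ∑' j, p (block j l T) ≤ band p T := by
  rw [band_apply, ← (Equiv.addLeft l).tsum_eq]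
  exact tsum_le_tsum fun m => le_iSup (fun l => p (block (l + m) l T)) l

lemma star_block (j k : Fin d → ℤ) (A : Op d) : star (block j k A) = block k j (star A) := by
  simp only [block, star_mul, star_cubeProj, mul_assoc]

lemma tsum_block_le_band_star (hp : IsIdealNorm p) (T : Op d)
    (l : Fin d → ℤ) : ∑' k, p (block l k T) ≤ band p (star T) := by
  refine le_trans (le_of_eq (tsum_congr fun k => ?_)) (tsum_block_le_band p (star T) l)
  rw [← star_block, hp.star_eq]

lemma hasSum_mul_cubeProj_mul (A B : Op d) (u : L2 d) :
    HasSum (fun l : Fin d → ℤ => (A * cubeProj l * (cubeProj l * B)) u) ((A * B) u) := by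
  have h := (hasSum_cubeProj (B u)).mapL A
  refine h.congr_fun fun l => ?_
  change A (cubeProj l (cubeProj l (B u))) = _
  congr 1
  exact congrArg (fun C : Op d => C (B u)) (cubeProj_mul_self l)

/-- A seminorm of a product, through the resolution of the identity by cubes. -/
lemma mul_le_tsum (p : ExtNorm (L2 d)) (A B : Op d) :
    p (A * B) ≤ ∑' l, p (A * cubeProj l * (cubeProj l * B)) :=
  p.le_tsum (hasSum_mul_cubeProj_mul A B)

lemma lat_mul_le {p q r : ExtNorm (L2 d)} (h : ∀ S T, r (S * T) ≤ p S * q T) (T A : Op d) :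
    lat r (T * A) ≤ band p T * lat q A := by
  have h1 : ∀ j k, r (block j k (T * A)) ≤ ∑' l, p (block j l T) * q (block l k A) := fun j k => by
    have e : block j k (T * A) = (cubeProj j * T) * (A * cubeProj k) := by
      simp only [block, mul_assoc]
    rw [e]
    refine (mul_le_tsum r _ _).trans (tsum_le_tsum fun l => ?_)
    refine (h _ _).trans (le_of_eq ?_)
    simp only [block, mul_assoc]
  calc lat r (T * A) ≤ ∑' j, ∑' k, ∑' l, p (block j l T) * q (block l k A) := by
        rw [lat_apply']
        exact tsum_le_tsum fun j => tsum_le_tsum fun k => h1 j k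
    _ = ∑' j, ∑' l, p (block j l T) * ∑' k, q (block l k A) := by
        refine tsum_congr fun j => ?_
        rw [tsum_comm]
        simp only [ENNReal.tsum_mul_left]
    _ = ∑' l, (∑' j, p (block j l T)) * ∑' k, q (block l k A) := by
        rw [tsum_comm]
        simp only [ENNReal.tsum_mul_right]
    _ ≤ ∑' l, band p T * ∑' k, q (block l k A) :=
        tsum_le_tsum fun l => by gcongr; exact tsum_block_le_band p T l
    _ = _ := by rw [ENNReal.tsum_mul_left, ← lat_apply']

lemma lat_star (hp : IsIdealNorm p) (A : Op d) : lat p (star A) = lat p A := by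
  rw [lat_apply', lat_apply', tsum_comm]
  refine tsum_congr fun j => tsum_congr fun k => ?_
  rw [← star_block, hp.star_eq]

lemma le_lat (p : ExtNorm (L2 d)) (A : Op d) : p A ≤ lat p A := by
  rw [lat_apply', tsum_comm]
  refine (p.le_tsum (hasSum_mul_cubeProj A)).trans (tsum_le_tsum fun k => ?_)
  refine (p.le_tsum (hasSum_cubeProj_mul (A * cubeProj k))).trans (tsum_le_tsum fun j => ?_)
  rw [block, mul_assoc]

lemma hsNorm_le_colSum (A : Op d) : hsNorm A ≤ colSum d A := by
  rw [colSum_apply]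
  exact (hsN d).le_tsum (hasSum_mul_cubeProj A)

lemma tsum_hsNorm_cubeProj_mul_le (A : Op d) : ∑' l, hsNorm (cubeProj l * A) ≤ lat (hsN d) A := by
  rw [lat_apply']
  refine tsum_le_tsum fun l => ?_
  exact (hsN d).le_tsum (hasSum_mul_cubeProj (cubeProj l * A))

lemma colSup_le_band (T : Op d) : colSup d T ≤ band (hsN d) T := by
  rw [colSup_apply]
  refine iSup_le fun k => ?_
  refine le_trans ?_ (tsum_block_le_band (hsN d) T k)
  refine ((hsN d).le_tsum (hasSum_cubeProj_mul (T * cubeProj k))).trans (le_of_eq ?_)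
  simp only [block, mul_assoc]

lemma colSum_mul_le (T A : Op d) : colSum d (T * A) ≤ colSup d T * lat (opN d) A := by
  rw [colSum_apply, lat_apply', tsum_comm, ← ENNReal.tsum_mul_left]
  refine tsum_le_tsum fun k => ?_
  rw [← ENNReal.tsum_mul_left, mul_assoc]
  refine (mul_le_tsum (hsN d) _ _).trans (tsum_le_tsum fun l => ?_)
  refine (hsNorm_mul_le' _ _).trans ?_
  rw [← mul_assoc]
  exact mul_le_mul' (hsNorm_mul_cubeProj_le_colSup T l) le_rfl

lemma colSum_op_mul_le (T A : Op d) : colSum d (T * A) ≤ ‖T‖ₑ * colSum d A := by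
  rw [colSum_apply, colSum_apply, ← ENNReal.tsum_mul_left]
  refine tsum_le_tsum fun k => ?_
  rw [mul_assoc]
  exact hsNorm_mul_le _ _

lemma colSum_mul_band_le (A T : Op d) : colSum d (A * T) ≤ colSum d A * band (opN d) (star T) := by
  have h1 : ∀ k, hsNorm (A * T * cubeProj k) ≤ ∑' l, hsNorm (A * cubeProj l) * opN d (block l k T) :=
    fun k => by
      rw [mul_assoc]
      refine (mul_le_tsum (hsN d) _ _).trans (tsum_le_tsum fun l => ?_)
      rw [← mul_assoc (cubeProj l)]
      exact hsNorm_mul_le' _ _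
  calc colSum d (A * T) ≤ ∑' k, ∑' l, hsNorm (A * cubeProj l) * opN d (block l k T) := by
        rw [colSum_apply]; exact tsum_le_tsum h1
    _ = ∑' l, hsNorm (A * cubeProj l) * ∑' k, opN d (block l k T) := by
        rw [tsum_comm]; simp only [ENNReal.tsum_mul_left]
    _ ≤ ∑' l, hsNorm (A * cubeProj l) * band (opN d) (star T) :=
        tsum_le_tsum fun l => by gcongr; exact tsum_block_le_band_star isIdealNorm_op T l
    _ = _ := by rw [ENNReal.tsum_mul_right, colSum_apply]

lemma trNorm_mul_le_colSum (A T : Op d) : trNorm (A * T) ≤ colSum d A * colSup d (star T) := by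
  refine (mul_le_tsum (trN d) A T).trans ?_
  rw [colSum_apply, ← ENNReal.tsum_mul_right]
  refine tsum_le_tsum fun l => ?_
  refine (trNorm_mul_le_hsNorm _ _).trans ?_
  gcongr
  rw [← hsNorm_star, star_mul, star_cubeProj]
  exact hsNorm_mul_cubeProj_le_colSup _ l

lemma trNorm_mul_le_lat (T A : Op d) : trNorm (T * A) ≤ colSup d T * lat (hsN d) A := by
  refine (mul_le_tsum (trN d) T A).trans ?_
  calc _ ≤ ∑' l, colSup d T * hsNorm (cubeProj l * A) := by
        refine tsum_le_tsum fun l => (trNorm_mul_le_hsNorm _ _).trans ?_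
        gcongr
        exact hsNorm_mul_cubeProj_le_colSup T l
    _ ≤ _ := by rw [ENNReal.tsum_mul_left]; gcongr; exact tsum_hsNorm_cubeProj_mul_le A

/-! ### Operators commuting with the frequency cubes -/

lemma cubeProj_freeProp_comm (k : Fin d → ℤ) (t : ℝ) :
    cubeProj k * freeProp t = freeProp t * cubeProj k :=
  freqProj_freeProp_comm (measurableSet_cube k) t

lemma cubeProj_freqProj_comm (k : Fin d → ℤ) (hS : MeasurableSet S) :
    cubeProj k * freqProj S = freqProj S * cubeProj k :=
  freqProj_comm (measurableSet_cube k) (memLp_top_indicator hS)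

lemma block_mul_of_comm {S : Op d} (h : cubeProj k * S = S * cubeProj k)
    (A : Op d) : block j k (A * S) = block j k A * S := by
  simp only [block, mul_assoc, h]

lemma mul_block_of_comm {S : Op d} (h : cubeProj j * S = S * cubeProj j)
    (A : Op d) : block j k (S * A) = S * block j k A := by
  simp only [block, ← mul_assoc, h]

lemma block_freeEvol (j k : Fin d → ℤ) (t : ℝ) (A : Op d) :
    block j k (freeEvol t A) = freeEvol t (block j k A) := by
  rw [freeEvol, freeEvol, block_mul_of_comm (cubeProj_freeProp_comm k _),
    mul_block_of_comm (cubeProj_freeProp_comm j _)]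

lemma lat_freeEvol (hp : IsIdealNorm p) (t : ℝ) (A : Op d) : lat p (freeEvol t A) = lat p A := by
  rw [lat_apply, lat_apply]
  exact tsum_congr fun q => by rw [block_freeEvol, hp.freeEvol_eq]

lemma freeEvol_mul_cubeProj (t : ℝ) (A : Op d) (k : Fin d → ℤ) :
    freeEvol t (A * cubeProj k) = freeEvol t A * cubeProj k := by
  simp only [freeEvol, mul_assoc, cubeProj_freeProp_comm]

lemma colSum_freeEvol (t : ℝ) (A : Op d) : colSum d (freeEvol t A) = colSum d A := by
  rw [colSum_apply, colSum_apply]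
  refine tsum_congr fun k => ?_
  rw [← freeEvol_mul_cubeProj]
  exact isIdealNorm_hs.freeEvol_eq t _

lemma lat_mul_freqProj_le (hp : IsIdealNorm p) (A : Op d)
    (hS : MeasurableSet S) : lat p (A * freqProj S) ≤ lat p A := by
  rw [lat_apply, lat_apply]
  refine tsum_le_tsum fun q => ?_
  rw [block_mul_of_comm (cubeProj_freqProj_comm _ hS)]
  exact hp.mul_contr_le (enorm_freqProj_le S) _

/-- The cubes meeting the set `S`. -/
def cubesOf (S : Set (Space d)) : Set (Fin d → ℤ) := {k | (cube k ∩ S).Nonempty}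

lemma cubeProj_mul_freqProj_of_notMem (hS : MeasurableSet S)
    (hk : k ∉ cubesOf S) : cubeProj k * freqProj S = 0 := by
  rw [cubeProj, freqProj_mul (measurableSet_cube k) hS,
    Set.not_nonempty_iff_eq_empty.1 hk, freqProj_empty]

lemma finite_cubesOf (hS : Bornology.IsBounded S) : (cubesOf S).Finite := by
  obtain ⟨R, hR⟩ := hS.subset_closedBall 0
  refine (Set.finite_Icc (fun _ => ⌊-R⌋) (fun _ => ⌊R⌋) : (Icc (fun _ : Fin d => ⌊-R⌋) fun _ => ⌊R⌋).Finite).subset ?_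
  rintro k ⟨ξ, hξ, hS⟩
  have h1 : ∀ i, |ξ i| ≤ R := fun i => by
    have h2 := hR hS
    rw [mem_closedBall_zero_iff] at h2
    have := PiLp.norm_apply_le ξ i
    rw [Real.norm_eq_abs] at this
    exact this.trans h2
  refine ⟨fun i => ?_, fun i => ?_⟩
  · change ⌊-R⌋ ≤ k i
    rw [← hξ i]; exact Int.floor_mono (abs_le.1 (h1 i)).1
  · change k i ≤ ⌊R⌋
    rw [← hξ i]; exact Int.floor_mono (abs_le.1 (h1 i)).2

def cubeCount (S : Set (Space d)) : ℝ≥0∞ := ∑' k : Fin d → ℤ, (cubesOf S).indicator (fun _ => 1) k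

lemma tsum_indicator_lt_top {ι : Type*} {s : Set ι} (hs : s.Finite) :
    ∑' k, s.indicator (fun _ => (1 : ℝ≥0∞)) k < ∞ := by
  rw [tsum_eq_sum (s := hs.toFinset) (fun k hk => by rw [indicator_of_notMem]; simpa using hk)]
  refine ENNReal.sum_lt_top.2 fun k _ => ?_
  refine lt_of_le_of_lt ?_ one_lt_top
  by_cases h : k ∈ s <;> simp [h]

lemma cubeCount_lt_top (hS : Bornology.IsBounded S) : cubeCount S < ∞ :=
  tsum_indicator_lt_top (finite_cubesOf hS)

lemma colSum_mul_freqProj_le (hS : MeasurableSet S) (A : Op d) :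
    colSum d (A * freqProj S) ≤ cubeCount S * hsNorm A := by
  rw [colSum_apply, cubeCount, ← ENNReal.tsum_mul_right]
  refine tsum_le_tsum fun k => ?_
  rw [mul_assoc, ← cubeProj_freqProj_comm k hS]
  by_cases hk : k ∈ cubesOf S
  · rw [indicator_of_mem hk, one_mul]
    refine isIdealNorm_hs.mul_contr_le ?_ A
    refine (enorm_mul_op_le _ _).trans (mul_le_one' (enorm_cubeProj_le k) (enorm_freqProj_le S))
  · rw [cubeProj_mul_freqProj_of_notMem hS hk, mul_zero, hsNorm_zero]
    exact zero_le

lemma lat_compress_le (hp : IsIdealNorm p) (hS : MeasurableSet S) (A : Op d) :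
    lat p (freqProj S * A * freqProj S) ≤ cubeCount S * cubeCount S * p A := by
  have hR : cubeCount S * cubeCount S * p A = ∑' j : Fin d → ℤ, ∑' k : Fin d → ℤ,
      (cubesOf S).indicator (fun _ => 1) j * ((cubesOf S).indicator (fun _ => 1) k * p A) := by
    simp only [ENNReal.tsum_mul_left, ENNReal.tsum_mul_right, cubeCount]
    ring
  rw [lat_apply', hR]
  refine tsum_le_tsum fun j => tsum_le_tsum fun k => ?_
  have e : block j k (freqProj S * A * freqProj S) =
      (cubeProj j * freqProj S) * A * (cubeProj k * freqProj S) := by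
    rw [cubeProj_freqProj_comm k hS]; simp only [block, mul_assoc]
  rw [e]
  by_cases hj : j ∈ cubesOf S
  · by_cases hk : k ∈ cubesOf S
    · rw [indicator_of_mem hk, indicator_of_mem hj, one_mul, one_mul]
      refine (hp.mul_contr_le ?_ _).trans (hp.contr_mul_le ?_ A) <;>
        exact (enorm_mul_op_le _ _).trans (mul_le_one' (enorm_cubeProj_le _) (enorm_freqProj_le S))
    · rw [cubeProj_mul_freqProj_of_notMem hS hk, mul_zero, p.map_zero]; exact zero_le
  · rw [cubeProj_mul_freqProj_of_notMem hS hj, zero_mul, zero_mul, p.map_zero]; exact zero_le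

lemma isBounded_lowSet (m : ℝ) : Bornology.IsBounded (lowSet d m) := by
  refine (Metric.isBounded_closedBall (x := (0 : Space d)) (r := 1 + |m|)).subset fun ξ hξ => ?_
  rw [mem_closedBall_zero_iff]
  have h : (2 * Real.pi * ‖ξ‖) ^ 2 ≤ m := hξ
  by_contra hc
  rw [not_le] at hc
  have h0 := abs_nonneg m
  have h1 : ‖ξ‖ ≤ 2 * Real.pi * ‖ξ‖ := by nlinarith [Real.pi_gt_three, norm_nonneg ξ]
  have h2 : ‖ξ‖ ^ 2 ≤ (2 * Real.pi * ‖ξ‖) ^ 2 := by gcongr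
  nlinarith [le_abs_self m]

/-! ### The mean-field potential as an operator -/

/-- Multiplication by the mean-field potential `w * ρ_A`. -/
def pot (w : Space d → ℝ) (A : Op d) : Op d := mulOp fun x => (meanField w A x : ℂ)

section Pot

variable {A A' : Op d}

lemma pot_eq (h : HasDens A ρ) (hA : IsSelfAdjoint A) : pot w A = mulOp (conv w ρ) := by
  rw [pot]
  congr 1
  ext x
  exact h.meanField_eq hA w x

lemma isSelfAdjoint_pot (hW : IsPot w) (h : HasDens A ρ)
    (hA : IsSelfAdjoint A) : IsSelfAdjoint (pot w A) := by
  have he : (fun x => (meanField w A x : ℂ)) = conv w ρ := funext (h.meanField_eq hA w)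
  have hm : MemLp (fun x => (meanField w A x : ℂ)) ∞ volume := by
    rw [he]; exact h.convolvable.memLp_conv hW
  rw [IsSelfAdjoint, pot, star_mulOp hm]
  congr 1
  ext x
  exact Complex.conj_ofReal _

lemma pot_add (hW : IsPot w) (h : HasDens A ρ)
    (hA : IsSelfAdjoint A) (h' : HasDens A' ρ') (hA' : IsSelfAdjoint A') :
    pot w (A + A') = pot w A + pot w A' := by
  rw [pot_eq (h.add h') (hA.add hA'), pot_eq h hA, pot_eq h' hA',
    ← mulOp_add (h.convolvable.memLp_conv hW) (h'.convolvable.memLp_conv hW)]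
  congr 1
  ext x
  exact h.convolvable.conv_add h'.convolvable hW x

lemma isSelfAdjoint_real_smul (c : ℝ) (hA : IsSelfAdjoint A) : IsSelfAdjoint (c • A) := by
  have e : c • A = (c : ℂ) • A := by
    ext1 u
    exact (Complex.coe_smul c (A u)).symm
  rw [IsSelfAdjoint, e, star_smul, hA.star_eq]
  congr 1
  exact Complex.conj_ofReal c

lemma pot_smul (hW : IsPot w) (h : HasDens A ρ)
    (hA : IsSelfAdjoint A) (c : ℝ) : pot w (c • A) = c • pot w A := by
  rw [pot_eq (h.smul c) (isSelfAdjoint_real_smul c hA), pot_eq h hA]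
  have e : c • mulOp (conv w ρ) = (c : ℂ) • mulOp (conv w ρ) := by
    ext1 u
    exact (Complex.coe_smul c (mulOp (conv w ρ) u)).symm
  rw [e, ← mulOp_smul (h.convolvable.memLp_conv hW)]
  congr 1
  ext x
  exact IsConvolvable.conv_smul c x

lemma pot_sub (hW : IsPot w) (h : HasDens A ρ)
    (hA : IsSelfAdjoint A) (h' : HasDens A' ρ') (hA' : IsSelfAdjoint A') :
    pot w (A - A') = pot w A - pot w A' := by
  have := pot_add hW (h.sub h') (hA.sub hA') h' hA'
  rw [sub_add_cancel] at this
  rw [this, add_sub_cancel_right]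

lemma pot_sub_left (hW : IsPot w) (hW' : IsPot w') (h : HasDens A ρ) (hA : IsSelfAdjoint A) :
    pot (w - w') A = pot w A - pot w' A := by
  rw [eq_sub_iff_add_eq, pot_eq h hA, pot_eq h hA, pot_eq h hA, ← mulOp_add
    (h.convolvable.memLp_conv (hW.sub hW')) (h.convolvable.memLp_conv hW')]
  congr 1
  ext x
  rw [h.convolvable.conv_sub_left hW hW' x, sub_add_cancel]

lemma enorm_mulOp_le_of_forall {c : ℝ≥0∞} (h : ∀ x, ‖V x‖ₑ ≤ c) : ‖mulOp V‖ₑ ≤ c := by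
  rcases eq_or_ne c ∞ with rfl | hc
  · exact le_top
  rw [← ofReal_norm]
  refine ENNReal.ofReal_le_of_le_toReal (norm_mulOp_le toReal_nonneg (.of_forall fun x => ?_))
  have := h x
  rw [← ofReal_norm] at this
  exact (ENNReal.ofReal_le_iff_le_toReal hc).1 this

lemma enorm_pot_le {c : ℝ≥0∞} (h : HasDens A ρ) (hA : IsSelfAdjoint A)
    (hc : ∀ x, lconv (fun y => ‖w y‖ₑ) (fun y => ‖ρ y‖ₑ) x ≤ c) : ‖pot w A‖ₑ ≤ c := by
  rw [pot_eq h hA]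
  exact enorm_mulOp_le_of_forall fun x => (enorm_conv_le w ρ x).trans (hc x)

lemma enorm_pot_le_two (hW : IsPot w) (h : HasDens A ρ) (hA : IsSelfAdjoint A) :
    ‖pot w A‖ₑ ≤ wNorm w * eLpNorm ρ 2 volume :=
  enorm_pot_le h hA (lconv_le_of_two hW.1.1 h.convolvable.meas)

lemma enorm_pot_le_one (h : HasDens A ρ) (hA : IsSelfAdjoint A) :
    ‖pot w A‖ₑ ≤ wNorm w * eLpNorm ρ 1 volume :=
  enorm_pot_le h hA (lconv_le_of_one h.convolvable.meas)

lemma colSup_pot_le (hW : IsPot w) (h : HasDens A ρ)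
    (hA : IsSelfAdjoint A) : colSup d (pot w A) ≤ eLpNorm (conv w ρ) 2 volume := by
  rw [pot_eq h hA, colSup_apply]
  exact iSup_le fun k => hsNorm_mulOp_cubeProj_le (h.convolvable.memLp_conv hW) k

lemma colSup_pot_le_two (hW : IsPot w) (h : HasDens A ρ)
    (hA : IsSelfAdjoint A) : colSup d (pot w A) ≤ wNorm w * eLpNorm ρ 2 volume :=
  (colSup_pot_le hW h hA).trans (eLpNorm_conv_le_two hW.1.1 h.convolvable.meas)

lemma colSup_pot_le_one (hW : IsPot w) (h : HasDens A ρ)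
    (hA : IsSelfAdjoint A) : colSup d (pot w A) ≤ wNorm w * eLpNorm ρ 1 volume :=
  (colSup_pot_le hW h hA).trans (eLpNorm_conv_le_one hW.1.1 h.convolvable.meas)

end Pot

/-! ### Densities of lattice-summable operators -/

lemma summable_norm_block (h : lat (opN d) A < ∞) :
    Summable fun q : (Fin d → ℤ) × (Fin d → ℤ) => ‖block q.1 q.2 A‖ := by
  have h1 : ∑' q : (Fin d → ℤ) × (Fin d → ℤ), ‖block q.1 q.2 A‖ₑ ≠ ∞ := h.ne
  exact (summable_toReal h1).congr fun q => toReal_enorm _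

lemma hasSum_block (h : lat (opN d) A < ∞) (u : L2 d) :
    HasSum (fun q : (Fin d → ℤ) × (Fin d → ℤ) => block q.1 q.2 A u) (A u) := by
  have hs : Summable fun q : (Fin d → ℤ) × (Fin d → ℤ) => block q.1 q.2 A u := by
    refine Summable.of_norm_bounded (g := fun q => ‖block q.1 q.2 A‖ * ‖u‖) ?_
      fun q => (block q.1 q.2 A).le_opNorm u
    exact (summable_norm_block h).mul_right _
  have h1 := hs.hasSum.prod_fiberwise fun j => hasSum_mul_cubeProj (cubeProj j * A) u
  have h2 := h1.unique (hasSum_cubeProj_mul A u)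
  rw [← h2]
  exact hs.hasSum

lemma isDensSeries_block (h : lat (opN d) A < ∞) :
    IsDensSeries (fun q : (Fin d → ℤ) × (Fin d → ℤ) => block q.1 q.2 A)
      (fun q => blockDens q.1 q.2 A) (fun q => ‖block q.1 q.2 A‖ₑ) where
  dens q := hasDens_block q.1 q.2 A
  sum_lt_top := h
  lconv_le w hW := ⟨wNorm w, wNorm_lt_top hW, fun q =>
    lconv_le_of_top hW.1.1 (enorm_blockDens_le q.1 q.2 A)⟩
  tr_le _ hB hb := ⟨_, pow_lt_top (eLpNorm_indicator_lt_top hb hB), fun q =>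
    trNorm_cutOff_block_le hB q.1 q.2 A⟩

def latDens (A : Op d) (x : Space d) : ℂ := ∑' q : (Fin d → ℤ) × (Fin d → ℤ), blockDens q.1 q.2 A x

lemma hasDens_lat (h : lat (opN d) A < ∞) : HasDens A (latDens A) :=
  (isDensSeries_block h).hasDens (hasSum_block h)

lemma enorm_latDens_le (A : Op d) : ∀ᵐ x, ‖latDens A x‖ₑ ≤ lat (opN d) A := by
  filter_upwards [ae_all_iff.2 fun q : (Fin d → ℤ) × (Fin d → ℤ) => enorm_blockDens_le q.1 q.2 A]
    with x hx
  exact enorm_tsum_le_tsum_enorm.trans (tsum_le_tsum hx)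

/-- The number of lattice points near a given one. -/
def nearCount (d : ℕ) : ℝ≥0∞ := ∑' m : Fin d → ℤ, {m | Near m 0}.indicator (fun _ => 1) m

lemma finite_near (n : Fin d → ℤ) : {m | Near m n}.Finite := by
  refine (Set.finite_Icc (fun i => n i - 1) (fun i => n i + 1) :
    (Icc (fun i : Fin d => n i - 1) fun i => n i + 1).Finite).subset fun m hm => ?_
  exact ⟨fun i => by have := abs_le.1 (hm i); change n i - 1 ≤ m i; linarith [this.1],
    fun i => by have := abs_le.1 (hm i); change m i ≤ n i + 1; linarith [this.2]⟩

lemma nearCount_lt_top : nearCount d < ∞ := tsum_indicator_lt_top (finite_near 0)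

lemma tsum_near (n : Fin d → ℤ) :
    ∑' m : Fin d → ℤ, {m | Near m n}.indicator (fun _ => (1 : ℝ≥0∞)) m = nearCount d := by
  rw [nearCount, ← (Equiv.addRight n).tsum_eq]
  refine tsum_congr fun m => ?_
  have : ((Equiv.addRight n) m ∈ {m | Near m n}) ↔ m ∈ {m : Fin d → ℤ | Near m 0} := by simp [Near]
  by_cases h : m ∈ {m : Fin d → ℤ | Near m 0}
  · rw [indicator_of_mem h, indicator_of_mem (this.2 h)]
  · rw [indicator_of_notMem h, indicator_of_notMem fun hc => h (this.1 hc)]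

section LatPot

lemma enorm_pot_le_lat (hW : IsPot w) (h : lat (opN d) A < ∞) (hA : IsSelfAdjoint A) :
    ‖pot w A‖ₑ ≤ wNorm w * lat (opN d) A :=
  enorm_pot_le (hasDens_lat h) hA (lconv_le_of_top hW.1.1 (enorm_latDens_le A))

lemma hasSum_pot (hW : IsPot w) (h : lat (opN d) A < ∞) (hA : IsSelfAdjoint A) :
    HasSum (fun q : (Fin d → ℤ) × (Fin d → ℤ) => mulOp (conv w (blockDens q.1 q.2 A)))
      (pot w A) := by
  set V : (Fin d → ℤ) × (Fin d → ℤ) → Space d → ℂ := fun q => conv w (blockDens q.1 q.2 A)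
  have hV : ∀ q, MemLp (V q) ∞ volume := fun q =>
    (hasDens_block q.1 q.2 A).convolvable.memLp_conv hW
  have hw := wNorm_lt_top hW
  have hb : ∀ q x, ‖V q x‖ ≤ (wNorm w).toReal * ‖block q.1 q.2 A‖ := fun q x => by
    have := (enorm_conv_le w _ x).trans (lconv_le_of_top hW.1.1 (enorm_blockDens_le q.1 q.2 A) x)
    rw [← ofReal_norm, ENNReal.ofReal_le_iff_le_toReal (mul_lt_top hw enorm_lt_top).ne] at this
    simpa using this
  have hsum : Summable fun q : (Fin d → ℤ) × (Fin d → ℤ) => (wNorm w).toReal * ‖block q.1 q.2 A‖ :=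
    (summable_norm_block h).mul_left _
  have hu := tendstoUniformly_tsum hsum hb
  have hpot : pot w A = mulOp fun x => ∑' q, V q x := by
    rw [pot_eq (hasDens_lat h) hA]
    congr 1
    ext x
    exact ((isDensSeries_block h).hasSum_conv hW x).tsum_eq.symm
  have hVs : MemLp (fun x => ∑' q, V q x) ∞ volume := by
    have : (fun x => ∑' q, V q x) = conv w (latDens A) := by
      ext x
      exact ((isDensSeries_block h).hasSum_conv hW x).tsum_eq
    rw [this]
    exact (hasDens_lat h).convolvable.memLp_conv hW
  rw [HasSum, SummationFilter.unconditional_filter, Metric.tendsto_nhds]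
  intro ε hε
  filter_upwards [Metric.tendstoUniformly_iff.1 hu (ε / 2) (half_pos hε)] with s hs
  have hfin : ∀ s : Finset ((Fin d → ℤ) × (Fin d → ℤ)), MemLp (fun x => ∑ q ∈ s, V q x) ∞ volume ∧
      ∑ q ∈ s, mulOp (V q) = mulOp fun x => ∑ q ∈ s, V q x := fun s => by
    classical
    induction s using Finset.induction_on with
    | empty =>
      simp only [Finset.sum_empty, mulOp_zero]
      exact ⟨MemLp.zero, trivial⟩
    | insert q s hq ih =>
      simp only [Finset.sum_insert hq]
      exact ⟨(hV q).add ih.1, by rw [ih.2, mulOp_add (hV q) ih.1]⟩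
  rw [hpot, (hfin s).2, dist_comm, dist_eq_norm]
  have hd : mulOp (fun x => ∑' q, V q x) - mulOp (fun x => ∑ q ∈ s, V q x) =
      mulOp (fun x => ∑' q, V q x - ∑ q ∈ s, V q x) := by
    have := mulOp_add (m := fun x => ∑' q, V q x - ∑ q ∈ s, V q x) (hVs.sub (hfin s).1) (hfin s).1
    rw [sub_eq_iff_eq_add, ← this]
    simp only [sub_add_cancel]
  rw [hd]
  refine lt_of_le_of_lt (norm_mulOp_le (half_pos hε).le (.of_forall fun x => ?_))
    (half_lt_self hε)
  have := (hs x).le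
  rwa [dist_eq_norm] at this

lemma block_pot_le (hW : IsPot w) (h : lat (opN d) A < ∞)
    (hA : IsSelfAdjoint A) (p : ExtNorm (L2 d)) (m l : Fin d → ℤ) :
    p (block m l (pot w A)) ≤
      ∑' q : (Fin d → ℤ) × (Fin d → ℤ), p (block m l (mulOp (conv w (blockDens q.1 q.2 A)))) := by
  refine p.le_tsum fun u => ?_
  have h3 := (hasSum_pot hW h hA).mapL (ContinuousLinearMap.apply ℂ (L2 d) (cubeProj l u))
  exact h3.mapL (cubeProj m)

lemma band_pot_le (hW : IsPot w) (h : lat (opN d) A < ∞)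
    (hA : IsSelfAdjoint A) (p : ExtNorm (L2 d)) {c : (Fin d → ℤ) × (Fin d → ℤ) → ℝ≥0∞}
    (hc : ∀ q m l, p (block m l (mulOp (conv w (blockDens q.1 q.2 A)))) ≤ c q) :
    band p (pot w A) ≤ nearCount d * ∑' q, c q := by
  have h3 : ∀ m l, p (block (l + m) l (pot w A)) ≤
      ∑' q : (Fin d → ℤ) × (Fin d → ℤ), {m | Near m (q.1 - q.2)}.indicator (fun _ => 1) m * c q :=
    fun m l => by
      refine (block_pot_le hW h hA p _ _).trans (tsum_le_tsum fun q => ?_)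
      by_cases hn : Near m (q.1 - q.2)
      · rw [indicator_of_mem (s := {m | Near m (q.1 - q.2)}) hn, one_mul]
        exact hc _ _ _
      · rw [block_conv_blockDens_eq_zero _ hW, p.map_zero]
        · exact zero_le
        · refine fun hc => hn fun i => ?_
          have := hc i
          simp only [Pi.add_apply, Pi.sub_apply] at this ⊢
          rw [abs_le] at this ⊢
          constructor <;> linarith [this.1, this.2]
  calc band p (pot w A) ≤ ∑' m, ∑' q : (Fin d → ℤ) × (Fin d → ℤ),
        {m | Near m (q.1 - q.2)}.indicator (fun _ => 1) m * c q := by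
        rw [band_apply]
        exact tsum_le_tsum fun m => iSup_le fun l => h3 m l
    _ = ∑' q, nearCount d * c q := by
        rw [tsum_comm]
        refine tsum_congr fun q => ?_
        rw [ENNReal.tsum_mul_right, tsum_near]
    _ = _ := ENNReal.tsum_mul_left

lemma band_op_pot_le (hW : IsPot w) (h : lat (opN d) A < ∞) (hA : IsSelfAdjoint A) :
    band (opN d) (pot w A) ≤ nearCount d * (wNorm w * lat (opN d) A) := by
  rw [lat_apply, ← ENNReal.tsum_mul_left]
  refine band_pot_le hW h hA _ fun q m l => ?_
  refine (isIdealNorm_op.block_le m l _).trans ?_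
  exact enorm_mulOp_le_of_forall fun x => (enorm_conv_le w _ x).trans
    (lconv_le_of_top hW.1.1 (enorm_blockDens_le q.1 q.2 A) x)

lemma hsNorm_block_mulOp_le (hV : MemLp V ∞ volume) (m l : Fin d → ℤ) :
    hsNorm (block m l (mulOp V)) ≤ eLpNorm V 2 volume := by
  refine le_trans ?_ (hsNorm_mulOp_cubeProj_le hV l)
  rw [block, mul_assoc]
  exact isIdealNorm_hs.contr_mul_le (enorm_cubeProj_le m) _

lemma band_hs_pot_le (hW : IsPot w) (h : lat (opN d) A < ∞) (hA : IsSelfAdjoint A) :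
    band (hsN d) (pot w A) ≤ nearCount d * (wNorm w * lat (hsN d) A) := by
  rw [lat_apply, ← ENNReal.tsum_mul_left]
  refine band_pot_le hW h hA _ fun q m l => ?_
  have hc := (hasDens_block q.1 q.2 A).convolvable
  refine (hsNorm_block_mulOp_le (hc.memLp_conv hW) m l).trans ?_
  refine (eLpNorm_conv_le_two hW.1.1 hc.meas).trans ?_
  gcongr
  exact eLpNorm_blockDens_le q.1 q.2 A

/-- The diagonals which carry the potentials generated by operators with frequencies in `S`. -/
def bandsOf (S : Set (Space d)) : Set (Fin d → ℤ) :=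
  ⋃ j ∈ cubesOf S, ⋃ k ∈ cubesOf S, {m | Near m (j - k)}

def bandCount (S : Set (Space d)) : ℝ≥0∞ := ∑' m : Fin d → ℤ, (bandsOf S).indicator (fun _ => 1) m

lemma bandCount_lt_top (hS : Bornology.IsBounded S) : bandCount S < ∞ :=
  tsum_indicator_lt_top ((finite_cubesOf hS).biUnion fun j _ =>
    (finite_cubesOf hS).biUnion fun k _ => finite_near (j - k))

lemma lat_lt_top_of_compress (hS : MeasurableSet S) (hb : Bornology.IsBounded S)
    (hc : freqProj S * A * freqProj S = A) : lat (opN d) A < ∞ := by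
  rw [← hc]
  exact (lat_compress_le isIdealNorm_op hS A).trans_lt (mul_lt_top
    (mul_lt_top (cubeCount_lt_top hb) (cubeCount_lt_top hb)) enorm_lt_top)

lemma block_eq_zero_of_compress (hS : MeasurableSet S) (hc : freqProj S * A * freqProj S = A)
    (hjk : ¬ (j ∈ cubesOf S ∧ k ∈ cubesOf S)) : block j k A = 0 := by
  have e : block j k A = (cubeProj j * freqProj S) * A * (cubeProj k * freqProj S) := by
    rw [cubeProj_freqProj_comm k hS]
    conv_lhs => rw [← hc]
    simp only [block, mul_assoc]
  rw [e]
  by_cases hj : j ∈ cubesOf S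
  · have hk : k ∉ cubesOf S := fun hk => hjk ⟨hj, hk⟩
    rw [cubeProj_mul_freqProj_of_notMem hS hk, mul_zero]
  · rw [cubeProj_mul_freqProj_of_notMem hS hj, zero_mul, zero_mul]

lemma band_hs_pot_le_of_compress (hW : IsPot w) (hS : MeasurableSet S) (hb : Bornology.IsBounded S)
    (hc : freqProj S * A * freqProj S = A) (hA : IsSelfAdjoint A) :
    band (hsN d) (pot w A) ≤ bandCount S * (wNorm w * eLpNorm (density A) 2 volume) := by
  have h := lat_lt_top_of_compress hS hb hc
  have hd := hasDens_lat h
  have h3 : ∀ m l, hsN d (block (l + m) l (pot w A)) ≤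
      (bandsOf S).indicator (fun _ => 1) m * (wNorm w * eLpNorm (density A) 2 volume) :=
    fun m l => by
      by_cases hm : m ∈ bandsOf S
      · rw [indicator_of_mem hm, one_mul, hd.eLpNorm_density hA, pot_eq hd hA]
        exact (hsNorm_block_mulOp_le (hd.convolvable.memLp_conv hW) _ _).trans
          (eLpNorm_conv_le_two hW.1.1 hd.convolvable.meas)
      · refine (block_pot_le hW h hA _ _ _).trans (le_trans (le_of_eq ?_) zero_le)
        refine ENNReal.tsum_eq_zero.2 fun q => ?_
        by_cases hq : q.1 ∈ cubesOf S ∧ q.2 ∈ cubesOf S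
        · rw [block_conv_blockDens_eq_zero _ hW, ExtNorm.map_zero]
          refine fun hn => hm (mem_biUnion hq.1 (mem_biUnion hq.2 fun i => ?_))
          have := hn i
          simp only [Pi.add_apply, Pi.sub_apply] at this ⊢
          rw [abs_le] at this ⊢
          constructor <;> linarith [this.1, this.2]
        · have hz : blockDens q.1 q.2 A =ᵐ[volume] fun _ => 0 := by
            filter_upwards [enorm_blockDens_le q.1 q.2 A] with x hx
            rw [block_eq_zero_of_compress hS hc hq, ← opN_apply, ExtNorm.map_zero,
              nonpos_iff_eq_zero, enorm_eq_zero] at hx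
            exact hx
          have hz2 : conv w (blockDens q.1 q.2 A) = fun _ => 0 := by
            rw [conv_congr hz]; ext x; simp [conv]
          rw [hz2, mulOp_zero, block, mul_zero, zero_mul, ExtNorm.map_zero]
  rw [band_apply, bandCount, ← ENNReal.tsum_mul_right]
  exact tsum_le_tsum fun m => iSup_le fun l => h3 m l

end LatPot

/-! ### Densities of column-summable operators -/

lemma eLpNorm_tsum_le {ι : Type*} [Countable ι] {f : ι → Space d → ℂ}
    (hf : ∀ i, AEStronglyMeasurable (f i) volume) :
    eLpNorm (fun x => ∑' i, f i x) 2 volume ≤ ∑' i, eLpNorm (f i) 2 volume := by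
  have h1 : ∀ s : Finset ι, ∫⁻ x, (∑ i ∈ s, ‖f i x‖ₑ) ^ 2 ≤ (∑' i, eLpNorm (f i) 2 volume) ^ 2 :=
    fun s => by
      have h2 := eLpNorm_sum_le (μ := volume) (p := 2) (s := s)
        (f := fun i x => (‖f i x‖ : ℂ)) (fun i _ =>
          Complex.continuous_ofReal.comp_aestronglyMeasurable (hf i).norm) (by norm_num)
      have h3 : ∀ i, eLpNorm (fun x => (‖f i x‖ : ℂ)) 2 volume = eLpNorm (f i) 2 volume := fun i =>
        eLpNorm_congr_norm_ae (.of_forall fun x => by simp)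
      simp only [h3] at h2
      have h4 : eLpNorm (∑ i ∈ s, fun x => (‖f i x‖ : ℂ)) 2 volume ^ 2 =
          ∫⁻ x, (∑ i ∈ s, ‖f i x‖ₑ) ^ 2 := by
        rw [eLpNorm_two_sq]
        refine lintegral_congr fun x => ?_
        rw [Finset.sum_apply, ← Complex.ofReal_sum, enorm_ofReal_complex,
          Real.enorm_of_nonneg (Finset.sum_nonneg fun i _ => norm_nonneg _),
          ofReal_sum_of_nonneg fun i _ => norm_nonneg _]
        simp only [ofReal_norm]
      rw [← h4]
      gcongr
      exact h2.trans (ENNReal.sum_le_tsum s)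
  refine (pow_le_pow_left_iff two_ne_zero).1 ?_
  rw [eLpNorm_two_sq]
  have h5 : ∀ x, ‖∑' i, f i x‖ₑ ^ 2 ≤ ⨆ s : Finset ι, (∑ i ∈ s, ‖f i x‖ₑ) ^ 2 := fun x => by
    calc ‖∑' i, f i x‖ₑ ^ 2 ≤ (∑' i, ‖f i x‖ₑ) ^ 2 := by gcongr; exact enorm_tsum_le_tsum_enorm
      _ = (⨆ s : Finset ι, ∑ i ∈ s, ‖f i x‖ₑ) ^ 2 := by rw [ENNReal.tsum_eq_iSup_sum]
      _ = _ := Monotone.map_iSup_of_continuousAt (f := fun a : ℝ≥0∞ => a ^ 2)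
        (ENNReal.continuous_pow 2).continuousAt (fun a b hab => by dsimp only; gcongr) (by simp)
  calc _ ≤ ∫⁻ x, ⨆ s : Finset ι, (∑ i ∈ s, ‖f i x‖ₑ) ^ 2 := lintegral_mono h5
    _ = ⨆ s : Finset ι, ∫⁻ x, (∑ i ∈ s, ‖f i x‖ₑ) ^ 2 := by
        refine lintegral_iSup_directed (fun s => ?_) ?_
        · exact (Finset.aemeasurable_fun_sum s fun i _ => (hf i).enorm).pow_const 2
        · refine Monotone.directed_le fun s t hst x => ?_
          change (∑ i ∈ s, ‖f i x‖ₑ) ^ 2 ≤ (∑ i ∈ t, ‖f i x‖ₑ) ^ 2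
          gcongr
    _ ≤ _ := iSup_le h1

lemma isDensSeries_col (h : colSum d A < ∞) : IsDensSeries (fun k : Fin d → ℤ => A * cubeProj k)
      (fun k => dens2 (A * cubeProj k) (cubeProj k)) (fun k => hsNorm (A * cubeProj k)) := by
  have hk : ∀ k, hsNorm (A * cubeProj k) < ∞ := fun k => by
    refine lt_of_le_of_lt ?_ h
    rw [colSum_apply]
    exact ENNReal.le_tsum k
  refine ⟨fun k => (hasDens_mul_cubeProj k (hk k)).1, by rwa [← colSum_apply], fun w hW =>
    ⟨wNorm w, wNorm_lt_top hW, fun k x => ?_⟩, fun B hB hb =>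
    ⟨_, eLpNorm_indicator_lt_top hb hB, fun k => trNorm_cutOff_mul_cubeProj_le hB k A⟩⟩
  have := hasDens_mul_cubeProj k (hk k)
  refine (lconv_le_of_two hW.1.1 this.1.convolvable.meas x).trans ?_
  gcongr
  exact this.2

lemma exists_hasDens_of_colSum (h : colSum d A < ∞) :
    ∃ ρ, HasDens A ρ ∧ eLpNorm ρ 2 volume ≤ colSum d A := by
  have hs := isDensSeries_col h
  refine ⟨_, hs.hasDens (hasSum_mul_cubeProj A), ?_⟩
  rw [colSum_apply]
  refine (eLpNorm_tsum_le fun k => (hs.dens k).convolvable.meas).trans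
    (tsum_le_tsum fun k => ?_)
  refine (hasDens_mul_cubeProj k ?_).2
  refine lt_of_le_of_lt ?_ h
  rw [colSum_apply]
  exact ENNReal.le_tsum k

lemma eLpNorm_star : eLpNorm (fun x => star (ρ x)) 2 volume = eLpNorm ρ 2 volume :=
  eLpNorm_congr_norm_ae (.of_forall fun x => norm_star (ρ x))

lemma exists_hasDens_add_star (h : colSum d A < ∞) :
    ∃ ρ, HasDens (A + star A) ρ ∧ eLpNorm ρ 2 volume ≤ 2 * colSum d A := by
  obtain ⟨ρ, h1, h2⟩ := exists_hasDens_of_colSum h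
  refine ⟨_, h1.add h1.star, ?_⟩
  refine (eLpNorm_add_le h1.convolvable.meas h1.star.convolvable.meas (by norm_num)).trans ?_
  rw [eLpNorm_star, two_mul]
  gcongr

section

/-! ### The low and high frequency projections -/

/-- The projection on the frequencies `-Δ ≤ 2μ`. -/
def loProj (μ : ℝ) : Op d := freqProj (lowSet d (2 * μ))

def hiProj (μ : ℝ) : Op d := 1 - loProj μ

lemma lowProj_two_mul (μ : ℝ) : lowProj (2 * μ) = (loProj μ : Op d) := lowProj_eq _

lemma volume_lapSymbol_eq {m : ℝ} (hm : 0 < m) : volume {ξ : Space d | lapSymbol ξ = m} = 0 := by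
  have h : {ξ : Space d | lapSymbol ξ = m} ⊆ Metric.sphere 0 (√m / (2 * Real.pi)) := by
    intro ξ hξ
    have h1 : (2 * Real.pi * ‖ξ‖) ^ 2 = m := hξ
    rw [mem_sphere_zero_iff_norm, ← h1, Real.sqrt_sq (by positivity)]
    field_simp
  exact measure_mono_null h (Measure.addHaar_sphere_of_ne_zero _ _ (by positivity))

lemma highProj_two_mul (hμ : 0 < μ) : highProj (2 * μ) = (hiProj μ : Op d) := by
  rw [hiProj, eq_sub_iff_add_eq, highProj_eq, loProj]
  unfold freqProj
  rw [← fourierMul_add (memLp_top_indicator (measurableSet_highSet _))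
    (memLp_top_indicator (measurableSet_lowSet _)), ← fourierMul_one]
  refine (fourierMul_congr (memLp_top_const 1) ?_).symm
  have h0 : ∀ᵐ ξ : Space d, lapSymbol ξ ≠ 2 * μ := by
    rw [ae_iff]
    simpa using volume_lapSymbol_eq (d := d) (m := 2 * μ) (by positivity)
  filter_upwards [h0] with ξ hξ
  rcases lt_or_gt_of_ne hξ with h | h
  · rw [indicator_of_notMem (show ξ ∉ highSet d (2 * μ) from not_le.2 h),
      indicator_of_mem (show ξ ∈ lowSet d (2 * μ) from h.le), zero_add]
  · rw [indicator_of_mem (show ξ ∈ highSet d (2 * μ) from h.le),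
      indicator_of_notMem (show ξ ∉ lowSet d (2 * μ) from not_le.2 h), add_zero]

lemma lo_add_hi : (loProj μ : Op d) + hiProj μ = 1 := by rw [hiProj]; abel

lemma lo_mul_lo : (loProj μ : Op d) * loProj μ = loProj μ := by
  rw [loProj, freqProj_mul (measurableSet_lowSet _) (measurableSet_lowSet _), inter_self]

lemma lo_mul_hi : (loProj μ : Op d) * hiProj μ = 0 := by
  rw [hiProj, mul_sub, mul_one, lo_mul_lo, sub_self]

lemma hi_mul_lo : (hiProj μ : Op d) * loProj μ = 0 := by
  rw [hiProj, sub_mul, one_mul, lo_mul_lo, sub_self]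

lemma star_lo : star (loProj μ : Op d) = loProj μ := star_freqProj (measurableSet_lowSet _)

lemma star_hi : star (hiProj μ : Op d) = hiProj μ := by rw [hiProj, star_sub, star_one, star_lo]

lemma enorm_lo_le : ‖(loProj μ : Op d)‖ₑ ≤ 1 := enorm_freqProj_le _

lemma enorm_hi_le : ‖(hiProj μ : Op d)‖ₑ ≤ 1 := by
  have h : (hiProj μ : Op d) = freqProj (lowSet d (2 * μ))ᶜ := by
    rw [hiProj, sub_eq_iff_eq_add, loProj]
    unfold freqProj
    rw [← fourierMul_add (memLp_top_indicator (measurableSet_lowSet _).compl)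
      (memLp_top_indicator (measurableSet_lowSet _)), ← fourierMul_one]
    congr 1
    ext ξ
    by_cases hξ : ξ ∈ lowSet d (2 * μ) <;> simp [hξ]
  rw [h]
  exact enorm_freqProj_le _

lemma lo_freeProp_comm (t : ℝ) : (loProj μ : Op d) * freeProp t = freeProp t * loProj μ :=
  freqProj_freeProp_comm (measurableSet_lowSet _) t

lemma hi_freeProp_comm (t : ℝ) : (hiProj μ : Op d) * freeProp t = freeProp t * hiProj μ := by
  rw [hiProj, sub_mul, mul_sub, lo_freeProp_comm, one_mul, mul_one]

lemma freeEvol_lo (t : ℝ) : freeEvol t (loProj μ : Op d) = loProj μ :=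
  freeEvol_of_comm t (lo_freeProp_comm t)

lemma freeEvol_hi (t : ℝ) : freeEvol t (hiProj μ : Op d) = hiProj μ :=
  freeEvol_of_comm t (hi_freeProp_comm t)

lemma hi_mul_of_lo_mul (h : loProj μ * A = A) : hiProj μ * A = 0 := by
  rw [← h, ← mul_assoc, hi_mul_lo, zero_mul]

lemma mul_hi_of_mul_lo (h : A * loProj μ = A) : A * hiProj μ = 0 := by
  rw [← h, mul_assoc, lo_mul_hi, mul_zero]

/-- A constant that bounds the square root of the volume of the low frequencies. -/
def lowVol (d : ℕ) (μ : ℝ) : ℝ≥0∞ := 1 + volume (lowSet d (2 * μ))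

lemma volume_lowSet_lt_top : volume (lowSet d (2 * μ)) < ∞ := (isBounded_lowSet _).measure_lt_top

lemma lowVol_lt_top : lowVol d μ < ∞ := add_lt_top.2 ⟨one_lt_top, volume_lowSet_lt_top⟩

lemma one_le_lowVol : 1 ≤ lowVol d μ := le_self_add

lemma volume_le_lowVol_sq : volume (lowSet d (2 * μ)) ≤ lowVol d μ ^ 2 := by
  rw [pow_two]
  exact (le_add_self : _ ≤ lowVol d μ).trans (le_mul_of_one_le_left' one_le_lowVol)

/-- The density of a Hilbert–Schmidt operator restricted to low frequencies. -/
lemma exists_hasDens_mul_lo (hX : hsNorm (X * loProj μ) < ∞) :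
    ∃ ρ, HasDens (X * loProj μ) ρ ∧ eLpNorm ρ 2 volume ≤ lowVol d μ * hsNorm (X * loProj μ) := by
  obtain ⟨h1, h2⟩ := hasDens_mul_freqProj (measurableSet_lowSet (2 * μ)) volume_lowSet_lt_top hX
  refine ⟨_, h1, (pow_le_pow_left_iff two_ne_zero).1 (h2.trans ?_)⟩
  rw [mul_pow, mul_comm]
  gcongr
  · exact volume_le_lowVol_sq
  · rfl

def lowCut (μ : ℝ) (A : Op d) : Op d := loProj μ * A * loProj μ

lemma lowBlock_eq (A : Op d) : lowBlock μ A = lowCut μ A := by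
  rw [lowBlock, lowProj_two_mul, lowCut]

lemma lo_mul_lowCut (A : Op d) : loProj μ * lowCut μ A = lowCut μ A := by
  simp only [lowCut, ← mul_assoc, lo_mul_lo]

lemma lowCut_mul_lo (A : Op d) : lowCut μ A * loProj μ = lowCut μ A := by
  simp only [lowCut, mul_assoc, lo_mul_lo]

lemma lowCut_lowCut (A : Op d) : lowCut μ (lowCut μ A) = lowCut μ A := by
  rw [lowCut, lo_mul_lowCut, lowCut_mul_lo]

lemma lowCut_add (A B : Op d) : lowCut μ (A + B) = lowCut μ A + lowCut μ B := by
  simp only [lowCut, mul_add, add_mul]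

lemma lowCut_sub (A B : Op d) : lowCut μ (A - B) = lowCut μ A - lowCut μ B := by
  simp only [lowCut, mul_sub, sub_mul]

lemma isSelfAdjoint_conj {A K : Op d} (hA : IsSelfAdjoint A) (hK : star K = K) :
    IsSelfAdjoint (K * A * K) := by
  have := hA.star_eq
  rw [IsSelfAdjoint, star_mul, star_mul, hK, this, mul_assoc]

lemma isSelfAdjoint_lowCut (hA : IsSelfAdjoint A) : IsSelfAdjoint (lowCut μ A) :=
  isSelfAdjoint_conj hA star_lo

lemma isSelfAdjoint_freeEvol (hA : IsSelfAdjoint A) (t : ℝ) : IsSelfAdjoint (freeEvol t A) := by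
  have h : star A = A := hA
  rw [IsSelfAdjoint, star_freeEvol, h]

lemma freeEvol_lowCut (t : ℝ) (A : Op d) : freeEvol t (lowCut μ A) = lowCut μ (freeEvol t A) := by
  rw [lowCut, freeEvol_mul, freeEvol_mul, freeEvol_lo, lowCut]

lemma lat_lowCut_lt_top (A : Op d) : lat (opN d) (lowCut μ A) < ∞ :=
  lat_lt_top_of_compress (measurableSet_lowSet (2 * μ)) (isBounded_lowSet _) (lowCut_lowCut A)

lemma hasDens_lowCut (A : Op d) : HasDens (lowCut μ A) (latDens (lowCut μ A)) :=
  hasDens_lat (lat_lowCut_lt_top A)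

lemma HasDens.eLpNorm_density_add {A B : Op d} (h : HasDens A ρ)
    (hA : IsSelfAdjoint A) (h' : HasDens B ρ') (hB : IsSelfAdjoint B) :
    eLpNorm (density (A + B)) 2 volume ≤ eLpNorm (density A) 2 volume +
      eLpNorm (density B) 2 volume := by
  rw [(h.add h').eLpNorm_density (hA.add hB), h.eLpNorm_density hA, h'.eLpNorm_density hB]
  exact eLpNorm_add_le h.convolvable.meas h'.convolvable.meas (by norm_num)

lemma HasDens.eLpNorm_density_sub {A B : Op d} (h : HasDens A ρ)
    (hA : IsSelfAdjoint A) (h' : HasDens B ρ') (hB : IsSelfAdjoint B) :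
    eLpNorm (density (A - B)) 2 volume = eLpNorm (density A - density B) 2 volume := by
  rw [(h.sub h').eLpNorm_density (hA.sub hB)]
  refine eLpNorm_congr_norm_ae ?_
  filter_upwards [h.coe_density hA, h'.coe_density hB] with x hx hx'
  rw [← hx, ← hx', ← Complex.ofReal_sub, Complex.norm_real, Pi.sub_apply]

lemma density_aestronglyMeasurable (h : HasDens A ρ)
    (hA : IsSelfAdjoint A) : AEStronglyMeasurable (density A) volume := by
  refine (Complex.continuous_re.comp_aestronglyMeasurable h.convolvable.meas).congr ?_
  filter_upwards [h.coe_density hA] with x hx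
  rw [← hx, Complex.ofReal_re]

/-- The free low-momentum density vanishes with the Hilbert–Schmidt norm. -/
lemma eLpNorm_density_lowCut_le (hX : IsSelfAdjoint X) :
    eLpNorm (density (lowCut μ X)) 2 volume ≤ lowVol d μ * hsNorm X := by
  have h0 : hsNorm (loProj μ * X * loProj μ) ≤ hsNorm X :=
    (isIdealNorm_hs.mul_contr_le enorm_lo_le _).trans (isIdealNorm_hs.contr_mul_le enorm_lo_le _)
  rcases eq_top_or_lt_top (hsNorm X) with h | h
  · rw [h, mul_top (one_le_lowVol.trans_lt' zero_lt_one).ne']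
    exact le_top
  obtain ⟨ρ, h1, h2⟩ := exists_hasDens_mul_lo (μ := μ) (h0.trans_lt h)
  have h3 : HasDens (lowCut μ X) ρ := h1
  rw [h3.eLpNorm_density (isSelfAdjoint_lowCut hX)]
  exact h2.trans (by gcongr)

/-! ### The norm of `𝒴_μ` -/

/-- The part of the norm of `𝒴_μ` that does not involve the density. -/
def zNorm (μ : ℝ) (A : Op d) : ℝ≥0∞ :=
  ‖A‖ₑ + hsNorm (hiProj μ * A * loProj μ) + trNorm (hiProj μ * A * hiProj μ)

/-- The density part of the norm of `𝒴_μ`. -/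
def lowDensNorm (μ : ℝ) (A : Op d) : ℝ≥0∞ := eLpNorm (density (lowCut μ A)) 2 volume

lemma yNorm_eq (hμ : 0 < μ) (A : Op d) : yNorm μ A = zNorm μ A + lowDensNorm μ A := by
  rw [yNorm, zNorm, lowDensNorm, mixedBlock, highBlock, schattenENorm_one, schattenENorm_two,
    highProj_two_mul hμ, lowProj_two_mul, lowBlock_eq, ofReal_norm]

lemma inY_iff (hμ : 0 < μ) : InY μ A ↔ IsSelfAdjoint A ∧ yNorm μ A < ∞ := by
  rw [InY, yNorm_eq hμ, zNorm, lowDensNorm, mixedBlock, highBlock, schattenENorm_one,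
    schattenENorm_two, highProj_two_mul hμ, lowProj_two_mul, lowBlock_eq]
  simp only [add_lt_top, enorm_lt_top, true_and]
  constructor
  · rintro ⟨h1, h2, h3, h4⟩; exact ⟨h1, ⟨h2, h3⟩, h4.2⟩
  · rintro ⟨h1, ⟨h2, h3⟩, h4⟩
    exact ⟨h1, h2, h3, density_aestronglyMeasurable (hasDens_lowCut A) (isSelfAdjoint_lowCut h1), h4⟩

/-- The difference of two elements of `𝒴_μ` measured without the free part: Hilbert–Schmidt norm
plus trace norm of the high-momentum block, on self-adjoint operators. -/
def xN (d : ℕ) (μ : ℝ) : ExtNorm (L2 d) := ((hsN d).add ((trN d).sandwich (hiProj μ) (hiProj μ))).sa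

lemma xN_apply (hA : IsSelfAdjoint A) :
    xN d μ A = hsNorm A + trNorm (hiProj μ * A * hiProj μ) := ExtNorm.sa_apply _ hA

lemma isSelfAdjoint_of_xN (hA : xN d μ A < ∞) : IsSelfAdjoint A := selfAdjoint_of_sa _ hA

lemma hsNorm_le_xN (A : Op d) : hsNorm A ≤ xN d μ A :=
  (le_self_add : _ ≤ hsNorm A + trNorm (hiProj μ * A * hiProj μ)).trans (ExtNorm.le_sa _ A)

lemma trNorm_hi_le_xN (A : Op d) : trNorm (hiProj μ * A * hiProj μ) ≤ xN d μ A :=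
  (le_add_self : _ ≤ hsNorm A + trNorm (hiProj μ * A * hiProj μ)).trans (ExtNorm.le_sa _ A)

lemma hsNorm_hi_lo_le (A : Op d) : hsNorm (hiProj μ * A * loProj μ) ≤ hsNorm A :=
  (isIdealNorm_hs.mul_contr_le enorm_lo_le _).trans (isIdealNorm_hs.contr_mul_le enorm_hi_le _)

lemma zNorm_le_xN (A : Op d) : zNorm μ A ≤ 3 * xN d μ A := by
  calc zNorm μ A ≤ xN d μ A + xN d μ A + xN d μ A := by
        unfold zNorm
        gcongr
        · exact (enorm_le_hsNorm A).trans (hsNorm_le_xN A)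
        · exact (hsNorm_hi_lo_le A).trans (hsNorm_le_xN A)
        · exact trNorm_hi_le_xN A
    _ = 3 * xN d μ A := by ring

lemma yNorm_le_xN (hμ : 0 < μ) (A : Op d) : yNorm μ A ≤ (3 + lowVol d μ) * xN d μ A := by
  by_cases hA : IsSelfAdjoint A
  · rw [yNorm_eq hμ, add_mul]
    gcongr
    · exact zNorm_le_xN A
    · exact (eLpNorm_density_lowCut_le hA).trans (by gcongr; exact hsNorm_le_xN A)
  · have : xN d μ A = ∞ := by
      by_contra h
      exact hA (isSelfAdjoint_of_xN (lt_top_iff_ne_top.2 h))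
    rw [this, mul_top (by simp)]
    exact le_top

lemma inY_of_xN (hμ : 0 < μ) (hA : xN d μ A < ∞) : InY μ A :=
  (inY_iff hμ).2 ⟨isSelfAdjoint_of_xN hA, (yNorm_le_xN hμ A).trans_lt (mul_lt_top
    (add_lt_top.2 ⟨by norm_num, lowVol_lt_top⟩) hA)⟩

lemma zNorm_add_le (A B : Op d) : zNorm μ (A + B) ≤ zNorm μ A + zNorm μ B := by
  have h1 : ‖A + B‖ₑ ≤ ‖A‖ₑ + ‖B‖ₑ := enorm_add_le A B
  have h2 : hsNorm (hiProj μ * (A + B) * loProj μ) ≤ hsNorm (hiProj μ * A * loProj μ) +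
      hsNorm (hiProj μ * B * loProj μ) := by
    rw [mul_add, add_mul]; exact hsNorm_add_le _ _
  have h3 : trNorm (hiProj μ * (A + B) * hiProj μ) ≤ trNorm (hiProj μ * A * hiProj μ) +
      trNorm (hiProj μ * B * hiProj μ) := by
    rw [mul_add, add_mul]; exact trNorm_add_le _ _
  calc zNorm μ (A + B) ≤ _ := add_le_add (add_le_add h1 h2) h3
    _ = _ := by unfold zNorm; ring

lemma lowDensNorm_add_le {A B : Op d} (hA : IsSelfAdjoint A) (hB : IsSelfAdjoint B) :
    lowDensNorm μ (A + B) ≤ lowDensNorm μ A + lowDensNorm μ B := by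
  unfold lowDensNorm
  rw [lowCut_add]
  exact (hasDens_lowCut A).eLpNorm_density_add (isSelfAdjoint_lowCut hA) (hasDens_lowCut B)
    (isSelfAdjoint_lowCut hB)

lemma yNorm_add_le (hμ : 0 < μ) {A B : Op d} (hA : IsSelfAdjoint A) (hB : IsSelfAdjoint B) :
    yNorm μ (A + B) ≤ yNorm μ A + yNorm μ B := by
  rw [yNorm_eq hμ, yNorm_eq hμ, yNorm_eq hμ]
  calc _ ≤ _ := add_le_add (zNorm_add_le A B) (lowDensNorm_add_le hA hB)
    _ = _ := by ring

lemma lowCut_neg (A : Op d) : lowCut μ (-A) = -lowCut μ A := by simp only [lowCut, mul_neg, neg_mul]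

lemma yNorm_neg (hμ : 0 < μ) (hA : IsSelfAdjoint A) : yNorm μ (-A) = yNorm μ A := by
  have e1 : hsNorm (hiProj μ * -A * loProj μ) = hsNorm (hiProj μ * A * loProj μ) := by
    rw [mul_neg, neg_mul]; exact (hsN d).neg_eq _
  have e2 : trNorm (hiProj μ * -A * hiProj μ) = trNorm (hiProj μ * A * hiProj μ) := by
    rw [mul_neg, neg_mul]; exact (trN d).neg_eq _
  have e3 : lowDensNorm μ (-A) = lowDensNorm μ A := by
    unfold lowDensNorm
    have h := (hasDens_lowCut (μ := μ) A).smul (-1)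
    have e : (-1 : ℝ) • lowCut μ A = lowCut μ (-A) := by rw [lowCut_neg, neg_one_smul]
    rw [e] at h
    rw [h.eLpNorm_density (isSelfAdjoint_lowCut hA.neg),
      (hasDens_lowCut A).eLpNorm_density (isSelfAdjoint_lowCut hA)]
    exact eLpNorm_congr_norm_ae (.of_forall fun x => by simp)
  have e4 : ‖-A‖ₑ = ‖A‖ₑ := enorm_neg A
  rw [yNorm_eq hμ, yNorm_eq hμ, e3, zNorm, zNorm, e1, e2, e4]

lemma yNorm_sub_le (hμ : 0 < μ) {A B : Op d} (hA : IsSelfAdjoint A) (hB : IsSelfAdjoint B) :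
    yNorm μ (A - B) ≤ yNorm μ A + yNorm μ B := by
  rw [sub_eq_add_neg, ← yNorm_neg hμ hB]
  exact yNorm_add_le hμ hA hB.neg

lemma yNorm_sub_comm (hμ : 0 < μ) {A B : Op d} (hA : IsSelfAdjoint A) (hB : IsSelfAdjoint B) :
    yNorm μ (A - B) = yNorm μ (B - A) := by
  rw [← neg_sub, yNorm_neg hμ (hB.sub hA)]

lemma InY.yNorm_lt_top (hμ : 0 < μ) (h : InY μ A) : yNorm μ A < ∞ := ((inY_iff hμ).1 h).2

lemma InY.add (hμ : 0 < μ) {A B : Op d} (hA : InY μ A) (hB : InY μ B) : InY μ (A + B) :=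
  (inY_iff hμ).2 ⟨hA.1.add hB.1, (yNorm_add_le hμ hA.1 hB.1).trans_lt
    (add_lt_top.2 ⟨hA.yNorm_lt_top hμ, hB.yNorm_lt_top hμ⟩)⟩

lemma InY.sub (hμ : 0 < μ) {A B : Op d} (hA : InY μ A) (hB : InY μ B) : InY μ (A - B) :=
  (inY_iff hμ).2 ⟨hA.1.sub hB.1, (yNorm_sub_le hμ hA.1 hB.1).trans_lt
    (add_lt_top.2 ⟨hA.yNorm_lt_top hμ, hB.yNorm_lt_top hμ⟩)⟩

lemma zNorm_le_yNorm (hμ : 0 < μ) (A : Op d) : zNorm μ A ≤ yNorm μ A := by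
  rw [yNorm_eq hμ]; exact le_self_add

lemma enorm_le_yNorm (hμ : 0 < μ) (A : Op d) : ‖A‖ₑ ≤ yNorm μ A :=
  (le_self_add.trans le_self_add : ‖A‖ₑ ≤ zNorm μ A).trans (zNorm_le_yNorm hμ A)

/-! ### The mean-field potential of an element of `𝒴_μ` -/

/-- The size of a potential. -/
def vN (d : ℕ) (μ : ℝ) : ExtNorm (L2 d) := (opN d).add ((hsN d).sandwich 1 (loProj μ))

lemma vN_apply (V : Op d) : vN d μ V = ‖V‖ₑ + hsNorm (V * loProj μ) := by
  have : vN d μ V = ‖V‖ₑ + hsNorm (1 * V * loProj μ) := rfl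
  rw [this, one_mul]

lemma hsNorm_mulOp_lo_le (hV : MemLp V ∞ volume) :
    hsNorm (mulOp V * loProj μ) ≤ lowVol d μ * eLpNorm V 2 volume := by
  have h := hsNorm_mulOp_freqProj_mul_le (measurableSet_lowSet (2 * μ)) volume_lowSet_lt_top hV
    (1 : Op d)
  rw [mul_one] at h
  refine (pow_le_pow_left_iff two_ne_zero).1 (h.trans ?_)
  rw [mul_pow, mul_comm]
  gcongr
  calc ‖(1 : Op d)‖ₑ ^ 2 * volume (lowSet d (2 * μ)) ≤ 1 ^ 2 * lowVol d μ ^ 2 := by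
        gcongr
        · exact enorm_one_op_le
        · exact volume_le_lowVol_sq
    _ = lowVol d μ ^ 2 := by rw [one_pow, one_mul]

variable {A B : Op d}

lemma vN_pot_le_two (hW : IsPot w) (h : HasDens A ρ)
    (hA : IsSelfAdjoint A) : vN d μ (pot w A) ≤ (1 + lowVol d μ) * (wNorm w * eLpNorm ρ 2 volume) := by
  rw [vN_apply, add_mul, one_mul]
  gcongr
  · exact enorm_pot_le_two hW h hA
  · rw [pot_eq h hA]
    exact (hsNorm_mulOp_lo_le (h.convolvable.memLp_conv hW)).trans
      (by gcongr; exact eLpNorm_conv_le_two hW.1.1 h.convolvable.meas)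

lemma vN_pot_le_one (hW : IsPot w) (h : HasDens A ρ)
    (hA : IsSelfAdjoint A) : vN d μ (pot w A) ≤ (1 + lowVol d μ) * (wNorm w * eLpNorm ρ 1 volume) := by
  rw [vN_apply, add_mul, one_mul]
  gcongr
  · exact enorm_pot_le_one h hA
  · rw [pot_eq h hA]
    exact (hsNorm_mulOp_lo_le (h.convolvable.memLp_conv hW)).trans
      (by gcongr; exact eLpNorm_conv_le_one hW.1.1 h.convolvable.meas)

lemma eq_blocks (hA : IsSelfAdjoint A) : A = lowCut μ A +
    (hiProj μ * A * loProj μ + star (hiProj μ * A * loProj μ)) + hiProj μ * A * hiProj μ := by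
  have h : star A = A := hA
  have e : star (hiProj μ * A * loProj μ) = loProj μ * A * hiProj μ := by
    rw [star_mul, star_mul, h, star_lo, star_hi, mul_assoc]
  rw [e, lowCut]
  calc A = (loProj μ + hiProj μ) * A * (loProj μ + hiProj μ) := by
        rw [lo_add_hi, one_mul, mul_one]
    _ = _ := by
      simp only [add_mul, mul_add]
      abel

/-- The constant in the bound of the potential by the `𝒴_μ` norm. -/
def potConst (d : ℕ) (μ : ℝ) : ℝ≥0∞ := (1 + lowVol d μ) * (2 * lowVol d μ)

lemma potConst_lt_top : potConst d μ < ∞ :=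
  mul_lt_top (add_lt_top.2 ⟨one_lt_top, lowVol_lt_top⟩) (mul_lt_top (by norm_num) lowVol_lt_top)

lemma InY.exists_hasDens_and_pot_le (hμ : 0 < μ) (hA : InY μ A) : (∃ ρ, HasDens A ρ) ∧
    ∀ w, IsPot w → vN d μ (pot w A) ≤ potConst d μ * (wNorm w * yNorm μ A) := by
  have hy := hA.yNorm_lt_top hμ
  have hs := hA.1
  rw [yNorm_eq hμ, zNorm] at hy
  simp only [add_lt_top] at hy
  obtain ⟨⟨⟨-, hm⟩, ht⟩, hl⟩ := hy
  obtain ⟨ρ₂, h2, h2'⟩ := exists_hasDens_mul_lo hm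
  obtain ⟨ρ₃, h3, h3'⟩ := exists_hasDens_of_trNorm ht
  have h1 := hasDens_lowCut (μ := μ) A
  have s1 := isSelfAdjoint_lowCut (μ := μ) hs
  have hM : ∀ M : Op d, IsSelfAdjoint (M + star M) := fun M => IsSelfAdjoint.add_star_self M
  have s2 := hM (hiProj μ * A * loProj μ)
  have s3 := isSelfAdjoint_conj (K := hiProj μ) hs star_hi
  have h2s := h2.add h2.star
  have e := eq_blocks (μ := μ) hs
  have hD := (h1.add h2s).add h3
  rw [← e] at hD
  refine ⟨⟨_, hD⟩, fun w hW => ?_⟩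
  nth_rw 1 [e]
  rw [pot_add hW (h1.add h2s) (s1.add s2) h3 s3, pot_add hW h1 s1 h2s s2]
  have b1 : vN d μ (pot w (lowCut μ A)) ≤ (1 + lowVol d μ) * (wNorm w * lowDensNorm μ A) := by
    rw [lowDensNorm, h1.eLpNorm_density s1]
    exact vN_pot_le_two hW h1 s1
  have b2 := vN_pot_le_two (μ := μ) hW h2s s2
  have b2' : eLpNorm (fun x => ρ₂ x + star (ρ₂ x)) 2 volume ≤
      2 * (lowVol d μ * hsNorm (hiProj μ * A * loProj μ)) := by
    calc _ ≤ eLpNorm ρ₂ 2 volume + eLpNorm (fun x => star (ρ₂ x)) 2 volume :=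
          eLpNorm_add_le h2.convolvable.meas h2.star.convolvable.meas (by norm_num)
      _ ≤ lowVol d μ * hsNorm (hiProj μ * A * loProj μ) +
          lowVol d μ * hsNorm (hiProj μ * A * loProj μ) := by
        rw [eLpNorm_star]; gcongr
      _ = _ := by ring
  have b3 := vN_pot_le_one (μ := μ) hW h3 s3
  have hv : 1 ≤ 2 * lowVol d μ := le_mul_of_one_le_of_le one_le_two one_le_lowVol
  calc _ ≤ vN d μ (pot w (lowCut μ A)) + vN d μ (pot w (hiProj μ * A * loProj μ +
        star (hiProj μ * A * loProj μ))) + vN d μ (pot w (hiProj μ * A * hiProj μ)) :=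
        ((vN d μ).add_le _ _).trans (by gcongr; exact (vN d μ).add_le _ _)
    _ ≤ (1 + lowVol d μ) * (wNorm w * (2 * lowVol d μ * lowDensNorm μ A)) +
        (1 + lowVol d μ) * (wNorm w * (2 * (lowVol d μ * hsNorm (hiProj μ * A * loProj μ)))) +
        (1 + lowVol d μ) * (wNorm w * (2 * lowVol d μ * trNorm (hiProj μ * A * hiProj μ))) := by
      gcongr ?_ + ?_ + ?_
      · exact b1.trans (by gcongr; exact le_mul_of_one_le_left' hv)
      · exact b2.trans (by gcongr)
      · exact b3.trans (by gcongr; exact h3'.trans (le_mul_of_one_le_left' hv))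
    _ = potConst d μ * (wNorm w * (hsNorm (hiProj μ * A * loProj μ) +
        trNorm (hiProj μ * A * hiProj μ) + lowDensNorm μ A)) := by unfold potConst; ring
    _ ≤ _ := by
      rw [yNorm_eq hμ, zNorm]
      gcongr
      exact le_add_self

lemma InY.exists_hasDens (hμ : 0 < μ) (hA : InY μ A) : ∃ ρ, HasDens A ρ :=
  (hA.exists_hasDens_and_pot_le hμ).1

lemma InY.vN_pot_le (hμ : 0 < μ) (hA : InY μ A) (hW : IsPot w) :
    vN d μ (pot w A) ≤ potConst d μ * (wNorm w * yNorm μ A) :=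
  (hA.exists_hasDens_and_pot_le hμ).2 w hW

lemma InY.isSelfAdjoint_pot (hμ : 0 < μ) (hA : InY μ A) (hW : IsPot w) : IsSelfAdjoint (pot w A) := by
  obtain ⟨ρ, h⟩ := hA.exists_hasDens hμ
  exact Hartree.isSelfAdjoint_pot hW h hA.1

lemma InY.pot_sub (hμ : 0 < μ) (hA : InY μ A) (hB : InY μ B) (hW : IsPot w) : pot w (A - B) = pot w A - pot w B := by
  obtain ⟨ρ, h⟩ := hA.exists_hasDens hμ
  obtain ⟨ρ', h'⟩ := hB.exists_hasDens hμ
  exact Hartree.pot_sub hW h hA.1 h' hB.1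

lemma InY.pot_sub_left (hμ : 0 < μ) (hA : InY μ A) (hW : IsPot w) (hW' : IsPot w') :
    pot (w - w') A = pot w A - pot w' A := by
  obtain ⟨ρ, h⟩ := hA.exists_hasDens hμ
  exact Hartree.pot_sub_left hW hW' h hA.1

/-! ### Commutators -/

/-- The generator `-i [V, A]`. -/
def qcomm (V A : Op d) : Op d := (-Complex.I) • (V * A - A * V)

lemma smul_hartreeComm (A : Op d) :
    (-Complex.I) • hartreeComm μ w A = qcomm (pot w A) (lowProj μ + A) := rfl

lemma isSelfAdjoint_qcomm {V A : Op d} (hV : IsSelfAdjoint V) (hA : IsSelfAdjoint A) :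
    IsSelfAdjoint (qcomm V A) := by
  have h1 : star V = V := hV
  have h2 : star A = A := hA
  have h3 : star (V * A - A * V) = -(V * A - A * V) := by
    rw [star_sub, star_mul, star_mul, h1, h2]; abel
  rw [IsSelfAdjoint, qcomm, star_smul, h3, smul_neg, ← neg_smul]
  simp

lemma IsIdealNorm.neg_I_smul_le (hp : IsIdealNorm p) (A : Op d) : p ((-Complex.I) • A) ≤ p A := by
  have e : (-Complex.I) • A = ((-Complex.I) • (1 : Op d)) * A := by rw [smul_mul_assoc, one_mul]
  rw [e]
  refine hp.contr_mul_le ?_ A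
  have h : ‖(-Complex.I) • (1 : Op d)‖ = ‖(1 : Op d)‖ := by
    rw [norm_smul, norm_neg, Complex.norm_I, one_mul]
  rw [← ofReal_norm, h, ofReal_norm]
  exact enorm_one_op_le

lemma IsIdealNorm.qcomm_le (hp : IsIdealNorm p) {V A : Op d}
    (hV : IsSelfAdjoint V) (hA : IsSelfAdjoint A) : p (qcomm V A) ≤ 2 * p (V * A) := by
  have h1 : star V = V := hV
  have h2 : star A = A := hA
  have h3 : p (A * V) = p (V * A) := by rw [← hp.star_eq, star_mul, h1, h2]
  calc p (qcomm V A) ≤ p (V * A - A * V) := hp.neg_I_smul_le _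
    _ ≤ p (V * A) + p (A * V) := p.sub_le _ _
    _ = 2 * p (V * A) := by rw [h3]; ring

lemma hi_qcomm_hi (V A : Op d) : hiProj μ * qcomm V A * hiProj μ = (-Complex.I) •
    (hiProj μ * (V * A) * hiProj μ - hiProj μ * (A * V) * hiProj μ) := by
  simp only [qcomm, mul_smul_comm, smul_mul_assoc, mul_sub, sub_mul]

lemma trNorm_hi_qcomm_hi_le {V A : Op d} (hV : IsSelfAdjoint V) (hA : IsSelfAdjoint A) :
    trNorm (hiProj μ * qcomm V A * hiProj μ) ≤ 2 * trNorm (hiProj μ * (V * A) * hiProj μ) := by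
  have h1 : star V = V := hV
  have h2 : star A = A := hA
  have h3 : trNorm (hiProj μ * (A * V) * hiProj μ) = trNorm (hiProj μ * (V * A) * hiProj μ) := by
    rw [← trNorm_star, star_mul, star_mul, star_mul, h1, h2, star_hi, ← mul_assoc]
  rw [hi_qcomm_hi]
  calc _ ≤ trNorm (hiProj μ * (V * A) * hiProj μ - hiProj μ * (A * V) * hiProj μ) :=
        isIdealNorm_tr.neg_I_smul_le _
    _ ≤ trNorm (hiProj μ * (V * A) * hiProj μ) + trNorm (hiProj μ * (A * V) * hiProj μ) :=
        (trN d).sub_le _ _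
    _ = _ := by rw [h3]; ring

lemma xN_qcomm_le {V A : Op d} (hV : IsSelfAdjoint V) (hA : IsSelfAdjoint A) :
    xN d μ (qcomm V A) ≤ 4 * (vN d μ V * zNorm μ A) := by
  have h2 : star A = A := hA
  have z1 : ‖A‖ₑ ≤ zNorm μ A := le_self_add.trans le_self_add
  have z2 : hsNorm (hiProj μ * A * loProj μ) ≤ zNorm μ A := le_add_self.trans le_self_add
  have z3 : trNorm (hiProj μ * A * hiProj μ) ≤ zNorm μ A := le_add_self
  have z4 : hsNorm (loProj μ * A * hiProj μ) ≤ zNorm μ A := by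
    rw [← hsNorm_star, star_mul, star_mul, h2, star_lo, star_hi, ← mul_assoc]; exact z2
  have z5 : hsNorm (hiProj μ * A) ≤ zNorm μ A := by
    have : hiProj μ * A = hiProj μ * A * loProj μ + hiProj μ * A * hiProj μ := by
      rw [← mul_add, lo_add_hi, mul_one]
    rw [this]
    calc _ ≤ _ := hsNorm_add_le _ _
      _ ≤ hsNorm (hiProj μ * A * loProj μ) + trNorm (hiProj μ * A * hiProj μ) := by
        gcongr; exact hsNorm_le_trNorm _
      _ ≤ zNorm μ A := by unfold zNorm; gcongr; exact le_add_self
  have e : V * A = V * loProj μ * A + V * (hiProj μ * A) := by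
    rw [← mul_assoc V, ← add_mul, ← mul_add, lo_add_hi, mul_one]
  have b1 : hsNorm (V * A) ≤ vN d μ V * zNorm μ A := by
    rw [e, vN_apply, add_comm ‖V‖ₑ, add_mul]
    refine (hsNorm_add_le _ _).trans ?_
    gcongr
    · exact (hsNorm_mul_le' _ _).trans (by gcongr)
    · exact (hsNorm_mul_le _ _).trans (by gcongr)
  have b2 : trNorm (hiProj μ * (V * A) * hiProj μ) ≤ vN d μ V * zNorm μ A := by
    have e' : hiProj μ * (V * A) * hiProj μ = hiProj μ * (V * loProj μ * (loProj μ * A * hiProj μ)) +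
        hiProj μ * (V * (hiProj μ * A * hiProj μ)) := by
      rw [e]
      simp only [mul_add, add_mul, mul_assoc]
      rw [← mul_assoc (loProj μ) (loProj μ), lo_mul_lo]
    rw [e', vN_apply, add_comm ‖V‖ₑ, add_mul]
    refine (trNorm_add_le _ _).trans ?_
    gcongr
    · refine (isIdealNorm_tr.contr_mul_le enorm_hi_le _).trans ?_
      exact (trNorm_mul_le_hsNorm _ _).trans (by gcongr)
    · refine (isIdealNorm_tr.contr_mul_le enorm_hi_le _).trans ?_
      exact (trNorm_mul_le _ _).trans (by gcongr)
  rw [xN_apply (isSelfAdjoint_qcomm hV hA)]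
  calc _ ≤ 2 * (vN d μ V * zNorm μ A) + 2 * (vN d μ V * zNorm μ A) :=
        add_le_add ((isIdealNorm_hs.qcomm_le hV hA).trans (by gcongr; exact b1))
          ((trNorm_hi_qcomm_hi_le hV hA).trans (by gcongr))
    _ = _ := by ring

lemma xN_freeEvol (t : ℝ) (A : Op d) : xN d μ (freeEvol t A) = xN d μ A := by
  have key : ∀ (t : ℝ) (A : Op d), xN d μ (freeEvol t A) ≤ xN d μ A := by
    intro t A
    by_cases hA : IsSelfAdjoint A
    · rw [xN_apply hA, xN_apply (isSelfAdjoint_freeEvol hA t)]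
      have e : hiProj μ * freeEvol t A * hiProj μ = freeEvol t (hiProj μ * A * hiProj μ) := by
        rw [freeEvol_mul, freeEvol_mul, freeEvol_hi]
      rw [e]
      exact add_le_add (isIdealNorm_hs.freeEvol_le t A) (isIdealNorm_tr.freeEvol_le t _)
    · have : xN d μ A = ∞ := by
        by_contra h
        exact hA (isSelfAdjoint_of_xN (lt_top_iff_ne_top.2 h))
      rw [this]; exact le_top
  refine le_antisymm (key t A) ?_
  have := key (-t) (freeEvol t A)
  rwa [freeEvol_freeEvol, neg_add_cancel, freeEvol_zero] at this

lemma zNorm_freeEvol_le (t : ℝ) (A : Op d) : zNorm μ (freeEvol t A) ≤ zNorm μ A := by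
  have e1 : hiProj μ * freeEvol t A * hiProj μ = freeEvol t (hiProj μ * A * hiProj μ) := by
    rw [freeEvol_mul, freeEvol_mul, freeEvol_hi]
  have e2 : hiProj μ * freeEvol t A * loProj μ = freeEvol t (hiProj μ * A * loProj μ) := by
    rw [freeEvol_mul, freeEvol_mul, freeEvol_hi, freeEvol_lo]
  unfold zNorm
  rw [e1, e2]
  exact add_le_add (add_le_add (isIdealNorm_op.freeEvol_le t A) (isIdealNorm_hs.freeEvol_le t _))
    (isIdealNorm_tr.freeEvol_le t _)

lemma freeLowDensity_eq (t : ℝ) (A : Op d) : freeLowDensity μ A t =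
    density (lowCut μ (freeEvol t A)) := by
  rw [freeLowDensity, lowBlock_eq, freeEvol_lowCut]

lemma yNorm_freeEvol_le (hμ : 0 < μ) (t : ℝ) (A : Op d) :
    yNorm μ (freeEvol t A) ≤ yNorm μ A + eLpNorm (freeLowDensity μ A t) 2 volume := by
  rw [yNorm_eq hμ, lowDensNorm, freeLowDensity_eq]
  gcongr
  exact (zNorm_freeEvol_le t A).trans (zNorm_le_yNorm hμ A)

end

section

/-! ### Gronwall estimates for seminorms of integrals -/

section Integral

lemma ExtNorm.convex_epigraph (p : ExtNorm H) :
    Convex ℝ {q : (BOp H) × ℝ | 0 ≤ q.2 ∧ p q.1 ≤ ofReal q.2} := by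
  rintro ⟨A, r⟩ ⟨hr, hA⟩ ⟨B, r'⟩ ⟨hr', hB⟩ a b ha hb -
  simp only [Prod.smul_mk, Prod.mk_add_mk, smul_eq_mul] at *
  refine ⟨by positivity, (p.add_le _ _).trans ?_⟩
  rw [p.smul_eq, p.smul_eq, ofReal_add (by positivity) (by positivity),
    ofReal_mul ha, ofReal_mul hb, Real.enorm_of_nonneg ha, Real.enorm_of_nonneg hb]
  gcongr

lemma ExtNorm.isClosed_epigraph (p : ExtNorm H) :
    IsClosed {q : (BOp H) × ℝ | 0 ≤ q.2 ∧ p q.1 ≤ ofReal q.2} := by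
  refine isClosed_of_closure_subset fun q hq => ?_
  rw [mem_closure_iff_nhdsWithin_neBot] at hq
  set S := {q : (BOp H) × ℝ | 0 ≤ q.2 ∧ p q.1 ≤ ofReal q.2}
  have h1 : Tendsto (fun x : (BOp H) × ℝ => x.1) (𝓝[S] q) (𝓝 q.1) :=
    (continuous_fst.tendsto q).mono_left nhdsWithin_le_nhds
  have h2 : Tendsto (fun x : (BOp H) × ℝ => x.2) (𝓝[S] q) (𝓝 q.2) :=
    (continuous_snd.tendsto q).mono_left nhdsWithin_le_nhds
  have hS : ∀ᶠ x in 𝓝[S] q, x ∈ S := self_mem_nhdsWithin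
  refine ⟨ge_of_tendsto h2 (hS.mono fun x hx => hx.1), ?_⟩
  have h3 : Tendsto (fun ε : ℝ => ofReal (q.2 + ε)) (𝓝[>] 0) (𝓝 (ofReal q.2)) := by
    have : Continuous fun ε : ℝ => ofReal (q.2 + ε) := ENNReal.continuous_ofReal.comp (by fun_prop)
    have h := this.tendsto 0
    rw [add_zero] at h
    exact h.mono_left nhdsWithin_le_nhds
  refine ge_of_tendsto h3 ?_
  filter_upwards [self_mem_nhdsWithin] with ε hε
  refine p.le_of_tendsto h1 ?_
  filter_upwards [hS, h2.eventually_lt_const (lt_add_of_pos_right q.2 hε)] with x hx hx'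
  exact hx.2.trans (ofReal_le_ofReal hx'.le)

/-- The seminorm of an integral is at most the integral of a bound of the seminorm. -/
lemma ExtNorm.integral_le_integral [CompleteSpace H] (p : ExtNorm H) {f : ℝ → BOp H}
    {g : ℝ → ℝ} {a b : ℝ} (hf : IntervalIntegrable f volume a b)
    (hg : IntervalIntegrable g volume a b) (hg0 : ∀ s, 0 ≤ g s)
    (hc : ∀ s ∈ uIoc a b, p (f s) ≤ ofReal (g s)) :
    p (∫ s in a..b, f s) ≤ ofReal |∫ s in a..b, g s| := by
  wlog hab : a ≤ b generalizing a b
  · have h := this hf.symm hg.symm (by rwa [uIoc_comm]) (le_of_not_ge hab)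
    rw [intervalIntegral.integral_symm b a (f := f), p.neg_eq,
      intervalIntegral.integral_symm b a (f := g), abs_neg]
    exact h
  rcases hab.eq_or_lt with rfl | hab'
  · simp
  have hi : IntegrableOn (fun s => (f s, g s)) (Ioc a b) volume := hf.1.prodMk hg.1
  have h1 : ⨍ s in Ioc a b, (f s, g s) ∈ {q : (BOp H) × ℝ | 0 ≤ q.2 ∧ p q.1 ≤ ofReal q.2} := by
    refine p.convex_epigraph.set_average_mem p.isClosed_epigraph ?_ ?_ ?_ hi
    · simpa using hab'
    · simp
    · refine (ae_restrict_iff' measurableSet_Ioc).2 (.of_forall fun s hs => ?_)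
      exact ⟨hg0 s, hc s (by rwa [uIoc_of_le hab])⟩
  rw [setAverage_eq, integral_pair hf.1 hg.1, Prod.smul_mk,
    ← intervalIntegral.integral_of_le hab, ← intervalIntegral.integral_of_le hab] at h1
  have hv : volume.real (Ioc a b) = b - a := Real.volume_real_Ioc_of_le hab
  rw [hv] at h1
  have h2 := h1.2
  have hba : 0 < b - a := sub_pos.2 hab'
  simp only [smul_eq_mul] at h2
  rw [p.smul_eq, ofReal_mul (by positivity), Real.enorm_of_nonneg (by positivity)] at h2
  have h3 : ofReal (b - a)⁻¹ ≠ 0 := by simpa using hba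
  have h4 := (ENNReal.mul_le_mul_iff_right h3 ENNReal.ofReal_ne_top).1 h2
  exact h4.trans (ofReal_le_ofReal (le_abs_self _))

end Integral

lemma abs_integral_exp_abs_le {K : ℝ} (hK : 0 < K) (t : ℝ) :
    |∫ s in (0 : ℝ)..t, Real.exp (K * |s|)| ≤ Real.exp (K * |t|) / K := by
  have key : ∀ t : ℝ, 0 ≤ t → |∫ s in (0 : ℝ)..t, Real.exp (K * |s|)| ≤ Real.exp (K * |t|) / K := by
    intro t ht
    have h1 : ∫ s in (0 : ℝ)..t, Real.exp (K * |s|) = ∫ s in (0 : ℝ)..t, Real.exp (K * s) := by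
      refine intervalIntegral.integral_congr fun s hs => ?_
      rw [uIcc_of_le ht] at hs
      simp only [abs_of_nonneg hs.1]
    have h2 : ∫ s in (0 : ℝ)..t, Real.exp (K * s) = (Real.exp (K * t) - 1) / K := by
      rw [intervalIntegral.integral_comp_mul_left (fun x => Real.exp x) hK.ne', integral_exp]
      simp only [mul_zero, Real.exp_zero, smul_eq_mul]
      field_simp
    rw [h1, h2, abs_of_nonneg ht, abs_of_nonneg]
    · gcongr; linarith
    · have : 1 ≤ Real.exp (K * t) := Real.one_le_exp (by positivity)
      exact div_nonneg (by linarith) hK.le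
  rcases le_total 0 t with ht | ht
  · exact key t ht
  · have h := key (-t) (by linarith)
    have e : ∫ s in (0 : ℝ)..(-t), Real.exp (K * |s|) = -∫ s in (0 : ℝ)..t, Real.exp (K * |s|) := by
      have := intervalIntegral.integral_comp_neg (a := t) (b := 0) fun s => Real.exp (K * |s|)
      simp only [abs_neg, neg_zero] at this
      rw [← this, intervalIntegral.integral_symm]
    rwa [e, abs_neg, abs_neg] at h

/-- Gronwall's inequality for a seminorm of Duhamel integrals on an interval around `0`. -/
lemma gronwall_sup {J : Set ℝ} {φ : ℝ → ℝ≥0∞} {a ε T : ℝ} (ha : 0 < a) (hε : 0 ≤ ε) (hT : 0 ≤ T)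
    (hJ : ∀ t ∈ J, |t| ≤ T) {B : ℝ≥0∞} (hB : B < ∞) (hφB : ∀ t ∈ J, φ t ≤ B)
    (hφ : ∀ m : ℝ, 0 ≤ m → (∀ t ∈ J, φ t ≤ ofReal (m * Real.exp (2 * a * |t|))) →
      ∀ t ∈ J, φ t ≤ ofReal |∫ s in (0 : ℝ)..t, a * (ε + m * Real.exp (2 * a * |s|))|) :
    ∀ t ∈ J, φ t ≤ ofReal (2 * a * T * Real.exp (2 * a * T) * ε) := by
  set m := ⨆ t ∈ J, φ t * ofReal (Real.exp (-(2 * a * |t|))) with hm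
  have hmB : m ≤ B := iSup₂_le fun t ht => by
    refine (mul_le_of_le_one_right' ?_).trans (hφB t ht)
    rw [← ENNReal.ofReal_one]
    refine ofReal_le_ofReal (Real.exp_le_one_iff.2 ?_)
    have := abs_nonneg t
    simp only [neg_nonpos]; positivity
  have hmt : m ≠ ∞ := (hmB.trans_lt hB).ne
  have hφm : ∀ t ∈ J, φ t ≤ ofReal (m.toReal * Real.exp (2 * a * |t|)) := by
    intro t ht
    rw [ofReal_mul toReal_nonneg, ofReal_toReal hmt]
    calc φ t = φ t * ofReal (Real.exp (-(2 * a * |t|))) *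
          ofReal (Real.exp (2 * a * |t|)) := by
          rw [mul_assoc, ← ofReal_mul (Real.exp_nonneg _), ← Real.exp_add]
          simp
      _ ≤ m * ofReal (Real.exp (2 * a * |t|)) := by
          gcongr
          exact le_iSup₂ (f := fun t _ => φ t * ofReal (Real.exp (-(2 * a * |t|)))) t ht
  have hint : ∀ t ∈ J, |∫ s in (0 : ℝ)..t, a * (ε + m.toReal * Real.exp (2 * a * |s|))| ≤
      a * ε * T + m.toReal / 2 * Real.exp (2 * a * |t|) := by
    intro t ht
    have e : ∫ s in (0 : ℝ)..t, a * (ε + m.toReal * Real.exp (2 * a * |s|)) =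
        a * ε * t + a * m.toReal * ∫ s in (0 : ℝ)..t, Real.exp (2 * a * |s|) := by
      have h1 : Continuous fun s : ℝ => a * m.toReal * Real.exp (2 * a * |s|) := by fun_prop
      rw [← intervalIntegral.integral_const_mul]
      have : (fun s : ℝ => a * (ε + m.toReal * Real.exp (2 * a * |s|))) =
          fun s => a * ε + a * m.toReal * Real.exp (2 * a * |s|) := by ext s; ring
      rw [this, intervalIntegral.integral_add (by simp) (h1.intervalIntegrable _ _)]
      rw [intervalIntegral.integral_const, sub_zero, smul_eq_mul, mul_comm t]
    rw [e]
    have h1 := abs_integral_exp_abs_le (K := 2 * a) (by positivity) t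
    calc _ ≤ |a * ε * t| + |a * m.toReal * ∫ s in (0 : ℝ)..t, Real.exp (2 * a * |s|)| := abs_add_le _ _
      _ ≤ a * ε * T + a * m.toReal * (Real.exp (2 * a * |t|) / (2 * a)) := by
        rw [abs_mul, abs_mul _ (∫ s in (0 : ℝ)..t, _), abs_of_nonneg (by positivity : 0 ≤ a * ε),
          abs_of_nonneg (by positivity : 0 ≤ a * m.toReal)]
        gcongr
        exact hJ t ht
      _ = _ := by field_simp
  have hm2 : m ≤ ofReal (a * ε * T + m.toReal / 2) := iSup₂_le fun t ht => by
    have h1 := (hφ m.toReal toReal_nonneg hφm t ht).trans (ofReal_le_ofReal (hint t ht))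
    calc _ ≤ ofReal (a * ε * T + m.toReal / 2 * Real.exp (2 * a * |t|)) *
          ofReal (Real.exp (-(2 * a * |t|))) := by gcongr
      _ = ofReal (a * ε * T * Real.exp (-(2 * a * |t|)) + m.toReal / 2) := by
        rw [← ofReal_mul (by positivity), add_mul, mul_assoc (m.toReal / 2), ← Real.exp_add]
        simp
      _ ≤ _ := by
        refine ofReal_le_ofReal ?_
        have : Real.exp (-(2 * a * |t|)) ≤ 1 := Real.exp_le_one_iff.2 (by
          have := abs_nonneg t
          simp only [neg_nonpos]; positivity)
        have h2 : 0 ≤ a * ε * T := by positivity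
        nlinarith
  have hm3 : m.toReal ≤ 2 * a * ε * T := by
    have h1 := toReal_mono ENNReal.ofReal_ne_top hm2
    rw [toReal_ofReal (by positivity)] at h1
    linarith
  intro t ht
  refine (hφm t ht).trans (ofReal_le_ofReal ?_)
  calc m.toReal * Real.exp (2 * a * |t|) ≤ (2 * a * ε * T) * Real.exp (2 * a * T) := by
        gcongr
        exact hJ t ht
    _ = _ := by ring

/-! ### The nonlinearity -/

/-- The nonlinearity `-i [w * ρ_Q, Π_μ^- + Q]`. -/
def hartreeF (μ : ℝ) (w : Space d → ℝ) (Q : Op d) : Op d := qcomm (pot w Q) (lowProj μ + Q)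

lemma qcomm_add_left (V V' A : Op d) : qcomm (V + V') A = qcomm V A + qcomm V' A := by
  simp only [qcomm, add_mul, mul_add, ← smul_add]; congr 1; abel

lemma qcomm_add_right (V A A' : Op d) : qcomm V (A + A') = qcomm V A + qcomm V A' := by
  simp only [qcomm, add_mul, mul_add, ← smul_add]; congr 1; abel

lemma qcomm_sub_left (V V' A : Op d) : qcomm (V - V') A = qcomm V A - qcomm V' A := by
  simp only [qcomm, sub_mul, mul_sub, ← smul_sub]; congr 1; abel

lemma qcomm_sub_right (V A A' : Op d) : qcomm V (A - A') = qcomm V A - qcomm V A' := by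
  simp only [qcomm, sub_mul, mul_sub, ← smul_sub]; congr 1; abel

lemma isSelfAdjoint_lowProj (m : ℝ) : IsSelfAdjoint (lowProj m : Op d) := by
  rw [lowProj_eq]; exact star_freqProj (measurableSet_lowSet m)

lemma hi_mul_lowProj (hμ : 0 < μ) : (hiProj μ : Op d) * lowProj μ = 0 := by
  refine hi_mul_of_lo_mul ?_
  have h : lowSet d (2 * μ) ∩ lowSet d μ = lowSet d μ :=
    inter_eq_right.2 fun ξ hξ => (show lapSymbol ξ ≤ μ from hξ).trans (by linarith)
  rw [lowProj_eq, loProj, freqProj_mul (measurableSet_lowSet _) (measurableSet_lowSet _), h]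

lemma zNorm_lowProj_le (hμ : 0 < μ) : zNorm μ (lowProj μ : Op d) ≤ 1 := by
  rw [zNorm, hi_mul_lowProj hμ, zero_mul, zero_mul, hsNorm_zero, trNorm_zero, add_zero, add_zero,
    lowProj_eq]
  exact enorm_freqProj_le _

variable {Q Q' : Op d}

lemma zNorm_lowProj_add_le (hμ : 0 < μ) (Q : Op d) : zNorm μ (lowProj μ + Q) ≤ 1 + yNorm μ Q :=
  (zNorm_add_le _ _).trans (add_le_add (zNorm_lowProj_le hμ) (zNorm_le_yNorm hμ Q))

lemma xN_hartreeF_le (hμ : 0 < μ) (hQ : InY μ Q) (hW : IsPot w) :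
    xN d μ (hartreeF μ w Q) ≤ 4 * (potConst d μ * (wNorm w * yNorm μ Q) * (1 + yNorm μ Q)) := by
  refine (xN_qcomm_le (hQ.isSelfAdjoint_pot hμ hW) ((isSelfAdjoint_lowProj μ).add hQ.1)).trans ?_
  gcongr
  · exact hQ.vN_pot_le hμ hW
  · exact zNorm_lowProj_add_le hμ Q

lemma hartreeF_sub (hμ : 0 < μ) (hQ : InY μ Q) (hQ' : InY μ Q') (hW : IsPot w) (hW' : IsPot w') :
    hartreeF μ w' Q' - hartreeF μ w Q = qcomm (pot w' (Q' - Q)) (lowProj μ + Q') +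
      qcomm (pot (w' - w) Q) (lowProj μ + Q') + qcomm (pot w Q) (Q' - Q) := by
  rw [hQ'.pot_sub hμ hQ hW', hQ.pot_sub_left hμ hW' hW, qcomm_sub_left, qcomm_sub_left,
    qcomm_sub_right, hartreeF, hartreeF, qcomm_add_right, qcomm_add_right, qcomm_add_right,
    qcomm_add_right]
  abel

lemma xN_hartreeF_sub_le (hμ : 0 < μ) (hQ : InY μ Q) (hQ' : InY μ Q') (hW : IsPot w) (hW' : IsPot w') {M : ℝ≥0∞}
    (hM : 1 ≤ M) (hw : wNorm w ≤ M) (hw' : wNorm w' ≤ M) (hQM : yNorm μ Q ≤ M)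
    (hQM' : yNorm μ Q' ≤ M) :
    xN d μ (hartreeF μ w' Q' - hartreeF μ w Q) ≤
      12 * (potConst d μ * M ^ 2) * (yNorm μ (Q' - Q) + wNorm (w' - w)) := by
  have hD := hQ'.sub hμ hQ
  have s := (isSelfAdjoint_lowProj (d := d) μ).add hQ'.1
  have hz : zNorm μ (lowProj μ + Q') ≤ 2 * M := by
    refine (zNorm_lowProj_add_le hμ Q').trans ?_
    rw [two_mul]; gcongr
  have b1 := xN_qcomm_le (μ := μ) (hD.isSelfAdjoint_pot hμ hW') s
  have b2 := xN_qcomm_le (μ := μ) (hQ.isSelfAdjoint_pot hμ (hW'.sub hW)) s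
  have b3 := xN_qcomm_le (μ := μ) (hQ.isSelfAdjoint_pot hμ hW) hD.1
  have c1 := hD.vN_pot_le hμ hW'
  have c2 := hQ.vN_pot_le hμ (hW'.sub hW)
  have c3 := hQ.vN_pot_le hμ hW
  rw [hartreeF_sub hμ hQ hQ' hW hW']
  calc _ ≤ 4 * (vN d μ (pot w' (Q' - Q)) * zNorm μ (lowProj μ + Q')) +
        4 * (vN d μ (pot (w' - w) Q) * zNorm μ (lowProj μ + Q')) +
        4 * (vN d μ (pot w Q) * zNorm μ (Q' - Q)) :=
        ((xN d μ).add_le _ _).trans (add_le_add (((xN d μ).add_le _ _).trans (add_le_add b1 b2)) b3)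
    _ ≤ 4 * (potConst d μ * (M * yNorm μ (Q' - Q)) * (2 * M)) +
        4 * (potConst d μ * (wNorm (w' - w) * M) * (2 * M)) +
        4 * (potConst d μ * (M * M) * yNorm μ (Q' - Q)) := by
      gcongr
      · exact c1.trans (by gcongr)
      · exact c2.trans (by gcongr)
      · exact c3.trans (by gcongr)
      · exact zNorm_le_yNorm hμ _
    _ = potConst d μ * M ^ 2 * (12 * yNorm μ (Q' - Q) + 8 * wNorm (w' - w)) := by ring
    _ ≤ potConst d μ * M ^ 2 * (12 * yNorm μ (Q' - Q) + 12 * wNorm (w' - w)) := by gcongr; norm_num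
    _ = _ := by ring

/-! ### Solutions -/

variable {Q₀ Q₀' : Op d} {J J' : Set ℝ} {q q' : ℝ → Op d}

lemma freeEvol_hartreeF (t : ℝ) (Q : Op d) : (-Complex.I) • freeEvol t (hartreeComm μ w Q) =
    freeEvol t (hartreeF μ w Q) := by
  rw [← freeEvol_smul, smul_hartreeComm, hartreeF]

lemma IsSolution.intervalIntegrable (h : IsSolution μ w Q₀ J q) (ht : t ∈ J) :
    IntervalIntegrable (fun s => freeEvol (t - s) (hartreeF μ w (q s))) volume 0 t := by
  simp only [← freeEvol_hartreeF]
  exact (h.integrable t ht).smul (-Complex.I)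

lemma IsSolution.eq_add (h : IsSolution μ w Q₀ J q) (ht : t ∈ J) :
    q t = freeEvol t Q₀ + ∫ s in (0 : ℝ)..t, freeEvol (t - s) (hartreeF μ w (q s)) := by
  simp only [← freeEvol_hartreeF]
  rw [intervalIntegral.integral_smul, neg_smul, ← sub_eq_add_neg]
  exact h.duhamel t ht

lemma isSolution_iff : IsSolution μ w Q₀ J q ↔ (∀ t ∈ J, InY μ (q t)) ∧
    (∀ t₀ ∈ J, Tendsto (fun t => yNorm μ (q t - q t₀)) (𝓝[J] t₀) (𝓝 0)) ∧
    (∀ t ∈ J, IntervalIntegrable (fun s => freeEvol (t - s) (hartreeF μ w (q s))) volume 0 t) ∧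
    ∀ t ∈ J, q t = freeEvol t Q₀ + ∫ s in (0 : ℝ)..t, freeEvol (t - s) (hartreeF μ w (q s)) := by
  constructor
  · exact fun h => ⟨h.mem, h.cont, fun t ht => h.intervalIntegrable ht, fun t ht => h.eq_add ht⟩
  · rintro ⟨h1, h2, h3, h4⟩
    have e : ∀ t : ℝ, (fun s => freeEvol (t - s) (hartreeComm μ w (q s))) =
        fun s => Complex.I • freeEvol (t - s) (hartreeF μ w (q s)) := by
      intro t; ext1 s
      rw [← freeEvol_hartreeF, smul_smul]
      simp
    refine ⟨h1, h2, fun t ht => ?_, fun t ht => ?_⟩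
    · rw [e]; exact (h3 t ht).smul Complex.I
    · rw [e, intervalIntegral.integral_smul, smul_smul, Complex.I_mul_I, neg_one_smul, sub_neg_eq_add]
      exact h4 t ht

lemma IsSolution.mono (h : IsSolution μ w Q₀ J q) (hJ : J' ⊆ J) : IsSolution μ w Q₀ J' q where
  mem t ht := h.mem t (hJ ht)
  cont t ht := (h.cont t (hJ ht)).mono_left (nhdsWithin_mono t hJ)
  integrable t ht := h.integrable t (hJ ht)
  duhamel t ht := h.duhamel t (hJ ht)

lemma IsSolution.congr (h : IsSolution μ w Q₀ J q) (hJ : J.OrdConnected) (h0 : (0 : ℝ) ∈ J)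
    (he : EqOn q' q J) : IsSolution μ w Q₀ J q' := by
  rw [isSolution_iff] at h ⊢
  obtain ⟨h1, h2, h3, h4⟩ := h
  have e : ∀ t ∈ J, EqOn (fun s => freeEvol (t - s) (hartreeF μ w (q' s)))
      (fun s => freeEvol (t - s) (hartreeF μ w (q s))) (uIcc 0 t) := by
    intro t ht s hs
    simp only [he (hJ.uIcc_subset h0 ht hs)]
  refine ⟨fun t ht => by rw [he ht]; exact h1 t ht, fun t ht => ?_, fun t ht => ?_, fun t ht => ?_⟩
  · refine (h2 t ht).congr' ?_
    filter_upwards [self_mem_nhdsWithin] with s hs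
    rw [he ht, he hs]
  · exact (h3 t ht).congr fun s hs => (e t ht (uIoc_subset_uIcc hs)).symm
  · rw [he ht, h4 t ht, intervalIntegral.integral_congr (e t ht)]

lemma exists_bound_of_tendsto {f : ℝ → ℝ≥0∞} {g : ℝ → ℝ → ℝ≥0∞} {K : Set ℝ} (hK : IsCompact K)
    (hf : ∀ t ∈ K, f t < ∞) (hfg : ∀ t ∈ K, ∀ s ∈ K, f s ≤ g s t + f t)
    (hg : ∀ t ∈ K, Tendsto (fun s => g s t) (𝓝[K] t) (𝓝 0)) : ∃ M < ∞, ∀ t ∈ K, f t ≤ M := by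
  refine hK.induction_on (p := fun s => ∃ M < ∞, ∀ t ∈ s, f t ≤ M) ⟨0, by simp, by simp⟩
    (fun s t hst ⟨M, hM, h⟩ => ⟨M, hM, fun u hu => h u (hst hu)⟩)
    (fun s t ⟨M, hM, h⟩ ⟨M', hM', h'⟩ => ⟨max M M', max_lt hM hM', fun u hu => hu.elim
      (fun hu => (h u hu).trans (le_max_left _ _)) fun hu => (h' u hu).trans (le_max_right _ _)⟩)
    fun t ht => ⟨_, ((hg t ht).eventually_lt_const zero_lt_one).and self_mem_nhdsWithin, 1 + f t,
      add_lt_top.2 ⟨one_lt_top, hf t ht⟩, fun s hs => (hfg t ht s hs.2).trans ?_⟩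
  gcongr
  exact hs.1.le

lemma IsSolution.exists_bound (hμ : 0 < μ) (h : IsSolution μ w Q₀ J q) {K : Set ℝ}
    (hK : IsCompact K) (hKJ : K ⊆ J) : ∃ M < ∞, ∀ t ∈ K, yNorm μ (q t) ≤ M := by
  refine exists_bound_of_tendsto hK (fun t ht => (h.mem t (hKJ ht)).yNorm_lt_top hμ)
    (fun t ht s hs => ?_) fun t ht => (h.cont t (hKJ ht)).mono_left (nhdsWithin_mono t hKJ)
  have := yNorm_add_le hμ ((h.mem s (hKJ hs)).1.sub (h.mem t (hKJ ht)).1) (h.mem t (hKJ ht)).1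
  rwa [sub_add_cancel] at this

lemma IsSolution.xN_sub_free_le (hμ : 0 < μ) (h : IsSolution μ w Q₀ J q) (hJ : J.OrdConnected)
    (h0 : (0 : ℝ) ∈ J) (hW : IsPot w) {M : ℝ≥0∞}
    (hM : ∀ t ∈ J, yNorm μ (q t) ≤ M) (ht : t ∈ J) :
    xN d μ (q t - freeEvol t Q₀) ≤ ‖t‖ₑ * (4 * (potConst d μ * (wNorm w * M) * (1 + M))) := by
  rw [h.eq_add ht, add_sub_cancel_left]
  have := (xN d μ).integral_le (h.intervalIntegrable ht)
    (c := 4 * (potConst d μ * (wNorm w * M) * (1 + M))) fun s hs => ?_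
  · rwa [sub_zero] at this
  · rw [xN_freeEvol]
    have hs' := hJ.uIcc_subset h0 ht (uIoc_subset_uIcc hs)
    refine (xN_hartreeF_le hμ (h.mem s hs') hW).trans ?_
    have := hM s hs'
    gcongr

/-- The rate in the stability estimate. -/
def stabRate (d : ℕ) (μ : ℝ) (M : ℝ≥0∞) : ℝ≥0∞ := 1 + 12 * (potConst d μ * M ^ 2) * (3 + lowVol d μ)

/-- The constant in the stability estimate. -/
def stabConst (d : ℕ) (μ : ℝ) (M : ℝ≥0∞) (T : ℝ) : ℝ≥0∞ :=
  2 + (3 + lowVol d μ) * ofReal (2 * (stabRate d μ M).toReal * T *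
    Real.exp (2 * (stabRate d μ M).toReal * T) * 3)

lemma three_add_lowVol_lt_top : 3 + lowVol d μ < ∞ := add_lt_top.2 ⟨by norm_num, lowVol_lt_top⟩

lemma stabRate_lt_top {M : ℝ≥0∞} (hM : M < ∞) : stabRate d μ M < ∞ :=
  add_lt_top.2 ⟨one_lt_top, mul_lt_top (mul_lt_top (by norm_num)
    (mul_lt_top potConst_lt_top (pow_lt_top hM))) three_add_lowVol_lt_top⟩

lemma stabConst_lt_top {M : ℝ≥0∞} {T : ℝ} : stabConst d μ M T < ∞ :=
  add_lt_top.2 ⟨by norm_num, mul_lt_top three_add_lowVol_lt_top ofReal_lt_top⟩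

/-- Stability of the equation with respect to the datum and the potential. -/
theorem IsSolution.stability (hμ : 0 < μ) (h : IsSolution μ w Q₀ J q)
    (h' : IsSolution μ w' Q₀' J q') (hQ₀ : InY μ Q₀) (hQ₀' : InY μ Q₀') (hJ : J.OrdConnected)
    (h0 : (0 : ℝ) ∈ J) (hW : IsPot w) (hW' : IsPot w') {M : ℝ≥0∞} {T : ℝ} (hM1 : 1 ≤ M) (hMt : M < ∞)
    (hw : wNorm w ≤ M) (hw' : wNorm w' ≤ M) (hM : ∀ t ∈ J, yNorm μ (q t) ≤ M)
    (hM' : ∀ t ∈ J, yNorm μ (q' t) ≤ M) (hT : ∀ t ∈ J, |t| ≤ T) {ε : ℝ} (hε : 0 ≤ ε)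
    (hεw : wNorm (w' - w) ≤ ofReal ε) (hεQ : yNorm μ (Q₀' - Q₀) ≤ ofReal ε)
    (hεd : ∀ t ∈ J, eLpNorm (freeLowDensity μ (Q₀' - Q₀) t) 2 volume ≤ ofReal ε) :
    ∀ t ∈ J, yNorm μ (q' t - q t) ≤ stabConst d μ M T * ofReal ε := by
  have hT0 : 0 ≤ T := (abs_nonneg 0).trans (hT 0 h0)
  set D₀ := Q₀' - Q₀ with hD₀
  have hD₀Y : InY μ D₀ := hQ₀'.sub hμ hQ₀
  set R : ℝ → Op d := fun t => q' t - q t - freeEvol t D₀ with hR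
  have hRt : ∀ t, R t = (q' t - freeEvol t Q₀') - (q t - freeEvol t Q₀) := fun t => by
    simp only [hR, hD₀, freeEvol_sub]; abel
  have hsa : ∀ t ∈ J, IsSelfAdjoint (R t) := fun t ht =>
    ((h'.mem t ht).1.sub (h.mem t ht).1).sub (isSelfAdjoint_freeEvol hD₀Y.1 t)
  have hDt : ∀ t ∈ J, yNorm μ (q' t - q t) ≤ 2 * ofReal ε + (3 + lowVol d μ) * xN d μ (R t) := by
    intro t ht
    have e : q' t - q t = freeEvol t D₀ + R t := by simp only [hR]; abel
    rw [e]
    refine (yNorm_add_le hμ (isSelfAdjoint_freeEvol hD₀Y.1 t) (hsa t ht)).trans ?_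
    refine add_le_add ((yNorm_freeEvol_le hμ t D₀).trans ?_) (yNorm_le_xN hμ _)
    rw [two_mul]
    exact add_le_add hεQ (hεd t ht)
  have ha1 : 1 ≤ stabRate d μ M := le_self_add
  have hat := stabRate_lt_top (d := d) (μ := μ) hMt
  set a := (stabRate d μ M).toReal with ha
  have ha0 : 0 < a := ENNReal.toReal_pos (zero_lt_one.trans_le ha1).ne' hat.ne
  have hofa : ofReal a = stabRate d μ M := ofReal_toReal hat.ne
  have key := gronwall_sup (J := J) (φ := fun t => xN d μ (R t)) (a := a) (ε := 3 * ε) (T := T)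
    ha0 (by positivity) hT0 hT
    (B := ofReal T * (4 * (potConst d μ * (M * M) * (1 + M))) +
      ofReal T * (4 * (potConst d μ * (M * M) * (1 + M)))) ?_ ?_ ?_
  · intro t ht
    refine (hDt t ht).trans ?_
    have e1 := key t ht
    have e2 : stabConst d μ M T * ofReal ε = 2 * ofReal ε + (3 + lowVol d μ) *
        ofReal (2 * a * T * Real.exp (2 * a * T) * (3 * ε)) := by
      rw [stabConst, add_mul _ _ (ofReal ε), mul_assoc (3 + lowVol d μ),
        ← ofReal_mul (by positivity), ← ha]
      congr 3; ring
    rw [e2]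
    gcongr
  · have : ofReal T * (4 * (potConst d μ * (M * M) * (1 + M))) < ∞ :=
      mul_lt_top ofReal_lt_top (mul_lt_top (by norm_num)
        (mul_lt_top (mul_lt_top potConst_lt_top (mul_lt_top hMt hMt))
          (add_lt_top.2 ⟨one_lt_top, hMt⟩)))
    exact add_lt_top.2 ⟨this, this⟩
  · intro t ht
    have hte : ‖t‖ₑ ≤ ofReal T := by rw [← ofReal_norm]; exact ofReal_le_ofReal (hT t ht)
    simp only [hRt]
    refine ((xN d μ).sub_le _ _).trans (add_le_add ?_ ?_)
    · exact (h'.xN_sub_free_le hμ hJ h0 hW' hM' ht).trans (by gcongr)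
    · exact (h.xN_sub_free_le hμ hJ h0 hW hM ht).trans (by gcongr)
  · intro m hm hφ t ht
    have e : R t = ∫ s in (0 : ℝ)..t,
        freeEvol (t - s) (hartreeF μ w' (q' s) - hartreeF μ w (q s)) := by
      simp only [freeEvol_sub]
      rw [intervalIntegral.integral_sub (h'.intervalIntegrable ht) (h.intervalIntegrable ht), hRt,
        h'.eq_add ht, h.eq_add ht, add_sub_cancel_left, add_sub_cancel_left]
    change xN d μ (R t) ≤ _
    rw [e]
    refine (xN d μ).integral_le_integral ?_ ?_ ?_ fun s hs => ?_
    · simp only [freeEvol_sub]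
      exact (h'.intervalIntegrable ht).sub (h.intervalIntegrable ht)
    · exact Continuous.intervalIntegrable (by fun_prop) _ _
    · intro s; positivity
    · have hs' := hJ.uIcc_subset h0 ht (uIoc_subset_uIcc hs)
      rw [xN_freeEvol]
      refine (xN_hartreeF_sub_le hμ (h.mem s hs') (h'.mem s hs') hW hW' hM1 hw hw'
        (hM s hs') (hM' s hs')).trans ?_
      rw [ofReal_mul ha0.le, hofa, ofReal_add (by positivity) (by positivity),
        ofReal_mul (by norm_num)]
      have hL : (1 : ℝ≥0∞) ≤ 3 + lowVol d μ := one_le_lowVol.trans le_add_self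
      calc _ ≤ 12 * (potConst d μ * M ^ 2) * ((2 * ofReal ε + (3 + lowVol d μ) *
            ofReal (m * Real.exp (2 * a * |s|))) + ofReal ε) := by
            gcongr
            exact (hDt s hs').trans (by gcongr; exact hφ s hs')
        _ = 12 * (potConst d μ * M ^ 2) * (3 * ofReal ε + (3 + lowVol d μ) *
            ofReal (m * Real.exp (2 * a * |s|))) := by ring
        _ ≤ 12 * (potConst d μ * M ^ 2) * ((3 + lowVol d μ) * (3 * ofReal ε) +
            (3 + lowVol d μ) * ofReal (m * Real.exp (2 * a * |s|))) := by
            exact mul_le_mul' le_rfl (add_le_add (le_mul_of_one_le_left' hL) le_rfl)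
        _ = 12 * (potConst d μ * M ^ 2) * (3 + lowVol d μ) * (3 * ofReal ε +
            ofReal (m * Real.exp (2 * a * |s|))) := by ring
        _ ≤ _ := by
          unfold stabRate
          gcongr
          · exact le_add_self
          · norm_num

lemma eLpNorm_freeLowDensity_zero (t : ℝ) :
    eLpNorm (freeLowDensity μ (0 : Op d) t) 2 volume = 0 := by
  rw [freeLowDensity_eq]
  have e : freeEvol t (0 : Op d) = 0 := by simp [freeEvol]
  rw [e]
  have := eLpNorm_density_lowCut_le (μ := μ) (IsSelfAdjoint.zero (Op d))
  rw [hsNorm_zero, mul_zero] at this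
  exact nonpos_iff_eq_zero.1 this

lemma yNorm_zero (hμ : 0 < μ) : yNorm μ (0 : Op d) = 0 := by
  have := yNorm_le_xN hμ (0 : Op d)
  rw [(xN d μ).map_zero, mul_zero] at this
  exact nonpos_iff_eq_zero.1 this

/-- Uniqueness of solutions. -/
theorem IsSolution.eqOn (hμ : 0 < μ) (h : IsSolution μ w Q₀ J q) (h' : IsSolution μ w Q₀ J q')
    (hQ₀ : InY μ Q₀) (hJ : J.OrdConnected) (h0 : (0 : ℝ) ∈ J) (hW : IsPot w) : EqOn q' q J := by
  intro t ht
  have hs : uIcc 0 t ⊆ J := hJ.uIcc_subset h0 ht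
  obtain ⟨M, hMt, hM⟩ := h.exists_bound hμ isCompact_uIcc hs
  obtain ⟨M', hMt', hM'⟩ := h'.exists_bound hμ isCompact_uIcc hs
  have key := (h.mono hs).stability hμ (h'.mono hs) hQ₀ hQ₀ ordConnected_uIcc left_mem_uIcc
    hW hW (M := 1 + M + M' + wNorm w) (T := |t|) (by rw [add_assoc, add_assoc]; exact le_self_add)
    (by simp only [add_lt_top]; exact ⟨⟨⟨one_lt_top, hMt⟩, hMt'⟩, wNorm_lt_top hW⟩)
    le_add_self le_add_self
    (fun s hs => (hM s hs).trans (by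
      rw [add_assoc, add_assoc, add_left_comm]; exact le_self_add))
    (fun s hs => (hM' s hs).trans (by rw [add_assoc, add_left_comm]; exact le_self_add))
    (fun s hs => by
      have := abs_sub_left_of_mem_uIcc hs
      simpa using this) (ε := 0) le_rfl
    (by simp [wNorm]) (by rw [sub_self, yNorm_zero hμ]; exact zero_le)
    (fun s _ => by rw [sub_self, eLpNorm_freeLowDensity_zero]; exact zero_le) t right_mem_uIcc
  rw [ENNReal.ofReal_zero, mul_zero] at key
  have h3 := (enorm_le_yNorm hμ _).trans key
  rw [nonpos_iff_eq_zero, ← ofReal_norm, ENNReal.ofReal_eq_zero] at h3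
  exact sub_eq_zero.1 (norm_le_zero_iff.1 h3)

end

/-! ### Continuity of the free evolution -/

/-- Dominated convergence for series in `[0, ∞]`. -/
lemma tendsto_tsum_zero {α ι : Type*} {l : Filter α} [l.IsCountablyGenerated] {f : α → ι → ℝ≥0∞}
    {g : ι → ℝ≥0∞} (hg : ∑' i, g i < ∞) (hle : ∀ t i, f t i ≤ g i)
    (h : ∀ i, Tendsto (fun t => f t i) l (𝓝 0)) : Tendsto (fun t => ∑' i, f t i) l (𝓝 0) := by
  let _ : MeasurableSpace ι := ⊤
  simp only [← lintegral_count] at hg ⊢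
  have := tendsto_lintegral_filter_of_dominated_convergence (μ := Measure.count) (l := l)
    (F := f) (f := fun _ => 0) g (.of_forall fun t => measurable_from_top)
    (.of_forall fun t => .of_forall (hle t)) hg.ne (.of_forall h)
  simpa using this

lemma tendsto_zero_of_sq {α : Type*} {l : Filter α} {f : α → ℝ≥0∞}
    (h : Tendsto (fun t => f t ^ 2) l (𝓝 0)) : Tendsto f l (𝓝 0) := by
  have h1 := ((ENNReal.continuous_rpow_const (y := (2 : ℝ)⁻¹)).tendsto 0).comp h
  rw [ENNReal.zero_rpow_of_pos (by norm_num)] at h1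
  refine h1.congr fun t => ?_
  rw [Function.comp_apply, ← ENNReal.rpow_natCast, ← ENNReal.rpow_mul]
  norm_num

lemma tendsto_hsNorm_freeProp_mul (hX : hsNorm X < ∞) :
    Tendsto (fun t => hsNorm (freeProp t * X - X)) (𝓝 0) (𝓝 0) := by
  refine tendsto_zero_of_sq ?_
  simp only [hsNorm_sq_eq_tsum (basis d)]
  refine tendsto_tsum_zero (g := fun i => 4 * ‖X (basis d i)‖ₑ ^ 2) ?_ (fun t i => ?_) fun i => ?_
  · rw [ENNReal.tsum_mul_left, ← hsNorm_sq_eq_tsum]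
    exact mul_lt_top (by norm_num) (pow_lt_top hX)
  · have h1 : ‖(freeProp t * X - X : Op d) (basis d i)‖ₑ ≤ 2 * ‖X (basis d i)‖ₑ := by
      have e : (freeProp t * X - X : Op d) (basis d i) = freeProp t (X (basis d i)) - X (basis d i) := rfl
      rw [e, two_mul]
      refine enorm_sub_le.trans ?_
      gcongr
      exact ((freeProp t).le_opENorm _).trans (mul_le_of_le_one_left' (enorm_freeProp_le t))
    calc _ ≤ (2 * ‖X (basis d i)‖ₑ) ^ 2 := by gcongr
      _ = _ := by ring
  · have h1 : Tendsto (fun t : ℝ => (freeProp t * X - X : Op d) (basis d i)) (𝓝 0) (𝓝 0) := by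
      have h := ((continuous_freeProp_apply (X (basis d i))).tendsto 0).sub_const (X (basis d i))
      rw [freeProp_zero] at h
      simpa using h
    have h2 := (continuous_enorm.tendsto _).comp h1
    rw [enorm_zero] at h2
    have h3 := (ENNReal.continuous_pow 2).tendsto 0 |>.comp h2
    rw [zero_pow two_ne_zero] at h3
    exact h3

lemma tendsto_hsNorm_mul_freeProp (hX : hsNorm X < ∞) :
    Tendsto (fun t => hsNorm (X * freeProp (-t) - X)) (𝓝 0) (𝓝 0) := by
  have h := tendsto_hsNorm_freeProp_mul (X := star X) (by rwa [hsNorm_star])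
  refine h.congr fun t => ?_
  rw [← hsNorm_star (X * freeProp (-t) - X), star_sub, star_mul, star_freeProp, neg_neg]

/-- Seminorms that are invariant under the free evolution, which acts continuously. -/
structure IsFreeCts (p : ExtNorm (L2 d)) : Prop where
  freeEvol_le : ∀ t A, p (freeEvol t A) ≤ p A
  tendsto : ∀ A, p A < ∞ → Tendsto (fun t => p (freeEvol t A - A)) (𝓝 0) (𝓝 0)

lemma freeEvol_sub_self (t : ℝ) (A : Op d) :
    freeEvol t A - A = (freeProp t * A - A) * freeProp (-t) + (A * freeProp (-t) - A) := by
  rw [freeEvol, sub_mul]; abel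

lemma enorm_freeProp_neg_le (t : ℝ) : ‖(freeProp (-t) : Op d)‖ₑ ≤ 1 := enorm_freeProp_le (-t)

lemma isFreeCts_hs : IsFreeCts (hsN d) where
  freeEvol_le := isIdealNorm_hs.freeEvol_le
  tendsto A hA := by
    have h := (tendsto_hsNorm_freeProp_mul hA).add (tendsto_hsNorm_mul_freeProp hA)
    rw [add_zero] at h
    refine tendsto_zero_of_le h fun t => ?_
    change hsNorm _ ≤ _
    rw [freeEvol_sub_self]
    refine (hsNorm_add_le _ _).trans ?_
    gcongr
    exact isIdealNorm_hs.mul_contr_le (enorm_freeProp_neg_le t) _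

lemma isFreeCts_tr : IsFreeCts (trN d) where
  freeEvol_le := isIdealNorm_tr.freeEvol_le
  tendsto A hA := by
    obtain ⟨X, Y, rfl, hX, hY⟩ := exists_hsNorm_factorisation A
    have hX' : hsNorm X < ∞ := by
      by_contra h
      rw [not_lt, top_le_iff] at h
      rw [h, ENNReal.top_pow two_ne_zero] at hX
      exact absurd hA (not_lt.2 hX)
    have hY' : hsNorm Y < ∞ := by
      by_contra h
      rw [not_lt, top_le_iff] at h
      rw [h, ENNReal.top_pow two_ne_zero] at hY
      exact absurd hA (not_lt.2 hY)
    have h1 := ENNReal.Tendsto.mul_const (b := hsNorm Y) (tendsto_hsNorm_freeProp_mul hX')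
      (Or.inr hY'.ne)
    have h2 := ENNReal.Tendsto.const_mul (a := hsNorm X) (tendsto_hsNorm_mul_freeProp hY')
      (Or.inr hX'.ne)
    have h := h1.add h2
    rw [zero_mul, mul_zero, add_zero] at h
    refine tendsto_zero_of_le h fun t => ?_
    change trNorm _ ≤ _
    have e : freeEvol t (X * Y) - X * Y = (freeProp t * X - X) * (Y * freeProp (-t)) +
        X * (Y * freeProp (-t) - Y) := by
      simp only [freeEvol, sub_mul, mul_sub, mul_assoc]; abel
    rw [e]
    refine (trNorm_add_le _ _).trans (add_le_add ?_ (trNorm_mul_le_hsNorm _ _))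
    refine (trNorm_mul_le_hsNorm _ _).trans ?_
    gcongr
    exact isIdealNorm_hs.mul_contr_le (enorm_freeProp_neg_le t) _

lemma norm_freeSymbol_sub_one_le (t : ℝ) (ξ : Space d) : ‖freeSymbol t ξ - 1‖ ≤ |t| * lapSymbol ξ := by
  have e : freeSymbol t ξ = Complex.exp (Complex.I * ((-(t * lapSymbol ξ) : ℝ) : ℂ)) := by
    rw [freeSymbol]; congr 1; push_cast; ring
  have h0 : 0 ≤ lapSymbol ξ := sq_nonneg _
  rw [e]
  refine (Real.norm_exp_I_mul_ofReal_sub_one_le).trans (le_of_eq ?_)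
  rw [Real.norm_eq_abs, abs_neg, abs_mul, abs_of_nonneg h0]

lemma exists_enorm_freeProp_sub_le (hS : MeasurableSet S)
    (hb : Bornology.IsBounded S) : ∃ C : ℝ, 0 ≤ C ∧
      ∀ t : ℝ, ‖(freeProp t * freqProj S - freqProj S : Op d)‖ ≤ |t| * C := by
  obtain ⟨r, hr⟩ := hb.exists_norm_le
  refine ⟨(2 * Real.pi * r) ^ 2, sq_nonneg _, fun t => ?_⟩
  have hm := (memLp_freeSymbol (d := d) t)
  have h1 : MemLp (fun ξ => freeSymbol t ξ * S.indicator (fun _ => (1 : ℂ)) ξ) ∞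
      (volume : Measure (Space d)) := memLp_top_mul hm (memLp_top_indicator hS)
  have e : (freeProp t * freqProj S - freqProj S : Op d) =
      fourierMul fun ξ => (freeSymbol t ξ - 1) * S.indicator (fun _ => 1) ξ := by
    rw [sub_eq_iff_eq_add, freeProp_eq]
    unfold freqProj
    rw [fourierMul_mul hm (memLp_top_indicator hS), ← fourierMul_add
      (memLp_top_mul (m := fun ξ => freeSymbol t ξ - 1) (hm.sub (memLp_top_const 1))
        (memLp_top_indicator hS)) (memLp_top_indicator hS)]
    congr 1; ext ξ; ring
  rw [e]
  refine norm_fourierMul_le (by positivity) (.of_forall fun ξ => ?_)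
  by_cases hξ : ξ ∈ S
  · rw [indicator_of_mem hξ, mul_one]
    refine (norm_freeSymbol_sub_one_le t ξ).trans ?_
    unfold lapSymbol
    have := hr ξ hξ
    gcongr
  · rw [indicator_of_notMem hξ, mul_zero, norm_zero]; positivity

/-- The free evolution is norm continuous on operators with bounded frequencies. -/
lemma tendsto_freeEvol_of_band {S S' : Set (Space d)} (hS : MeasurableSet S)
    (hb : Bornology.IsBounded S) (hS' : MeasurableSet S') (hb' : Bornology.IsBounded S')
    (h : freqProj S * A = A) (h' : A * freqProj S' = A) :
    Tendsto (fun t => ‖freeEvol t A - A‖ₑ) (𝓝 0) (𝓝 0) := by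
  obtain ⟨C, hC, hC1⟩ := exists_enorm_freeProp_sub_le hS hb
  obtain ⟨C', hC', hC1'⟩ := exists_enorm_freeProp_sub_le hS' hb'
  have hle : ∀ t : ℝ, ‖freeEvol t A - A‖ₑ ≤ ofReal (|t| * (C * ‖A‖ + C' * ‖A‖)) := by
    intro t
    rw [← ofReal_norm]
    refine ofReal_le_ofReal ?_
    rw [freeEvol_sub_self]
    have e1 : freeProp t * A - A = (freeProp t * freqProj S - freqProj S) * A := by
      rw [sub_mul, mul_assoc, h]
    have e2 : A * freeProp (-t) - A = A * (freeProp (-t) * freqProj S' - freqProj S') := by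
      rw [mul_sub, ← freqProj_freeProp_comm hS', ← mul_assoc, h']
    have n1 : ‖(freeProp t * A - A) * freeProp (-t)‖ ≤ |t| * C * ‖A‖ := by
      calc _ ≤ ‖(freeProp t * freqProj S - freqProj S) * A‖ * ‖(freeProp (-t) : Op d)‖ := by
            rw [e1]; exact norm_mul_le _ _
        _ ≤ (|t| * C * ‖A‖) * 1 := by
            gcongr
            · exact (norm_mul_le _ _).trans (by gcongr; exact hC1 t)
            · exact norm_freeProp_le _
        _ = _ := mul_one _
    have n2 : ‖A * freeProp (-t) - A‖ ≤ ‖A‖ * (|t| * C') := by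
      rw [e2]
      refine (norm_mul_le _ _).trans ?_
      gcongr
      simpa using hC1' (-t)
    calc _ ≤ |t| * C * ‖A‖ + ‖A‖ * (|t| * C') := (norm_add_le _ _).trans (add_le_add n1 n2)
      _ = _ := by ring
  have hlim : Tendsto (fun t : ℝ => ofReal (|t| * (C * ‖A‖ + C' * ‖A‖))) (𝓝 0) (𝓝 0) := by
    have hc : Continuous fun t : ℝ => ofReal (|t| * (C * ‖A‖ + C' * ‖A‖)) :=
      ENNReal.continuous_ofReal.comp (by fun_prop)
    have := hc.tendsto 0
    simpa using this
  exact tendsto_of_tendsto_of_tendsto_of_le_of_le tendsto_const_nhds hlim (fun _ => zero_le) hle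

lemma isBounded_cube (k : Fin d → ℤ) : Bornology.IsBounded (cube k) := by
  refine (Metric.isBounded_closedBall (x := (0 : Space d))
    (r := √(∑ i, (|(k i : ℝ)| + 1) ^ 2))).subset fun ξ hξ => ?_
  rw [mem_closedBall_zero_iff, EuclideanSpace.norm_eq]
  refine Real.sqrt_le_sqrt (Finset.sum_le_sum fun i _ => ?_)
  have h := hξ i
  have h1 : |ξ i| ≤ |(k i : ℝ)| + 1 := by
    have h2 := Int.floor_le (ξ i)
    have h3 := Int.lt_floor_add_one (ξ i)
    have h4 := le_abs_self (k i : ℝ)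
    have h5 := neg_abs_le (k i : ℝ)
    rw [h] at h2 h3
    rw [abs_le]
    constructor <;> linarith
  rw [Real.norm_eq_abs]
  gcongr

lemma sub_self_le (h : ∀ t A, p (freeEvol t A) ≤ p A) (t : ℝ) (A : Op d) :
    p (freeEvol t A - A) ≤ 2 * p A := by
  rw [two_mul]
  exact (p.sub_le _ _).trans (by gcongr; exact h t A)

lemma isFreeCts_lat (hp : IsIdealNorm p)
    (h : ∀ j k A, p A < ∞ → Tendsto (fun t => p (freeEvol t (block j k A) - block j k A)) (𝓝 0) (𝓝 0)) :
    IsFreeCts (lat p) where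
  freeEvol_le t A := (lat_freeEvol hp t A).le
  tendsto A hA := by
    simp only [lat_apply]
    have e : ∀ (q : (Fin d → ℤ) × (Fin d → ℤ)) (t : ℝ), block q.1 q.2 (freeEvol t A - A) =
        freeEvol t (block q.1 q.2 A) - block q.1 q.2 A := fun q t => by
      rw [← block_freeEvol]; simp only [block, mul_sub, sub_mul]
    refine tendsto_tsum_zero (g := fun q => 2 * p (block q.1 q.2 A)) ?_ (fun t q => ?_) fun q => ?_
    · rw [ENNReal.tsum_mul_left, ← lat_apply]
      exact mul_lt_top (by norm_num) hA
    · rw [e]; exact sub_self_le hp.freeEvol_le _ _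
    · simp only [e]
      exact h _ _ _ ((le_lat p A).trans_lt hA)

lemma isFreeCts_lat_op : IsFreeCts (lat (opN d)) :=
  isFreeCts_lat isIdealNorm_op fun j k A _ => tendsto_freeEvol_of_band (measurableSet_cube j)
    (isBounded_cube j) (measurableSet_cube k) (isBounded_cube k) (cubeProj_mul_block j k A)
    (block_mul_cubeProj j k A)

lemma isFreeCts_lat_hs : IsFreeCts (lat (hsN d)) :=
  isFreeCts_lat isIdealNorm_hs fun j k A hA =>
    isFreeCts_hs.tendsto _ ((isIdealNorm_hs.block_le j k A).trans_lt hA)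

lemma isFreeCts_colSum : IsFreeCts (colSum d) where
  freeEvol_le t A := (colSum_freeEvol t A).le
  tendsto A hA := by
    simp only [colSum_apply]
    have e : ∀ (k : Fin d → ℤ) (t : ℝ), (freeEvol t A - A) * cubeProj k =
        freeEvol t (A * cubeProj k) - A * cubeProj k := fun k t => by
      rw [freeEvol_mul_cubeProj, sub_mul]
    refine tendsto_tsum_zero (g := fun k => 2 * hsNorm (A * cubeProj k)) ?_ (fun t k => ?_) fun k => ?_
    · rw [ENNReal.tsum_mul_left, ← colSum_apply]
      exact mul_lt_top (by norm_num) hA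
    · rw [e]; exact sub_self_le isIdealNorm_hs.freeEvol_le _ _
    · simp only [e]
      exact isFreeCts_hs.tendsto _ ((isIdealNorm_hs.mul_contr_le (enorm_cubeProj_le k) A).trans_lt
        ((hsNorm_le_colSum A).trans_lt hA))

lemma IsFreeCts.add {p q : ExtNorm (L2 d)} (hp : IsFreeCts p) (hq : IsFreeCts q) :
    IsFreeCts (p.add q) where
  freeEvol_le t A := add_le_add (hp.freeEvol_le t A) (hq.freeEvol_le t A)
  tendsto A hA := by
    obtain ⟨h1, h2⟩ := add_lt_top.1 (show p A + q A < ∞ from hA)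
    have := (hp.tendsto A h1).add (hq.tendsto A h2)
    rw [add_zero] at this
    exact this

lemma IsFreeCts.scale (hp : IsFreeCts p) {c : NNReal} (hc : c ≠ 0) : IsFreeCts (p.scale c) where
  freeEvol_le t A := by
    change (c : ℝ≥0∞) * _ ≤ c * _
    gcongr
    exact hp.freeEvol_le t A
  tendsto A hA := by
    have h : p A < ∞ := by
      by_contra h
      rw [not_lt, top_le_iff] at h
      have h' : (c : ℝ≥0∞) * p A < ∞ := hA
      rw [h, mul_top (by simpa using hc)] at h'
      exact lt_irrefl _ h'
    have := ENNReal.Tendsto.const_mul (a := (c : ℝ≥0∞)) (hp.tendsto A h) (Or.inr ENNReal.coe_ne_top)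
    rw [mul_zero] at this
    exact this

lemma IsFreeCts.sandwich (hp : IsFreeCts p) {L R : Op d}
    (hL : ∀ t, freeEvol t L = L) (hR : ∀ t, freeEvol t R = R) : IsFreeCts (p.sandwich L R) := by
  have e : ∀ (t : ℝ) (A : Op d), L * freeEvol t A * R = freeEvol t (L * A * R) := fun t A => by
    rw [freeEvol_mul, freeEvol_mul, hL, hR]
  refine ⟨fun t A => ?_, fun A hA => ?_⟩
  · change p (L * freeEvol t A * R) ≤ p (L * A * R)
    rw [e]; exact hp.freeEvol_le t _
  · refine (hp.tendsto (L * A * R) hA).congr fun t => ?_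
    change _ = p (L * (freeEvol t A - A) * R)
    rw [mul_sub, sub_mul, e]

lemma IsFreeCts.sa (hp : IsFreeCts p) : IsFreeCts p.sa where
  freeEvol_le t A := by
    by_cases hA : IsSelfAdjoint A
    · rw [p.sa_apply hA, p.sa_apply (isSelfAdjoint_freeEvol hA t)]
      exact hp.freeEvol_le t A
    · have : p.sa A = ∞ := by
        by_contra h
        exact hA (p.selfAdjoint_of_sa (lt_top_iff_ne_top.2 h))
      rw [this]; exact le_top
  tendsto A hA := by
    have hs := p.selfAdjoint_of_sa hA
    refine (hp.tendsto A ((p.le_sa A).trans_lt hA)).congr fun t => ?_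
    rw [p.sa_apply ((isSelfAdjoint_freeEvol hs t).sub hs)]

lemma isFreeCts_xN : IsFreeCts (xN d μ) :=
  (isFreeCts_hs.add (isFreeCts_tr.sandwich freeEvol_hi freeEvol_hi)).sa

/-- Continuity of the free evolution of a continuous family. -/
lemma IsFreeCts.tendsto_of_tendsto (hp : IsFreeCts p) {l : Filter ℝ} {t₀ : ℝ}
    (hl : l ≤ 𝓝 t₀) {X : ℝ → Op d} (h0 : p (X t₀) < ∞)
    (hX : Tendsto (fun t => p (X t - X t₀)) l (𝓝 0)) :
    Tendsto (fun t => p (freeEvol t (X t) - freeEvol t₀ (X t₀))) l (𝓝 0) := by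
  have h1 : Tendsto (fun t => t - t₀) l (𝓝 0) := by
    have : Tendsto (fun t => t - t₀) (𝓝 t₀) (𝓝 (t₀ - t₀)) := (continuous_id.sub continuous_const).tendsto t₀
    rw [sub_self] at this
    exact this.mono_left hl
  have h2 := (hp.tendsto (X t₀) h0).comp h1
  have h := hX.add h2
  rw [add_zero] at h
  refine tendsto_zero_of_le h fun t => ?_
  have e : freeEvol t (X t) - freeEvol t₀ (X t₀) =
      freeEvol t (X t - X t₀) + freeEvol t₀ (freeEvol (t - t₀) (X t₀) - X t₀) := by
    rw [freeEvol_sub, freeEvol_sub, freeEvol_freeEvol, add_sub_cancel]; abel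
  rw [e]
  exact (p.add_le _ _).trans (add_le_add (hp.freeEvol_le _ _) (hp.freeEvol_le _ _))

/-! ### Bounds for the maps between the spaces `FN p` -/

namespace FN

section

variable {p q r : ExtNorm H}

lemma norm_lin_le {L : BOp H → (BOp H)} {C : NNReal}
    (hadd : ∀ A B, p A < ∞ → p B < ∞ → L (A + B) = L A + L B)
    (hsmul : ∀ (c : ℝ) A, p A < ∞ → L (c • A) = c • L A)
    (hL : ∀ A, p A < ∞ → ‖L A‖ₑ + q (L A) ≤ C * (‖A‖ₑ + p A)) (a : FN p) :
    ‖(lin L C hadd hsmul hL : FN p →L[ℝ] FN q) a‖ ≤ C * ‖a‖ :=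
  ContinuousLinearMap.le_of_opNorm_le _ (LinearMap.mkContinuous_norm_le _ C.coe_nonneg _) a

lemma tendsto_of_enorm {α : Type*} {l : Filter α} {u : α → FN p} {a : FN p}
    (h1 : Tendsto (fun t => ‖(u t).val - a.val‖ₑ) l (𝓝 0))
    (h2 : Tendsto (fun t => p ((u t).val - a.val)) l (𝓝 0)) : Tendsto u l (𝓝 a) := by
  rw [tendsto_iff_edist_tendsto_0]
  have := h1.add h2
  rw [add_zero] at this
  refine this.congr fun t => ?_
  rw [edist_eq_enorm_sub, enorm_def]; rfl

end

def evol (hp : IsFreeCts p) (t : ℝ) : FN p →L[ℝ] FN p :=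
  FN.lin (freeEvol t) 1 (fun A B _ _ => freeEvol_add t A B) (fun c A _ => freeEvol_smul c t A)
    fun A _ => by
      rw [ENNReal.coe_one, one_mul]
      exact add_le_add (isIdealNorm_op.freeEvol_le t A) (hp.freeEvol_le t A)

lemma norm_evol_le (hp : IsFreeCts p) (t : ℝ) (a : FN p) : ‖evol hp t a‖ ≤ ‖a‖ := by
  have := norm_lin_le (q := p) (C := 1) (fun A B _ _ => freeEvol_add t A B)
    (fun c A _ => freeEvol_smul c t A) (fun A _ => by
      rw [ENNReal.coe_one, one_mul]
      exact add_le_add (isIdealNorm_op.freeEvol_le t A) (hp.freeEvol_le t A)) a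
  rw [NNReal.coe_one, one_mul] at this
  exact this

lemma continuous_evol (hp : IsFreeCts p) (hop : ∀ A : Op d, ‖A‖ₑ ≤ p A) (a : FN p) :
    Continuous fun t => evol hp t a := by
  rw [continuous_iff_continuousAt]
  intro t₀
  have h : Tendsto (fun t => p (freeEvol t a.val - freeEvol t₀ a.val)) (𝓝 t₀) (𝓝 0) := by
    refine hp.tendsto_of_tendsto (X := fun _ => a.val) le_rfl a.lt_top ?_
    simp
  refine tendsto_of_enorm ?_ h
  exact tendsto_zero_of_le h fun t => hop _

end FN

/-! ### An abstract local existence theorem -/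

/-- A lower bound of the existence time. -/
def lifeTime (β ℓ r : ℝ) : ℝ := min 1 (r / (β * (r + ℓ * (2 * r)) ^ 2 + 1))

lemma lifeTime_pos {β ℓ r : ℝ} (hβ : 0 ≤ β) (hr : 0 < r) : 0 < lifeTime β ℓ r := by
  unfold lifeTime; positivity

lemma lifeTime_le_one (β ℓ r : ℝ) : lifeTime β ℓ r ≤ 1 := min_le_left _ _

lemma lifeTime_mul_le {β ℓ r : ℝ} (hβ : 0 ≤ β) :
    β * (r + ℓ * (2 * r)) ^ 2 * lifeTime β ℓ r ≤ r ∨ r < 0 := by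
  by_cases hr : r < 0
  · exact Or.inr hr
  left
  have h0 : 0 ≤ β * (r + ℓ * (2 * r)) ^ 2 := by positivity
  calc _ ≤ β * (r + ℓ * (2 * r)) ^ 2 * (r / (β * (r + ℓ * (2 * r)) ^ 2 + 1)) := by
        gcongr; exact min_le_right _ _
    _ = (β * (r + ℓ * (2 * r)) ^ 2) / (β * (r + ℓ * (2 * r)) ^ 2 + 1) * r := by ring
    _ ≤ 1 * r := by
        gcongr
        · exact not_lt.1 hr
        · rw [div_le_one (by positivity)]; linarith
    _ = r := one_mul r

section Picard

variable {E X Y : Type*} [NormedAddCommGroup E] [NormedSpace ℝ E]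
  [NormedAddCommGroup X] [NormedSpace ℝ X] [NormedAddCommGroup Y] [NormedSpace ℝ Y]

/-- A quadratic evolution equation in the interaction picture. -/
structure QuadraticFlow (E X Y : Type*) [NormedAddCommGroup E] [NormedSpace ℝ E]
    [NormedAddCommGroup X] [NormedSpace ℝ X] [NormedAddCommGroup Y] [NormedSpace ℝ Y]
    (β ℓ : ℝ) where
  S : ℝ → E →L[ℝ] E
  norm_S_le : ∀ t u, ‖S t u‖ ≤ ‖u‖
  continuous_S : ∀ u, Continuous fun t => S t u
  B : X → Y → E
  B_sub : ∀ x x' y y', B x y - B x' y' = B (x - x') y + B x' (y - y')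
  norm_B_le : ∀ x y, ‖B x y‖ ≤ β * ‖x‖ * ‖y‖
  L : E →L[ℝ] X
  norm_L_le : ∀ u, ‖L u‖ ≤ ℓ * ‖u‖
  M : E →L[ℝ] Y
  norm_M_le : ∀ u, ‖M u‖ ≤ ℓ * ‖u‖
  v : ℝ → X
  a : ℝ → Y

namespace QuadraticFlow

variable {β ℓ : ℝ} (F : QuadraticFlow E X Y β ℓ)

def field (t : ℝ) (u : E) : E := F.S (-t) (F.B (F.v t + F.L (F.S t u)) (F.a t + F.M (F.S t u)))

lemma continuousOn_S {K : Set ℝ} {g : ℝ → E} {τ : ℝ → ℝ} (hτ : ContinuousOn τ K)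
    (hg : ContinuousOn g K) : ContinuousOn (fun t => F.S (τ t) (g t)) K := by
  intro t₀ ht₀
  have h1 : Tendsto (fun t => F.S (τ t) (g t₀)) (𝓝[K] t₀) (𝓝 (F.S (τ t₀) (g t₀))) :=
    ((F.continuous_S (g t₀)).tendsto _).comp (hτ t₀ ht₀)
  have h2 : Tendsto (fun t => F.S (τ t) (g t - g t₀)) (𝓝[K] t₀) (𝓝 0) := by
    refine squeeze_zero_norm (fun t => F.norm_S_le _ _) ?_
    exact tendsto_iff_norm_sub_tendsto_zero.1 (hg t₀ ht₀)
  have h := h2.add h1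
  rw [zero_add] at h
  refine h.congr fun t => ?_
  rw [map_sub, sub_add_cancel]

lemma continuousOn_B {K : Set ℝ} {x : ℝ → X} {y : ℝ → Y} (hx : ContinuousOn x K)
    (hy : ContinuousOn y K) : ContinuousOn (fun t => F.B (x t) (y t)) K := by
  intro t₀ ht₀
  have hx' := tendsto_iff_norm_sub_tendsto_zero.1 (hx t₀ ht₀)
  have hy' := tendsto_iff_norm_sub_tendsto_zero.1 (hy t₀ ht₀)
  have hyn := (hy t₀ ht₀).norm
  have h : Tendsto (fun t => β * ‖x t - x t₀‖ * ‖y t‖ + β * ‖x t₀‖ * ‖y t - y t₀‖) (𝓝[K] t₀)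
      (𝓝 0) := by
    have := ((hx'.const_mul β).mul hyn).add (hy'.const_mul (β * ‖x t₀‖))
    simpa using this
  refine tendsto_iff_norm_sub_tendsto_zero.2 (squeeze_zero (fun _ => norm_nonneg _) (fun t => ?_) h)
  rw [F.B_sub]
  exact (norm_add_le _ _).trans (add_le_add (F.norm_B_le _ _) (F.norm_B_le _ _))

lemma continuousOn_field {K : Set ℝ} (hv : ContinuousOn F.v K) (ha : ContinuousOn F.a K)
    {u : ℝ → E} (hu : ContinuousOn u K) : ContinuousOn (fun t => F.field t (u t)) K := by
  have hS := F.continuousOn_S continuousOn_id hu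
  refine F.continuousOn_S continuousOn_id.neg (F.continuousOn_B ?_ ?_)
  · exact hv.add (F.L.continuous.comp_continuousOn hS)
  · exact ha.add (F.M.continuous.comp_continuousOn hS)

theorem exists_solution [CompleteSpace E] (hβ : 0 ≤ β) (hℓ : 0 ≤ ℓ) {r : ℝ} (hr : 0 < r)
    (hv : ContinuousOn F.v (Icc (-1) 1)) (ha : ContinuousOn F.a (Icc (-1) 1))
    (hvr : ∀ t ∈ Icc (-1 : ℝ) 1, ‖F.v t‖ ≤ r) (har : ∀ t ∈ Icc (-1 : ℝ) 1, ‖F.a t‖ ≤ r)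
    {u₀ : E} (hu₀ : ‖u₀‖ ≤ r) : ∃ u : ℝ → E, Continuous u ∧
      ∀ t ∈ Icc (-lifeTime β ℓ r) (lifeTime β ℓ r), u t = u₀ + ∫ s in (0 : ℝ)..t, F.field s (u s) := by
  set c := lifeTime β ℓ r with hc
  have hc0 : 0 < c := lifeTime_pos hβ hr
  have hc1 : Icc (-c) c ⊆ Icc (-1) 1 := by
    have := lifeTime_le_one β ℓ r
    exact Icc_subset_Icc (by linarith) (by linarith)
  have hball : ∀ u ∈ Metric.closedBall u₀ r, ‖u‖ ≤ 2 * r := fun u hu => by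
    have h1 : ‖u - u₀‖ ≤ r := by rwa [← dist_eq_norm]
    calc ‖u‖ = ‖(u - u₀) + u₀‖ := by rw [sub_add_cancel]
      _ ≤ ‖u - u₀‖ + ‖u₀‖ := norm_add_le _ _
      _ ≤ 2 * r := by linarith
  have hx : ∀ t ∈ Icc (-1 : ℝ) 1, ∀ u : E, ‖u‖ ≤ 2 * r →
      ‖F.v t + F.L (F.S t u)‖ ≤ r + ℓ * (2 * r) := fun t ht u hu =>
    (norm_add_le _ _).trans (add_le_add (hvr t ht) ((F.norm_L_le _).trans
      (by gcongr; exact (F.norm_S_le _ _).trans hu)))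
  have hy : ∀ t ∈ Icc (-1 : ℝ) 1, ∀ u : E, ‖u‖ ≤ 2 * r →
      ‖F.a t + F.M (F.S t u)‖ ≤ r + ℓ * (2 * r) := fun t ht u hu =>
    (norm_add_le _ _).trans (add_le_add (har t ht) ((F.norm_M_le _).trans
      (by gcongr; exact (F.norm_S_le _ _).trans hu)))
  have hR : 0 ≤ r + ℓ * (2 * r) := by positivity
  have hP : IsPicardLindelof F.field (tmin := -c) (tmax := c)
      (⟨0, by constructor <;> linarith⟩ : Icc (-c) c) u₀ ⟨r, hr.le⟩ 0
      ⟨β * (r + ℓ * (2 * r)) ^ 2, by positivity⟩ ⟨2 * β * ℓ * (r + ℓ * (2 * r)), by positivity⟩ := by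
    refine ⟨fun t ht => ?_, fun u hu => ?_, fun t ht u hu => ?_, ?_⟩
    · refine LipschitzOnWith.of_dist_le_mul fun u hu u' hu' => ?_
      have hu1 := hball u hu
      have hu2 := hball u' hu'
      rw [dist_eq_norm, dist_eq_norm]
      unfold field
      rw [← map_sub]
      refine (F.norm_S_le _ _).trans ?_
      rw [F.B_sub, add_sub_add_left_eq_sub, add_sub_add_left_eq_sub, ← map_sub F.L,
        ← map_sub F.M, ← map_sub (F.S t)]
      refine (norm_add_le _ _).trans ((add_le_add (F.norm_B_le _ _) (F.norm_B_le _ _)).trans ?_)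
      have e1 : ‖F.L (F.S t (u - u'))‖ ≤ ℓ * ‖u - u'‖ :=
        (F.norm_L_le _).trans (by gcongr; exact F.norm_S_le _ _)
      have e2 : ‖F.M (F.S t (u - u'))‖ ≤ ℓ * ‖u - u'‖ :=
        (F.norm_M_le _).trans (by gcongr; exact F.norm_S_le _ _)
      calc _ ≤ β * (ℓ * ‖u - u'‖) * (r + ℓ * (2 * r)) +
            β * (r + ℓ * (2 * r)) * (ℓ * ‖u - u'‖) := by
            gcongr
            · exact hy t (hc1 ht) u hu1
            · exact hx t (hc1 ht) u' hu2
        _ = 2 * β * ℓ * (r + ℓ * (2 * r)) * ‖u - u'‖ := by ring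
    · exact F.continuousOn_field (hv.mono hc1) (ha.mono hc1) continuousOn_const
    · have hu1 := hball u hu
      refine (F.norm_S_le _ _).trans ((F.norm_B_le _ _).trans ?_)
      calc _ ≤ β * (r + ℓ * (2 * r)) * (r + ℓ * (2 * r)) := by
            gcongr
            · exact hx t (hc1 ht) u hu1
            · exact hy t (hc1 ht) u hu1
        _ = β * (r + ℓ * (2 * r)) ^ 2 := by ring
    · have := (lifeTime_mul_le (ℓ := ℓ) (r := r) hβ).resolve_right (not_lt.2 hr.le)
      change β * (r + ℓ * (2 * r)) ^ 2 * max (c - 0) (0 - -c) ≤ r - (0 : ℝ)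
      simpa using this
  have hm : u₀ ∈ Metric.closedBall u₀ ((0 : NNReal) : ℝ) := by simp
  obtain ⟨α, hα⟩ := ODE.FunSpace.exists_isFixedPt_next hP hm
  refine ⟨α.compProj, α.continuous_compProj, fun t ht => ?_⟩
  have e : α.compProj t = (ODE.FunSpace.next hP hm α).toFun ⟨t, ht⟩ := by
    rw [hα]
    exact congrArg α.toFun (projIcc_of_mem _ ht)
  exact e

end QuadraticFlow

end Picard

section

namespace ExtNorm

variable (p q : ExtNorm H)

lemma sandwich_apply (L R A : BOp H) : p.sandwich L R A = p (L * A * R) := rfl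

lemma add_apply (A : BOp H) : p.add q A = p A + q A := rfl

lemma scale_apply (c : NNReal) (A : BOp H) : p.scale c A = c * p A := rfl

end ExtNorm

variable {c : NNReal}

/-! ### Scalar multiplication by `-i` and commutators in the lattice norms -/

def negI (d : ℕ) : Op d := (-Complex.I) • 1

lemma enorm_negI_le : ‖negI d‖ₑ ≤ 1 := by
  have h : ‖negI d‖ = ‖(1 : Op d)‖ := by rw [negI, norm_smul, norm_neg, Complex.norm_I, one_mul]
  rw [← ofReal_norm, h, ofReal_norm]
  exact enorm_one_op_le

lemma negI_mul (A : Op d) : negI d * A = (-Complex.I) • A := by rw [negI, smul_mul_assoc, one_mul]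

lemma lat_negI_smul_le (hp : IsIdealNorm p) (A : Op d) : lat p ((-Complex.I) • A) ≤ lat p A := by
  rw [lat_apply, lat_apply]
  refine tsum_le_tsum fun q => ?_
  have e : block q.1 q.2 ((-Complex.I) • A) = (-Complex.I) • block q.1 q.2 A := by
    simp only [block, mul_smul_comm, smul_mul_assoc]
  rw [e]
  exact hp.neg_I_smul_le _

lemma colSum_negI_smul_le (A : Op d) : colSum d ((-Complex.I) • A) ≤ colSum d A := by
  rw [← negI_mul]
  exact (colSum_op_mul_le _ _).trans (mul_le_of_le_one_left' enorm_negI_le)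

lemma lat_qcomm_le (hp : IsIdealNorm p) {V A : Op d}
    (hV : IsSelfAdjoint V) (hA : IsSelfAdjoint A) : lat p (qcomm V A) ≤ 2 * lat p (V * A) := by
  have h1 : star V = V := hV
  have h2 : star A = A := hA
  have h3 : lat p (A * V) = lat p (V * A) := by rw [← lat_star hp, star_mul, h1, h2]
  calc lat p (qcomm V A) ≤ lat p (V * A - A * V) := lat_negI_smul_le hp _
    _ ≤ lat p (V * A) + lat p (A * V) := (lat p).sub_le _ _
    _ = 2 * lat p (V * A) := by rw [h3]; ring

lemma hiProj_eq : (hiProj μ : Op d) = freqProj (lowSet d (2 * μ))ᶜ := by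
  rw [hiProj, sub_eq_iff_eq_add, loProj]
  unfold freqProj
  rw [← fourierMul_add (memLp_top_indicator (measurableSet_lowSet _).compl)
    (memLp_top_indicator (measurableSet_lowSet _)), ← fourierMul_one]
  congr 1
  ext ξ
  by_cases hξ : ξ ∈ lowSet d (2 * μ) <;> simp [hξ]

lemma lat_mul_hi_le (hp : IsIdealNorm p) (A : Op d) : lat p (A * hiProj μ) ≤ lat p A := by
  rw [hiProj_eq]
  exact lat_mul_freqProj_le hp A (measurableSet_lowSet _).compl

lemma trNorm_mul_hi_le (A : Op d) : trNorm (A * hiProj μ) ≤ trNorm A :=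
  isIdealNorm_tr.mul_contr_le enorm_hi_le A

lemma trNorm_hi_mul_le (A : Op d) : trNorm (hiProj μ * A) ≤ trNorm A :=
  isIdealNorm_tr.contr_mul_le enorm_hi_le A

/-! ### The norms of the local theory -/

/-- Seminorm for `Π_μ` plus the low-momentum part. -/
def pA (d : ℕ) (μ : ℝ) (c : NNReal) : ExtNorm (L2 d) :=
  ((lat (opN d)).add (((lat (hsN d)).sandwich 1 (hiProj μ)).scale c)).sa

/-- Seminorm for the correction of the low-momentum part. -/
def pD (d : ℕ) (μ : ℝ) (c : NNReal) : ExtNorm (L2 d) :=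
  (((lat (opN d)).add ((lat (hsN d)).scale c)).add
    (((trN d).sandwich (hiProj μ) (hiProj μ)).scale (c ^ 2))).sa

/-- Seminorm for the Hilbert–Schmidt part. -/
def pK (d : ℕ) (μ : ℝ) (c : NNReal) : ExtNorm (L2 d) :=
  (colSum d).add (((trN d).sandwich 1 (hiProj μ)).scale c)

/-- Seminorm for the trace-class part. -/
def pS (d : ℕ) : ExtNorm (L2 d) := (trN d).sa

/-- Seminorm for the potentials generated by the low-momentum part. -/
def pW (d : ℕ) (c : NNReal) : ExtNorm (L2 d) :=
  (((opN d).add (band (opN d))).add ((band (hsN d)).scale c)).sa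

/-- Seminorm for the potentials generated by the Hilbert–Schmidt and trace-class parts. -/
def pL (d : ℕ) : ExtNorm (L2 d) := ((opN d).add (colSup d)).sa

variable {A V : Op d}

lemma pA_apply (hA : IsSelfAdjoint A) :
    pA d μ c A = lat (opN d) A + c * lat (hsN d) (A * hiProj μ) := by
  rw [pA, ExtNorm.sa_apply _ hA, ExtNorm.add_apply, ExtNorm.scale_apply,
    ExtNorm.sandwich_apply, one_mul]

lemma pD_apply (hA : IsSelfAdjoint A) : pD d μ c A = lat (opN d) A + c * lat (hsN d) A +
    c ^ 2 * trNorm (hiProj μ * A * hiProj μ) := by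
  rw [pD, ExtNorm.sa_apply _ hA, ExtNorm.add_apply, ExtNorm.add_apply,
    ExtNorm.scale_apply, ExtNorm.scale_apply, ExtNorm.sandwich_apply, trN_apply,
    ENNReal.coe_pow]

lemma pK_apply (A : Op d) : pK d μ c A = colSum d A + c * trNorm (A * hiProj μ) := by
  rw [pK, ExtNorm.add_apply, ExtNorm.scale_apply, ExtNorm.sandwich_apply, trN_apply, one_mul]

lemma pS_apply (hA : IsSelfAdjoint A) : pS d A = trNorm A := ExtNorm.sa_apply _ hA

lemma pW_apply (hA : IsSelfAdjoint A) :
    pW d c A = ‖A‖ₑ + band (opN d) A + c * band (hsN d) A := ExtNorm.sa_apply _ hA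

lemma pL_apply (hA : IsSelfAdjoint A) : pL d A = ‖A‖ₑ + colSup d A := ExtNorm.sa_apply _ hA

lemma isFreeCts_pD (hc : c ≠ 0) : IsFreeCts (pD d μ c) :=
  ((isFreeCts_lat_op.add (isFreeCts_lat_hs.scale hc)).add
    ((isFreeCts_tr.sandwich freeEvol_hi freeEvol_hi).scale (pow_ne_zero 2 hc))).sa

lemma freeEvol_one (t : ℝ) : freeEvol t (1 : Op d) = 1 :=
  freeEvol_of_comm t (by rw [one_mul, mul_one])

lemma isFreeCts_pK (hc : c ≠ 0) : IsFreeCts (pK d μ c) :=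
  isFreeCts_colSum.add ((isFreeCts_tr.sandwich freeEvol_one freeEvol_hi).scale hc)

lemma isFreeCts_pS : IsFreeCts (pS d) := isFreeCts_tr.sa

lemma lat_op_le_pD (A : Op d) : lat (opN d) A ≤ pD d μ c A :=
  (le_self_add.trans le_self_add).trans (ExtNorm.le_sa _ A)

lemma lat_hs_le_pD (A : Op d) : c * lat (hsN d) A ≤ pD d μ c A :=
  (le_add_self.trans le_self_add : (c : ℝ≥0∞) * lat (hsN d) A ≤ lat (opN d) A + c * lat (hsN d) A +
    ((c ^ 2 : NNReal) : ℝ≥0∞) * trNorm (hiProj μ * A * hiProj μ)).trans (ExtNorm.le_sa _ A)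

lemma enorm_le_pD (A : Op d) : ‖A‖ₑ ≤ pD d μ c A := (le_lat (opN d) A).trans (lat_op_le_pD A)

lemma colSum_le_pK (A : Op d) : colSum d A ≤ pK d μ c A := le_self_add

lemma enorm_le_pK (A : Op d) : ‖A‖ₑ ≤ pK d μ c A :=
  ((enorm_le_hsNorm A).trans (hsNorm_le_colSum A)).trans (colSum_le_pK A)

lemma trNorm_le_pS (A : Op d) : trNorm A ≤ pS d A := ExtNorm.le_sa (trN d) A

lemma enorm_le_pS (A : Op d) : ‖A‖ₑ ≤ pS d A := (enorm_le_trNorm A).trans (trNorm_le_pS A)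

/-! ### Product estimates -/

lemma enorm_add_pK_le {x : ℝ≥0∞} (h : colSum d A ≤ x) (h' : c * trNorm (A * hiProj μ) ≤ x) :
    ‖A‖ₑ + pK d μ c A ≤ 3 * x := by
  rw [pK_apply]
  calc _ ≤ x + (x + x) := add_le_add (((enorm_le_hsNorm _).trans (hsNorm_le_colSum _)).trans h)
        (add_le_add h h')
    _ = _ := by ring

lemma enorm_add_pS_le {x : ℝ≥0∞} (hA : IsSelfAdjoint A) (h : trNorm A ≤ x) :
    ‖A‖ₑ + pS d A ≤ 2 * x := by
  rw [pS_apply hA, two_mul]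
  exact add_le_add ((enorm_le_trNorm _).trans h) h

lemma qcomm_pD_le (hV : pW d c V < ∞) (hA : pA d μ c A < ∞) :
    ‖qcomm V A‖ₑ + pD d μ c (qcomm V A) ≤ 8 * (pW d c V * pA d μ c A) := by
  have sV := selfAdjoint_of_sa _ hV
  have sA := selfAdjoint_of_sa _ hA
  have b1 : lat (opN d) (V * A) ≤ pW d c V * pA d μ c A := by
    refine (lat_mul_le (p := opN d) (q := opN d) enorm_mul_op_le V A).trans ?_
    rw [pW_apply sV, pA_apply sA]
    gcongr
    · exact le_add_self.trans le_self_add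
    · exact le_self_add
  have b2 : c * lat (hsN d) (V * A) ≤ pW d c V * pA d μ c A := by
    refine (mul_le_mul_right (lat_mul_le (p := hsN d) (q := opN d) (r := hsN d)
      (fun S T => isIdealNorm_hs.mul_le' S T) V A) _).trans ?_
    rw [← mul_assoc, pW_apply sV, pA_apply sA]
    gcongr
    · exact le_add_self
    · exact le_self_add
  have b3 : (c : ℝ≥0∞) ^ 2 * trNorm (hiProj μ * (V * A) * hiProj μ) ≤ pW d c V * pA d μ c A := by
    have h1 : trNorm (hiProj μ * (V * A) * hiProj μ) ≤
        band (hsN d) V * lat (hsN d) (A * hiProj μ) := by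
      rw [mul_assoc, mul_assoc]
      refine (trNorm_hi_mul_le _).trans ((trNorm_mul_le_lat _ _).trans ?_)
      gcongr
      exact colSup_le_band V
    calc _ ≤ (c : ℝ≥0∞) ^ 2 * (band (hsN d) V * lat (hsN d) (A * hiProj μ)) := by gcongr
      _ = (c * band (hsN d) V) * (c * lat (hsN d) (A * hiProj μ)) := by ring
      _ ≤ _ := by
        rw [pW_apply sV, pA_apply sA]
        gcongr
        · exact le_add_self
        · exact le_add_self
  generalize pW d c V * pA d μ c A = x at b1 b2 b3 ⊢
  have c1 : lat (opN d) (qcomm V A) ≤ 2 * x := (lat_qcomm_le isIdealNorm_op sV sA).trans (by gcongr)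
  have c2 : c * lat (hsN d) (qcomm V A) ≤ 2 * x := by
    calc _ ≤ c * (2 * lat (hsN d) (V * A)) := by gcongr; exact lat_qcomm_le isIdealNorm_hs sV sA
      _ = 2 * (c * lat (hsN d) (V * A)) := by ring
      _ ≤ _ := by gcongr
  have c3 : (c : ℝ≥0∞) ^ 2 * trNorm (hiProj μ * qcomm V A * hiProj μ) ≤ 2 * x := by
    calc _ ≤ (c : ℝ≥0∞) ^ 2 * (2 * trNorm (hiProj μ * (V * A) * hiProj μ)) := by
          gcongr; exact trNorm_hi_qcomm_hi_le sV sA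
      _ = 2 * ((c : ℝ≥0∞) ^ 2 * trNorm (hiProj μ * (V * A) * hiProj μ)) := by ring
      _ ≤ _ := by gcongr
  rw [pD_apply (isSelfAdjoint_qcomm sV sA)]
  calc _ ≤ 2 * x + (2 * x +
        2 * x + 2 * x) := by
        gcongr
        exact (le_lat (opN d) _).trans c1
    _ = _ := by ring

def lmul (V A : Op d) : Op d := (-Complex.I) • (V * A)

lemma lmul_pA_le (hV : pL d V < ∞) (hA : pA d μ c A < ∞) :
    ‖lmul V A‖ₑ + pK d μ c (lmul V A) ≤ 8 * (pL d V * pA d μ c A) := by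
  have sV := selfAdjoint_of_sa _ hV
  have sA := selfAdjoint_of_sa _ hA
  have b1 : colSum d (lmul V A) ≤ pL d V * pA d μ c A := by
    refine (colSum_negI_smul_le _).trans ((colSum_mul_le V A).trans ?_)
    rw [pL_apply sV, pA_apply sA]
    gcongr
    · exact le_add_self
    · exact le_self_add
  have b2 : c * trNorm (lmul V A * hiProj μ) ≤ pL d V * pA d μ c A := by
    have h1 : trNorm (lmul V A * hiProj μ) ≤ colSup d V * lat (hsN d) (A * hiProj μ) := by
      rw [lmul, smul_mul_assoc, mul_assoc]
      exact (isIdealNorm_tr.neg_I_smul_le _).trans (trNorm_mul_le_lat _ _)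
    calc _ ≤ c * (colSup d V * lat (hsN d) (A * hiProj μ)) := by gcongr
      _ = colSup d V * (c * lat (hsN d) (A * hiProj μ)) := by ring
      _ ≤ _ := by
        rw [pL_apply sV, pA_apply sA]
        gcongr
        · exact le_add_self
        · exact le_add_self
  exact (enorm_add_pK_le b1 b2).trans (by gcongr; norm_num)

lemma lmul_pK_le (hV : pL d V < ∞) (A : Op d) :
    ‖lmul V A‖ₑ + pK d μ c (lmul V A) ≤ 8 * (pL d V * pK d μ c A) := by
  have hV' : ‖V‖ₑ ≤ pL d V := by rw [pL_apply (selfAdjoint_of_sa _ hV)]; exact le_self_add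
  have b1 : colSum d (lmul V A) ≤ pL d V * pK d μ c A := by
    refine (colSum_negI_smul_le _).trans ((colSum_op_mul_le V A).trans ?_)
    gcongr
    exact colSum_le_pK A
  have b2 : c * trNorm (lmul V A * hiProj μ) ≤ pL d V * pK d μ c A := by
    have h1 : trNorm (lmul V A * hiProj μ) ≤ ‖V‖ₑ * trNorm (A * hiProj μ) := by
      rw [lmul, smul_mul_assoc, mul_assoc]
      exact (isIdealNorm_tr.neg_I_smul_le _).trans (trNorm_mul_le _ _)
    calc _ ≤ c * (‖V‖ₑ * trNorm (A * hiProj μ)) := by gcongr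
      _ = ‖V‖ₑ * (c * trNorm (A * hiProj μ)) := by ring
      _ ≤ _ := by
        rw [pK_apply]
        gcongr
        exact le_add_self
  exact (enorm_add_pK_le b1 b2).trans (by gcongr; norm_num)

lemma qcomm_pK_le (hV : pW d c V < ∞) (A : Op d) :
    ‖qcomm V A‖ₑ + pK d μ c (qcomm V A) ≤ 8 * (pW d c V * pK d μ c A) := by
  have sV := selfAdjoint_of_sa _ hV
  have hs : star V = V := sV
  have w1 : ‖V‖ₑ ≤ pW d c V := by rw [pW_apply sV]; exact le_self_add.trans le_self_add
  have w2 : band (opN d) V ≤ pW d c V := by rw [pW_apply sV]; exact le_add_self.trans le_self_add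
  have w3 : c * colSup d V ≤ pW d c V := by
    rw [pW_apply sV]
    exact (mul_le_mul_right (colSup_le_band V) _).trans le_add_self
  have k1 : colSum d A ≤ pK d μ c A := colSum_le_pK A
  have k2 : c * trNorm (A * hiProj μ) ≤ pK d μ c A := le_add_self.trans (pK_apply A).ge
  generalize pW d c V = v at w1 w2 w3 ⊢
  generalize pK d μ c A = k at k1 k2 ⊢
  have b1 : colSum d (qcomm V A) ≤ 2 * (v * k) := by
    calc _ ≤ colSum d (V * A - A * V) := colSum_negI_smul_le _
      _ ≤ colSum d (V * A) + colSum d (A * V) := (colSum d).sub_le _ _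
      _ ≤ v * k + k * v := by
        gcongr
        · exact (colSum_op_mul_le V A).trans (by gcongr)
        · refine (colSum_mul_band_le A V).trans ?_
          rw [hs]; gcongr
      _ = _ := by ring
  have b2 : c * trNorm (qcomm V A * hiProj μ) ≤ 2 * (v * k) := by
    have h1 : trNorm (qcomm V A * hiProj μ) ≤
        ‖V‖ₑ * trNorm (A * hiProj μ) + colSum d A * colSup d V := by
      rw [qcomm, smul_mul_assoc, sub_mul]
      refine (isIdealNorm_tr.neg_I_smul_le _).trans (((trN d).sub_le _ _).trans (add_le_add ?_ ?_))
      · rw [mul_assoc]; exact trNorm_mul_le _ _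
      · refine (trNorm_mul_hi_le _).trans ((trNorm_mul_le_colSum A V).trans ?_)
        rw [hs]
    calc _ ≤ c * (‖V‖ₑ * trNorm (A * hiProj μ) + colSum d A * colSup d V) := by gcongr
      _ = ‖V‖ₑ * (c * trNorm (A * hiProj μ)) + colSum d A * (c * colSup d V) := by ring
      _ ≤ v * k + k * v := by gcongr
      _ = _ := by ring
  refine (enorm_add_pK_le b1 b2).trans ?_
  rw [← mul_assoc]
  gcongr
  norm_num

def smulStar (V A : Op d) : Op d := (-Complex.I) • (V * star A - A * V)

lemma isSelfAdjoint_smulStar (hV : IsSelfAdjoint V) (A : Op d) : IsSelfAdjoint (smulStar V A) := by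
  have h1 : star V = V := hV
  have h3 : star (V * star A - A * V) = -(V * star A - A * V) := by
    rw [star_sub, star_mul, star_mul, h1, star_star]; abel
  rw [IsSelfAdjoint, smulStar, star_smul, h3, smul_neg, ← neg_smul]
  simp

lemma smulStar_pS_le (hV : pL d V < ∞) (A : Op d) :
    ‖smulStar V A‖ₑ + pS d (smulStar V A) ≤ 8 * (pL d V * pK d μ c A) := by
  have sV := selfAdjoint_of_sa _ hV
  have hs : star V = V := sV
  have b1 : trNorm (smulStar V A) ≤ 2 * (pL d V * pK d μ c A) := by
    have h1 : trNorm (A * V) ≤ pL d V * pK d μ c A := by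
      refine (trNorm_mul_le_colSum A V).trans ?_
      rw [hs, mul_comm, pL_apply sV]
      gcongr
      · exact le_add_self
      · exact colSum_le_pK A
    have h2 : trNorm (V * star A) = trNorm (A * V) := by rw [← trNorm_star, star_mul, star_star, hs]
    calc _ ≤ trNorm (V * star A - A * V) := isIdealNorm_tr.neg_I_smul_le _
      _ ≤ trNorm (V * star A) + trNorm (A * V) := (trN d).sub_le _ _
      _ ≤ _ := by rw [h2, two_mul]; gcongr
  refine (enorm_add_pS_le (isSelfAdjoint_smulStar sV A) b1).trans ?_
  rw [← mul_assoc]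
  gcongr
  norm_num

lemma qcomm_pS_le (hV : IsSelfAdjoint V) (hA : pS d A < ∞) :
    ‖qcomm V A‖ₑ + pS d (qcomm V A) ≤ 8 * (‖V‖ₑ * pS d A) := by
  have sA := selfAdjoint_of_sa _ hA
  have b1 : trNorm (qcomm V A) ≤ 2 * (‖V‖ₑ * pS d A) :=
    (isIdealNorm_tr.qcomm_le hV sA).trans (by
      gcongr
      exact (trNorm_mul_le _ _).trans (by gcongr; exact trNorm_le_pS A))
  refine (enorm_add_pS_le (isSelfAdjoint_qcomm hV sA) b1).trans ?_
  rw [← mul_assoc]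
  gcongr
  norm_num

/-! ### Bilinear maps -/

lemma star_real_smul (r : ℝ) (A : Op d) : star (r • A) = r • star A := by
  have e : ∀ B : Op d, r • B = (r : ℂ) • B := fun B => by
    ext1 u; exact (Complex.coe_smul r (B u)).symm
  rw [e, e, star_smul]
  simp

def qcommL (d : ℕ) : Op d →ₗ[ℝ] Op d →ₗ[ℝ] Op d :=
  LinearMap.mk₂ ℝ qcomm qcomm_add_left (fun r V A => by
      simp only [qcomm, smul_mul_assoc, mul_smul_comm, ← smul_sub]; rw [smul_comm])
    qcomm_add_right
    (fun r V A => by simp only [qcomm, smul_mul_assoc, mul_smul_comm, ← smul_sub]; rw [smul_comm])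

def lmulL (d : ℕ) : Op d →ₗ[ℝ] Op d →ₗ[ℝ] Op d :=
  LinearMap.mk₂ ℝ lmul (fun V V' A => by simp only [lmul, add_mul, smul_add])
    (fun r V A => by simp only [lmul, smul_mul_assoc]; rw [smul_comm])
    (fun V A A' => by simp only [lmul, mul_add, smul_add])
    (fun r V A => by simp only [lmul, mul_smul_comm]; rw [smul_comm])

def smulStarL (d : ℕ) : Op d →ₗ[ℝ] Op d →ₗ[ℝ] Op d :=
  LinearMap.mk₂ ℝ smulStar
    (fun V V' A => by simp only [smulStar, add_mul, mul_add, ← smul_add]; congr 1; abel)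
    (fun r V A => by
      simp only [smulStar, smul_mul_assoc, mul_smul_comm, ← smul_sub]; rw [smul_comm])
    (fun V A A' => by simp only [smulStar, star_add, add_mul, mul_add, ← smul_add]; congr 1; abel)
    (fun r V A => by
      simp only [smulStar, star_real_smul, smul_mul_assoc, mul_smul_comm, ← smul_sub]
      rw [smul_comm])

lemma mul_le_weaken {a b a' b' x : ℝ≥0∞} (h : x ≤ 8 * (a * b)) (ha : a ≤ a') (hb : b ≤ b') :
    x ≤ (8 : NNReal) * (a' * b') := by
  have e : ((8 : NNReal) : ℝ≥0∞) = 8 := by norm_num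
  rw [e]
  exact h.trans (by gcongr)

/-- `[V, A]` with `V` a regular potential and `A` the low-momentum part. -/
def bWA (d : ℕ) (μ : ℝ) (c : NNReal) : FN (pW d c) →L[ℝ] FN (pA d μ c) →L[ℝ] FN (pD d μ c) :=
  FN.bilin (qcommL d) 8 fun _ _ hV hA => mul_le_weaken (qcomm_pD_le hV hA) le_add_self le_add_self

/-- `[V, A]` with `V` a regular potential and `A` the Hilbert–Schmidt part. -/
def bWK (d : ℕ) (μ : ℝ) (c : NNReal) : FN (pW d c) →L[ℝ] FN (pK d μ c) →L[ℝ] FN (pK d μ c) :=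
  FN.bilin (qcommL d) 8 fun _ A hV _ => mul_le_weaken (qcomm_pK_le hV A) le_add_self le_add_self

/-- `[V, A]` with `V` a regular potential and `A` the trace-class part. -/
def bWS (d : ℕ) (c : NNReal) : FN (pW d c) →L[ℝ] FN (pS d) →L[ℝ] FN (pS d) :=
  FN.bilin (qcommL d) 8 fun _ _ hV hA => mul_le_weaken
    (qcomm_pS_le (selfAdjoint_of_sa _ hV) hA) le_self_add le_add_self

/-- `[V, A]` with `V` a square-integrable potential and `A` the trace-class part. -/
def bLS (d : ℕ) : FN (pL d) →L[ℝ] FN (pS d) →L[ℝ] FN (pS d) :=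
  FN.bilin (qcommL d) 8 fun _ _ hV hA => mul_le_weaken
    (qcomm_pS_le (selfAdjoint_of_sa _ hV) hA) le_self_add le_add_self

/-- `V A` with `V` a square-integrable potential and `A` the low-momentum part. -/
def bLA (d : ℕ) (μ : ℝ) (c : NNReal) : FN (pL d) →L[ℝ] FN (pA d μ c) →L[ℝ] FN (pK d μ c) :=
  FN.bilin (lmulL d) 8 fun _ _ hV hA => mul_le_weaken (lmul_pA_le hV hA) le_add_self le_add_self

/-- `V A` with `V` a square-integrable potential and `A` the Hilbert–Schmidt part. -/
def bLK (d : ℕ) (μ : ℝ) (c : NNReal) : FN (pL d) →L[ℝ] FN (pK d μ c) →L[ℝ] FN (pK d μ c) :=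
  FN.bilin (lmulL d) 8 fun _ A hV _ => mul_le_weaken (lmul_pK_le hV A) le_add_self le_add_self

/-- `V A* - A V` with `V` a square-integrable potential and `A` the Hilbert–Schmidt part. -/
def bLKS (d : ℕ) (μ : ℝ) (c : NNReal) : FN (pL d) →L[ℝ] FN (pK d μ c) →L[ℝ] FN (pS d) :=
  FN.bilin (smulStarL d) 8 fun _ A hV _ =>
    mul_le_weaken (smulStar_pS_le hV A) le_add_self le_add_self

end

section

variable {c : NNReal}

/-! ### The potential as a map between the spaces `FN` -/

def potMapConst (w : Space d → ℝ) : NNReal := ((6 + 2 * nearCount d) * wNorm w).toNNReal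

lemma coe_potMapConst (hW : IsPot w) : (potMapConst w : ℝ≥0∞) = (6 + 2 * nearCount d) * wNorm w :=
  ENNReal.coe_toNNReal (mul_lt_top (add_lt_top.2 ⟨by norm_num,
    mul_lt_top (by norm_num) nearCount_lt_top⟩) (wNorm_lt_top hW)).ne

lemma pW_pot_le (hW : IsPot w) (hA : IsSelfAdjoint A) (hl : lat (opN d) A < ∞) :
    pW d c (pot w A) ≤ (1 + nearCount d) * (wNorm w * lat (opN d) A) +
      c * band (hsN d) (pot w A) := by
  rw [pW_apply (isSelfAdjoint_pot hW (hasDens_lat hl) hA), add_mul, one_mul]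
  gcongr
  · exact enorm_pot_le_lat hW hl hA
  · exact band_op_pot_le hW hl hA

lemma pot_pD_le (hW : IsPot w) (A : Op d) (hA : pD d μ c A < ∞) :
    ‖pot w A‖ₑ + pW d c (pot w A) ≤ potMapConst w * (‖A‖ₑ + pD d μ c A) := by
  have sA := selfAdjoint_of_sa _ hA
  have hl := (lat_op_le_pD A).trans_lt hA
  have b1 : c * band (hsN d) (pot w A) ≤ nearCount d * (wNorm w * pD d μ c A) := by
    calc _ ≤ c * (nearCount d * (wNorm w * lat (hsN d) A)) := by
          gcongr; exact band_hs_pot_le hW hl sA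
      _ = nearCount d * (wNorm w * (c * lat (hsN d) A)) := by ring
      _ ≤ _ := by gcongr; exact lat_hs_le_pD A
  rw [coe_potMapConst hW]
  calc _ ≤ wNorm w * pD d μ c A + ((1 + nearCount d) * (wNorm w * pD d μ c A) +
        nearCount d * (wNorm w * pD d μ c A)) := by
        refine add_le_add ((enorm_pot_le_lat hW hl sA).trans (by gcongr; exact lat_op_le_pD A))
          ((pW_pot_le hW sA hl).trans ?_)
        gcongr
        exact lat_op_le_pD A
    _ = (2 + 2 * nearCount d) * wNorm w * pD d μ c A := by ring
    _ ≤ _ := by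
      gcongr
      · norm_num
      · exact le_add_self

def potD (μ : ℝ) (c : NNReal) (hW : IsPot w) : FN (pD d μ c) →L[ℝ] FN (pW d c) :=
  FN.lin (pot w) (potMapConst w)
    (fun A B hA hB => pot_add hW (hasDens_lat ((lat_op_le_pD A).trans_lt hA))
      (selfAdjoint_of_sa _ hA) (hasDens_lat ((lat_op_le_pD B).trans_lt hB))
      (selfAdjoint_of_sa _ hB))
    (fun r A hA => pot_smul hW (hasDens_lat ((lat_op_le_pD A).trans_lt hA))
      (selfAdjoint_of_sa _ hA) r)
    (pot_pD_le hW)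

lemma exists_hasDens_of_pK (hA : pK d μ c A < ∞) :
    ∃ ρ, HasDens (A + star A) ρ ∧ eLpNorm ρ 2 volume ≤ 2 * colSum d A :=
  exists_hasDens_add_star ((colSum_le_pK A).trans_lt hA)

lemma isSelfAdjoint_add_star (A : Op d) : IsSelfAdjoint (A + star A) := IsSelfAdjoint.add_star_self A

lemma pot_pK_le (hW : IsPot w) (A : Op d) (hA : pK d μ c A < ∞) :
    ‖pot w (A + star A)‖ₑ + pL d (pot w (A + star A)) ≤ potMapConst w * (‖A‖ₑ + pK d μ c A) := by
  obtain ⟨ρ, h, hρ⟩ := exists_hasDens_of_pK hA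
  have s := isSelfAdjoint_add_star A
  have hρ' : eLpNorm ρ 2 volume ≤ 2 * pK d μ c A := hρ.trans (by gcongr; exact colSum_le_pK A)
  have b1 : ‖pot w (A + star A)‖ₑ ≤ wNorm w * (2 * pK d μ c A) :=
    (enorm_pot_le_two hW h s).trans (by gcongr)
  have b2 : colSup d (pot w (A + star A)) ≤ wNorm w * (2 * pK d μ c A) :=
    (colSup_pot_le_two hW h s).trans (by gcongr)
  rw [pL_apply (isSelfAdjoint_pot hW h s), coe_potMapConst hW]
  calc _ ≤ wNorm w * (2 * pK d μ c A) + (wNorm w * (2 * pK d μ c A) + wNorm w * (2 * pK d μ c A)) := by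
        gcongr
    _ = 6 * wNorm w * pK d μ c A := by ring
    _ ≤ _ := by
      gcongr
      · exact le_self_add
      · exact le_add_self

def potK (μ : ℝ) (c : NNReal) (hW : IsPot w) : FN (pK d μ c) →L[ℝ] FN (pL d) :=
  FN.lin (fun A => pot w (A + star A)) (potMapConst w)
    (fun A B hA hB => by
      obtain ⟨ρ, h, -⟩ := exists_hasDens_of_pK hA
      obtain ⟨ρ', h', -⟩ := exists_hasDens_of_pK hB
      rw [← pot_add hW h (isSelfAdjoint_add_star A) h' (isSelfAdjoint_add_star B), star_add,
        add_add_add_comm])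
    (fun r A hA => by
      obtain ⟨ρ, h, -⟩ := exists_hasDens_of_pK hA
      change pot w (r • A + star (r • A)) = r • pot w (A + star A)
      rw [star_real_smul, ← smul_add]
      exact pot_smul hW h (isSelfAdjoint_add_star A) r)
    (pot_pK_le hW)

lemma pot_pS_le (hW : IsPot w) (A : Op d) (hA : pS d A < ∞) :
    ‖pot w A‖ₑ + pL d (pot w A) ≤ potMapConst w * (‖A‖ₑ + pS d A) := by
  have s := selfAdjoint_of_sa _ hA
  obtain ⟨ρ, h, hρ⟩ := exists_hasDens_of_trNorm ((trNorm_le_pS A).trans_lt hA)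
  have hρ' : eLpNorm ρ 1 volume ≤ pS d A := hρ.trans (trNorm_le_pS A)
  have b1 : ‖pot w A‖ₑ ≤ wNorm w * pS d A := (enorm_pot_le_one h s).trans (by gcongr)
  have b2 : colSup d (pot w A) ≤ wNorm w * pS d A := (colSup_pot_le_one hW h s).trans (by gcongr)
  rw [pL_apply (isSelfAdjoint_pot hW h s), coe_potMapConst hW]
  calc _ ≤ wNorm w * pS d A + (wNorm w * pS d A + wNorm w * pS d A) := by gcongr
    _ = 3 * wNorm w * pS d A := by ring
    _ ≤ _ := by
      gcongr
      · calc (3 : ℝ≥0∞) ≤ 6 := by norm_num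
          _ ≤ _ := le_self_add
      · exact le_add_self

def potS (hW : IsPot w) : FN (pS d) →L[ℝ] FN (pL d) :=
  FN.lin (pot w) (potMapConst w) (fun A B hA hB => by
      obtain ⟨ρ, h, -⟩ := exists_hasDens_of_trNorm ((trNorm_le_pS A).trans_lt hA)
      obtain ⟨ρ', h', -⟩ := exists_hasDens_of_trNorm ((trNorm_le_pS B).trans_lt hB)
      exact pot_add hW h (selfAdjoint_of_sa _ hA) h' (selfAdjoint_of_sa _ hB))
    (fun r A hA => by
      obtain ⟨ρ, h, -⟩ := exists_hasDens_of_trNorm ((trNorm_le_pS A).trans_lt hA)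
      exact pot_smul hW h (selfAdjoint_of_sa _ hA) r)
    (pot_pS_le hW)

lemma pA_le_pD (A : Op d) (hA : pD d μ c A < ∞) :
    ‖A‖ₑ + pA d μ c A ≤ (1 : NNReal) * (‖A‖ₑ + pD d μ c A) := by
  have s := selfAdjoint_of_sa _ hA
  rw [ENNReal.coe_one, one_mul, pA_apply s, pD_apply s]
  exact add_le_add le_rfl ((add_le_add le_rfl (mul_le_mul_right
    (lat_mul_hi_le isIdealNorm_hs A) _)).trans le_self_add)

/-- The inclusion of the corrections in the low-momentum operators. -/
def embDA (d : ℕ) (μ : ℝ) (c : NNReal) : FN (pD d μ c) →L[ℝ] FN (pA d μ c) :=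
  FN.lin id 1 (fun _ _ _ _ => rfl) (fun _ _ _ => rfl) pA_le_pD

lemma norm_embDA_le (a : FN (pD d μ c)) : ‖embDA d μ c a‖ ≤ ‖a‖ := by
  have := FN.norm_lin_le (p := pD d μ c) (q := pA d μ c) (L := id) (C := 1) (fun _ _ _ _ => rfl)
    (fun _ _ _ => rfl) pA_le_pD a
  rwa [NNReal.coe_one, one_mul] at this

lemma norm_potD_le (hW : IsPot w) (a : FN (pD d μ c)) :
    ‖potD μ c hW a‖ ≤ potMapConst w * ‖a‖ := FN.norm_lin_le _ _ (pot_pD_le hW) a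

lemma norm_potK_le (hW : IsPot w) (a : FN (pK d μ c)) :
    ‖potK μ c hW a‖ ≤ potMapConst w * ‖a‖ := FN.norm_lin_le _ _ (pot_pK_le hW) a

lemma norm_potS_le (hW : IsPot w) (a : FN (pS d)) :
    ‖potS hW a‖ ≤ potMapConst w * ‖a‖ := FN.norm_lin_le _ _ (pot_pS_le hW) a

/-! ### The quadratic flow -/

/-- The unknowns: corrections of the low-momentum part, Hilbert–Schmidt part, trace-class part. -/
abbrev Unknown (d : ℕ) (μ : ℝ) (c : NNReal) : Type := FN (pD d μ c) × FN (pK d μ c) × FN (pS d)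

abbrev Potentials (d : ℕ) (c : NNReal) : Type := FN (pW d c) × FN (pL d)

/-- The parts of the density matrix. -/
abbrev Parts (d : ℕ) (μ : ℝ) (c : NNReal) : Type := FN (pA d μ c) × FN (pK d μ c) × FN (pS d)

def quadB (x : Potentials d c) (y : Parts d μ c) : Unknown d μ c :=
  (bWA d μ c x.1 y.1, bLA d μ c x.2 y.1 + bWK d μ c x.1 y.2.1 + bLK d μ c x.2 y.2.1,
    bWS d c x.1 y.2.2 + bLS d x.2 y.2.2 + bLKS d μ c x.2 y.2.1)

lemma quadB_sub (x x' : Potentials d c) (y y' : Parts d μ c) :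
    quadB x y - quadB x' y' = quadB (x - x') y + quadB x' (y - y') := by
  refine Prod.ext ?_ (Prod.ext ?_ ?_) <;>
    simp only [quadB, Prod.fst_sub, Prod.snd_sub, Prod.fst_add, Prod.snd_add, map_sub, sub_apply] <;>
    abel

lemma norm_quadB_le (x : Potentials d c) (y : Parts d μ c) : ‖quadB x y‖ ≤ 24 * ‖x‖ * ‖y‖ := by
  have k : ∀ {a b z : ℝ}, a ≤ ‖x‖ → b ≤ ‖y‖ → 0 ≤ b → z ≤ 8 * a * b → z ≤ 8 * ‖x‖ * ‖y‖ :=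
    fun ha hb h0 h => h.trans (by gcongr)
  have hx1 := norm_fst_le x
  have hx2 := norm_snd_le x
  have hy2 := (norm_fst_le y.2).trans (norm_snd_le y)
  have hy3 := (norm_snd_le y.2).trans (norm_snd_le y)
  have h0 : 0 ≤ ‖x‖ * ‖y‖ := by positivity
  refine norm_prod_le_iff.2 ⟨(k hx1 (norm_fst_le y) (norm_nonneg _)
    (FN.norm_bilin_le _ _ _ _ _)).trans (by linarith), norm_prod_le_iff.2
    ⟨norm_add₃_le.trans (le_trans (add_le_add_three
      (k hx2 (norm_fst_le y) (norm_nonneg _) (FN.norm_bilin_le _ _ _ _ _))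
      (k hx1 hy2 (norm_nonneg _) (FN.norm_bilin_le _ _ _ _ _))
      (k hx2 hy2 (norm_nonneg _) (FN.norm_bilin_le _ _ _ _ _))) (by linarith)),
    norm_add₃_le.trans (le_trans (add_le_add_three
      (k hx1 hy3 (norm_nonneg _) (FN.norm_bilin_le _ _ _ _ _))
      (k hx2 hy3 (norm_nonneg _) (FN.norm_bilin_le _ _ _ _ _))
      (k hx2 hy2 (norm_nonneg _) (FN.norm_bilin_le _ _ _ _ _))) (by linarith))⟩⟩

def potL (μ : ℝ) (c : NNReal) (hW : IsPot w) : Unknown d μ c →L[ℝ] Potentials d c :=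
  ((potD μ c hW).comp (ContinuousLinearMap.fst ℝ _ _)).prod
    (((potK μ c hW).comp (ContinuousLinearMap.fst ℝ _ _)).comp (ContinuousLinearMap.snd ℝ _ _) +
      ((potS hW).comp (ContinuousLinearMap.snd ℝ _ _)).comp (ContinuousLinearMap.snd ℝ _ _))

lemma potL_apply (hW : IsPot w) (u : Unknown d μ c) :
    potL μ c hW u = (potD μ c hW u.1, potK μ c hW u.2.1 + potS hW u.2.2) := rfl

lemma norm_potL_le (hW : IsPot w) (u : Unknown d μ c) :
    ‖potL μ c hW u‖ ≤ (2 * potMapConst w + 1) * ‖u‖ := by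
  have hu1 : ‖u.1‖ ≤ ‖u‖ := norm_fst_le u
  have hu2 : ‖u.2.1‖ ≤ ‖u‖ := (norm_fst_le u.2).trans (norm_snd_le u)
  have hu3 : ‖u.2.2‖ ≤ ‖u‖ := (norm_snd_le u.2).trans (norm_snd_le u)
  have hk : 0 ≤ (potMapConst w : ℝ) := NNReal.coe_nonneg _
  have hu : 0 ≤ ‖u‖ := norm_nonneg u
  have h0 : 0 ≤ (potMapConst w : ℝ) * ‖u‖ := by positivity
  rw [potL_apply]
  refine norm_prod_le_iff.2 ⟨?_, ?_⟩
  · have := (norm_potD_le hW u.1).trans (mul_le_mul_of_nonneg_left hu1 hk)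
    dsimp only; linarith
  · have b1 := (norm_potK_le hW u.2.1).trans (mul_le_mul_of_nonneg_left hu2 hk)
    have b2 := (norm_potS_le hW u.2.2).trans (mul_le_mul_of_nonneg_left hu3 hk)
    dsimp only
    exact (norm_add_le _ _).trans (by linarith)

def partsL (d : ℕ) (μ : ℝ) (c : NNReal) : Unknown d μ c →L[ℝ] Parts d μ c :=
  ((embDA d μ c).comp (ContinuousLinearMap.fst ℝ _ _)).prod (ContinuousLinearMap.snd ℝ _ _)

lemma partsL_apply (u : Unknown d μ c) : partsL d μ c u = (embDA d μ c u.1, u.2) := rfl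

lemma norm_partsL_le (k : NNReal) (u : Unknown d μ c) :
    ‖partsL d μ c u‖ ≤ (2 * (k : ℝ) + 1) * ‖u‖ := by
  have hu : 0 ≤ ‖u‖ := norm_nonneg u
  have hk : 0 ≤ (k : ℝ) * ‖u‖ := by positivity
  have h : ‖partsL d μ c u‖ ≤ ‖u‖ := by
    rw [partsL_apply]
    exact norm_prod_le_iff.2 ⟨(norm_embDA_le _).trans (norm_fst_le u), norm_snd_le u⟩
  linarith

def unknownEvol (hc : c ≠ 0) (t : ℝ) : Unknown d μ c →L[ℝ] Unknown d μ c :=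
  (FN.evol (isFreeCts_pD hc) t).prodMap
    ((FN.evol (isFreeCts_pK hc) t).prodMap (FN.evol isFreeCts_pS t))

lemma unknownEvol_apply (hc : c ≠ 0) (t : ℝ) (u : Unknown d μ c) : unknownEvol hc t u =
    (FN.evol (isFreeCts_pD hc) t u.1, FN.evol (isFreeCts_pK hc) t u.2.1,
      FN.evol isFreeCts_pS t u.2.2) := rfl

/-- The Hartree equation as a quadratic flow, with the external potential `v` and the external
low-momentum part `a`. -/
def hartreeFlow (hc : c ≠ 0) (hW : IsPot w) (v : ℝ → Potentials d c) (a : ℝ → Parts d μ c) :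
    QuadraticFlow (Unknown d μ c) (Potentials d c) (Parts d μ c) 24 (2 * potMapConst w + 1) where
  S := unknownEvol hc
  norm_S_le t u := by
    rw [unknownEvol_apply]
    exact norm_prod_le_iff.2 ⟨(FN.norm_evol_le _ _ _).trans (norm_fst_le u), norm_prod_le_iff.2
      ⟨(FN.norm_evol_le _ _ _).trans ((norm_fst_le u.2).trans (norm_snd_le u)),
        (FN.norm_evol_le _ _ _).trans ((norm_snd_le u.2).trans (norm_snd_le u))⟩⟩
  continuous_S u := by
    simp only [unknownEvol_apply]
    exact (FN.continuous_evol _ enorm_le_pD _).prodMk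
      ((FN.continuous_evol _ enorm_le_pK _).prodMk (FN.continuous_evol _ enorm_le_pS _))
  B := quadB
  B_sub := quadB_sub
  norm_B_le := norm_quadB_le
  L := potL μ c hW
  norm_L_le := norm_potL_le hW
  M := partsL d μ c
  norm_M_le := norm_partsL_le _
  v := v
  a := a

end

section

variable {c : NNReal} {Q₀ : Op d}

/-! ### The free evolution of the low-momentum part -/

lemma yNorm_lowCut (hμ : 0 < μ) (A : Op d) : yNorm μ (lowCut μ A) =
    ‖lowCut μ A‖ₑ + eLpNorm (density (lowCut μ A)) 2 volume := by
  have e : hiProj μ * lowCut μ A = 0 := hi_mul_of_lo_mul (lo_mul_lowCut A)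
  rw [yNorm_eq hμ, lowDensNorm, lowCut_lowCut, zNorm, e, zero_mul, zero_mul, hsNorm_zero,
    trNorm_zero, add_zero, add_zero]

def freeLow (μ : ℝ) (Q₀ : Op d) (t : ℝ) : Op d := lowCut μ (freeEvol t Q₀)

lemma freeLow_eq (t : ℝ) : freeLow μ Q₀ t = freeEvol t (lowCut μ Q₀) := (freeEvol_lowCut t Q₀).symm

lemma isSelfAdjoint_freeLow (h : IsSelfAdjoint Q₀) (t : ℝ) : IsSelfAdjoint (freeLow μ Q₀ t) :=
  isSelfAdjoint_lowCut (isSelfAdjoint_freeEvol h t)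

lemma hasDens_freeLow (t : ℝ) : HasDens (freeLow μ Q₀ t) (latDens (freeLow μ Q₀ t)) :=
  hasDens_lowCut _

lemma eLpNorm_freeLowDensity_sub (h : IsSelfAdjoint Q₀) (t s : ℝ) :
    eLpNorm (density (freeLow μ Q₀ t - freeLow μ Q₀ s)) 2 volume =
      eLpNorm (freeLowDensity μ Q₀ t - freeLowDensity μ Q₀ s) 2 volume := by
  rw [freeLowDensity_eq, freeLowDensity_eq]
  exact (hasDens_lowCut _).eLpNorm_density_sub (isSelfAdjoint_freeLow h t) (hasDens_lowCut _)
    (isSelfAdjoint_freeLow h s)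

lemma freeLow_sub (t s : ℝ) :
    freeLow μ Q₀ t - freeLow μ Q₀ s = lowCut μ (freeEvol t Q₀ - freeEvol s Q₀) :=
  (lowCut_sub _ _).symm

lemma tendsto_lat_freeLow (t₀ : ℝ) :
    Tendsto (fun t => lat (opN d) (freeLow μ Q₀ t - freeLow μ Q₀ t₀)) (𝓝 t₀) (𝓝 0) := by
  simp only [freeLow_eq]
  refine isFreeCts_lat_op.tendsto_of_tendsto (X := fun _ => lowCut μ Q₀) le_rfl
    (lat_lowCut_lt_top Q₀) ?_
  simp

lemma inY_freeLow (hμ : 0 < μ) (h : IsSelfAdjoint Q₀) (hf : FreeLowDensityContinuous μ Q₀) (t : ℝ) :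
    InY μ (freeLow μ Q₀ t) := by
  refine (inY_iff hμ).2 ⟨isSelfAdjoint_freeLow h t, ?_⟩
  rw [freeLow, yNorm_lowCut hμ, ← freeLowDensity_eq]
  exact add_lt_top.2 ⟨enorm_lt_top, (hf.1 t).2⟩

lemma tendsto_yNorm_freeLow (hμ : 0 < μ) (h : IsSelfAdjoint Q₀) (hf : FreeLowDensityContinuous μ Q₀)
    (t₀ : ℝ) : Tendsto (fun t => yNorm μ (freeLow μ Q₀ t - freeLow μ Q₀ t₀)) (𝓝 t₀) (𝓝 0) := by
  have h3 := (tendsto_lat_freeLow (μ := μ) (Q₀ := Q₀) t₀).add (hf.2 t₀)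
  rw [add_zero] at h3
  refine tendsto_zero_of_le h3 fun t => ?_
  rw [← eLpNorm_freeLowDensity_sub h, freeLow_sub, yNorm_lowCut hμ]
  exact add_le_add (le_lat (opN d) _) le_rfl

lemma FreeLowDensityContinuous.exists_bound (hf : FreeLowDensityContinuous μ Q₀) {K : Set ℝ}
    (hK : IsCompact K) : ∃ M < ∞, ∀ t ∈ K, eLpNorm (freeLowDensity μ Q₀ t) 2 volume ≤ M := by
  refine exists_bound_of_tendsto hK (fun t _ => (hf.1 t).2) (fun t _ s _ => ?_) fun t _ =>
    (hf.2 t).mono_left nhdsWithin_le_nhds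
  have := eLpNorm_add_le (((hf.1 s).sub (hf.1 t)).1) (hf.1 t).1 (p := 2) (by norm_num)
  rwa [sub_add_cancel] at this

lemma lat_lowCut_le (A : Op d) : lat (opN d) (lowCut μ A) ≤
    cubeCount (lowSet d (2 * μ)) * cubeCount (lowSet d (2 * μ)) * ‖A‖ₑ :=
  lat_compress_le isIdealNorm_op (measurableSet_lowSet _) A

lemma pW_pot_lowCut_le (hW : IsPot w) (hA : IsSelfAdjoint A) : pW d c (pot w (lowCut μ A)) ≤
      (1 + nearCount d) * (wNorm w * lat (opN d) (lowCut μ A)) +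
      c * (bandCount (lowSet d (2 * μ)) * wNorm w) * eLpNorm (density (lowCut μ A)) 2 volume := by
  refine (pW_pot_le hW (isSelfAdjoint_lowCut hA) (lat_lowCut_lt_top A)).trans (add_le_add le_rfl ?_)
  rw [mul_assoc, mul_assoc]
  exact mul_le_mul_right (band_hs_pot_le_of_compress hW (measurableSet_lowSet (2 * μ))
    (isBounded_lowSet _) (lowCut_lowCut A) (isSelfAdjoint_lowCut hA)) _

lemma isSelfAdjoint_pot_freeLow (hW : IsPot w)
    (h : IsSelfAdjoint Q₀) (t : ℝ) : IsSelfAdjoint (pot w (freeLow μ Q₀ t)) :=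
  isSelfAdjoint_pot hW (hasDens_freeLow t) (isSelfAdjoint_freeLow h t)

lemma pW_coeff_lt_top (hW : IsPot w) :
    (1 + nearCount d) * wNorm w < ∞ ∧ c * (bandCount (lowSet d (2 * μ)) * wNorm w) < ∞ :=
  ⟨mul_lt_top (add_lt_top.2 ⟨by simp, nearCount_lt_top⟩) (wNorm_lt_top hW), mul_lt_top coe_lt_top
      (mul_lt_top (bandCount_lt_top (isBounded_lowSet _)) (wNorm_lt_top hW))⟩

lemma pW_pot_freeLow_lt_top (hW : IsPot w) (h : IsSelfAdjoint Q₀)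
    (hf : FreeLowDensityContinuous μ Q₀) (t : ℝ) : pW d c (pot w (freeLow μ Q₀ t)) < ∞ := by
  refine (pW_pot_lowCut_le hW (isSelfAdjoint_freeEvol h t)).trans_lt ?_
  rw [← freeLowDensity_eq, ← mul_assoc]
  exact add_lt_top.2 ⟨mul_lt_top (pW_coeff_lt_top (c := c) (μ := μ) hW).1
    (lat_lowCut_lt_top _), mul_lt_top (pW_coeff_lt_top hW).2 (hf.1 t).2⟩

/-- The potential of the free evolution of the low-momentum block. -/
def extPot (c : NNReal) (hW : IsPot w) (h : IsSelfAdjoint Q₀)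
    (hf : FreeLowDensityContinuous μ Q₀) (t : ℝ) : Potentials d c :=
  (FN.mk _ (pW_pot_freeLow_lt_top hW h hf t), 0)

lemma continuous_extPot (hW : IsPot w) (h : IsSelfAdjoint Q₀)
    (hf : FreeLowDensityContinuous μ Q₀) : Continuous (extPot c hW h hf) := by
  refine Continuous.prodMk (continuous_iff_continuousAt.2 fun t₀ => ?_) continuous_const
  have h3 := (ENNReal.Tendsto.const_mul (tendsto_lat_freeLow (μ := μ) (Q₀ := Q₀) t₀)
    (Or.inr (pW_coeff_lt_top (c := c) (μ := μ) hW).1.ne)).add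
    (ENNReal.Tendsto.const_mul (hf.2 t₀) (Or.inr (pW_coeff_lt_top (c := c) (μ := μ) hW).2.ne))
  rw [mul_zero, mul_zero, add_zero] at h3
  have h4 : Tendsto (fun t => pW d c (pot w (freeLow μ Q₀ t) - pot w (freeLow μ Q₀ t₀))) (𝓝 t₀)
      (𝓝 0) := by
    refine tendsto_zero_of_le h3 fun t => ?_
    rw [← pot_sub hW (hasDens_freeLow t) (isSelfAdjoint_freeLow h t) (hasDens_freeLow t₀)
      (isSelfAdjoint_freeLow h t₀), ← eLpNorm_freeLowDensity_sub h, freeLow_sub, mul_assoc (1 + _)]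
    exact pW_pot_lowCut_le hW ((isSelfAdjoint_freeEvol h t).sub (isSelfAdjoint_freeEvol h t₀))
  refine FN.tendsto_of_enorm (tendsto_zero_of_le h4 fun t => ?_) h4
  dsimp only [FN.val_mk]
  rw [pW_apply ((isSelfAdjoint_pot_freeLow hW h t).sub (isSelfAdjoint_pot_freeLow hW h t₀)),
    add_assoc]
  exact le_self_add

lemma lowCut_lowProj (hμ : 0 < μ) : lowCut μ (lowProj μ : Op d) = lowProj μ := by
  have h1 : (loProj μ : Op d) * lowProj μ = lowProj μ := by
    have := hi_mul_lowProj (d := d) hμ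
    rwa [hiProj, sub_mul, one_mul, sub_eq_zero, eq_comm] at this
  have h2 : (lowProj μ : Op d) * loProj μ = lowProj μ := by
    have := congrArg star h1
    rwa [star_mul, star_lo, (isSelfAdjoint_lowProj μ).star_eq] at this
  rw [lowCut, h1, h2]

lemma lowProj_add_freeLow (hμ : 0 < μ) (t : ℝ) :
    lowProj μ + freeLow μ Q₀ t = lowCut μ (lowProj μ + freeEvol t Q₀) := by
  rw [lowCut_add, lowCut_lowProj hμ]; rfl

lemma pA_lowCut (hA : IsSelfAdjoint A) : pA d μ c (lowCut μ A) = lat (opN d) (lowCut μ A) := by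
  rw [pA_apply (isSelfAdjoint_lowCut hA), mul_hi_of_mul_lo (lowCut_mul_lo A), ExtNorm.map_zero,
    mul_zero, add_zero]

lemma isSelfAdjoint_lowProj_add (h : IsSelfAdjoint Q₀) (t : ℝ) :
    IsSelfAdjoint (lowProj μ + freeEvol t Q₀) :=
  (isSelfAdjoint_lowProj μ).add (isSelfAdjoint_freeEvol h t)

lemma pA_freeLow_lt_top (hμ : 0 < μ) (h : IsSelfAdjoint Q₀) (t : ℝ) :
    pA d μ c (lowProj μ + freeLow μ Q₀ t) < ∞ := by
  rw [lowProj_add_freeLow hμ, pA_lowCut (isSelfAdjoint_lowProj_add h t)]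
  exact lat_lowCut_lt_top _

/-- The Fermi sea together with the free evolution of the low-momentum block. -/
def extParts (c : NNReal) (hμ : 0 < μ) (h : IsSelfAdjoint Q₀) (t : ℝ) : Parts d μ c :=
  (FN.mk _ (pA_freeLow_lt_top hμ h t), 0)

lemma continuous_extParts (hμ : 0 < μ) (h : IsSelfAdjoint Q₀) : Continuous (extParts c hμ h) := by
  refine Continuous.prodMk (continuous_iff_continuousAt.2 fun t₀ => ?_) continuous_const
  have h3 := tendsto_lat_freeLow (μ := μ) (Q₀ := Q₀) t₀
  refine FN.tendsto_of_enorm ?_ ?_ <;>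
    refine tendsto_zero_of_le h3 fun t => ?_ <;> simp only [FN.val_mk, add_sub_add_left_eq_sub]
  · exact le_lat (opN d) _
  · rw [freeLow_sub, pA_lowCut ((isSelfAdjoint_freeEvol h t).sub (isSelfAdjoint_freeEvol h t₀))]

/-! ### Reassembling the density matrix -/

def starL (d : ℕ) : Op d →L[ℝ] Op d :=
  LinearMap.mkContinuous ⟨⟨star, star_add⟩, star_real_smul⟩ 1 fun A => by
    rw [one_mul]; exact (norm_star A).le

/-- The density matrix assembled from its parts. -/
def assemble (d : ℕ) (μ : ℝ) (c : NNReal) : Unknown d μ c →L[ℝ] Op d :=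
  (FN.valL _).comp (ContinuousLinearMap.fst ℝ _ _) +
    ((FN.valL _ + (starL d).comp (FN.valL _)).comp (ContinuousLinearMap.fst ℝ _ _) +
      (FN.valL _).comp (ContinuousLinearMap.snd ℝ _ _)).comp (ContinuousLinearMap.snd ℝ _ _)

lemma assemble_apply (u : Unknown d μ c) : assemble d μ c u =
    u.1.val + (u.2.1.val + star u.2.1.val + u.2.2.val) := rfl

lemma assemble_unknownEvol (hc : c ≠ 0) (t : ℝ) (u : Unknown d μ c) :
    assemble d μ c (unknownEvol hc t u) = freeEvol t (assemble d μ c u) := by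
  simp only [assemble_apply, freeEvol_add, ← star_freeEvol]; rfl

lemma qcomm_split {V W A : Op d} (hV : IsSelfAdjoint V) (hW : IsSelfAdjoint W)
    (hA : IsSelfAdjoint A) (K T : Op d) :
    qcomm V A + ((lmul W A + qcomm V K + lmul W K) + star (lmul W A + qcomm V K + lmul W K) +
      (qcomm V T + qcomm W T + smulStar W K)) = qcomm (V + W) (A + (K + star K + T)) := by
  simp only [qcomm, lmul, smulStar, star_add, star_smul, star_sub, star_mul, hV.star_eq, hW.star_eq,
    hA.star_eq, star_neg, Complex.star_def, Complex.conj_I, neg_neg, neg_smul, smul_sub, smul_add,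
    mul_add, add_mul]
  abel

lemma assemble_quadB (x : Potentials d c) (y : Parts d μ c) : assemble d μ c (quadB x y) =
    qcomm (x.1.val + x.2.val) (y.1.val + (y.2.1.val + star y.2.1.val + y.2.2.val)) := by
  rw [← qcomm_split (selfAdjoint_of_sa _ x.1.lt_top) (selfAdjoint_of_sa _ x.2.lt_top)
    (selfAdjoint_of_sa _ y.1.lt_top)]
  rfl

lemma pot_assemble (hW : IsPot w) {f : Op d}
    (hf : HasDens f ρ) (sf : IsSelfAdjoint f) (u : Unknown d μ c) :
    pot w (f + assemble d μ c u) =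
      pot w f + (pot w u.1.val + (pot w (u.2.1.val + star u.2.1.val) + pot w u.2.2.val)) := by
  have d1 := hasDens_lat ((lat_op_le_pD u.1.val).trans_lt u.1.lt_top)
  have s1 := selfAdjoint_of_sa _ u.1.lt_top
  obtain ⟨ρ2, d2, -⟩ := exists_hasDens_of_pK u.2.1.lt_top
  have s2 := isSelfAdjoint_add_star u.2.1.val
  obtain ⟨ρ3, d3, -⟩ := exists_hasDens_of_trNorm ((trNorm_le_pS _).trans_lt u.2.2.lt_top)
  have s3 := selfAdjoint_of_sa _ u.2.2.lt_top
  rw [assemble_apply, pot_add hW hf sf (d1.add (d2.add d3)) (s1.add (s2.add s3)),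
    pot_add hW d1 s1 (d2.add d3) (s2.add s3), pot_add hW d2 s2 d3 s3]

lemma assemble_field (hμ : 0 < μ) (hc : c ≠ 0) (hW : IsPot w)
    (h : IsSelfAdjoint Q₀) (hf : FreeLowDensityContinuous μ Q₀) (t : ℝ) (u : Unknown d μ c) :
    assemble d μ c ((hartreeFlow hc hW (extPot c hW h hf) (extParts c hμ h)).field t u) =
      freeEvol (-t) (hartreeF μ w (freeEvol t (lowCut μ Q₀ + assemble d μ c u))) := by
  change assemble d μ c (unknownEvol hc (-t) (quadB (extPot c hW h hf t +
    potL μ c hW (unknownEvol hc t u)) (extParts c hμ h t + partsL d μ c (unknownEvol hc t u)))) = _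
  rw [assemble_unknownEvol, assemble_quadB, hartreeF, freeEvol_add, ← freeLow_eq,
    ← assemble_unknownEvol hc, pot_assemble hW (hasDens_freeLow t) (isSelfAdjoint_freeLow h t),
    assemble_apply, ← add_assoc (lowProj μ)]
  congr 2
  · change pot w (freeLow μ Q₀ t) + _ + (0 + _) = _
    rw [zero_add, add_assoc]; rfl
  · change lowProj μ + freeLow μ Q₀ t + _ + (0 + _ + star (0 + _) + (0 + _)) = _
    rw [zero_add, zero_add, add_assoc]; rfl

lemma le_inv_mul_of_mul_le {a b : ℝ≥0∞} (hc : c ≠ 0) (h : c * a ≤ b) : a ≤ (c : ℝ≥0∞)⁻¹ * b := by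
  calc a = (c : ℝ≥0∞)⁻¹ * (c * a) := by
        rw [← mul_assoc, ENNReal.inv_mul_cancel (by simpa using hc) ENNReal.coe_ne_top, one_mul]
    _ ≤ _ := by gcongr

def assembleConst (c : NNReal) : ℝ≥0∞ := 8 * (1 + (c : ℝ≥0∞)⁻¹ + ((c ^ 2 : NNReal) : ℝ≥0∞)⁻¹)

lemma assembleConst_lt_top (hc : c ≠ 0) : assembleConst c < ∞ := by
  have := ENNReal.inv_lt_top.2 (show (0 : ℝ≥0∞) < c by simpa [pos_iff_ne_zero] using hc)
  have h2 := ENNReal.inv_lt_top.2 (show (0 : ℝ≥0∞) < (c ^ 2 : NNReal) by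
    simpa [pos_iff_ne_zero] using hc)
  exact mul_lt_top (by simp) (add_lt_top.2 ⟨add_lt_top.2 ⟨by simp, this⟩, h2⟩)

lemma xN_assemble_le (hc : c ≠ 0) (u : Unknown d μ c) :
    xN d μ (assemble d μ c u) ≤ assembleConst c * ‖u‖ₑ := by
  have n1 : pD d μ c u.1.val ≤ ‖u‖ₑ := (FN.le_enorm u.1).trans (enorm_le_iff_norm_le.2 (norm_fst_le u))
  have n2 : pK d μ c u.2.1.val ≤ ‖u‖ₑ := (FN.le_enorm u.2.1).trans
    (enorm_le_iff_norm_le.2 ((norm_fst_le u.2).trans (norm_snd_le u)))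
  have n3 : pS d u.2.2.val ≤ ‖u‖ₑ := (FN.le_enorm u.2.2).trans
    (enorm_le_iff_norm_le.2 ((norm_snd_le u.2).trans (norm_snd_le u)))
  have s1 := selfAdjoint_of_sa _ u.1.lt_top
  have s3 := selfAdjoint_of_sa _ u.2.2.lt_top
  set x := ‖u‖ₑ
  set k := (c : ℝ≥0∞)⁻¹
  set l := ((c ^ 2 : NNReal) : ℝ≥0∞)⁻¹
  have b1 : xN d μ u.1.val ≤ k * x + l * x := by
    rw [xN_apply s1]
    refine add_le_add ?_ ?_
    · exact (le_lat (hsN d) _).trans (le_inv_mul_of_mul_le hc ((lat_hs_le_pD _).trans n1))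
    · refine le_inv_mul_of_mul_le (pow_ne_zero 2 hc) (le_trans ?_ n1)
      rw [pD_apply s1, ENNReal.coe_pow]
      exact le_add_self
  have b2 : xN d μ (u.2.1.val + star u.2.1.val) ≤ 2 * x + 2 * (k * x) := by
    have t2 : trNorm (u.2.1.val * hiProj μ) ≤ k * x := by
      refine le_inv_mul_of_mul_le hc (le_trans ?_ n2)
      rw [pK_apply]; exact le_add_self
    have t3 : trNorm (hiProj μ * u.2.1.val * hiProj μ) ≤ k * x := by
      rw [mul_assoc]; exact (trNorm_hi_mul_le _).trans t2
    rw [xN_apply (isSelfAdjoint_add_star _), two_mul, two_mul]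
    refine add_le_add ((hsNorm_add_le _ _).trans ?_) ?_
    · rw [hsNorm_star]
      have := (hsNorm_le_colSum u.2.1.val).trans ((colSum_le_pK _).trans n2)
      exact add_le_add this this
    · rw [mul_add, add_mul]
      refine (trNorm_add_le _ _).trans (add_le_add t3 ?_)
      rw [← trNorm_star, star_mul, star_mul, star_star, star_hi, ← mul_assoc]
      exact t3
  have b3 : xN d μ u.2.2.val ≤ 2 * x := by
    rw [xN_apply s3, two_mul]
    exact add_le_add ((hsNorm_le_trNorm _).trans ((trNorm_le_pS _).trans n3))
      ((trNorm_mul_hi_le _).trans ((trNorm_hi_mul_le _).trans ((trNorm_le_pS _).trans n3)))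
  calc xN d μ (assemble d μ c u) ≤ (k * x + l * x) + ((2 * x + 2 * (k * x)) + 2 * x) := by
        rw [assemble_apply]
        exact (ExtNorm.add_le _ _ _).trans (add_le_add b1
          ((ExtNorm.add_le _ _ _).trans (add_le_add b2 b3)))
    _ = (4 + 3 * k + l) * x := by ring
    _ ≤ (8 + 8 * k + 8 * l) * x := by
        gcongr
        · norm_num
        · norm_num
        · exact le_mul_of_one_le_left' (by norm_num)
    _ = _ := by rw [assembleConst]; ring

/-! ### Local existence -/

lemma hi_mul_block : (hiProj μ * A * loProj μ) * hiProj μ = 0 := by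
  rw [mul_assoc, lo_mul_hi, mul_zero]

lemma pK_block_le (A : Op d) : pK d μ c (hiProj μ * A * loProj μ) ≤
    cubeCount (lowSet d (2 * μ)) * zNorm μ A := by
  rw [pK_apply, hi_mul_block, trNorm_zero, mul_zero, add_zero]
  have e : hiProj μ * A * loProj μ = hiProj μ * A * loProj μ * freqProj (lowSet d (2 * μ)) := by
    rw [mul_assoc _ (loProj μ)]; exact congrArg (hiProj μ * A * ·) lo_mul_lo.symm
  rw [e]
  refine (colSum_mul_freqProj_le (measurableSet_lowSet _) _).trans (mul_le_mul_right ?_ _)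
  rw [zNorm]
  exact le_add_self.trans le_self_add

lemma pS_block_le (hA : IsSelfAdjoint A) : pS d (hiProj μ * A * hiProj μ) ≤ zNorm μ A := by
  rw [pS_apply (isSelfAdjoint_conj hA star_hi), zNorm]
  exact le_add_self

lemma FN.norm_le_two_mul {a : FN p} {b : ℝ≥0∞} (hop : ‖a.val‖ₑ ≤ p a.val)
    (h : p a.val ≤ b) (hb : b < ∞) : ‖a‖ ≤ (2 * b).toReal := by
  refine FN.norm_le_of_enorm (mul_lt_top (by simp) hb).ne ?_
  rw [two_mul]
  exact add_le_add (hop.trans h) h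

/-- A bound of the data of the quadratic flow in terms of the size of the initial state. -/
def dataBound (d : ℕ) (μ : ℝ) (w : Space d → ℝ) (R : ℝ≥0∞) : ℝ≥0∞ :=
  ((1 + nearCount d) * wNorm w + 1) *
    (cubeCount (lowSet d (2 * μ)) * cubeCount (lowSet d (2 * μ)) * (1 + R)) + 1 +
    cubeCount (lowSet d (2 * μ)) * R + R

lemma dataBound_lt_top (hW : IsPot w) {R : ℝ≥0∞} (hR : R < ∞) : dataBound d μ w R < ∞ := by
  have hC := cubeCount_lt_top (isBounded_lowSet (d := d) (2 * μ))
  have h3 := (pW_coeff_lt_top (c := 0) (μ := μ) hW).1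
  have h4 : 1 + R < ∞ := add_lt_top.2 ⟨by simp, hR⟩
  exact add_lt_top.2 ⟨add_lt_top.2 ⟨add_lt_top.2 ⟨mul_lt_top
    (add_lt_top.2 ⟨h3, by simp⟩) (mul_lt_top (mul_lt_top hC hC) h4), by simp⟩,
    mul_lt_top hC hR⟩, hR⟩

lemma lat_freeLow_le (hμ : 0 < μ) (t : ℝ) : lat (opN d) (freeLow μ Q₀ t) ≤
    cubeCount (lowSet d (2 * μ)) * cubeCount (lowSet d (2 * μ)) * yNorm μ Q₀ :=
  (lat_lowCut_le _).trans (mul_le_mul_right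
    ((isIdealNorm_op.freeEvol_le t Q₀).trans (enorm_le_yNorm hμ Q₀)) _)

lemma norm_extPot_le (hμ : 0 < μ) (hW : IsPot w)
    (h : IsSelfAdjoint Q₀) (hf : FreeLowDensityContinuous μ Q₀) {R : ℝ≥0∞} (hR : R < ∞)
    (hQR : yNorm μ Q₀ ≤ R) (hc : c * (bandCount (lowSet d (2 * μ)) * wNorm w) *
      eLpNorm (freeLowDensity μ Q₀ t) 2 volume ≤ 1) :
    ‖extPot c hW h hf t‖ ≤ (2 * dataBound d μ w R).toReal := by
  refine norm_prod_le_iff.2 ⟨FN.norm_le_two_mul ?_ ?_ (dataBound_lt_top hW hR), ?_⟩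
  · change ‖pot w (freeLow μ Q₀ t)‖ₑ ≤ pW d c (pot w (freeLow μ Q₀ t))
    rw [pW_apply (isSelfAdjoint_pot_freeLow hW h t), add_assoc]
    exact le_self_add
  · refine (pW_pot_lowCut_le hW (isSelfAdjoint_freeEvol h t)).trans ?_
    rw [← freeLowDensity_eq, dataBound, add_assoc _ _ R, ← mul_assoc]
    refine le_trans (add_le_add (mul_le_mul' le_self_add ?_) hc) le_self_add
    exact (lat_freeLow_le hμ t).trans (mul_le_mul_right (hQR.trans le_add_self) _)
  · exact norm_zero.le.trans toReal_nonneg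

lemma norm_extParts_le (hμ : 0 < μ) (hW : IsPot w)
    (h : IsSelfAdjoint Q₀) {R : ℝ≥0∞} (hR : R < ∞) (hQR : yNorm μ Q₀ ≤ R) (t : ℝ) :
    ‖extParts c hμ h t‖ ≤ (2 * dataBound d μ w R).toReal := by
  have e : pA d μ c (lowProj μ + freeLow μ Q₀ t) = lat (opN d) (lowProj μ + freeLow μ Q₀ t) := by
    rw [lowProj_add_freeLow hμ, pA_lowCut (isSelfAdjoint_lowProj_add h t)]
  refine norm_prod_le_iff.2 ⟨FN.norm_le_two_mul ?_ ?_ (dataBound_lt_top hW hR), ?_⟩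
  · change ‖_‖ₑ ≤ pA d μ c (lowProj μ + freeLow μ Q₀ t)
    rw [e]
    exact le_lat (opN d) _
  · change pA d μ c (lowProj μ + freeLow μ Q₀ t) ≤ _
    rw [e, lowProj_add_freeLow hμ, dataBound, add_mul _ 1, one_mul, add_assoc, add_assoc, add_assoc]
    refine (lat_lowCut_le _).trans (le_trans (mul_le_mul_right ?_ _)
      (le_self_add.trans le_add_self))
    exact (enorm_add_le _ _).trans (add_le_add (enorm_freqProj_le _)
      ((isIdealNorm_op.freeEvol_le t Q₀).trans ((enorm_le_yNorm hμ Q₀).trans hQR)))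
  · exact norm_zero.le.trans toReal_nonneg

/-- The initial unknowns: the off-diagonal and the high-momentum blocks. -/
def initUnknown (c : NNReal) (hμ : 0 < μ) (hQ : InY μ Q₀) : Unknown d μ c :=
  (0, FN.mk (hiProj μ * Q₀ * loProj μ) ((pK_block_le Q₀).trans_lt (mul_lt_top
    (cubeCount_lt_top (isBounded_lowSet _)) ((zNorm_le_yNorm hμ Q₀).trans_lt (hQ.yNorm_lt_top hμ)))),
    FN.mk (hiProj μ * Q₀ * hiProj μ) ((pS_block_le hQ.1).trans_lt
      ((zNorm_le_yNorm hμ Q₀).trans_lt (hQ.yNorm_lt_top hμ))))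

lemma norm_initUnknown_le (hμ : 0 < μ) (hQ : InY μ Q₀) (hW : IsPot w) {R : ℝ≥0∞} (hR : R < ∞) (hQR : yNorm μ Q₀ ≤ R) :
    ‖initUnknown c hμ hQ‖ ≤ (2 * dataBound d μ w R).toReal := by
  have hz := (zNorm_le_yNorm hμ Q₀).trans hQR
  refine norm_prod_le_iff.2 ⟨norm_zero.le.trans toReal_nonneg, norm_prod_le_iff.2
    ⟨FN.norm_le_two_mul (enorm_le_pK _) ((pK_block_le Q₀).trans ?_) (dataBound_lt_top hW hR),
      FN.norm_le_two_mul (enorm_le_pS _) ((pS_block_le hQ.1).trans ?_) (dataBound_lt_top hW hR)⟩⟩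
  · exact (mul_le_mul_right hz _).trans (le_add_self.trans le_self_add)
  · exact hz.trans le_add_self

lemma assemble_initUnknown (hμ : 0 < μ) (hQ : InY μ Q₀) :
    lowCut μ Q₀ + assemble d μ c (initUnknown c hμ hQ) = Q₀ := by
  conv_rhs => rw [eq_blocks (μ := μ) hQ.1]
  change lowCut μ Q₀ + (0 + (_ + _ + _)) = _
  rw [zero_add, ← add_assoc]; rfl

/-- A solution of the quadratic flow provides a solution of the Hartree equation. -/
lemma isSolution_assemble (hμ : 0 < μ) (hc : c ≠ 0) (hW : IsPot w)
    (hQ : InY μ Q₀) (hf : FreeLowDensityContinuous μ Q₀) {τ : ℝ}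
    {u : ℝ → Unknown d μ c} (hu : Continuous u)
    (hsol : ∀ t ∈ Icc (-τ) τ, u t = initUnknown c hμ hQ + ∫ s in (0 : ℝ)..t,
      (hartreeFlow hc hW (extPot c hW hQ.1 hf) (extParts c hμ hQ.1)).field s (u s)) :
    IsSolution μ w Q₀ (Icc (-τ) τ) fun t => freeEvol t (lowCut μ Q₀ + assemble d μ c (u t)) := by
  set F := hartreeFlow hc hW (extPot c hW hQ.1 hf) (extParts c hμ hQ.1)
  have hq : ∀ t, freeEvol t (lowCut μ Q₀ + assemble d μ c (u t)) =
      freeLow μ Q₀ t + freeEvol t (assemble d μ c (u t)) := fun t => by rw [freeEvol_add, freeLow_eq]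
  have hx : ∀ t, xN d μ (freeEvol t (assemble d μ c (u t))) < ∞ := fun t => by
    rw [xN_freeEvol]
    exact (xN_assemble_le hc _).trans_lt (mul_lt_top (assembleConst_lt_top hc) enorm_lt_top)
  have hfield : Continuous fun s => F.field s (u s) := continuousOn_univ.1
    (F.continuousOn_field (continuous_extPot hW hQ.1 hf).continuousOn
      (continuous_extParts hμ hQ.1).continuousOn hu.continuousOn)
  have hint : ∀ t s, freeEvol (t - s) (hartreeF μ w (freeEvol s (lowCut μ Q₀ + assemble d μ c (u s)))) =
      ((freeEvolL t).comp (assemble d μ c)) (F.field s (u s)) := fun t s => by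
    rw [ContinuousLinearMap.comp_apply, assemble_field, freeEvolL_apply, freeEvol_freeEvol,
      sub_eq_add_neg]
  refine isSolution_iff.2 ⟨fun t _ => ?_, fun t₀ _ => ?_, fun t _ => ?_, fun t ht => ?_⟩
  · rw [hq]
    exact (inY_freeLow hμ hQ.1 hf t).add hμ (inY_of_xN hμ (hx t))
  · refine Tendsto.mono_left ?_ nhdsWithin_le_nhds
    have h3 : Tendsto (fun t => xN d μ (assemble d μ c (u t) - assemble d μ c (u t₀))) (𝓝 t₀) (𝓝 0) := by
      have h4 : Tendsto (fun t => assembleConst c * ‖u t - u t₀‖ₑ) (𝓝 t₀) (𝓝 0) := by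
        rw [← mul_zero (assembleConst c)]
        refine ENNReal.Tendsto.const_mul ?_ (Or.inr (assembleConst_lt_top hc).ne)
        simpa [edist_eq_enorm_sub] using tendsto_iff_edist_tendsto_0.1 (hu.tendsto t₀)
      refine tendsto_zero_of_le h4 fun t => ?_
      rw [← map_sub]
      exact xN_assemble_le hc _
    have h5 := isFreeCts_xN.tendsto_of_tendsto le_rfl (X := fun t => assemble d μ c (u t))
      ((xN_assemble_le hc _).trans_lt (mul_lt_top (assembleConst_lt_top hc) enorm_lt_top)) h3
    have h6 := (tendsto_yNorm_freeLow hμ hQ.1 hf t₀).add (ENNReal.Tendsto.const_mul h5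
      (Or.inr (three_add_lowVol_lt_top (d := d) (μ := μ)).ne))
    rw [mul_zero, add_zero] at h6
    refine tendsto_zero_of_le h6 fun t => ?_
    rw [hq, hq, add_sub_add_comm]
    have s1 := (isSelfAdjoint_freeLow (μ := μ) hQ.1 t).sub (isSelfAdjoint_freeLow (μ := μ) hQ.1 t₀)
    have s2 := (isSelfAdjoint_of_xN (hx t)).sub (isSelfAdjoint_of_xN (hx t₀))
    exact (yNorm_add_le hμ s1 s2).trans (add_le_add le_rfl (yNorm_le_xN hμ _))
  · simp only [hint]
    exact (((freeEvolL t).comp (assemble d μ c)).continuous.comp hfield).intervalIntegrable _ _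
  · simp only [hint]
    rw [ContinuousLinearMap.intervalIntegral_comp_comm _ (hfield.intervalIntegrable _ _), hsol t ht,
      ContinuousLinearMap.comp_apply, freeEvolL_apply, ← freeEvol_add, map_add, ← add_assoc,
      assemble_initUnknown]

lemma exists_scale_le {a b : ℝ≥0∞} (ha : a < ∞) (hb : b < ∞) : ∃ c : NNReal, c ≠ 0 ∧ c * a * b ≤ 1 := by
  lift a to NNReal using ha.ne
  lift b to NNReal using hb.ne
  refine ⟨(a * b + 1)⁻¹, by positivity, ?_⟩
  norm_cast
  rw [mul_assoc, inv_mul_le_iff₀ (by positivity), mul_one]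
  exact le_self_add

/-- Local existence, on an interval which only depends on the size of the initial state. -/
theorem exists_local_solution (hμ : 0 < μ) (hW : IsPot w)
    {R : ℝ≥0∞} (hR : R < ∞) : ∃ τ : ℝ, 0 < τ ∧ ∀ Q₀ : Op d, InY μ Q₀ →
      FreeLowDensityContinuous μ Q₀ → yNorm μ Q₀ ≤ R → ∃ q, IsSolution μ w Q₀ (Icc (-τ) τ) q := by
  set r := (2 * dataBound d μ w R).toReal + 1
  have hr : 0 < r := by positivity
  refine ⟨lifeTime 24 (2 * potMapConst w + 1) r, lifeTime_pos (by norm_num) hr,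
    fun Q₀ hQ hf hQR => ?_⟩
  obtain ⟨M, hM, hfM⟩ := hf.exists_bound (isCompact_Icc (a := (-1 : ℝ)) (b := 1))
  obtain ⟨c, hc, hcM⟩ := exists_scale_le (mul_lt_top
    (bandCount_lt_top (isBounded_lowSet (d := d) (2 * μ))) (wNorm_lt_top hW)) hM
  have hle : ∀ {x : ℝ}, x ≤ (2 * dataBound d μ w R).toReal → x ≤ r := fun h => h.trans (by linarith)
  obtain ⟨u, hu, hsol⟩ := (hartreeFlow hc hW (extPot c hW hQ.1 hf)
    (extParts c hμ hQ.1)).exists_solution (by norm_num) (by positivity) hr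
    (continuous_extPot hW hQ.1 hf).continuousOn (continuous_extParts hμ hQ.1).continuousOn
    (fun t ht => hle (norm_extPot_le hμ hW hQ.1 hf hR hQR
      ((mul_le_mul_right (hfM t ht) _).trans hcM)))
    (fun t _ => hle (norm_extParts_le hμ hW hQ.1 hR hQR t))
    (hle (norm_initUnknown_le (c := c) hμ hQ hW hR hQR))
  exact ⟨_, isSolution_assemble hμ hc hW hQ hf hu hsol⟩

end

section

variable {Q₀ : Op d} {q q' : ℝ → Op d} {J K : Set ℝ}

/-! ### Persistence of the continuity of the free density -/

lemma freeLowDensityContinuous_iff (hA : IsSelfAdjoint A) :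
    FreeLowDensityContinuous μ A ↔ (∀ t, lowDensNorm μ (freeEvol t A) < ∞) ∧
      ∀ t₀, Tendsto (fun t => lowDensNorm μ (freeEvol t A - freeEvol t₀ A)) (𝓝 t₀) (𝓝 0) := by
  have e : ∀ t s, lowDensNorm μ (freeEvol t A - freeEvol s A) =
      eLpNorm (freeLowDensity μ A t - freeLowDensity μ A s) 2 volume := fun t s => by
    rw [← eLpNorm_freeLowDensity_sub hA, freeLow_sub]; rfl
  simp only [FreeLowDensityContinuous, e]
  refine and_congr_left' (forall_congr' fun t => ?_)
  rw [freeLowDensity_eq]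
  exact ⟨fun h => h.2, fun h => ⟨density_aestronglyMeasurable (hasDens_freeLow t)
    (isSelfAdjoint_freeLow hA t), h⟩⟩

lemma FreeLowDensityContinuous.freeEvol (h : FreeLowDensityContinuous μ Q₀) (s : ℝ) :
    FreeLowDensityContinuous μ (freeEvol s Q₀) := by
  have e : ∀ t, freeLowDensity μ (Hartree.freeEvol s Q₀) t = freeLowDensity μ Q₀ (t + s) := fun t => by
    rw [freeLowDensity_eq, freeLowDensity_eq, freeEvol_freeEvol]
  simp only [FreeLowDensityContinuous, e]
  exact ⟨fun t => h.1 _, fun t₀ => (h.2 (t₀ + s)).comp ((continuous_add_const s).tendsto t₀)⟩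

lemma freeLowDensityContinuous_of_hs (hX : IsSelfAdjoint X) (h : hsNorm X < ∞) :
    FreeLowDensityContinuous μ X := by
  refine (freeLowDensityContinuous_iff hX).2 ⟨fun t => ?_, fun t₀ => ?_⟩
  · exact (eLpNorm_density_lowCut_le (isSelfAdjoint_freeEvol hX t)).trans_lt (mul_lt_top
      lowVol_lt_top ((isFreeCts_hs.freeEvol_le t X).trans_lt h))
  · have h3 := ENNReal.Tendsto.const_mul (isFreeCts_hs.tendsto_of_tendsto (X := fun _ => X)
      (le_refl (𝓝 t₀)) h (by simp)) (Or.inr (lowVol_lt_top (d := d) (μ := μ)).ne)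
    rw [mul_zero] at h3
    exact tendsto_zero_of_le h3 fun t => eLpNorm_density_lowCut_le
        ((isSelfAdjoint_freeEvol hX t).sub (isSelfAdjoint_freeEvol hX t₀))

lemma FreeLowDensityContinuous.add {A B : Op d} (hA : IsSelfAdjoint A) (hB : IsSelfAdjoint B)
    (h : FreeLowDensityContinuous μ A) (h' : FreeLowDensityContinuous μ B) :
    FreeLowDensityContinuous μ (A + B) := by
  rw [freeLowDensityContinuous_iff hA] at h
  rw [freeLowDensityContinuous_iff hB] at h'
  refine (freeLowDensityContinuous_iff (hA.add hB)).2 ⟨fun t => ?_, fun t₀ => ?_⟩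
  · rw [freeEvol_add]
    exact (lowDensNorm_add_le (isSelfAdjoint_freeEvol hA t) (isSelfAdjoint_freeEvol hB t)).trans_lt
      (add_lt_top.2 ⟨h.1 t, h'.1 t⟩)
  · have h3 := (h.2 t₀).add (h'.2 t₀)
    rw [add_zero] at h3
    refine tendsto_zero_of_le h3 fun t => ?_
    rw [freeEvol_add, freeEvol_add, add_sub_add_comm]
    exact lowDensNorm_add_le ((isSelfAdjoint_freeEvol hA t).sub (isSelfAdjoint_freeEvol hA t₀))
      ((isSelfAdjoint_freeEvol hB t).sub (isSelfAdjoint_freeEvol hB t₀))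

lemma IsSolution.freeLowDensityContinuous (hμ : 0 < μ) (h : IsSolution μ w Q₀ J q)
    (hQ : IsSelfAdjoint Q₀) (hf : FreeLowDensityContinuous μ Q₀) (hJ : J.OrdConnected)
    (h0 : (0 : ℝ) ∈ J) (hW : IsPot w) {s : ℝ} (hs : s ∈ J) :
    FreeLowDensityContinuous μ (q s) := by
  have hK : uIcc 0 s ⊆ J := hJ.uIcc_subset h0 hs
  obtain ⟨M, hMt, hM⟩ := h.exists_bound hμ isCompact_uIcc hK
  have hx := ((h.mono hK).xN_sub_free_le hμ ordConnected_uIcc left_mem_uIcc hW hM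
    right_mem_uIcc).trans_lt (mul_lt_top enorm_lt_top (mul_lt_top (by simp)
      (mul_lt_top (mul_lt_top potConst_lt_top
        (mul_lt_top (wNorm_lt_top hW) hMt)) (add_lt_top.2 ⟨by simp, hMt⟩))))
  have sx := isSelfAdjoint_of_xN hx
  rw [← add_sub_cancel (freeEvol s Q₀) (q s)]
  exact (hf.freeEvol s).add (isSelfAdjoint_freeEvol hQ s) sx
    (freeLowDensityContinuous_of_hs sx ((hsNorm_le_xN _).trans_lt hx))

/-! ### Restarting and gluing solutions -/

/-- The Hartree equation between any two times of `J`, in the interaction picture. -/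
structure IsFlow (μ : ℝ) (w : Space d → ℝ) (J : Set ℝ) (q : ℝ → Op d) : Prop where
  mem : ∀ t ∈ J, InY μ (q t)
  cont : ∀ t₀ ∈ J, Tendsto (fun t => yNorm μ (q t - q t₀)) (𝓝[J] t₀) (𝓝 0)
  integrable : ∀ s ∈ J, ∀ t ∈ J,
    IntervalIntegrable (fun r => freeEvol (-r) (hartreeF μ w (q r))) volume s t
  duhamel : ∀ s ∈ J, ∀ t ∈ J, freeEvol (-t) (q t) - freeEvol (-s) (q s) =
    ∫ r in s..t, freeEvol (-r) (hartreeF μ w (q r))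

lemma intervalIntegrable_freeEvol {g : ℝ → Op d} {a b : ℝ} (t : ℝ)
    (h : IntervalIntegrable g volume a b) :
    IntervalIntegrable (fun r => freeEvol t (g r)) volume a b :=
  ⟨(freeEvolL t).integrable_comp h.1, (freeEvolL t).integrable_comp h.2⟩

lemma integral_freeEvol {g : ℝ → Op d} {a b : ℝ} (t : ℝ) (h : IntervalIntegrable g volume a b) :
    ∫ r in a..b, freeEvol t (g r) = freeEvol t (∫ r in a..b, g r) :=
  ContinuousLinearMap.intervalIntegral_comp_comm (freeEvolL t) h

lemma isSolution_iff_isFlow (h0 : (0 : ℝ) ∈ J) :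
    IsSolution μ w Q₀ J q ↔ IsFlow μ w J q ∧ q 0 = Q₀ := by
  have e : ∀ t, (fun s => freeEvol (t - s) (hartreeF μ w (q s))) =
      fun s => freeEvol t (freeEvol (-s) (hartreeF μ w (q s))) := fun t => by
    ext1 s; rw [freeEvol_freeEvol, sub_eq_add_neg]
  rw [isSolution_iff]
  constructor
  · rintro ⟨h1, h2, h3, h4⟩
    have h3' : ∀ t ∈ J, IntervalIntegrable (fun r => freeEvol (-r) (hartreeF μ w (q r))) volume 0 t :=
      fun t ht => by
        have := intervalIntegrable_freeEvol (-t) (h3 t ht)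
        simp only [freeEvol_freeEvol] at this
        refine this.congr fun s _ => ?_
        congr 1; ring
    have h4' : ∀ t ∈ J, freeEvol (-t) (q t) = Q₀ + ∫ r in (0 : ℝ)..t,
        freeEvol (-r) (hartreeF μ w (q r)) := fun t ht => by
      have := h4 t ht
      rw [e, integral_freeEvol t (h3' t ht), ← freeEvol_add] at this
      rw [this, freeEvol_freeEvol, neg_add_cancel, freeEvol_zero]
    have hint : ∀ s ∈ J, ∀ t ∈ J, IntervalIntegrable
      (fun r => freeEvol (-r) (hartreeF μ w (q r))) volume s t := fun s hs t ht =>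
        (h3' s hs).symm.trans (h3' t ht)
    refine ⟨⟨h1, h2, hint, fun s hs t ht => ?_⟩, ?_⟩
    · rw [h4' s hs, h4' t ht, add_sub_add_left_eq_sub,
        intervalIntegral.integral_interval_sub_left (h3' t ht) (h3' s hs)]
    · have := h4 0 h0
      rwa [intervalIntegral.integral_same, add_zero, freeEvol_zero] at this
  · rintro ⟨⟨h1, h2, h3, h4⟩, rfl⟩
    refine ⟨h1, h2, fun t ht => ?_, fun t ht => ?_⟩
    · rw [e]
      exact intervalIntegrable_freeEvol t (h3 0 h0 t ht)
    · rw [e, integral_freeEvol t (h3 0 h0 t ht), ← h4 0 h0 t ht, neg_zero, freeEvol_zero,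
        ← freeEvol_add, add_sub_cancel, freeEvol_freeEvol, add_neg_cancel, freeEvol_zero]

lemma IsFlow.mono (h : IsFlow μ w J q) (hK : K ⊆ J) : IsFlow μ w K q :=
  ⟨fun t ht => h.mem t (hK ht), fun t ht => (h.cont t (hK ht)).mono_left (nhdsWithin_mono t hK),
    fun s hs t ht => h.integrable s (hK hs) t (hK ht),
    fun s hs t ht => h.duhamel s (hK hs) t (hK ht)⟩

lemma IsFlow.shift (h : IsFlow μ w J q) (a : ℝ) : IsFlow μ w ((· + a) ⁻¹' J) fun t => q (t + a) := by
  have e : ∀ r, freeEvol (-r) (hartreeF μ w (q (r + a))) =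
      freeEvol a (freeEvol (-(r + a)) (hartreeF μ w (q (r + a)))) := fun r => by
    rw [freeEvol_freeEvol]; congr 1; ring
  refine ⟨fun t ht => h.mem _ ht, fun t₀ ht₀ => ?_, fun s hs t ht => ?_, fun s hs t ht => ?_⟩
  · refine (h.cont (t₀ + a) ht₀).comp (tendsto_nhdsWithin_of_tendsto_nhds_of_eventually_within _ ?_ ?_)
    · exact ((continuous_add_const a).tendsto t₀).mono_left nhdsWithin_le_nhds
    · exact self_mem_nhdsWithin
  · simp only [e]
    have := (h.integrable _ hs _ ht).comp_add_right a
    rw [add_sub_cancel_right, add_sub_cancel_right] at this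
    exact intervalIntegrable_freeEvol a this
  · have := (h.integrable _ hs _ ht).comp_add_right a
    rw [add_sub_cancel_right, add_sub_cancel_right] at this
    simp only [e]
    rw [integral_freeEvol a this, intervalIntegral.integral_comp_add_right
      (fun r => freeEvol (-r) (hartreeF μ w (q r))), ← h.duhamel _ hs _ ht, freeEvol_sub,
      freeEvol_freeEvol, freeEvol_freeEvol]
    congr 3 <;> ring

lemma IsFlow.congr (h : IsFlow μ w J q) (hJ : J.OrdConnected) (he : EqOn q' q J) :
    IsFlow μ w J q' := by
  have e : ∀ s ∈ J, ∀ t ∈ J, EqOn (fun r => freeEvol (-r) (hartreeF μ w (q' r)))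
      (fun r => freeEvol (-r) (hartreeF μ w (q r))) (uIcc s t) := fun s hs t ht r hr => by
    simp only [he (hJ.uIcc_subset hs ht hr)]
  refine ⟨fun t ht => by rw [he ht]; exact h.mem t ht, fun t₀ ht₀ => ?_, fun s hs t ht => ?_,
    fun s hs t ht => ?_⟩
  · refine (h.cont t₀ ht₀).congr' ?_
    filter_upwards [self_mem_nhdsWithin] with t ht
    rw [he ht₀, he ht]
  · exact (h.integrable s hs t ht).congr fun r hr => (e s hs t ht (uIoc_subset_uIcc hr)).symm
  · rw [he hs, he ht, h.duhamel s hs t ht, intervalIntegral.integral_congr (e s hs t ht)]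

lemma IsFlow.union (h : IsFlow μ w J q) (h' : IsFlow μ w K q) (hJ : IsClosed J) (hK : IsClosed K)
    {x : ℝ} (hxJ : x ∈ J) (hxK : x ∈ K) : IsFlow μ w (J ∪ K) q := by
  have cont : ∀ {L : Set ℝ}, IsClosed L → IsFlow μ w L q → ∀ t₀,
      Tendsto (fun t => yNorm μ (q t - q t₀)) (𝓝[L] t₀) (𝓝 0) := fun {L} hL hf t₀ => by
    by_cases ht : t₀ ∈ L
    · exact hf.cont t₀ ht
    · rw [notMem_closure_iff_nhdsWithin_eq_bot.1 (hL.closure_eq.symm ▸ ht)]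
      exact tendsto_bot
  have key : ∀ t ∈ J ∪ K, IntervalIntegrable (fun r => freeEvol (-r) (hartreeF μ w (q r))) volume x t ∧
      freeEvol (-t) (q t) - freeEvol (-x) (q x) =
        ∫ r in x..t, freeEvol (-r) (hartreeF μ w (q r)) := fun t ht =>
    ht.elim (fun ht => ⟨h.integrable x hxJ t ht, h.duhamel x hxJ t ht⟩)
      fun ht => ⟨h'.integrable x hxK t ht, h'.duhamel x hxK t ht⟩
  refine ⟨fun t ht => ht.elim (h.mem t) (h'.mem t), fun t₀ _ => ?_, fun s hs t ht =>
    (key s hs).1.symm.trans (key t ht).1, fun s hs t ht => ?_⟩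
  · rw [nhdsWithin_union]
    exact (cont hJ h t₀).sup (cont hK h' t₀)
  · rw [← intervalIntegral.integral_interval_sub_left (key t ht).1 (key s hs).1, ← (key t ht).2,
      ← (key s hs).2, sub_sub_sub_cancel_right]

/-- A solution can be continued by the solution started at one of its values. -/
lemma IsSolution.extend (hμ : 0 < μ) (hW : IsPot w) {a b s τ : ℝ}
    (h0 : (0 : ℝ) ∈ Icc a b) (hs : s ∈ Icc a b) (hτ : 0 < τ) (h : IsSolution μ w Q₀ (Icc a b) q)
    (h' : IsSolution μ w (q s) (Icc (-τ) τ) q') :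
    ∃ p, IsSolution μ w Q₀ (Icc (min a (s - τ)) (max b (s + τ))) p := by
  classical
  have z : (0 : ℝ) ∈ Icc (-τ) τ := ⟨by linarith, hτ.le⟩
  obtain ⟨hf, hq0⟩ := (isSolution_iff_isFlow h0).1 h
  obtain ⟨hf', hq0'⟩ := (isSolution_iff_isFlow z).1 h'
  set K := Icc (s - τ) (s + τ)
  have hsK : s ∈ K := ⟨by linarith, by linarith⟩
  have hK : (fun t => t + -s) ⁻¹' Icc (-τ) τ = K := by
    ext t
    simp only [K, mem_preimage, mem_Icc]
    constructor <;> rintro ⟨_, _⟩ <;> constructor <;> linarith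
  have hfK := hf'.shift (-s)
  rw [hK] at hfK
  have hJ : (Icc a b ∩ K).OrdConnected := ordConnected_Icc.inter ordConnected_Icc
  have hJ' : ((fun t => t + s) ⁻¹' (Icc a b ∩ K)).OrdConnected :=
    hJ.preimage_mono (add_left_mono (a := s))
  have z' : (0 : ℝ) ∈ (fun t => t + s) ⁻¹' (Icc a b ∩ K) := by
    rw [mem_preimage, zero_add]; exact ⟨hs, hsK⟩
  have heq : EqOn (fun t => q' (t + -s)) q (Icc a b ∩ K) := fun t ht => by
    have e1 := (isSolution_iff_isFlow (Q₀ := q s) z').2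
      ⟨(hf.mono inter_subset_left).shift s, by rw [zero_add]⟩
    have e2 := (isSolution_iff_isFlow (Q₀ := q s) z').2
      ⟨(hfK.mono inter_subset_right).shift s, by rw [zero_add, add_neg_cancel, hq0']⟩
    have := e1.eqOn hμ e2 (h.mem s hs) hJ' z' hW
      (show t - s ∈ (fun t => t + s) ⁻¹' (Icc a b ∩ K) by rwa [mem_preimage, sub_add_cancel])
    simpa using this
  rw [← Icc_union_Icc' (by linarith [hs.2]) (by linarith [hs.1])]
  refine ⟨fun t => if t ∈ Icc a b then q t else q' (t + -s), (isSolution_iff_isFlow (Or.inl h0)).2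
    ⟨(hf.congr ordConnected_Icc fun t ht => if_pos ht).union
      (hfK.congr ordConnected_Icc fun t ht => ?_) isClosed_Icc isClosed_Icc hs hsK, ?_⟩⟩
  · dsimp only
    split_ifs with hta
    · exact (heq ⟨hta, ht⟩).symm
    · rfl
  · rw [if_pos h0, hq0]

/-! ### The maximal solution -/

/-- The times up to which there is a solution. -/
def solSet (μ : ℝ) (w : Space d → ℝ) (Q₀ : Op d) : Set ℝ :=
  {t | ∃ q, IsSolution μ w Q₀ (uIcc 0 t) q}

open Classical in
def maxSol (μ : ℝ) (w : Space d → ℝ) (Q₀ : Op d) (t : ℝ) : Op d :=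
  if h : ∃ q, IsSolution μ w Q₀ (uIcc 0 t) q then h.choose t else 0

/-- The assumptions of the well-posedness theorem. -/
structure Data (μ : ℝ) (w : Space d → ℝ) (Q₀ : Op d) : Prop where
  pos : 0 < μ
  pot : IsPot w
  inY : InY μ Q₀
  free : FreeLowDensityContinuous μ Q₀

lemma IsSolution.subset_solSet (h : IsSolution μ w Q₀ J q) (hJ : J.OrdConnected)
    (h0 : (0 : ℝ) ∈ J) : J ⊆ solSet μ w Q₀ := fun _ ht => ⟨q, h.mono (hJ.uIcc_subset h0 ht)⟩

lemma ordConnected_solSet : (solSet μ w Q₀).OrdConnected := by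
  have h : ∀ t ∈ solSet μ w Q₀, uIcc 0 t ⊆ solSet μ w Q₀ := fun t ⟨q, hq⟩ =>
    hq.subset_solSet ordConnected_uIcc left_mem_uIcc
  refine ⟨fun a ha b hb t ht => ?_⟩
  rcases le_total 0 t with h0 | h0
  · exact h b hb (Icc_subset_uIcc ⟨h0, ht.2⟩)
  · exact h a ha (Icc_subset_uIcc' ⟨ht.1, h0⟩)

namespace Data

lemma eqOn (D : Data μ w Q₀) (hJ : J.OrdConnected) (h0 : (0 : ℝ) ∈ J) (h : IsSolution μ w Q₀ J q) :
    EqOn q (maxSol μ w Q₀) J := fun t ht => by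
  have hs := h.mono (hJ.uIcc_subset h0 ht)
  have hex : ∃ q, IsSolution μ w Q₀ (uIcc 0 t) q := ⟨q, hs⟩
  rw [maxSol, dif_pos hex]
  exact hex.choose_spec.eqOn D.pos hs D.inY ordConnected_uIcc left_mem_uIcc D.pot right_mem_uIcc

lemma exists_extend (D : Data μ w Q₀) {R : ℝ≥0∞} (hR : R < ∞) : ∃ τ : ℝ, 0 < τ ∧ ∀ s ∈ solSet μ w Q₀,
    yNorm μ (maxSol μ w Q₀ s) ≤ R →
      ∃ p, IsSolution μ w Q₀ (Icc (min (min 0 s) (s - τ)) (max (max 0 s) (s + τ))) p := by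
  obtain ⟨τ, hτ, H⟩ := exists_local_solution D.pos D.pot hR
  refine ⟨τ, hτ, fun s ⟨q, hq⟩ hs => ?_⟩
  rw [← D.eqOn ordConnected_uIcc left_mem_uIcc hq right_mem_uIcc] at hs
  obtain ⟨q', hq'⟩ := H (q s) (hq.mem s right_mem_uIcc) (hq.freeLowDensityContinuous D.pos D.inY.1
    D.free ordConnected_uIcc left_mem_uIcc D.pot right_mem_uIcc) hs
  exact hq.extend D.pos D.pot left_mem_uIcc right_mem_uIcc hτ hq'

lemma exists_Icc_subset (D : Data μ w Q₀) {R : ℝ≥0∞} (hR : R < ∞) : ∃ τ : ℝ, 0 < τ ∧ ∀ s ∈ solSet μ w Q₀,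
    yNorm μ (maxSol μ w Q₀ s) ≤ R → Icc (s - τ) (s + τ) ⊆ solSet μ w Q₀ := by
  obtain ⟨τ, hτ, H⟩ := D.exists_extend hR
  refine ⟨τ, hτ, fun s hs hsR => ?_⟩
  obtain ⟨p, hp⟩ := H s hs hsR
  refine Subset.trans ?_ (hp.subset_solSet ordConnected_Icc ⟨by simp, by simp⟩)
  exact Icc_subset_Icc (min_le_right _ _) (le_max_right _ _)

lemma zero_mem (D : Data μ w Q₀) : (0 : ℝ) ∈ solSet μ w Q₀ := by
  obtain ⟨τ, hτ, H⟩ := exists_local_solution D.pos D.pot (D.inY.yNorm_lt_top D.pos)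
  obtain ⟨q, hq⟩ := H Q₀ D.inY D.free le_rfl
  exact hq.subset_solSet ordConnected_Icc ⟨by linarith, hτ.le⟩ ⟨by linarith, hτ.le⟩

lemma inY_maxSol (D : Data μ w Q₀) (ht : t ∈ solSet μ w Q₀) : InY μ (maxSol μ w Q₀ t) := by
  obtain ⟨q, hq⟩ := ht
  rw [← D.eqOn ordConnected_uIcc left_mem_uIcc hq right_mem_uIcc]
  exact hq.mem t right_mem_uIcc

lemma exists_local (D : Data μ w Q₀) (ht : t ∈ solSet μ w Q₀) : ∃ a b p, (0 : ℝ) ∈ Icc a b ∧ t ∈ Ioo a b ∧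
    IsSolution μ w Q₀ (Icc a b) p := by
  obtain ⟨τ, hτ, H⟩ := D.exists_extend ((D.inY_maxSol ht).yNorm_lt_top D.pos)
  obtain ⟨p, hp⟩ := H t ht le_rfl
  exact ⟨_, _, p, ⟨by simp, by simp⟩, ⟨(min_le_right _ _).trans_lt (by linarith),
    lt_of_lt_of_le (by linarith) (le_max_right _ _)⟩, hp⟩

lemma isOpen_solSet (D : Data μ w Q₀) : IsOpen (solSet μ w Q₀) := isOpen_iff_mem_nhds.2 fun t ht => by
  obtain ⟨a, b, p, h0, ht, hp⟩ := D.exists_local ht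
  exact mem_of_superset (Icc_mem_nhds ht.1 ht.2) (hp.subset_solSet ordConnected_Icc h0)

lemma isSolution_maxSol (D : Data μ w Q₀) : IsSolution μ w Q₀ (solSet μ w Q₀) (maxSol μ w Q₀) := by
  have h : ∀ t ∈ solSet μ w Q₀, IsSolution μ w Q₀ (uIcc 0 t) (maxSol μ w Q₀) := fun t ⟨q, hq⟩ =>
    hq.congr ordConnected_uIcc left_mem_uIcc (D.eqOn ordConnected_uIcc left_mem_uIcc hq).symm
  refine ⟨fun t ht => D.inY_maxSol ht, fun t ht => ?_, fun t ht => (h t ht).integrable t right_mem_uIcc,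
    fun t ht => (h t ht).duhamel t right_mem_uIcc⟩
  obtain ⟨a, b, p, h0, ht', hp⟩ := D.exists_local ht
  have hp' := hp.congr ordConnected_Icc h0 (D.eqOn ordConnected_Icc h0 hp).symm
  have := hp'.cont t ⟨ht'.1.le, ht'.2.le⟩
  rw [nhdsWithin_eq_nhds.2 (Icc_mem_nhds ht'.1 ht'.2)] at this
  exact this.mono_left nhdsWithin_le_nhds

end Data

end

section

variable {Q₀ Q₀' : Op d} {q : ℝ → Op d} {Tm Tp : EReal}

/-! ### Lifespans -/

lemma mem_lifespan : t ∈ lifespan Tm Tp ↔ -Tm < (t : EReal) ∧ (t : EReal) < Tp := Iff.rfl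

lemma ordConnected_lifespan : (lifespan Tm Tp).OrdConnected :=
  ⟨fun _ ha _ hb _ ht => ⟨ha.1.trans_le (EReal.coe_le_coe_iff.2 ht.1),
    (EReal.coe_le_coe_iff.2 ht.2).trans_lt hb.2⟩⟩

lemma zero_mem_lifespan (hm : 0 < Tm) (hp : 0 < Tp) : (0 : ℝ) ∈ lifespan Tm Tp :=
  ⟨by rw [EReal.coe_zero]; exact by simpa using EReal.neg_lt_neg_iff.2 hm, by rwa [EReal.coe_zero]⟩

lemma exists_lifespan_eq {S : Set ℝ} (ho : IsOpen S) (hc : S.OrdConnected) (h0 : (0 : ℝ) ∈ S) :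
    ∃ Tm Tp : EReal, 0 < Tm ∧ 0 < Tp ∧ lifespan Tm Tp = S := by
  have hlt : ∀ t ∈ S, sInf (Real.toEReal '' S) < t ∧ (t : EReal) < sSup (Real.toEReal '' S) :=
    fun t ht => by
      obtain ⟨ε, hε, h⟩ := Metric.isOpen_iff.1 ho t ht
      rw [Real.ball_eq_Ioo] at h
      exact ⟨(sInf_le (mem_image_of_mem _ (h ⟨by linarith, by linarith⟩ : t - ε / 2 ∈ S))).trans_lt
        (EReal.coe_lt_coe_iff.2 (by linarith)), (EReal.coe_lt_coe_iff.2 (by linarith)).trans_le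
        (le_sSup (mem_image_of_mem _ (h ⟨by linarith, by linarith⟩ : t + ε / 2 ∈ S)))⟩
  have hz := hlt 0 h0
  rw [EReal.coe_zero] at hz
  refine ⟨-sInf (Real.toEReal '' S), sSup (Real.toEReal '' S), EReal.neg_pos.2 hz.1, hz.2, ?_⟩
  ext t
  rw [mem_lifespan, neg_neg]
  refine ⟨fun ⟨h, h'⟩ => ?_, hlt t⟩
  obtain ⟨_, ⟨a, ha, rfl⟩, ha'⟩ := sInf_lt_iff.1 h
  obtain ⟨_, ⟨b, hb, rfl⟩, hb'⟩ := lt_sSup_iff.1 h'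
  exact hc.out ha hb ⟨(EReal.coe_lt_coe_iff.1 ha').le, (EReal.coe_lt_coe_iff.1 hb').le⟩

namespace Data

lemma isMaximalSolution (D : Data μ w Q₀) (hm : 0 < Tm) (hp : 0 < Tp)
    (h : lifespan Tm Tp = solSet μ w Q₀) : IsMaximalSolution μ w Q₀ Tm Tp (maxSol μ w Q₀) where
  pos_left := hm
  pos_right := hp
  sol := h ▸ D.isSolution_maxSol
  maximal _ _ hJ hs hq _ := h ▸ hq.subset_solSet hJ (hs (zero_mem_lifespan hm hp))

lemma lifespan_eq (D : Data μ w Q₀) (h : IsMaximalSolution μ w Q₀ Tm Tp q) :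
    lifespan Tm Tp = solSet μ w Q₀ ∧ EqOn q (maxSol μ w Q₀) (solSet μ w Q₀) := by
  have h0 := zero_mem_lifespan h.pos_left h.pos_right
  have h1 := h.sol.subset_solSet ordConnected_lifespan h0
  have h2 := D.eqOn ordConnected_lifespan h0 h.sol
  have h3 := h1.antisymm (h.maximal _ _ ordConnected_solSet h1 D.isSolution_maxSol h2.symm)
  exact ⟨h3, h3 ▸ h2⟩

lemma tendsto_of_notMem (D : Data μ w Q₀) {l : Filter ℝ} {T : ℝ} (hl : l ≤ 𝓝 T)
    (hS : ∀ᶠ t in l, t ∈ solSet μ w Q₀) (hT : T ∉ solSet μ w Q₀) :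
    Tendsto (fun t => yNorm μ (maxSol μ w Q₀ t)) l (𝓝 ∞) := by
  refine ENNReal.tendsto_nhds_top_iff_nnreal.2 fun R => ?_
  by_contra hc
  obtain ⟨τ, hτ, H⟩ := D.exists_Icc_subset (coe_lt_top (r := R))
  obtain ⟨t, ht, htS, htT⟩ := ((not_eventually.1 hc).and_eventually
    (hS.and (hl (Metric.ball_mem_nhds T hτ)))).exists
  rw [Real.dist_eq, abs_lt] at htT
  exact hT (H t htS (not_lt.1 ht) ⟨by linarith, by linarith⟩)

lemma tendsto_yNorm_sub (D : Data μ w Q₀) (ht : t ∈ solSet μ w Q₀) :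
    Tendsto (fun s => yNorm μ (maxSol μ w Q₀ s - maxSol μ w Q₀ t)) (𝓝 t) (𝓝 0) := by
  have := D.isSolution_maxSol.cont t ht
  rwa [D.isOpen_solSet.nhdsWithin_eq ht] at this

lemma yNorm_sub_le_add (D : Data μ w Q₀) (D' : Data μ w' Q₀') {s t : ℝ}
    (hs : s ∈ solSet μ w Q₀) (hs' : s ∈ solSet μ w' Q₀') (ht : t ∈ solSet μ w Q₀)
    (ht' : t ∈ solSet μ w' Q₀') : yNorm μ (maxSol μ w' Q₀' s - maxSol μ w Q₀ s) ≤
      yNorm μ (maxSol μ w' Q₀' t - maxSol μ w Q₀ t) +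
        (yNorm μ (maxSol μ w' Q₀' s - maxSol μ w' Q₀' t) +
          yNorm μ (maxSol μ w Q₀ s - maxSol μ w Q₀ t)) := by
  have a := (D.inY_maxSol hs).1
  have a' := (D'.inY_maxSol hs').1
  have b := (D.inY_maxSol ht).1
  have b' := (D'.inY_maxSol ht').1
  have e : maxSol μ w' Q₀' s - maxSol μ w Q₀ s = (maxSol μ w' Q₀' t - maxSol μ w Q₀ t) +
      ((maxSol μ w' Q₀' s - maxSol μ w' Q₀' t) - (maxSol μ w Q₀ s - maxSol μ w Q₀ t)) := by abel
  rw [e]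
  exact (yNorm_add_le D.pos (b'.sub b) ((a'.sub b').sub (a.sub b))).trans
    (add_le_add le_rfl (yNorm_sub_le D.pos (a'.sub b') (a.sub b)))

lemma tendsto_yNorm_sub_add (D : Data μ w Q₀) (D' : Data μ w' Q₀')
    (ht : t ∈ solSet μ w Q₀) (ht' : t ∈ solSet μ w' Q₀') :
    Tendsto (fun s => yNorm μ (maxSol μ w' Q₀' s - maxSol μ w' Q₀' t) +
      yNorm μ (maxSol μ w Q₀ s - maxSol μ w Q₀ t)) (𝓝 t) (𝓝 0) := by
  have := (D'.tendsto_yNorm_sub ht').add (D.tendsto_yNorm_sub ht)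
  rwa [add_zero] at this

lemma eventually_yNorm_sub_lt (D : Data μ w Q₀) (D' : Data μ w' Q₀')
    (ht : t ∈ solSet μ w Q₀) (ht' : t ∈ solSet μ w' Q₀')
    {B : ℝ≥0∞} (hlt : yNorm μ (maxSol μ w' Q₀' t - maxSol μ w Q₀ t) < B) :
    ∀ᶠ s in 𝓝 t, s ∈ solSet μ w' Q₀' ∧ yNorm μ (maxSol μ w' Q₀' s - maxSol μ w Q₀ s) < B := by
  filter_upwards [D.isOpen_solSet.mem_nhds ht, D'.isOpen_solSet.mem_nhds ht',
    (D.tendsto_yNorm_sub_add D' ht ht').eventually_lt_const (tsub_pos_of_lt hlt)] with s hs hs' h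
  refine ⟨hs', (D.yNorm_sub_le_add D' hs hs' ht ht').trans_lt ?_⟩
  exact (ENNReal.add_lt_add_left hlt.ne_top h).trans_eq (add_tsub_cancel_of_le hlt.le)

lemma maxSol_zero (D : Data μ w Q₀) : maxSol μ w Q₀ 0 = Q₀ :=
  ((isSolution_iff_isFlow D.zero_mem).1 D.isSolution_maxSol).2

/-- Stability on a compact interval, by a continuity argument. -/
theorem stability (D : Data μ w Q₀) (D' : Data μ w' Q₀') {a b : ℝ} (h0 : (0 : ℝ) ∈ Icc a b)
    (hab : Icc a b ⊆ solSet μ w Q₀) {M : ℝ≥0∞} (hM1 : 1 ≤ M) (hMt : M < ∞)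
    (hw : wNorm w ≤ M) (hw' : wNorm w' ≤ M)
    (hM : ∀ t ∈ Icc a b, yNorm μ (maxSol μ w Q₀ t) + 1 ≤ M) {ε : ℝ} (hε : 0 ≤ ε)
    (hε1 : ofReal ε < 1)
    (hεw : wNorm (w' - w) ≤ ofReal ε) (hεQ : yNorm μ (Q₀' - Q₀) ≤ ofReal ε)
    (hεd : ∀ t ∈ Icc a b, eLpNorm (freeLowDensity μ (Q₀' - Q₀) t) 2 volume ≤ ofReal ε)
    (hsm : stabConst d μ M (|a| + |b|) * ofReal ε < 1) :
    Icc a b ⊆ solSet μ w' Q₀' ∧ ∀ t ∈ Icc a b, yNorm μ (maxSol μ w' Q₀' t - maxSol μ w Q₀ t) ≤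
      stabConst d μ M (|a| + |b|) * ofReal ε := by
  set p := maxSol μ w' Q₀'
  set q := maxSol μ w Q₀
  set P : ℝ → Prop := fun t => t ∈ solSet μ w' Q₀' ∧ yNorm μ (p t - q t) < 1 with hP
  have habs : ∀ t ∈ Icc a b, |t| ≤ |a| + |b| := fun t ht => by
    rcases abs_cases t with h | h <;> rcases abs_cases a with h' | h' <;>
      rcases abs_cases b with h'' | h'' <;> linarith [ht.1, ht.2, h0.1, h0.2]
  have bound : ∀ t ∈ Icc a b, P t → yNorm μ (p t) ≤ M := fun t ht hPt => by
    have h1 := D.inY_maxSol (hab ht)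
    have h2 := D'.inY_maxSol hPt.1
    have := yNorm_add_le D.pos h1.1 (h2.1.sub h1.1)
    rw [add_sub_cancel] at this
    exact this.trans ((add_le_add le_rfl hPt.2.le).trans (hM t ht))
  have key : ∀ J ⊆ Icc a b, J.OrdConnected → (0 : ℝ) ∈ J → (∀ t ∈ J, P t) → ∀ t ∈ J,
      yNorm μ (p t - q t) ≤ stabConst d μ M (|a| + |b|) * ofReal ε := fun J hJs hJ hJ0 hJP =>
    (D.isSolution_maxSol.mono (hJs.trans hab)).stability D.pos
      (D'.isSolution_maxSol.mono fun t ht => (hJP t ht).1) D.inY D'.inY hJ hJ0 D.pot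
      D'.pot hM1 hMt hw hw' (fun t ht => le_self_add.trans (hM t (hJs ht)))
      (fun t ht => bound t (hJs ht) (hJP t ht)) (fun t ht => habs t (hJs ht)) hε hεw hεQ
      fun t ht => hεd t (hJs ht)
  suffices h : ∀ t ∈ Icc a b, P t from ⟨fun t ht => (h t ht).1,
    key _ Subset.rfl ordConnected_Icc h0 h⟩
  by_contra! hcon
  set N := {r | ∃ t ∈ Icc a b, ¬ P t ∧ |t| = r}
  have hN : N.Nonempty := hcon.elim fun t ht => ⟨|t|, t, ht.1, ht.2, rfl⟩
  have hNb : BddBelow N := ⟨0, by rintro _ ⟨t, -, -, rfl⟩; exact abs_nonneg t⟩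
  set x := sInf N
  have hbelow : ∀ t ∈ Icc a b, |t| < x → P t := fun t ht htx => by
    by_contra h
    exact notMem_of_lt_csInf htx hNb ⟨t, ht, h, rfl⟩
  have hx0 : 0 ≤ x := le_csInf hN (by rintro _ ⟨t, -, -, rfl⟩; exact abs_nonneg t)
  have claim : ∀ t, |t| = x → ∀ᶠ s in 𝓝 t, s ∈ Icc a b → P s := fun t htx => by
    by_cases ht : t ∈ Icc a b
    · suffices h : P t from (D.eventually_yNorm_sub_lt D' (hab ht) h.1 h.2).mono fun s hs _ => hs
      rcases hx0.eq_or_lt with hx | hx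
      · have ht0 : t = 0 := abs_eq_zero.1 (htx.trans hx.symm)
        rw [ht0]
        refine ⟨D'.zero_mem, ?_⟩
        simp only [p, q]
        rw [D.maxSol_zero, D'.maxSol_zero]
        exact hεQ.trans_lt hε1
      set J := Icc a b ∩ Ioo (-x) x
      have hJP : ∀ s ∈ J, P s := fun s hs => hbelow s hs.1 (abs_lt.2 hs.2)
      have hJ := key J inter_subset_left (ordConnected_Icc.inter ordConnected_Ioo)
        ⟨h0, by linarith, hx⟩ hJP
      have hmem : ∀ᶠ r in 𝓝[<] (1 : ℝ), r * t ∈ J := by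
        filter_upwards [Ioo_mem_nhdsLT (zero_lt_one' ℝ)] with r hr
        refine ⟨?_, abs_lt.1 ?_⟩
        · have := (convex_Icc a b) h0 ht (sub_nonneg.2 hr.2.le) hr.1.le (by ring)
          simpa using this
        · rw [abs_mul, abs_of_pos hr.1, htx]
          exact mul_lt_of_lt_one_left hx hr.2
      have hlim : Tendsto (fun r : ℝ => r * t) (𝓝[<] 1) (𝓝 t) := by
        have : Tendsto (fun r : ℝ => r * t) (𝓝 1) (𝓝 (1 * t)) := (continuous_mul_const t).tendsto 1
        rw [one_mul] at this
        exact this.mono_left nhdsWithin_le_nhds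
      have htS : t ∈ solSet μ w' Q₀' := by
        obtain ⟨τ, hτ, H⟩ := D'.exists_Icc_subset hMt
        obtain ⟨r, hr, hr'⟩ := (hmem.and (hlim (Metric.ball_mem_nhds t hτ))).exists
        rw [Metric.mem_ball, Real.dist_eq, abs_lt] at hr'
        exact H _ (hJP _ hr).1 (bound _ hr.1 (hJP _ hr)) ⟨by linarith, by linarith⟩
      refine ⟨htS, ?_⟩
      obtain ⟨r, hr, h⟩ := (hmem.and (((D.tendsto_yNorm_sub_add D' (hab ht) htS).comp
        hlim).eventually_lt_const (tsub_pos_of_lt hsm))).exists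
      have hrS := hab hr.1
      have hrS' := (hJP _ hr).1
      rw [Function.comp_apply, yNorm_sub_comm D.pos (D.inY_maxSol hrS).1 (D.inY_maxSol (hab ht)).1,
        yNorm_sub_comm D.pos (D'.inY_maxSol hrS').1 (D'.inY_maxSol htS).1] at h
      refine (D.yNorm_sub_le_add D' (hab ht) htS hrS hrS').trans_lt ?_
      exact (ENNReal.add_lt_add_of_le_of_lt ((hJ _ hr).trans_lt hsm).ne_top (hJ _ hr) h).trans_eq
        (add_tsub_cancel_of_le hsm.le)
    · filter_upwards [isClosed_Icc.isOpen_compl.mem_nhds ht] with s hs hs'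
      exact absurd hs' hs
  obtain ⟨ε₁, hε₁, H₁⟩ := Metric.eventually_nhds_iff_ball.1 (claim x (abs_of_nonneg hx0))
  obtain ⟨ε₂, hε₂, H₂⟩ := Metric.eventually_nhds_iff_ball.1
    (claim (-x) (by rw [abs_neg, abs_of_nonneg hx0]))
  obtain ⟨_, ⟨t, ht, hPt, rfl⟩, htx⟩ := exists_lt_of_csInf_lt hN
    (show x < x + min ε₁ ε₂ by linarith [lt_min hε₁ hε₂])
  have hxt : x ≤ |t| := csInf_le hNb ⟨t, ht, hPt, rfl⟩
  rcases abs_cases t with ⟨h, -⟩ | ⟨h, -⟩ <;> rw [h] at htx hxt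
  · refine hPt (H₁ t ?_ ht)
    rw [Metric.mem_ball, Real.dist_eq, abs_lt]
    constructor <;> linarith [min_le_left ε₁ ε₂]
  · refine hPt (H₂ t ?_ ht)
    rw [Metric.mem_ball, Real.dist_eq, abs_lt]
    constructor <;> linarith [min_le_right ε₁ ε₂]

lemma wNorm_add_le (hw : AEStronglyMeasurable w volume) (hw' : AEStronglyMeasurable w' volume) :
    wNorm (w + w') ≤ wNorm w + wNorm w' := by
  rw [wNorm, wNorm, wNorm, add_add_add_comm]
  exact add_le_add (eLpNorm_add_le hw hw' le_rfl) (eLpNorm_add_le hw hw' le_top)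

/-- Continuous dependence on a compact interval. -/
theorem tendsto_iSup_yNorm_sub (D : Data μ w Q₀) {wn : ℕ → Space d → ℝ} {Q₀n : ℕ → Op d}
    (Dn : ∀ n, Data μ (wn n) (Q₀n n)) (hw : Tendsto (fun n => wNorm (wn n - w)) atTop (𝓝 0))
    (hQ : Tendsto (fun n => yNorm μ (Q₀n n - Q₀)) atTop (𝓝 0)) {a b : ℝ} (h0 : (0 : ℝ) ∈ Icc a b)
    (hab : Icc a b ⊆ solSet μ w Q₀)
    (hd : Tendsto (fun n => ⨆ t ∈ Icc a b,
      eLpNorm (freeLowDensity μ (Q₀n n) t - freeLowDensity μ Q₀ t) 2 volume) atTop (𝓝 0)) :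
    (∀ᶠ n in atTop, Icc a b ⊆ solSet μ (wn n) (Q₀n n)) ∧ Tendsto (fun n => ⨆ t ∈ Icc a b,
      yNorm μ (maxSol μ (wn n) (Q₀n n) t - maxSol μ w Q₀ t)) atTop (𝓝 0) := by
  obtain ⟨M, hMt, hM⟩ := D.isSolution_maxSol.exists_bound D.pos isCompact_Icc hab
  have hwt := wNorm_lt_top D.pot
  set M' := M + 1 + (wNorm w + 1)
  have hM't : M' < ∞ := by simp only [M', add_lt_top]; exact ⟨⟨hMt, by simp⟩, hwt, by simp⟩
  set e : ℕ → ℝ≥0∞ := fun n => wNorm (wn n - w) + yNorm μ (Q₀n n - Q₀) + ⨆ t ∈ Icc a b,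
    eLpNorm (freeLowDensity μ (Q₀n n) t - freeLowDensity μ Q₀ t) 2 volume with he_def
  have he : Tendsto e atTop (𝓝 0) := by
    have := (hw.add hQ).add hd
    rwa [add_zero, add_zero] at this
  have hC : Tendsto (fun n => stabConst d μ M' (|a| + |b|) * e n) atTop (𝓝 0) := by
    have := ENNReal.Tendsto.const_mul he (Or.inr (stabConst_lt_top (d := d) (μ := μ) (M := M')
      (T := |a| + |b|)).ne)
    rwa [mul_zero] at this
  have key : ∀ᶠ n in atTop, Icc a b ⊆ solSet μ (wn n) (Q₀n n) ∧ ∀ t ∈ Icc a b,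
      yNorm μ (maxSol μ (wn n) (Q₀n n) t - maxSol μ w Q₀ t) ≤
        stabConst d μ M' (|a| + |b|) * e n := by
    filter_upwards [he.eventually_lt_const zero_lt_one, hC.eventually_lt_const zero_lt_one]
      with n hn hn'
    have hen : ofReal (e n).toReal = e n := ofReal_toReal hn.ne_top
    have hwn : wNorm (wn n) ≤ wNorm w + 1 := by
      have := wNorm_add_le D.pot.1.1 ((Dn n).pot.1.sub D.pot.1).1
      rw [add_sub_cancel] at this
      exact this.trans (add_le_add le_rfl ((le_self_add.trans le_self_add).trans hn.le))
    have := D.stability (Dn n) h0 hab (M := M') (ε := (e n).toReal)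
      (le_trans le_add_self le_add_self) hM't (le_self_add.trans le_add_self) (hwn.trans le_add_self)
      (fun t ht => (add_le_add (hM t ht) le_rfl).trans le_self_add) toReal_nonneg
    rw [hen] at this
    refine this hn (le_self_add.trans le_self_add) (le_add_self.trans le_self_add) (fun t ht => ?_) hn'
    have e2 : eLpNorm (freeLowDensity μ (Q₀n n - Q₀) t) 2 volume =
        eLpNorm (freeLowDensity μ (Q₀n n) t - freeLowDensity μ Q₀ t) 2 volume := by
      rw [freeLowDensity_eq, freeLowDensity_eq, freeLowDensity_eq, freeEvol_sub, lowCut_sub]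
      exact (hasDens_lowCut _).eLpNorm_density_sub (isSelfAdjoint_freeLow (Dn n).inY.1 t)
        (hasDens_lowCut _) (isSelfAdjoint_freeLow D.inY.1 t)
    rw [e2]
    exact (le_iSup₂ (f := fun t (_ : t ∈ Icc a b) => eLpNorm (freeLowDensity μ (Q₀n n) t -
      freeLowDensity μ Q₀ t) 2 volume) t ht).trans le_add_self
  refine ⟨key.mono fun n hn => hn.1, ?_⟩
  exact tendsto_of_tendsto_of_tendsto_of_le_of_le' tendsto_const_nhds hC
    (.of_forall fun _ => zero_le) (key.mono fun n hn => iSup₂_le hn.2)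

end Data

end

end Hartree

end

open Hartree

theorem mainTheorem9 (d : ℕ) (hd : 1 ≤ d) (μ : ℝ) (hμ : 0 < μ)
    (w : Space d → ℝ) (hw₁ : MemLp w 1 volume) (hw_top : MemLp w ∞ volume)
    (Q₀ : Op d) (hQ₀ : InY μ Q₀) (hfree : FreeLowDensityContinuous μ Q₀) :
    ∃ (Tm Tp : EReal) (Q : ℝ → Op d),
      -- existence of a maximal solution
      IsMaximalSolution μ w Q₀ Tm Tp Q ∧
      -- uniqueness: every solution, on any interval containing `0`, is a restriction of it
      (∀ (J : Set ℝ) (Q' : ℝ → Op d), J.OrdConnected → (0 : ℝ) ∈ J → IsSolution μ w Q₀ J Q' →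
        J ⊆ lifespan Tm Tp ∧ EqOn Q' Q J) ∧
      -- blow-up criterion
      (∀ T : ℝ, Tp = (T : EReal) → Tendsto (fun t => yNorm μ (Q t)) (𝓝[<] T) (𝓝 ∞)) ∧
      (∀ T : ℝ, Tm = (T : EReal) → Tendsto (fun t => yNorm μ (Q t)) (𝓝[>] (-T)) (𝓝 ∞)) ∧
      -- continuous dependence on the datum, its free low-momentum density, and the potential
      (∀ (wn : ℕ → Space d → ℝ) (Q₀n : ℕ → Op d) (Tmn Tpn : ℕ → EReal) (Qn : ℕ → ℝ → Op d),
        (∀ n, MemLp (wn n) 1 volume) → (∀ n, MemLp (wn n) ∞ volume) →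
        (∀ n, InY μ (Q₀n n)) → (∀ n, FreeLowDensityContinuous μ (Q₀n n)) →
        (∀ n, IsMaximalSolution μ (wn n) (Q₀n n) (Tmn n) (Tpn n) (Qn n)) →
        Tendsto (fun n => eLpNorm (wn n - w) 1 volume) atTop (𝓝 0) →
        Tendsto (fun n => eLpNorm (wn n - w) ∞ volume) atTop (𝓝 0) →
        Tendsto (fun n => yNorm μ (Q₀n n - Q₀)) atTop (𝓝 0) →
        (∀ a b : ℝ, -Tm < (a : EReal) → (b : EReal) < Tp →
          Tendsto (fun n => ⨆ t ∈ Icc a b,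
            eLpNorm (freeLowDensity μ (Q₀n n) t - freeLowDensity μ Q₀ t) 2 volume)
            atTop (𝓝 0)) →
        Tm ≤ liminf Tmn atTop ∧ Tp ≤ liminf Tpn atTop ∧
        ∀ a b : ℝ, -Tm < (a : EReal) → (b : EReal) < Tp →
          Tendsto (fun n => ⨆ t ∈ Icc a b, yNorm μ (Qn n t - Q t)) atTop (𝓝 0)) := by
  have D : Data μ w Q₀ := ⟨hμ, ⟨hw₁, hw_top⟩, hQ₀, hfree⟩
  obtain ⟨Tm, Tp, hm, hp, hS⟩ := exists_lifespan_eq D.isOpen_solSet ordConnected_solSet D.zero_mem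
  have hmem : ∀ t : ℝ, t ∈ solSet μ w Q₀ ↔ -Tm < (t : EReal) ∧ (t : EReal) < Tp := fun t => by
    rw [← hS]; rfl
  refine ⟨Tm, Tp, maxSol μ w Q₀, D.isMaximalSolution hm hp hS, fun J Q' hJ h0 hQ' =>
    ⟨hS ▸ hQ'.subset_solSet hJ h0, D.eqOn hJ h0 hQ'⟩, fun T hT => ?_, fun T hT => ?_, ?_⟩
  · have hT0 : 0 < T := by rw [hT] at hp; exact_mod_cast hp
    refine D.tendsto_of_notMem nhdsWithin_le_nhds ?_ fun h => ?_
    · filter_upwards [Ioo_mem_nhdsLT hT0] with t ht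
      refine ordConnected_solSet.out D.zero_mem ?_ ⟨ht.1.le, le_rfl⟩
      exact (hmem t).2 ⟨((hmem 0).1 D.zero_mem).1.trans_le (EReal.coe_le_coe_iff.2 ht.1.le),
        hT ▸ EReal.coe_lt_coe_iff.2 ht.2⟩
    · exact absurd ((hmem T).1 h).2 (by rw [hT]; exact lt_irrefl _)
  · have hT0 : 0 < T := by rw [hT] at hm; exact_mod_cast hm
    refine D.tendsto_of_notMem nhdsWithin_le_nhds ?_ fun h => ?_
    · filter_upwards [Ioo_mem_nhdsGT (neg_lt_zero.2 hT0)] with t ht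
      exact (hmem t).2 ⟨by rw [hT, ← EReal.coe_neg]; exact EReal.coe_lt_coe_iff.2 ht.1,
        (EReal.coe_lt_coe_iff.2 ht.2).trans ((hmem 0).1 D.zero_mem).2⟩
    · exact absurd ((hmem (-T)).1 h).1 (by rw [hT, EReal.coe_neg]; exact lt_irrefl _)
  intro wn Q₀n Tmn Tpn Qn h1 h2 hQn hfn hmax hw1 hw2 hQ hd
  have Dn : ∀ n, Data μ (wn n) (Q₀n n) := fun n => ⟨hμ, ⟨h1 n, h2 n⟩, hQn n, hfn n⟩
  have hSn := fun n => (Dn n).lifespan_eq (hmax n)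
  have hw : Tendsto (fun n => wNorm (wn n - w)) atTop (𝓝 0) := by
    have := hw1.add hw2
    rwa [add_zero] at this
  have key : ∀ a b : ℝ, a ≤ 0 → 0 ≤ b → -Tm < (a : EReal) → (b : EReal) < Tp → _ :=
    fun a b ha hb hma hbp => D.tendsto_iSup_yNorm_sub Dn hw hQ ⟨ha, hb⟩
      (ordConnected_solSet.out ((hmem a).2 ⟨hma, (EReal.coe_le_coe_iff.2 ha).trans_lt hp⟩)
        ((hmem b).2 ⟨((hmem 0).1 D.zero_mem).1.trans_le (EReal.coe_le_coe_iff.2 hb), hbp⟩))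
      (hd a b hma hbp)
  have hz := (hmem 0).1 D.zero_mem
  refine ⟨le_of_forall_lt_imp_le_of_dense fun c hc => ?_, le_of_forall_lt_imp_le_of_dense
    fun c hc => ?_, fun a b ha hb => ?_⟩
  · obtain ⟨x, hcx, hx⟩ := EReal.lt_iff_exists_real_btwn.1 hc
    refine hcx.le.trans (le_liminf_of_le (by isBoundedDefault) ?_)
    have hx' : -Tm < ((-x : ℝ) : EReal) := by rw [EReal.coe_neg]; exact EReal.neg_lt_neg_iff.2 hx
    have h3 : -Tm < ((min (-x) 0 : ℝ) : EReal) := by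
      rcases min_cases (-x) 0 with ⟨h, -⟩ | ⟨h, -⟩ <;> rw [h]
      · exact hx'
      · exact hz.1
    filter_upwards [(key _ 0 (min_le_right (-x) 0) le_rfl h3 hz.2).1] with n hn
    have h4 := ((hSn n).1.symm ▸ hn ⟨le_rfl, min_le_right _ _⟩ : min (-x) 0 ∈ lifespan _ _).1
    have h5 := h4.trans_le (EReal.coe_le_coe_iff.2 (min_le_left (-x) 0))
    rw [EReal.coe_neg] at h5
    exact (EReal.neg_lt_neg_iff.1 h5).le
  · obtain ⟨x, hcx, hx⟩ := EReal.lt_iff_exists_real_btwn.1 hc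
    refine hcx.le.trans (le_liminf_of_le (by isBoundedDefault) ?_)
    have h3 : ((max x 0 : ℝ) : EReal) < Tp := by
      rcases max_cases x 0 with ⟨h, -⟩ | ⟨h, -⟩ <;> rw [h]
      · exact hx
      · exact hz.2
    filter_upwards [(key 0 _ le_rfl (le_max_right x 0) hz.1 h3).1] with n hn
    have h4 := ((hSn n).1.symm ▸ hn ⟨le_max_right _ _, le_rfl⟩ : max x 0 ∈ lifespan _ _).2
    exact ((EReal.coe_le_coe_iff.2 (le_max_left x 0)).trans_lt h4).le
  · have ha' : -Tm < ((min a 0 : ℝ) : EReal) := by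
      rcases min_cases a 0 with ⟨h, -⟩ | ⟨h, -⟩ <;> rw [h]
      · exact ha
      · exact hz.1
    have hb' : ((max b 0 : ℝ) : EReal) < Tp := by
      rcases max_cases b 0 with ⟨h, -⟩ | ⟨h, -⟩ <;> rw [h]
      · exact hb
      · exact hz.2
    obtain ⟨k1, k2⟩ := key _ _ (min_le_right a 0) (le_max_right b 0) ha' hb'
    refine tendsto_of_tendsto_of_tendsto_of_le_of_le' tendsto_const_nhds k2
      (.of_forall fun _ => zero_le) (k1.mono fun n hn => iSup₂_le fun t ht => ?_)
    have ht' : t ∈ Icc (min a 0) (max b 0) :=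
      ⟨(min_le_left _ _).trans ht.1, ht.2.trans (le_max_left _ _)⟩
    rw [(hSn n).2 (hn ht')]
    exact le_iSup₂ (f := fun t (_ : t ∈ Icc (min a 0) (max b 0)) =>
      yNorm μ (maxSol μ (wn n) (Q₀n n) t - maxSol μ w Q₀ t)) t ht'
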